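/- **Setting.** Let $K\ge 2$, $\mathcal K=\{1,\dots,K\}$. A generic cluster has a random size $N$ with $1\le N\le n_{\max}$, a binary cluster-level treatment $A$, covariates $\mathbf C=(\mathbf V,\mathbf X)$ (cluster-level $\mathbf V$, individual-level $\mathbf X=(\mathbf X_j)_{j\le N}$), potential mediators $\mathbf M(a)=(M^k_j(a))_{k\in\mathcal K,\,j\le N}$ and potential outcomes $Y_j(a,\mathbf m)$, where $m\mapsto Y_j(a,m)$ is a random function with jointly measurable evaluation, and independence statements about $Y_j(a,\cdot)$ concern this random function. Observed are $\mathcal O=(N,A,\mathbf C,\mathbf M,\mathbf Y)$ with $\mathbf M=\mathbf M(A)$, $Y_j=Y_j(A,\mathbf M)$ (consistency). For $U\subseteq\mathcal K\times[N]$ write $\mathbf m_U$ for the subvector of $\mathbf m$ indexed by $U$ and $U^c=(\mathcal K\times[N])\setminus U$; write $\mathbf M^{J}=\mathbf M_{J\times[N]}$ for $J\subseteq\mathcal K$. Let $\mathbf M(\mathbf a_J)=(\mathbf M^J(0),\mathbf M^{\mathcal K\setminus J}(1))$ and $a_{J1}=0$ if $1\in J$, $a_{J1}=1$ otherwise. Put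 $\eta_j(a,\mathbf m,\mathbf c,n)=E[Y_j\mid A=a,\mathbf M=\mathbf m,\mathbf C=\mathbf c,N=n]$, and let $f(\cdot\mid a,\mathbf c,n)$ be the conditional density of the mediators with respect to a product reference measure $d\mathbf m$ on their (product) support, mediator $k$ having a $\sigma$-finite reference measure $\nu_k$ (e.g. Lebesgue or counting measure on its support); $f(\mathbf m_U\mid a,\mathbf c,n)$ is the marginal density of $\mathbf m_U$. Let $w(\mathbf V,N)$ be a measurable bounded cluster weight with $E[w]\neq0$, and let $$\theta_1(a^*,\mathbf a_J)=\frac{E\{\frac{w(\mathbf V,N)}N\sum_{j=1}^N Y_j(a^*,\mathbf M(\mathbf a_J))\}}{E\{w(\mathbf V,N)\}},\qquad \theta_2(k,J)=\frac{E\{\frac{w(\mathbf V,N)}N\sum_{j=1}^N Y_j(1,\mathbf M_{U_j}(0),\mathbf M_{U_j^c}(1))\}}{E\{w(\mathbf V,N)\}},$$ where $U_j=((J\cup\{k\})\times[N])\setminus\{(k,j)\}$. **Assumptions.** 1. (Super-population) $A\sim\mathrm{Bernoulli}(\pi)$ with known $0<\pi<1$ and $A\perp\{N,\mathbf C,\mathbf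 M(a),Y_j(a,\cdot)\}$ for each $a,j$; given $N$, the outcomes $Y_j(a,\cdot)$ evaluated at any array whose entries are $M^k_i(0)$ or $M^k_i(1)$ have finite second moments; and $f_{\min}\le f(\mathbf m\mid A,\mathbf C,N)\le f_{\max}$ on the support with constants $0<f_{\min}\le f_{\max}<\infty$. 2. (Mediator–outcome ignorability) $Y_j(a,\cdot)\perp\{\mathbf M(0),\mathbf M(1)\}\mid A,N,\mathbf C$. 3. (Conditional homogeneity, indexed by $J$) for all $J^*\subseteq J$, $J^*\notin\{\emptyset,\mathcal K\}$, and a.e. value $\mathbf m^{J^*}$ of $\mathbf M^{J^*}(0)$, with $\bar Y(1,\mathbf m)=N^{-1}\sum_jY_j(1,\mathbf m)$: $E\{\bar Y(1,\mathbf M(\mathbf a_{J^*}))\mid\mathbf M^{J^*}(0)=\mathbf m^{J^*},\mathbf C,N\}=E\{\bar Y(1,\mathbf m^{J^*},\mathbf M^{\mathcal K\setminus J^*}(1))\mid\mathbf C,N\}$. 4. (Cross-world mediator independence, indexed by $(k,J)$) for all $J^*\subseteq J\setminus\{k\}$ and $j$, with $U_j=((J^*\cup\{k\})\times[N])\setminus\{(k,j)\}$: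 $\mathbf M_{U_j}(0)\perp\mathbf M_{U_j^c}(1)\mid\mathbf C,N$. **Model and EIF.** The model consists of all laws of $\mathcal O$ under which $A\sim\mathrm{Bernoulli}(\pi)$ is independent of $(\mathbf C,N)$ and nothing else is restricted. A regular submodel through $P$ with score $S\in L^2(P)$ is a path $(Q_\varepsilon)$ in the model with $Q_0=P$ whose likelihood ratios $dQ_\varepsilon/dP$ are, for $\varepsilon$ near $0$, bounded away from $0$ and $\infty$ and satisfy $\varepsilon^{-1}(dQ_\varepsilon/dP-1)\to S$ in $L^2(P)$. The EIF of a functional $\Psi$ at $P$ is the mean-zero $\varphi\in L^2(P)$ that lies in the closed linear span of all scores and satisfies $\frac{d}{d\varepsilon}\Psi(Q_\varepsilon)|_{\varepsilon=0}=E_P[\varphi S]$ for every regular submodel. **Auxiliary functions.** For $U\subseteq\mathcal K\times[N]$ and $\mathbf C,N$ given, $\lambda^{(1)}_j(U,a_1a_2a_3)=\int\eta_j(a_1,\mathbf m)f(\mathbf m_U|a_2)f(\mathbf m_{U^c}|a_3)d\mathbf m$, $\lambda^{(2)}_j(\mathbf m_{U^c};U,a_1)=\int\eta_j(1,\mathbf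 m)f(\mathbf m_U|a_1)d\mathbf m_U$ and $\lambda^{(3)}(\mathbf m;U,a_1a_2a_3)=f(\mathbf m_U|a_1)f(\mathbf m_{U^c}|a_2)/f(\mathbf m|a_3)$ (the arguments $\mathbf C,N$ being suppressed), and $\eta^*_{j,a^*a'}=\int\eta_j(a^*,\mathbf m)f(\mathbf m|a')d\mathbf m$. Let $I_a=\mathcal I(A=a)/\Pr(A=a)$. **Theorem.** For each parameter $\theta$ below, $\theta=\Psi_n(P)/E[w]$ at the true observed-data law $P$ for the observed-data functional $\Psi_n$ given; the EIF at $P$ of the functional $Q\mapsto\Psi_n(Q)/E_Q[w]$ is $$\varphi(\mathcal O;\theta)=E\{w(\mathbf V,N)\}^{-1}\{\phi(\mathcal O;\theta)-\theta\,w(\mathbf V,N)\},$$ and the EIF at $P$ of the unnormalised functional $\Psi_n$ is $\phi(\mathcal O;\theta)-E\{w\}\theta$. (For $w\equiv1$ both are $\phi(\mathcal O;\theta)-\theta$.) (i) Let Assumption 1 hold and $(a^*,J)\in\{(0,\mathcal K),(1,\mathcal K),(1,\emptyset)\}$, with Assumption 2 in addition if $(a^*,J)=(1,\mathcal K)$.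 For $\theta=\theta_1(a^*,\mathbf a_J)$ and $a'=a_{J1}$: $\Psi_n=E\{\frac wN\sum_j\eta^*_{j,a^*a'}\}$ and $$\phi=\frac wN\sum_{j=1}^N\Big[I_{a^*}\frac{f(\mathbf M|a',\mathbf C,N)}{f(\mathbf M|a^*,\mathbf C,N)}\{Y_j-\eta_j(a^*,\mathbf M,\mathbf C,N)\}+I_{a'}\{\eta_j(a^*,\mathbf M,\mathbf C,N)-\eta^*_{j,a^*a'}\}+\eta^*_{j,a^*a'}\Big].$$ (ii) Let Assumptions 1, 2 and 3 (for $J$) hold. For all $J^*\subseteq J$ with $J^*\notin\{\mathcal K,\emptyset\}$, $\theta=\theta_1(1,\mathbf a_{J^*})$ and $U=J^*\times[N]$: $\Psi_n=E\{\frac wN\sum_j\lambda^{(1)}_j(U,101)\}$ and $$\phi=\frac wN\sum_{j=1}^N\Big[I_0\lambda^{(2)}_j(\mathbf M_{U};U^c,1)+(1-I_0-I_1)\lambda^{(1)}_j(U,101)+I_1\big(\lambda^{(3)}(\mathbf M;U,011)\{Y_j-\eta_j(1,\mathbf M,\mathbf C,N)\}+\lambda^{(2)}_j(\mathbf M_{U^c};U,0)\big)\Big].$$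 (iii) Let Assumptions 1, 2 and 4 (for $(k,J)$) hold. For all $J^*\subseteq J\setminus\{k\}$, $\theta=\theta_2(k,J^*)$ and $U_j=((J^*\cup\{k\})\times[N])\setminus\{(k,j)\}$: $\Psi_n=E\{\frac wN\sum_j\lambda^{(1)}_j(U_j^c,110)\}$ and $$\phi=\frac wN\sum_{j=1}^N\Big[I_0\lambda^{(2)}_j(\mathbf M_{U_j};U_j^c,1)+(1-I_0-I_1)\lambda^{(1)}_j(U_j^c,110)+I_1\big(\lambda^{(3)}(\mathbf M;U_j,011)\{Y_j-\eta_j(1,\mathbf M,\mathbf C,N)\}+\lambda^{(2)}_j(\mathbf M_{U_j^c};U_j,0)\big)\Big].$$ -/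

import Mathlib

open MeasureTheory ProbabilityTheory Filter Topology
open scoped ENNReal

/-! ## Efficient influence functions in a general statistical model -/

section EIF

variable {𝒳 : Type*} [MeasurableSpace 𝒳]

/-- `Q : ℝ → ProbabilityMeasure 𝒳` is a regular one-dimensional parametric submodel of the
statistical model `model` through the law `P` (attained at `ε = 0`), with score `S` at `ε = 0`:
near `0` the laws belong to the model and have likelihood ratios `p ε = dQ_ε / dP` that are bounded
away from zero and infinity and differentiable in quadratic mean at `ε = 0`, where `p 0 = 1`.
The derivative of `p` (equivalently of `log p`) at `0` is the score `S`. -/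
structure IsRegularSubmodel (model : Set (ProbabilityMeasure 𝒳)) (P : ProbabilityMeasure 𝒳)
    (Q : ℝ → ProbabilityMeasure 𝒳) (S : 𝒳 → ℝ) : Prop where
  at_zero : Q 0 = P
  mem_model : ∀ᶠ ε in 𝓝 (0 : ℝ), Q ε ∈ model
  memLp_score : MemLp S 2 (P : Measure 𝒳)
  exists_ratio : ∃ p : ℝ → 𝒳 → ℝ, ∃ b : ℝ, 0 < b ∧ (∀ ε, Measurable (p ε)) ∧
    (∀ᶠ ε in 𝓝 (0 : ℝ),
      (Q ε : Measure 𝒳) = (P : Measure 𝒳).withDensity (fun o => ENNReal.ofReal (p ε o))) ∧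
    (∀ᶠ ε in 𝓝 (0 : ℝ), ∀ᵐ o ∂(P : Measure 𝒳), b ≤ p ε o ∧ p ε o ≤ b⁻¹) ∧
    Tendsto (fun ε : ℝ => eLpNorm (fun o => (p ε o - 1) / ε - S o) 2 (P : Measure 𝒳))
      (𝓝[≠] 0) (𝓝 0)

/-- The scores at `P` of all regular parametric submodels of `model`. -/
def scoreSet (model : Set (ProbabilityMeasure 𝒳)) (P : ProbabilityMeasure 𝒳) : Set (𝒳 → ℝ) :=
  {S | ∃ Q, IsRegularSubmodel model P Q S}

/-- `φ` is the efficient influence function at `P` of the functional `Ψ` in the model `model`: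
it is a mean-zero square-integrable function, it represents the pathwise derivative of `Ψ`
along every regular parametric submodel, and it lies in the tangent space, the closed linear span
in `L²(P)` of the scores. -/
structure IsEIF (model : Set (ProbabilityMeasure 𝒳)) (Ψ : ProbabilityMeasure 𝒳 → ℝ)
    (P : ProbabilityMeasure 𝒳) (φ : 𝒳 → ℝ) : Prop where
  memLp : MemLp φ 2 (P : Measure 𝒳)
  mean_zero : ∫ o, φ o ∂(P : Measure 𝒳) = 0
  pathwise_derivative : ∀ Q S, IsRegularSubmodel model P Q S →
    HasDerivAt (fun ε => Ψ (Q ε)) (∫ o, φ o * S o ∂(P : Measure 𝒳)) 0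
  mem_tangentSpace : ∀ δ : ℝ≥0∞, 0 < δ → ∃ g ∈ Submodule.span ℝ (scoreSet model P),
    eLpNorm (fun o => φ o - g o) 2 (P : Measure 𝒳) < δ

end EIF

/-! ## Observed cluster data -/

/-- Mediator arrays of a cluster of size `n`: coordinate `(k, j)` is mediator `k` of
individual `j`. -/
abbrev Med (K n : ℕ) : Type := Fin K × Fin n → ℝ

/-- Baseline covariates `C = (V, X)` of a cluster of size `n`. -/
abbrev Cov (dV dX n : ℕ) : Type := (Fin dV → ℝ) × (Fin n → Fin dX → ℝ)

/-- Observed data `(A, C, M, Y)` of a cluster of size `n`; treatment arms are `0, 1 : Fin 2`. -/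
abbrev ObsN (K dV dX n : ℕ) : Type := Fin 2 × Cov dV dX n × Med K n × (Fin n → ℝ)

/-- Observed data of a cluster of random size: `⟨N, (A, C, M, Y)⟩`. -/
abbrev Obs (K dV dX : ℕ) : Type := Σ n : ℕ, ObsN K dV dX n

section Observed

variable {K dV dX : ℕ}

/-- The treatment `A`. -/
def trt (o : Obs K dV dX) : Fin 2 := o.2.1

/-- The pair `(N, C)`. -/
def sizeCov (o : Obs K dV dX) : Σ n : ℕ, Cov dV dX n := ⟨o.1, o.2.2.1⟩

/-- The cluster weight `w(V, N)`. -/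
def weight (w : (Fin dV → ℝ) → ℕ → ℝ) (o : Obs K dV dX) : ℝ := w o.2.2.1.1 o.1

/-- The known treatment propensity: `Pr(A = 1) = π`, `Pr(A = 0) = 1 - π`. -/
def propensity (π : ℝ) (a : Fin 2) : ℝ := if a = 1 then π else 1 - π

/-- `I(A = a) / Pr(A = a)`. -/
noncomputable def armWeight (π : ℝ) (a A : Fin 2) : ℝ := (if A = a then 1 else 0) / propensity π a

/-- The nonparametric model for the observed data in which only the treatment mechanism is known:
`A` is Bernoulli(`π`) and independent of `(C, N)`. -/
def knownPropensityModel (K dV dX : ℕ) (π : ℝ) : Set (ProbabilityMeasure (Obs K dV dX)) :=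
  {Q | (Q : Measure (Obs K dV dX)) {o | trt o = 1} = ENNReal.ofReal π ∧
    IndepFun trt sizeCov (Q : Measure (Obs K dV dX))}

/-- The (unnormalised) law of the data on the event `N = n`. -/
noncomputable def slice (P : ProbabilityMeasure (Obs K dV dX)) (n : ℕ) :
    Measure (ObsN K dV dX n) :=
  (P : Measure (Obs K dV dX)).comap (Sigma.mk n)

instance (P : ProbabilityMeasure (Obs K dV dX)) (n : ℕ) : IsFiniteMeasure (slice P n) := by
  unfold slice; infer_instance

/-! ### Nuisance functions of an observed-data law -/

/-- `η_j(a, m, c, n) = E_P[Y_j | A = a, M = m, C = c, N = n]`. -/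
noncomputable def outcomeMean (P : ProbabilityMeasure (Obs K dV dX)) (n : ℕ) (j : Fin n)
    (a : Fin 2) (m : Med K n) (c : Cov dV dX n) : ℝ :=
  ∫ y, y ∂(condDistrib (fun x : ObsN K dV dX n => x.2.2.2 j)
    (fun x : ObsN K dV dX n => (x.1, x.2.2.1, x.2.1)) (slice P n) (a, m, c))

/-- Coordinatewise reference measures on mediator arrays, `ν k` being the reference measure for
the `k`-th mediator on its support (for instance Lebesgue measure restricted to the support of
a continuous mediator, counting measure on the support of a discrete one). -/
abbrev coordMeasure (ν : Fin K → Measure ℝ) (n : ℕ) : Fin K × Fin n → Measure ℝ := fun t => ν t.1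

/-- The reference measure `dm` on mediator arrays of a cluster of size `n`. -/
noncomputable def refMeasure (ν : Fin K → Measure ℝ) (n : ℕ) : Measure (Med K n) :=
  Measure.pi (coordMeasure ν n)

/-- The joint law of `((A, C), M)` on the event `N = n`. -/
noncomputable def jointLaw (P : ProbabilityMeasure (Obs K dV dX)) (n : ℕ) :
    Measure ((Fin 2 × Cov dV dX n) × Med K n) :=
  (slice P n).map (fun x => ((x.1, x.2.1), x.2.2.1))

/-- The product of the law of `(A, C)` on the event `N = n` with the reference measure `dm`. -/
noncomputable def baseMeasure (ν : Fin K → Measure ℝ) (P : ProbabilityMeasure (Obs K dV dX))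
    (n : ℕ) : Measure ((Fin 2 × Cov dV dX n) × Med K n) :=
  ((slice P n).map (fun x => (x.1, x.2.1))).prod (refMeasure ν n)

/-- The conditional density `f(m | a, c, n)` of the mediators with respect to `dm`. -/
noncomputable def medDensity (ν : Fin K → Measure ℝ) (P : ProbabilityMeasure (Obs K dV dX))
    (n : ℕ) (a : Fin 2) (c : Cov dV dX n) (m : Med K n) : ℝ≥0∞ :=
  (jointLaw P n).rnDeriv (baseMeasure ν P n) ((a, c), m)

/-- The conditional density `f(m_U | a, c, n)` of the subvector of mediators indexed by `U`,
obtained from the joint density by integrating out the coordinates outside `U`. -/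
noncomputable def subDensity (ν : Fin K → Measure ℝ) (P : ProbabilityMeasure (Obs K dV dX))
    (n : ℕ) (U : Finset (Fin K × Fin n)) (a : Fin 2) (c : Cov dV dX n) (m : Med K n) : ℝ :=
  (lmarginal (coordMeasure ν n) Uᶜ (medDensity ν P n a c) m).toReal

/-- `λ⁽¹⁾_j(c, n; U, a₁a₂a₃) = ∫ η_j(a₁, m, c, n) f(m_U | a₂, c, n) f(m_{Uᶜ} | a₃, c, n) dm`. -/
noncomputable def lam1 (ν : Fin K → Measure ℝ) (P : ProbabilityMeasure (Obs K dV dX))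
    (n : ℕ) (j : Fin n) (U : Finset (Fin K × Fin n)) (a₁ a₂ a₃ : Fin 2) (c : Cov dV dX n) : ℝ :=
  ∫ m, outcomeMean P n j a₁ m c * subDensity ν P n U a₂ c m * subDensity ν P n Uᶜ a₃ c m
    ∂(refMeasure ν n)

/-- `λ⁽²⁾_j(m_{Uᶜ}, c, n; U, a₁) = ∫ η_j(1, m, c, n) f(m_U | a₁, c, n) dm_U`, a function of the
coordinates of `m` outside `U`. -/
noncomputable def lam2 (ν : Fin K → Measure ℝ) (P : ProbabilityMeasure (Obs K dV dX))
    (n : ℕ) (j : Fin n) (U : Finset (Fin K × Fin n)) (a₁ : Fin 2) (m : Med K n)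
    (c : Cov dV dX n) : ℝ :=
  ∫ y : (∀ _ : U, ℝ), outcomeMean P n j 1 (Function.updateFinset m U y) c *
      subDensity ν P n U a₁ c (Function.updateFinset m U y)
    ∂(Measure.pi fun i : U => coordMeasure ν n i)

/-- `λ⁽³⁾(m, c, n; U, a₁a₂a₃) = f(m_U | a₁, c, n) f(m_{Uᶜ} | a₂, c, n) / f(m | a₃, c, n)`. -/
noncomputable def lam3 (ν : Fin K → Measure ℝ) (P : ProbabilityMeasure (Obs K dV dX))
    (n : ℕ) (U : Finset (Fin K × Fin n)) (a₁ a₂ a₃ : Fin 2) (m : Med K n)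
    (c : Cov dV dX n) : ℝ :=
  subDensity ν P n U a₁ c m * subDensity ν P n Uᶜ a₂ c m / (medDensity ν P n a₃ c m).toReal

/-- The coordinates `J × [n]`. -/
def blockSet (J : Finset (Fin K)) (n : ℕ) : Finset (Fin K × Fin n) := J ×ˢ Finset.univ

/-- The coordinates `((J ∪ {k}) × [n]) \ {(k, j)}`. -/
def spillSet (k : Fin K) (J : Finset (Fin K)) (n : ℕ) (j : Fin n) : Finset (Fin K × Fin n) :=
  (blockSet (J ∪ {k}) n).erase (k, j)

/-- The arm `a_{J,k}` of mediator `k` in the tuple `a_J`: `0` for `k ∈ J` and `1` otherwise. -/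
def armTuple (J : Finset (Fin K)) (k : Fin K) : Fin 2 := if k ∈ J then 0 else 1

/-- `η*_j(c, n) = ∫ η_j(a*, m, c, n) f(m | a', c, n) dm`. -/
noncomputable def etaStar (ν : Fin K → Measure ℝ) (P : ProbabilityMeasure (Obs K dV dX))
    (n : ℕ) (j : Fin n) (aS a' : Fin 2) (c : Cov dV dX n) : ℝ :=
  ∫ m, outcomeMean P n j aS m c * (medDensity ν P n a' c m).toReal ∂(refMeasure ν n)

/-- `w(V, N) N⁻¹ ∑_{j ∈ [N]} g_j(A, C, M, Y, N)`. -/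
noncomputable def weightedAvg (w : (Fin dV → ℝ) → ℕ → ℝ)
    (g : ∀ n : ℕ, Fin n → ObsN K dV dX n → ℝ) (o : Obs K dV dX) : ℝ :=
  weight w o / (o.1 : ℝ) * ∑ j : Fin o.1, g o.1 j o.2

/-- `E_Q[w(V, N)]`. -/
noncomputable def meanWeight (w : (Fin dV → ℝ) → ℕ → ℝ)
    (Q : ProbabilityMeasure (Obs K dV dX)) : ℝ :=
  ∫ o, weight w o ∂(Q : Measure (Obs K dV dX))

/-! ### The mediation functionals (identification formulas), before division by `E[w(V, N)]` -/

/-- `E[w/N ∑_j ∫ η_j(a*, m, C, N) f(m | a', C, N) dm]`. -/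
noncomputable def psiI (ν : Fin K → Measure ℝ) (w : (Fin dV → ℝ) → ℕ → ℝ) (aS a' : Fin 2)
    (Q : ProbabilityMeasure (Obs K dV dX)) : ℝ :=
  ∫ o, weightedAvg w (fun n j x => etaStar ν Q n j aS a' x.2.1) o ∂(Q : Measure (Obs K dV dX))

/-- `E[w/N ∑_j ∫ η_j(1, m, C, N) f(m^J | 0, C, N) f(m^{K∖J} | 1, C, N) dm]`. -/
noncomputable def psiII (ν : Fin K → Measure ℝ) (w : (Fin dV → ℝ) → ℕ → ℝ)
    (J : Finset (Fin K)) (Q : ProbabilityMeasure (Obs K dV dX)) : ℝ :=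
  ∫ o, weightedAvg w (fun n j x => lam1 ν Q n j (blockSet J n) 1 0 1 x.2.1) o
    ∂(Q : Measure (Obs K dV dX))

/-- `E[w/N ∑_j ∫ η_j(1, m, C, N) f(m^J, m^k_{-j} | 0, C, N) f(m^k_j, m^{K∖(J∪{k})} | 1, C, N) dm]`.
-/
noncomputable def psiIII (ν : Fin K → Measure ℝ) (w : (Fin dV → ℝ) → ℕ → ℝ) (k : Fin K)
    (J : Finset (Fin K)) (Q : ProbabilityMeasure (Obs K dV dX)) : ℝ :=
  ∫ o, weightedAvg w (fun n j x => lam1 ν Q n j (spillSet k J n j)ᶜ 1 1 0 x.2.1) o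
    ∂(Q : Measure (Obs K dV dX))

/-! ### The uncentred influence functions; `x = (A, C, M, Y)` is the data of a cluster of size `n` -/

/-- Uncentred influence function for `θ₁^I(a*, a_J)`, with `a' = a_{J,1}`. -/
noncomputable def phiI (ν : Fin K → Measure ℝ) (π : ℝ) (w : (Fin dV → ℝ) → ℕ → ℝ)
    (P : ProbabilityMeasure (Obs K dV dX)) (aS a' : Fin 2) : Obs K dV dX → ℝ :=
  weightedAvg w fun n j x =>
    let A := x.1
    let C := x.2.1
    let M := x.2.2.1
    let Y := x.2.2.2
    armWeight π aS A * ((medDensity ν P n a' C M).toReal / (medDensity ν P n aS C M).toReal) *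
        (Y j - outcomeMean P n j aS M C) +
      armWeight π a' A * (outcomeMean P n j aS M C - etaStar ν P n j aS a' C) +
      etaStar ν P n j aS a' C

/-- Uncentred influence function for `θ₁^II(1, a_J)`. -/
noncomputable def phiII (ν : Fin K → Measure ℝ) (π : ℝ) (w : (Fin dV → ℝ) → ℕ → ℝ)
    (P : ProbabilityMeasure (Obs K dV dX)) (J : Finset (Fin K)) : Obs K dV dX → ℝ :=
  weightedAvg w fun n j x =>
    let A := x.1
    let C := x.2.1
    let M := x.2.2.1
    let Y := x.2.2.2
    let U := blockSet J n
    let tau := lam1 ν P n j U 1 0 1 C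
    let tauTilde := lam2 ν P n j Uᶜ 1 M C
    let tauCheck := lam2 ν P n j U 0 M C
    let rTilde := lam3 ν P n U 0 1 1 M C
    armWeight π 0 A * tauTilde + (1 - ∑ a : Fin 2, armWeight π a A) * tau +
      armWeight π 1 A * (rTilde * (Y j - outcomeMean P n j 1 M C) + tauCheck)

/-- Uncentred influence function for `θ₂(k, J)`. -/
noncomputable def phiIII (ν : Fin K → Measure ℝ) (π : ℝ) (w : (Fin dV → ℝ) → ℕ → ℝ)
    (P : ProbabilityMeasure (Obs K dV dX)) (k : Fin K) (J : Finset (Fin K)) : Obs K dV dX → ℝ :=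
  weightedAvg w fun n j x =>
    let A := x.1
    let C := x.2.1
    let M := x.2.2.1
    let Y := x.2.2.2
    let U := spillSet k J n j
    let kappa := lam1 ν P n j Uᶜ 1 1 0 C
    let kappaTilde := lam2 ν P n j Uᶜ 1 M C
    let kappaCheck := lam2 ν P n j U 0 M C
    let r := lam3 ν P n U 0 1 1 M C
    armWeight π 0 A * kappaTilde + (1 - ∑ a : Fin 2, armWeight π a A) * kappa +
      armWeight π 1 A * (r * (Y j - outcomeMean P n j 1 M C) + kappaCheck)

end Observed

/-! ## Full data with potential outcomes -/

/-- The full data of a generic cluster, as random variables on `Ω`. Quantities indexed by a cluster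
size `n` matter only on the event `N = n`. The potential outcome `m ↦ Y_j(a, m)` is a random
function: a random element `Ypot n j a` of a measurable space `𝒰` of (codes of) functions, whose
value at the mediator array `m` is given by the jointly measurable evaluation map `ev n`. -/
structure FullData (Ω : Type*) [MeasurableSpace Ω] (𝒰 : Type*) [MeasurableSpace 𝒰]
    (K dV dX : ℕ) where
  N : Ω → ℕ
  A : Ω → Fin 2
  V : Ω → Fin dV → ℝ
  X : ∀ n : ℕ, Ω → Fin n → Fin dX → ℝ
  Mpot : ∀ n : ℕ, Fin 2 → Ω → Med K n
  Ypot : ∀ n : ℕ, Fin n → Fin 2 → Ω → 𝒰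
  ev : ∀ n : ℕ, 𝒰 → Med K n → ℝ
  measurable_N : Measurable N
  measurable_A : Measurable A
  measurable_V : Measurable V
  measurable_X : ∀ n, Measurable (X n)
  measurable_Mpot : ∀ n a, Measurable (Mpot n a)
  measurable_Ypot : ∀ n j a, Measurable (Ypot n j a)
  measurable_ev : ∀ n, Measurable (fun q : 𝒰 × Med K n => ev n q.1 q.2)

/-- The mediator array with the coordinates in `U` taken from `m₀` and the others from `m₁`. -/
def mergeMed {K n : ℕ} (U : Finset (Fin K × Fin n)) (m₀ m₁ : Med K n) : Med K n :=
  fun t => if t ∈ U then m₀ t else m₁ t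

namespace FullData

variable {Ω : Type*} [mΩ : MeasurableSpace Ω] {𝒰 : Type*} [MeasurableSpace 𝒰] {K dV dX : ℕ}
  (D : FullData Ω 𝒰 K dV dX)

/-- The potential outcome `Y_j(a, m)` (in a cluster of size `n`). -/
def Y (n : ℕ) (j : Fin n) (a : Fin 2) (m : Med K n) (ω : Ω) : ℝ := D.ev n (D.Ypot n j a ω) m

/-- The covariates `C = (V, X)`. -/
def C (n : ℕ) (ω : Ω) : Cov dV dX n := (D.V ω, D.X n ω)

/-- The counterfactual mediators with coordinates in `U` at their natural values under control and
the other coordinates at their natural values under treatment. With `U = J × [n]` this is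
`M(a_J) = (M^J(0), M^{K∖J}(1))`. -/
def Mmix (n : ℕ) (U : Finset (Fin K × Fin n)) (ω : Ω) : Med K n :=
  mergeMed U (D.Mpot n 0 ω) (D.Mpot n 1 ω)

/-- The observed data of the cluster if it has size `n`; by consistency the observed mediators are
`M(A)` and the observed outcomes are `Y_j(A, M)` with `M = M(A)`. -/
def obsN (n : ℕ) (ω : Ω) : ObsN K dV dX n :=
  (D.A ω, D.C n ω, D.Mpot n (D.A ω) ω,
    fun j => D.Y n j (D.A ω) (D.Mpot n (D.A ω) ω) ω)

/-- The observed data of the cluster. -/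
def obs (ω : Ω) : Obs K dV dX := ⟨D.N ω, D.obsN (D.N ω) ω⟩

lemma measurable_obsN (n : ℕ) : Measurable (D.obsN n) := by
  have hM : Measurable (fun ω => D.Mpot n (D.A ω) ω) := by
    have h : Measurable (fun q : Fin 2 × Ω => D.Mpot n q.1 q.2) :=
      measurable_from_prod_countable_right (fun a => D.measurable_Mpot n a)
    exact h.comp (D.measurable_A.prodMk measurable_id)
  have hY : ∀ j : Fin n, Measurable (fun ω => D.Ypot n j (D.A ω) ω) := by
    intro j
    have h : Measurable (fun q : Fin 2 × Ω => D.Ypot n j q.1 q.2) :=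
      measurable_from_prod_countable_right (fun a => D.measurable_Ypot n j a)
    exact h.comp (D.measurable_A.prodMk measurable_id)
  refine D.measurable_A.prodMk ((D.measurable_V.prodMk (D.measurable_X n)).prodMk
    (hM.prodMk (measurable_pi_lambda _ fun j => ?_)))
  exact (D.measurable_ev n).comp ((hY j).prodMk hM)

lemma measurable_obs : Measurable D.obs := by
  intro s hs
  have hs' : ∀ n, MeasurableSet (Sigma.mk n ⁻¹' s) := by
    have h := (MeasurableSpace.measurableSet_iInf).1 hs
    exact h
  have h : D.obs ⁻¹' s = ⋃ n, (D.N ⁻¹' {n}) ∩ (D.obsN n ⁻¹' (Sigma.mk n ⁻¹' s)) := by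
    ext ω
    simp only [Set.mem_preimage, Set.mem_iUnion, Set.mem_inter_iff, Set.mem_singleton_iff, obs]
    constructor
    · intro h
      exact ⟨D.N ω, rfl, h⟩
    · rintro ⟨n, rfl, h⟩
      exact h
  rw [h]
  exact MeasurableSet.iUnion fun n =>
    (D.measurable_N (measurableSet_singleton n)).inter (D.measurable_obsN n (hs' n))

/-- The law of the observed data. -/
noncomputable def obsLaw (μ : Measure Ω) [IsProbabilityMeasure μ] :
    ProbabilityMeasure (Obs K dV dX) :=
  ⟨μ.map D.obs, Measure.isProbabilityMeasure_map D.measurable_obs.aemeasurable⟩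

/-! ### Causal estimands -/

/-- `E[w(V,N)]`. -/
noncomputable def meanW (μ : Measure Ω) (w : (Fin dV → ℝ) → ℕ → ℝ) : ℝ :=
  ∫ ω, w (D.V ω) (D.N ω) ∂μ

/-- `θ₁(a*, a_J) = E[w/N ∑_j Y_j(a*, M(a_J))] / E[w]`. -/
noncomputable def theta1 (μ : Measure Ω) (w : (Fin dV → ℝ) → ℕ → ℝ) (aS : Fin 2)
    (J : Finset (Fin K)) : ℝ :=
  (∫ ω, w (D.V ω) (D.N ω) / (D.N ω : ℝ) *
      ∑ j : Fin (D.N ω), D.Y (D.N ω) j aS (D.Mmix (D.N ω) (blockSet J (D.N ω)) ω) ω ∂μ) /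
    D.meanW μ w

/-- `θ₂(k, J) = E[w/N ∑_j Y_j(1, M^J(0), M^k_{-j}(0), M^k_j(1), M^{K∖(J∪{k})}(1))] / E[w]`. -/
noncomputable def theta2 (μ : Measure Ω) (w : (Fin dV → ℝ) → ℕ → ℝ) (k : Fin K)
    (J : Finset (Fin K)) : ℝ :=
  (∫ ω, w (D.V ω) (D.N ω) / (D.N ω : ℝ) *
      ∑ j : Fin (D.N ω), D.Y (D.N ω) j 1 (D.Mmix (D.N ω) (spillSet k J (D.N ω) j) ω) ω ∂μ) /
    D.meanW μ w

/-! ### Structural assumptions -/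

/-- Super-population framework (consistency being built into `obs`): bounded cluster sizes,
cluster randomisation with known probability `π`, bounded second moments of the potential outcomes,
and a mediator density that is bounded away from zero on the support of the mediators. -/
structure SuperPopulation (μ : Measure Ω) [IsProbabilityMeasure μ] (ν : Fin K → Measure ℝ)
    (π : ℝ) : Prop where
  size_bounded : ∃ nmax : ℕ, ∀ᵐ ω ∂μ, 1 ≤ D.N ω ∧ D.N ω ≤ nmax
  treatment_prob : μ {ω | D.A ω = 1} = ENNReal.ofReal π
  treatment_indep_size : IndepFun D.A D.N μ
  randomization : ∀ (n : ℕ) (j : Fin n) (a : Fin 2),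
    IndepFun D.A (fun ω => (D.C n ω, D.Mpot n a ω, D.Ypot n j a ω)) (μ[|D.N ⁻¹' {n}])
  second_moments : ∀ (n : ℕ) (j : Fin n) (a : Fin 2) (U : Finset (Fin K × Fin n)),
    MemLp (fun ω => D.Y n j a (D.Mmix n U ω) ω) 2 (μ[|D.N ⁻¹' {n}])
  has_density : ∀ n : ℕ, jointLaw (D.obsLaw μ) n ≪ baseMeasure ν (D.obsLaw μ) n
  density_lower : ∃ fmin : ℝ, 0 < fmin ∧ ∀ n : ℕ, ∀ᵐ q ∂(baseMeasure ν (D.obsLaw μ) n),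
    ENNReal.ofReal fmin ≤ medDensity ν (D.obsLaw μ) n q.1.1 q.1.2 q.2

/-- Mediator-outcome ignorability: `Y_j(a, ·) ⟂ {M(0), M(1)} | A, N, C`. -/
def MediatorOutcomeIgnorability [StandardBorelSpace Ω] (μ : Measure Ω) : Prop :=
  ∀ (n : ℕ) (j : Fin n) (a : Fin 2),
    CondIndepFun (MeasurableSpace.comap (fun ω => (D.A ω, D.C n ω)) inferInstance)
      ((D.measurable_A.prodMk (D.measurable_V.prodMk (D.measurable_X n))).comap_le)
      (D.Ypot n j a) (fun ω => (D.Mpot n 0 ω, D.Mpot n 1 ω)) (μ[|D.N ⁻¹' {n}])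

/-- The cluster-average potential outcome `N⁻¹ ∑_j Y_j(1, m)` in a cluster of size `n`. -/
noncomputable def Ybar (n : ℕ) (m : Med K n) (ω : Ω) : ℝ := (n : ℝ)⁻¹ * ∑ j : Fin n, D.Y n j 1 m ω

/-- Conditional homogeneity in average potential outcomes, indexed by `J`: for every `Js ⊆ J` other
than `∅` and the full set, and almost every value `m` of `M^Js(0)`,
`E[Ȳ(1, M(a_Js)) | M^Js(0) = m, C, N] = E[Ȳ(1, m, M^{K∖Js}(1)) | C, N]`.
The right-hand side is computed from the regular conditional probability given `C` on `N = n`. -/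
def ConditionalHomogeneity [StandardBorelSpace Ω] (μ : Measure Ω) (J : Finset (Fin K)) : Prop :=
  ∀ Js ⊆ J, Js ≠ ∅ → Js ≠ Finset.univ → ∀ n : ℕ,
    ∀ᵐ ω ∂(μ[|D.N ⁻¹' {n}]),
      (μ[|D.N ⁻¹' {n}])[(fun ω' => D.Ybar n (D.Mmix n (blockSet Js n) ω') ω') |
          MeasurableSpace.comap
            (fun ω' => (D.C n ω', (blockSet Js n).restrict (D.Mpot n 0 ω'))) inferInstance] ω =
        ∫ ω', D.Ybar n (mergeMed (blockSet Js n) (D.Mpot n 0 ω) (D.Mpot n 1 ω')) ω'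
          ∂(condExpKernel (μ[|D.N ⁻¹' {n}]) (MeasurableSpace.comap (D.C n) inferInstance) ω)

/-- Cross-world mediator conditional independence, indexed by `(k, J)`: for all `j` and all
`Js ⊆ J ∖ {k}`,
`{M^Js(0), M^k_{-j}(0)} ⟂ {M^k_j(1), M^{K∖(Js∪{k})}(1)} | C, N`. -/
def CrossWorldIndependence [StandardBorelSpace Ω] (μ : Measure Ω) (k : Fin K)
    (J : Finset (Fin K)) : Prop :=
  ∀ Js ⊆ J \ {k}, ∀ (n : ℕ) (j : Fin n),
    CondIndepFun (MeasurableSpace.comap (D.C n) inferInstance)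
      ((D.measurable_V.prodMk (D.measurable_X n)).comap_le)
      (fun ω => (spillSet k Js n j).restrict (D.Mpot n 0 ω))
      (fun ω => (spillSet k Js n j)ᶜ.restrict (D.Mpot n 1 ω)) (μ[|D.N ⁻¹' {n}])

/-- Boundedness conditions under which the influence functions have finite variance: mediator
densities bounded above, and a measurable bounded cluster weight of nonzero mean. -/
structure Regularity (μ : Measure Ω) [IsProbabilityMeasure μ] (ν : Fin K → Measure ℝ)
    (w : (Fin dV → ℝ) → ℕ → ℝ) : Prop where
  density_upper : ∃ fmax : ℝ, ∀ n : ℕ, ∀ᵐ q ∂(baseMeasure ν (D.obsLaw μ) n),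
    medDensity ν (D.obsLaw μ) n q.1.1 q.1.2 q.2 ≤ ENNReal.ofReal fmax
  weight_measurable : ∀ n : ℕ, Measurable fun v => w v n
  weight_bounded : ∃ wmax : ℝ, ∀ᵐ ω ∂μ, |w (D.V ω) (D.N ω)| ≤ wmax
  weight_mean : D.meanW μ w ≠ 0

end FullData

/-!
All the functionals are instances of one functional of an observed-data law. In a cluster of a
fixed size `n`, let `f₀, f₁` be the mediator densities of the two arms, `η` an outcome regression
and `s` a set of mediator coordinates; `crossMean` is `∫ η(a, m) f(m_s | a₂) f(m_sᶜ | a₃) dm` as a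
function of the covariates, and `crossPsi` is the mean of its weighted average over the
individuals of a cluster. The cluster size is bounded, and the analysis is carried out for one
size at a time, on the slices of the law.

*Influence function.* For two laws `L, L'` with nuisance functions `(f, η)` and `(f', η')`, the
mean of `crossMean` under `L'` differs from the mean under `L'` of the proposed influence function
at `L` by two terms exactly: the integral of `η` times a product of two density errors, and the
mean of the outcome residual `Y - η` times a coefficient that is linear in the density errors up
to bounded factors (`integral_crossMean_sub_integral_crossIF`). Along a regular submodel the
likelihood ratio is `1 + O(ε)` in `L²`. Testing a density error against itself shows that it is
`O(ε)` in `L²` too. The residual has mean zero under `L` against every function of `(A, C, M)`, so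
its mean under `L'` carries a second factor `O(ε)`. As `Y` is only square-integrable, these
products are not `O(ε²)`, but they are `o(ε)`: a bounded sequence that tends to zero in `L²` still
does after multiplication by a fixed square-integrable function. Hence the derivative of the
functional is the integral of the influence function times the score. The tangent space is the
closed span of the scores of the model in which the arm is independent of `(C, N)` with known
probability: the mean-zero functions whose conditional mean given arm and `(C, N)` depends on
`(C, N)` only. Bounded such functions are scores of linear paths `1 + ε S` and are dense, and the
influence functions are of this form because their only terms that depend on the arm are centred
given arm and `(C, N)`. Dividing by `E_Q[w]`, which is itself linear in `Q`, is the quotient rule.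
This is `IsRegularLaw.isEIF`.

*Identification.* By randomisation `f_a` is the conditional density of `M(a)` given `(C, N)`, and
`η(a, ·)` is, on the support, the conditional mean of `Y(a, m)` at `M(a) = m`. Ignorability makes
the outcome function conditionally independent of both mediator arrays, so its conditional mean at
any array that depends on `(M(0), M(1))` is `∫ η(a, m) dκ`, where `κ` is the conditional law of
that array (`IsNuisance.integral_condLaw_ae_eq`); if `κ` has density `f₀(m_s) f₁(m_sᶜ)`, this is
the cross-arm mean. Under cross-world independence the array taking `s` from `M(0)` and the rest
from `M(1)` has exactly this density. Under conditional homogeneity it need not, but the mean is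
unchanged when the treated world, `M(1)` with the outcome function, is redrawn from its
conditional law given `(C, N)`, independently of `M(0)`, and the array with the redrawn `M(1)`
does (`sum_integral_weight_mul_homogeneous`).

The mediator densities are bounded away from zero almost everywhere for the reference measures,
which are therefore finite (`SuperPopulation.isFiniteMeasure_ref`); this makes all marginal
densities bounded.
-/

set_option linter.unusedSectionVars false

/-! ### Integrating out coordinates of a product measure -/

section Coordinates

variable {ι : Type*} [DecidableEq ι]

lemma updateFinset_updateFinset_same (s : Finset ι) (m : ι → ℝ) (y z : s → ℝ) :
    Function.updateFinset (Function.updateFinset m s y) s z = Function.updateFinset m s z := by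
  funext i
  by_cases hi : i ∈ s <;> simp [Function.updateFinset, hi]

lemma restrict_updateFinset_same (s : Finset ι) (m : ι → ℝ) (y : s → ℝ) :
    s.restrict (Function.updateFinset m s y) = y := by
  funext i
  simp [Function.updateFinset]

/-- Exchange the coordinates in `s` of the array with those of the second component. -/
def resample (s : Finset ι) (p : (ι → ℝ) × (s → ℝ)) : (ι → ℝ) × (s → ℝ) :=
  (Function.updateFinset p.1 s p.2, s.restrict p.1)

lemma measurable_resample (s : Finset ι) : Measurable (resample s) :=
  measurable_updateFinset'.prodMk ((Finset.measurable_restrict s).comp measurable_fst)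

end Coordinates

section Marginal

variable {ι : Type*} [Fintype ι] [DecidableEq ι] (ν : ι → Measure ℝ) [∀ i, SigmaFinite (ν i)]

/-- Integrating out the coordinates in `s` is a self-adjoint operation. -/
lemma lintegral_lmarginal_mul (s : Finset ι) {g h : (ι → ℝ) → ℝ≥0∞}
    (hg : Measurable g) (hh : Measurable h) :
    ∫⁻ m, lmarginal ν s g m * h m ∂Measure.pi ν
      = ∫⁻ m, g m * lmarginal ν s h m ∂Measure.pi ν := by
  refine lintegral_eq_of_lmarginal_eq s ((hg.lmarginal ν).mul hh)
    (hg.mul (hh.lmarginal ν)) ?_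
  funext m
  have e1 : lmarginal ν s (fun m => lmarginal ν s g m * h m) m
      = lmarginal ν s g m * lmarginal ν s h m := by
    simp only [lmarginal, updateFinset_updateFinset_same]
    exact lintegral_const_mul _ (hh.comp measurable_updateFinset)
  have e2 : lmarginal ν s (fun m => g m * lmarginal ν s h m) m
      = lmarginal ν s g m * lmarginal ν s h m := by
    simp only [lmarginal, updateFinset_updateFinset_same]
    exact lintegral_mul_const _ (hg.comp measurable_updateFinset)
  exact e1.trans e2.symm

lemma measurePreserving_resample (s : Finset ι) :
    MeasurePreserving (resample s)
      ((Measure.pi ν).prod (Measure.pi fun i : s => ν i))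
      ((Measure.pi ν).prod (Measure.pi fun i : s => ν i)) := by
  refine ⟨measurable_resample s, ?_⟩
  refine (Measure.prod_eq fun S T hS hT => ?_).symm
  have hR : Measurable (fun m : ι → ℝ => s.restrict m) := Finset.measurable_restrict s
  rw [Measure.map_apply (measurable_resample s) (hS.prod hT)]
  rw [← lintegral_indicator_one (measurable_resample s (hS.prod hT)), lintegral_prod]
  · have e1 : ∀ m : ι → ℝ, ∫⁻ y, (resample s ⁻¹' (S ×ˢ T)).indicator
        (1 : (ι → ℝ) × (s → ℝ) → ℝ≥0∞) (m, y)
        ∂(Measure.pi fun i : s => ν i)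
        = lmarginal ν s (S.indicator 1) m * (s.restrict ⁻¹' T).indicator 1 m := by
      intro m
      rw [lmarginal, ← lintegral_mul_const]
      · refine lintegral_congr fun y => ?_
        by_cases h1 : Function.updateFinset m s y ∈ S <;> by_cases h2 : s.restrict m ∈ T <;>
          simp [Set.indicator, resample, h1, h2]
      · exact (measurable_one.indicator hS).comp measurable_updateFinset
    simp_rw [e1]
    rw [lintegral_lmarginal_mul ν s (measurable_one.indicator hS)
      (measurable_one.indicator (hR hT))]
    have e2 : ∀ m : ι → ℝ, lmarginal ν s ((s.restrict ⁻¹' T).indicator 1) m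
        = (Measure.pi fun i : s => ν i) T := by
      intro m
      rw [lmarginal, ← lintegral_indicator_one hT]
      refine lintegral_congr fun y => ?_
      by_cases h2 : y ∈ T <;> simp [Set.indicator, restrict_updateFinset_same, h2]
    simp_rw [e2]
    rw [lintegral_mul_const _ (measurable_one.indicator hS), lintegral_indicator_one hS]
  · exact (measurable_one.indicator (measurable_resample s (hS.prod hT))).aemeasurable

variable {𝒞 : Type*} [MeasurableSpace 𝒞] (ρ : Measure 𝒞) [SFinite ρ]

/-- `resample` in the presence of a passive coordinate. -/
def resampleWith (𝒞 : Type*) (s : Finset ι) (p : (𝒞 × (ι → ℝ)) × (s → ℝ)) :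
    (𝒞 × (ι → ℝ)) × (s → ℝ) :=
  ((p.1.1, Function.updateFinset p.1.2 s p.2), s.restrict p.1.2)

lemma measurePreserving_resampleWith (s : Finset ι) :
    MeasurePreserving (resampleWith 𝒞 s)
      ((ρ.prod (Measure.pi ν)).prod (Measure.pi fun i : s => ν i))
      ((ρ.prod (Measure.pi ν)).prod (Measure.pi fun i : s => ν i)) := by
  have h1 : MeasurePreserving (MeasurableEquiv.prodAssoc : (𝒞 × (ι → ℝ)) × (s → ℝ) ≃ᵐ _)
      ((ρ.prod (Measure.pi ν)).prod (Measure.pi fun i : s => ν i))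
      (ρ.prod ((Measure.pi ν).prod (Measure.pi fun i : s => ν i))) :=
    ⟨MeasurableEquiv.prodAssoc.measurable, Measure.prodAssoc_prod⟩
  have h2 := (MeasurePreserving.id ρ).prod (measurePreserving_resample ν s)
  exact (h1.symm _).comp (h2.comp h1)

/-- The Bochner integral of `h` over the coordinates in `s`, as a function of the others. -/
noncomputable def marginal (s : Finset ι) (h : (ι → ℝ) → ℝ) (m : ι → ℝ) : ℝ :=
  ∫ y, h (Function.updateFinset m s y) ∂(Measure.pi fun i : s => ν i)

lemma measurable_updateWith (s : Finset ι) : Measurable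
    (fun p : (𝒞 × (ι → ℝ)) × (s → ℝ) => (p.1.1, Function.updateFinset p.1.2 s p.2)) := by
  have h : Measurable (fun p : (𝒞 × (ι → ℝ)) × (s → ℝ) => (p.1.2, p.2)) := by fun_prop
  exact (measurable_fst.comp measurable_fst).prodMk (measurable_updateFinset'.comp h)

lemma measurable_marginal (s : Finset ι) {h : 𝒞 × (ι → ℝ) → ℝ} (hh : Measurable h) :
    Measurable (fun q : 𝒞 × (ι → ℝ) => marginal ν s (fun m => h (q.1, m)) q.2) := by
  have : StronglyMeasurable (fun p : (𝒞 × (ι → ℝ)) × (s → ℝ) =>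
      h (p.1.1, Function.updateFinset p.1.2 s p.2)) :=
    (hh.comp (measurable_updateWith s)).stronglyMeasurable
  exact this.integral_prod_right.measurable

lemma measurable_lmarginal_prod (s : Finset ι) {h : 𝒞 × (ι → ℝ) → ℝ≥0∞} (hh : Measurable h) :
    Measurable (fun q : 𝒞 × (ι → ℝ) => lmarginal ν s (fun m => h (q.1, m)) q.2) :=
  Measurable.lintegral_prod_right (hh.comp (measurable_updateWith s))

/-- Self-adjointness of `marginal` for real functions. -/
lemma integral_mul_marginal (s : Finset ι) {g h : 𝒞 × (ι → ℝ) → ℝ}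
    (hgh : Integrable (fun p : (𝒞 × (ι → ℝ)) × (s → ℝ) =>
      g p.1 * h (p.1.1, Function.updateFinset p.1.2 s p.2))
      ((ρ.prod (Measure.pi ν)).prod (Measure.pi fun i : s => ν i))) :
    ∫ q, g q * marginal ν s (fun m => h (q.1, m)) q.2 ∂(ρ.prod (Measure.pi ν))
      = ∫ q, marginal ν s (fun m => g (q.1, m)) q.2 * h q ∂(ρ.prod (Measure.pi ν)) := by
  have hT := measurePreserving_resampleWith ν ρ s
  have hcomp := hT.integrable_comp_of_integrable hgh
  have key := integral_map hT.measurable.aemeasurable (by rw [hT.map_eq]; exact hgh.1)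
  rw [hT.map_eq] at key
  have e1 : ∫ q, g q * marginal ν s (fun m => h (q.1, m)) q.2 ∂(ρ.prod (Measure.pi ν))
      = ∫ p, g p.1 * h (p.1.1, Function.updateFinset p.1.2 s p.2)
        ∂((ρ.prod (Measure.pi ν)).prod (Measure.pi fun i : s => ν i)) := by
    rw [integral_prod _ hgh]
    refine integral_congr_ae (Eventually.of_forall fun q => ?_)
    simp only [marginal]
    rw [integral_const_mul]
  have e2 : ∫ q, marginal ν s (fun m => g (q.1, m)) q.2 * h q ∂(ρ.prod (Measure.pi ν))
      = ∫ p, g (p.1.1, Function.updateFinset p.1.2 s p.2) * h p.1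
        ∂((ρ.prod (Measure.pi ν)).prod (Measure.pi fun i : s => ν i)) := by
    have hc : Integrable (fun p : (𝒞 × (ι → ℝ)) × (s → ℝ) =>
        g (p.1.1, Function.updateFinset p.1.2 s p.2) * h p.1)
        ((ρ.prod (Measure.pi ν)).prod (Measure.pi fun i : s => ν i)) := by
      refine hcomp.congr (Eventually.of_forall fun p => ?_)
      simp [resampleWith, updateFinset_updateFinset_same]
    rw [integral_prod _ hc]
    refine integral_congr_ae (Eventually.of_forall fun q => ?_)
    simp only [marginal]
    rw [integral_mul_const]
  rw [e1, e2, key]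
  refine integral_congr_ae (Eventually.of_forall fun p => ?_)
  simp [resampleWith, updateFinset_updateFinset_same]

variable {ρ}

lemma ae_updateFinset (s : Finset ι) {p : 𝒞 × (ι → ℝ) → Prop}
    (hp : ∀ᵐ q ∂(ρ.prod (Measure.pi ν)), p q) :
    ∀ᵐ z ∂((ρ.prod (Measure.pi ν)).prod (Measure.pi fun i : s => ν i)),
      p (z.1.1, Function.updateFinset z.1.2 s z.2) :=
  ((Measure.quasiMeasurePreserving_fst.comp
    (measurePreserving_resampleWith ν ρ s).quasiMeasurePreserving).ae hp)

lemma ae_ae_updateFinset (s : Finset ι) {p : 𝒞 × (ι → ℝ) → Prop}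
    (hp : ∀ᵐ q ∂(ρ.prod (Measure.pi ν)), p q) :
    ∀ᵐ q ∂(ρ.prod (Measure.pi ν)), ∀ᵐ y ∂(Measure.pi fun i : s => ν i),
      p (q.1, Function.updateFinset q.2 s y) :=
  Measure.ae_ae_of_ae_prod (ae_updateFinset ν s hp)

lemma integrable_updateFinset [∀ i, IsFiniteMeasure (ν i)] (s : Finset ι)
    {h : 𝒞 × (ι → ℝ) → ℝ} (hh : Integrable h (ρ.prod (Measure.pi ν))) :
    Integrable (fun z : (𝒞 × (ι → ℝ)) × (s → ℝ) => h (z.1.1, Function.updateFinset z.1.2 s z.2))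
      ((ρ.prod (Measure.pi ν)).prod (Measure.pi fun i : s => ν i)) := by
  have h1 : Integrable (fun z : (𝒞 × (ι → ℝ)) × (s → ℝ) => h z.1)
      ((ρ.prod (Measure.pi ν)).prod (Measure.pi fun i : s => ν i)) := hh.comp_fst _
  exact (measurePreserving_resampleWith ν ρ s).integrable_comp_of_integrable h1

end Marginal

/-! ### Estimates in `L²` -/

section LTwo

variable {α γ : Type*} [MeasurableSpace α] [MeasurableSpace γ]

lemma eLpNorm_two_sq (f : α → ℝ) (μ : Measure α) :
    eLpNorm f 2 μ ^ 2 = ∫⁻ x, ‖f x‖ₑ ^ 2 ∂μ := by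
  have h := eLpNorm_nnreal_pow_eq_lintegral (f := f) (μ := μ) (p := 2) (by norm_num)
  simpa using h

lemma enorm_integral_mul_le (f g : α → ℝ) {μ : Measure α} (hf : AEStronglyMeasurable f μ)
    (hg : AEStronglyMeasurable g μ) :
    ‖∫ x, f x * g x ∂μ‖ₑ ≤ eLpNorm f 2 μ * eLpNorm g 2 μ := by
  refine (enorm_integral_le_lintegral_enorm _).trans ?_
  have h := eLpNorm_smul_le_mul_eLpNorm (p := 2) (q := 2) (r := 1) hg hf
  rwa [eLpNorm_one_eq_lintegral_enorm] at h

lemma eLpNorm_two_mul_le {f k : α → ℝ} {μ : Measure α} {B : ℝ} (hk : ∀ᵐ x ∂μ, |k x| ≤ B) :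
    eLpNorm (fun x => k x * f x) 2 μ ≤ ENNReal.ofReal B * eLpNorm f 2 μ := by
  refine eLpNorm_le_mul_eLpNorm_of_ae_le_mul ?_ 2
  filter_upwards [hk] with x hx
  rw [norm_mul]
  exact mul_le_mul_of_nonneg_right hx (norm_nonneg _)

lemma memLp_two_bdd_mul {f k : α → ℝ} {μ : Measure α} {B : ℝ} (hf : MemLp f 2 μ)
    (hk : AEStronglyMeasurable k μ) (hB : ∀ᵐ x ∂μ, |k x| ≤ B) :
    MemLp (fun x => k x * f x) 2 μ :=
  ⟨hk.mul hf.1, (eLpNorm_two_mul_le hB).trans_lt (ENNReal.mul_lt_top ENNReal.ofReal_lt_top hf.2)⟩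

/-- Integrating out a variable over a finite measure is bounded on `L²`. -/
lemma eLpNorm_two_integral_prod_le {β : Measure α} {r : Measure γ} [SFinite β] [IsFiniteMeasure r]
    {h : α × γ → ℝ} (hh : AEStronglyMeasurable h (β.prod r)) :
    eLpNorm (fun q => ∫ y, h (q, y) ∂r) 2 β ≤ r Set.univ ^ (1 / 2 : ℝ) * eLpNorm h 2 (β.prod r) := by
  have key : ∀ᵐ q ∂β, ‖∫ y, h (q, y) ∂r‖ₑ ^ 2 ≤ r Set.univ * ∫⁻ y, ‖h (q, y)‖ₑ ^ 2 ∂r := by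
    filter_upwards [hh.prodMk_left] with q hq
    have h1 := eLpNorm_le_eLpNorm_mul_rpow_measure_univ (p := 1) (q := 2) (by norm_num) hq
    rw [eLpNorm_one_eq_lintegral_enorm] at h1
    have h2 := pow_le_pow_left' ((enorm_integral_le_lintegral_enorm _).trans h1) 2
    refine h2.trans (le_of_eq ?_)
    rw [mul_pow, eLpNorm_two_sq, mul_comm]
    congr 1
    rw [← ENNReal.rpow_natCast, ← ENNReal.rpow_mul]
    norm_num
  have h3 : eLpNorm (fun q => ∫ y, h (q, y) ∂r) 2 β ^ 2
      ≤ (r Set.univ ^ (1 / 2 : ℝ) * eLpNorm h 2 (β.prod r)) ^ 2 := by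
    rw [eLpNorm_two_sq, mul_pow, eLpNorm_two_sq, ← ENNReal.rpow_natCast, ← ENNReal.rpow_mul]
    norm_num
    rw [lintegral_prod _ (by fun_prop), ← lintegral_const_mul'' _ (by fun_prop)]
    exact lintegral_mono_ae key
  exact (ENNReal.pow_le_pow_left_iff two_ne_zero).1 h3

/-- A bounded family that tends to zero in `L²` still does after multiplication by an unbounded
square-integrable function: approximate that function by simple ones. -/
lemma tendsto_eLpNorm_mul_of_bounded {E : Type*} {l : Filter E} {μ : Measure α}
    {h : α → ℝ} (hh : MemLp h 2 μ) {k : E → α → ℝ} {B : ℝ}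
    (hk : ∀ᶠ e in l, AEStronglyMeasurable (k e) μ) (hB : ∀ᶠ e in l, ∀ᵐ x ∂μ, |k e x| ≤ B)
    (hlim : Tendsto (fun e => eLpNorm (k e) 2 μ) l (𝓝 0)) :
    Tendsto (fun e => eLpNorm (fun x => k e x * h x) 2 μ) l (𝓝 0) := by
  rw [ENNReal.tendsto_nhds_zero]
  intro ε hε
  have hη : ε / 2 / (ENNReal.ofReal B + 1) ≠ 0 := by
    simp [ENNReal.div_eq_zero_iff, hε.ne']
  obtain ⟨g, hg, hgLp⟩ := hh.exists_simpleFunc_eLpNorm_sub_lt (by norm_num) hη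
  obtain ⟨G, hG⟩ := g.exists_forall_norm_le
  have h2 : Tendsto (fun e => ENNReal.ofReal G * eLpNorm (k e) 2 μ) l (𝓝 0) := by
    simpa using ENNReal.Tendsto.const_mul hlim (Or.inr ENNReal.ofReal_ne_top)
  have h3 := (ENNReal.tendsto_nhds_zero.1 h2) (ε / 2) (ENNReal.half_pos hε.ne')
  filter_upwards [hk, hB, h3] with e hk hB h3
  have e1 : (fun x => k e x * h x) = (fun x => k e x * (h - ⇑g) x) + fun x => g x * k e x := by
    funext x
    simp only [Pi.add_apply, Pi.sub_apply]
    ring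
  rw [e1]
  refine (eLpNorm_add_le (hk.mul (hh.1.sub hgLp.1)) (hgLp.1.mul hk) (by norm_num)).trans ?_
  rw [← ENNReal.add_halves ε]
  refine add_le_add ?_ ((eLpNorm_two_mul_le (Eventually.of_forall fun x => ?_)).trans h3)
  · refine (eLpNorm_two_mul_le hB).trans ?_
    refine (mul_le_mul' (le_self_add (b := 1)) hg.le).trans (le_of_eq ?_)
    exact ENNReal.mul_div_cancel (by simp) (by simp)
  · exact hG x

end LTwo

/-! ### Nuisance functions of the law of a cluster of fixed size -/

section Slice

variable {𝒞 ι 𝒴 : Type*} [MeasurableSpace 𝒞] [Fintype ι] [DecidableEq ι] [MeasurableSpace 𝒴]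

/-- Covariates and mediators of a record `(A, C, M, Y)`. -/
def covMed (x : Fin 2 × 𝒞 × (ι → ℝ) × 𝒴) : 𝒞 × (ι → ℝ) := (x.2.1, x.2.2.1)

lemma measurable_covMed : Measurable (covMed : Fin 2 × 𝒞 × (ι → ℝ) × 𝒴 → _) := by
  unfold covMed; fun_prop

/-- The law of the covariates. -/
noncomputable def covLaw (L : Measure (Fin 2 × 𝒞 × (ι → ℝ) × 𝒴)) : Measure 𝒞 :=
  L.map (fun x => x.2.1)

instance (L : Measure (Fin 2 × 𝒞 × (ι → ℝ) × 𝒴)) [IsFiniteMeasure L] :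
    IsFiniteMeasure (covLaw L) := by
  unfold covLaw; infer_instance

/-- The product of the law of the covariates with the reference measure on mediators. -/
noncomputable def covBase (ν : ι → Measure ℝ) (L : Measure (Fin 2 × 𝒞 × (ι → ℝ) × 𝒴)) :
    Measure (𝒞 × (ι → ℝ)) :=
  (covLaw L).prod (Measure.pi ν)

/-- The density `f` with the coordinates in `s` integrated out. -/
noncomputable def subMass (ν : ι → Measure ℝ) (s : Finset ι) (f : (ι → ℝ) → ℝ≥0∞)
    (m : ι → ℝ) : ℝ :=
  (lmarginal ν s f m).toReal

/-- `f` and `η` are a conditional density of the mediators and a conditional mean of the outcome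
`Y` for the law `L` of a record `(A, C, M, Y)` with known propensity: `f` is bounded between `lo`
and `hi`, `f(a, ·, ·)` is the density of `(C, M)` on `A = a` up to the factor `Pr(A = a)`, and
`Y - η(A, M, C)` is orthogonal to the bounded functions of `(A, C, M)`. -/
structure IsNuisance (L : Measure (Fin 2 × 𝒞 × (ι → ℝ) × 𝒴)) (Y : 𝒴 → ℝ) (ν : ι → Measure ℝ)
    (π : ℝ) (f : Fin 2 → 𝒞 → (ι → ℝ) → ℝ≥0∞) (η : Fin 2 → (ι → ℝ) → 𝒞 → ℝ) (lo hi : ℝ) :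
    Prop where
  measurable_density : ∀ a, Measurable fun q : 𝒞 × (ι → ℝ) => f a q.1 q.2
  measurable_mean : ∀ a, Measurable fun q : 𝒞 × (ι → ℝ) => η a q.2 q.1
  measurable_outcome : Measurable Y
  lo_pos : 0 < lo
  lo_le_hi : lo ≤ hi
  propensity_pos : ∀ a, 0 < propensity π a
  density_bounds : ∀ a, ∀ᵐ q ∂(covBase ν L),
    ENNReal.ofReal lo ≤ f a q.1 q.2 ∧ f a q.1 q.2 ≤ ENNReal.ofReal hi
  law : ∀ a, (L.restrict {x | x.1 = a}).map covMed
    = ENNReal.ofReal (propensity π a) • (covBase ν L).withDensity fun q => f a q.1 q.2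
  density_norm : ∀ a, ∀ᵐ c ∂(covLaw L), ∫⁻ m, f a c m ∂(Measure.pi ν) = 1
  memLp_outcome : MemLp (fun x => Y x.2.2.2) 2 L
  memLp_mean : MemLp (fun x => η x.1 x.2.2.1 x.2.1) 2 L
  residual : ∀ ψ : Fin 2 → 𝒞 × (ι → ℝ) → ℝ, (∀ a, Measurable (ψ a)) →
    ∀ B : ℝ, (∀ᵐ x ∂L, |ψ x.1 (covMed x)| ≤ B) →
      ∫ x, ψ x.1 (covMed x) * (Y x.2.2.2 - η x.1 x.2.2.1 x.2.1) ∂L = 0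

lemma measurable_armWeight (π : ℝ) (a : Fin 2) :
    Measurable fun x : Fin 2 × 𝒞 × (ι → ℝ) × 𝒴 => armWeight π a x.1 :=
  (measurable_of_countable (armWeight π a)).comp measurable_fst

lemma armWeight_mul_arm (π : ℝ) (a A : Fin 2) (G : Fin 2 → ℝ) :
    armWeight π a A * G A = armWeight π a A * G a := by
  by_cases h : A = a <;> simp [armWeight, h]

lemma measurable_subMass (ν : ι → Measure ℝ) [∀ i, SigmaFinite (ν i)] (s : Finset ι)
    {f : 𝒞 → (ι → ℝ) → ℝ≥0∞} (hf : Measurable fun q : 𝒞 × (ι → ℝ) => f q.1 q.2) :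
    Measurable fun q : 𝒞 × (ι → ℝ) => subMass ν s (f q.1) q.2 :=
  (measurable_lmarginal_prod ν s hf).ennreal_toReal

namespace IsNuisance

variable {L : Measure (Fin 2 × 𝒞 × (ι → ℝ) × 𝒴)} [IsFiniteMeasure L] {Y : 𝒴 → ℝ}
  {ν : ι → Measure ℝ} [∀ i, IsFiniteMeasure (ν i)] {π : ℝ}
  {f : Fin 2 → 𝒞 → (ι → ℝ) → ℝ≥0∞} {η : Fin 2 → (ι → ℝ) → 𝒞 → ℝ} {lo hi : ℝ}

instance : IsFiniteMeasure (covBase ν L) := by unfold covBase; infer_instance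

lemma density_lt_top (hL : IsNuisance L Y ν π f η lo hi) (a : Fin 2) :
    ∀ᵐ q ∂(covBase ν L), f a q.1 q.2 < ∞ := by
  filter_upwards [hL.density_bounds a] with q hq
  exact hq.2.trans_lt ENNReal.ofReal_lt_top

lemma hi_pos (hL : IsNuisance L Y ν π f η lo hi) : 0 < hi := hL.lo_pos.trans_le hL.lo_le_hi

lemma toReal_density_bounds (hL : IsNuisance L Y ν π f η lo hi) (a : Fin 2) :
    ∀ᵐ q ∂(covBase ν L), lo ≤ (f a q.1 q.2).toReal ∧ (f a q.1 q.2).toReal ≤ hi := by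
  filter_upwards [hL.density_bounds a] with q hq
  have h := hq.2.trans_lt ENNReal.ofReal_lt_top
  exact ⟨(ENNReal.ofReal_le_iff_le_toReal h.ne).1 hq.1,
    ENNReal.toReal_le_of_le_ofReal hL.hi_pos.le hq.2⟩

/-- Integrals over the arm `A = a` in terms of the density. -/
lemma integral_armWeight (hL : IsNuisance L Y ν π f η lo hi) (a : Fin 2) {g : 𝒞 × (ι → ℝ) → ℝ}
    (hg : Measurable g) :
    ∫ x, armWeight π a x.1 * g (covMed x) ∂L
      = ∫ q, (f a q.1 q.2).toReal * g q ∂(covBase ν L) := by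
  have hS : MeasurableSet {x : Fin 2 × 𝒞 × (ι → ℝ) × 𝒴 | x.1 = a} :=
    measurable_fst (measurableSet_singleton a)
  have hp := hL.propensity_pos a
  have e1 : ∀ x : Fin 2 × 𝒞 × (ι → ℝ) × 𝒴, armWeight π a x.1 * g (covMed x)
      = {x : Fin 2 × 𝒞 × (ι → ℝ) × 𝒴 | x.1 = a}.indicator
        (fun x => (propensity π a)⁻¹ * g (covMed x)) x := by
    intro x
    by_cases h : x.1 = a <;> simp [armWeight, h]
  simp_rw [e1]
  rw [integral_indicator hS, integral_const_mul,
    ← integral_map (f := g) measurable_covMed.aemeasurable hg.aestronglyMeasurable, hL.law a,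
    integral_smul_measure,
    integral_withDensity_eq_integral_toReal_smul (hL.measurable_density a) (hL.density_lt_top a),
    ENNReal.toReal_ofReal hp.le, smul_eq_mul, ← mul_assoc, inv_mul_cancel₀ hp.ne', one_mul]
  rfl

lemma ae_of_ae_covBase (hL : IsNuisance L Y ν π f η lo hi) {p : Fin 2 → 𝒞 × (ι → ℝ) → Prop}
    (hp : ∀ a, ∀ᵐ q ∂(covBase ν L), p a q) : ∀ᵐ x ∂L, p x.1 (covMed x) := by
  have h : ∀ a, ∀ᵐ x ∂L, x.1 = a → p a (covMed x) := by
    intro a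
    have hS : MeasurableSet {x : Fin 2 × 𝒞 × (ι → ℝ) × 𝒴 | x.1 = a} :=
      measurable_fst (measurableSet_singleton a)
    have h1 : (L.restrict {x | x.1 = a}).map covMed ≪ covBase ν L := by
      rw [hL.law a]
      exact (Measure.smul_absolutelyContinuous).trans (withDensity_absolutelyContinuous _ _)
    exact (ae_restrict_iff' hS).1 (ae_of_ae_map measurable_covMed.aemeasurable (h1.ae_le (hp a)))
  filter_upwards [ae_all_iff.2 h] with x hx
  exact hx x.1 rfl

lemma map_restrict_le (hL : IsNuisance L Y ν π f η lo hi) (a : Fin 2) :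
    (L.restrict {x | x.1 = a}).map covMed
      ≤ (ENNReal.ofReal (propensity π a) * ENNReal.ofReal hi) • covBase ν L := by
  rw [hL.law a, mul_smul]
  refine Measure.le_iff.2 fun S hS => ?_
  simp only [Measure.smul_apply, smul_eq_mul]
  refine mul_le_mul' le_rfl ?_
  rw [withDensity_apply _ hS]
  refine (lintegral_mono_ae (ae_restrict_of_ae ?_)).trans
    (le_of_eq (setLIntegral_const S (ENNReal.ofReal hi)))
  filter_upwards [hL.density_bounds a] with q hq using hq.2

lemma covBase_le_map_restrict (hL : IsNuisance L Y ν π f η lo hi) (a : Fin 2) :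
    covBase ν L ≤ (ENNReal.ofReal (propensity π a) * ENNReal.ofReal lo)⁻¹ •
      (L.restrict {x | x.1 = a}).map covMed := by
  have hp := hL.propensity_pos a
  have h1 : ENNReal.ofReal (propensity π a) * ENNReal.ofReal lo ≠ 0 := by
    simp [hp, hL.lo_pos]
  refine Measure.le_iff.2 fun S hS => ?_
  rw [hL.law a]
  simp only [Measure.smul_apply, smul_eq_mul]
  rw [withDensity_apply _ hS]
  have h2 : ENNReal.ofReal lo * covBase ν L S ≤ ∫⁻ q in S, f a q.1 q.2 ∂covBase ν L := by
    rw [← setLIntegral_const]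
    refine lintegral_mono_ae (ae_restrict_of_ae ?_)
    filter_upwards [hL.density_bounds a] with q hq using hq.1
  rw [← ENNReal.mul_le_iff_le_inv h1 (by finiteness), mul_assoc]
  gcongr

lemma map_covMed_le (hL : IsNuisance L Y ν π f η lo hi) :
    L.map covMed ≤ (ENNReal.ofReal (propensity π 0) * ENNReal.ofReal hi
      + ENNReal.ofReal (propensity π 1) * ENNReal.ofReal hi) • covBase ν L := by
  have h : L = L.restrict {x | x.1 = 0} + L.restrict {x | x.1 = 1} := by
    have h1 : ({x | x.1 = 1} : Set (Fin 2 × 𝒞 × (ι → ℝ) × 𝒴)) = {x | x.1 = 0}ᶜ := by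
      ext x
      simp only [Set.mem_compl_iff]
      change x.1 = 1 ↔ ¬ x.1 = 0
      omega
    have hS : MeasurableSet ({x | x.1 = 0} : Set (Fin 2 × 𝒞 × (ι → ℝ) × 𝒴)) :=
      measurable_fst (measurableSet_singleton _)
    rw [h1, Measure.restrict_add_restrict_compl hS]
  conv_lhs => rw [h]
  rw [Measure.map_add _ _ measurable_covMed, add_smul]
  exact add_le_add (hL.map_restrict_le 0) (hL.map_restrict_le 1)

lemma memLp_comp_covMed (hL : IsNuisance L Y ν π f η lo hi) {g : 𝒞 × (ι → ℝ) → ℝ}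
    (hg : MemLp g 2 (covBase ν L)) : MemLp (fun x => g (covMed x)) 2 L :=
  (hg.of_measure_le_smul (by finiteness) hL.map_covMed_le).comp_of_map
    measurable_covMed.aemeasurable

lemma memLp_covBase_mean (hL : IsNuisance L Y ν π f η lo hi) (a : Fin 2) :
    MemLp (fun q : 𝒞 × (ι → ℝ) => η a q.2 q.1) 2 (covBase ν L) := by
  have hp := hL.propensity_pos a
  refine MemLp.of_measure_le_smul ?_ (hL.covBase_le_map_restrict a) ?_
  · simp [hp, hL.lo_pos]
  · rw [memLp_map_measure_iff (hL.measurable_mean a).aestronglyMeasurable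
      measurable_covMed.aemeasurable]
    refine (memLp_congr_ae ?_).1 (hL.memLp_mean.restrict {x | x.1 = a})
    refine (ae_restrict_iff' (measurable_fst (measurableSet_singleton a))).2
      (Eventually.of_forall fun x hx => ?_)
    change η x.1 x.2.2.1 x.2.1 = η a x.2.2.1 x.2.1
    rw [show x.1 = a from hx]

lemma integral_comp_cov {g : 𝒞 → ℝ} (hg : Measurable g) :
    ∫ x, g x.2.1 ∂L = ∫ c, g c ∂(covLaw L) := by
  rw [covLaw, integral_map (by fun_prop) hg.aestronglyMeasurable]

lemma toReal_density_norm (hL : IsNuisance L Y ν π f η lo hi) (a : Fin 2) :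
    ∀ᵐ c ∂(covLaw L), ∫ m, (f a c m).toReal ∂(Measure.pi ν) = 1 := by
  filter_upwards [hL.density_norm a, Measure.ae_ae_of_ae_prod (hL.density_lt_top a)] with c h1 h2
  have h3 : Measurable (fun m => f a c m) := (hL.measurable_density a).comp measurable_prodMk_left
  rw [integral_toReal h3.aemeasurable h2, h1, ENNReal.toReal_one]

lemma integrable_density_mul (hL : IsNuisance L Y ν π f η lo hi) (a : Fin 2)
    {g : 𝒞 × (ι → ℝ) → ℝ} (hg : Integrable g (covBase ν L)) :
    Integrable (fun q => (f a q.1 q.2).toReal * g q) (covBase ν L) := by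
  refine hg.bdd_mul (c := hi)
    (hL.measurable_density a).ennreal_toReal.aestronglyMeasurable ?_
  filter_upwards [hL.toReal_density_bounds a] with q hq
  rw [Real.norm_eq_abs, abs_of_nonneg (hL.lo_pos.le.trans hq.1)]
  exact hq.2

lemma integral_armWeight_cov (hL : IsNuisance L Y ν π f η lo hi) (a : Fin 2) {g : 𝒞 → ℝ}
    (hg : Measurable g) (hgi : Integrable g (covLaw L)) :
    ∫ x, armWeight π a x.1 * g x.2.1 ∂L = ∫ c, g c ∂(covLaw L) := by
  have h1 := hL.integral_armWeight a (g := fun q => g q.1) (hg.comp measurable_fst)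
  have h2 : Integrable (fun q : 𝒞 × (ι → ℝ) => g q.1) (covBase ν L) := hgi.comp_fst _
  refine h1.trans ?_
  rw [covBase, integral_prod _ (hL.integrable_density_mul a h2)]
  refine integral_congr_ae ?_
  filter_upwards [hL.toReal_density_norm a] with c hc
  rw [integral_mul_const, hc, one_mul]

lemma subMass_eq_marginal (hL : IsNuisance L Y ν π f η lo hi) (a : Fin 2) (s : Finset ι) :
    ∀ᵐ q ∂(covBase ν L),
      subMass ν s (f a q.1) q.2 = marginal ν s (fun m => (f a q.1 m).toReal) q.2 := by
  have h := ae_ae_updateFinset ν (ρ := covLaw L) s (p := fun q => f a q.1 q.2 < ∞)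
    (hL.density_lt_top a)
  filter_upwards [h] with q hq
  rw [subMass, marginal, integral_toReal _ hq]
  · rfl
  · exact ((hL.measurable_density a).comp
      (measurable_const.prodMk measurable_updateFinset)).aemeasurable

/-- A bound on the partially integrated densities. -/
noncomputable def massBound (ν : ι → Measure ℝ) (hi : ℝ) (s : Finset ι) : ℝ :=
  hi * ((Measure.pi fun i : s => ν i) Set.univ).toReal

lemma abs_subMass_le (hL : IsNuisance L Y ν π f η lo hi) (a : Fin 2) (s : Finset ι) :
    ∀ᵐ q ∂(covBase ν L), |subMass ν s (f a q.1) q.2| ≤ massBound ν hi s := by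
  have h := ae_ae_updateFinset ν (ρ := covLaw L) s (p := fun q => f a q.1 q.2 ≤ ENNReal.ofReal hi)
    (by filter_upwards [hL.density_bounds a] with q hq using hq.2)
  filter_upwards [h] with q hq
  rw [subMass, abs_of_nonneg ENNReal.toReal_nonneg, lmarginal, massBound,
    ← ENNReal.toReal_ofReal hL.hi_pos.le, ← ENNReal.toReal_mul]
  refine ENNReal.toReal_mono (by finiteness) ?_
  rw [← lintegral_const]
  exact lintegral_mono_ae hq

lemma massBound_nonneg (hL : IsNuisance L Y ν π f η lo hi) (s : Finset ι) :
    0 ≤ massBound ν hi s := mul_nonneg hL.hi_pos.le ENNReal.toReal_nonneg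

/-- The expectation over the arm `A = a` of a partial integral of `h` is the integral of `h` against
the partially integrated density. -/
lemma integral_armWeight_marginal (hL : IsNuisance L Y ν π f η lo hi) (a : Fin 2) (s : Finset ι)
    {h : 𝒞 × (ι → ℝ) → ℝ} (hm : Measurable h) (hint : Integrable h (covBase ν L)) :
    ∫ x, armWeight π a x.1 * marginal ν s (fun m => h (x.2.1, m)) x.2.2.1 ∂L
      = ∫ q, subMass ν s (f a q.1) q.2 * h q ∂(covBase ν L) := by
  have h1 := hL.integral_armWeight a (g := fun q => marginal ν s (fun m => h (q.1, m)) q.2)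
    (measurable_marginal ν s hm)
  refine h1.trans ?_
  rw [covBase, integral_mul_marginal ν (covLaw L) s]
  · refine integral_congr_ae ?_
    filter_upwards [hL.subMass_eq_marginal a s] with q hq
    rw [hq]
  · refine (integrable_updateFinset ν s hint).bdd_mul (c := hi)
      ((hL.measurable_density a).ennreal_toReal.comp measurable_fst).aestronglyMeasurable ?_
    have h2 : ∀ᵐ q ∂((covBase ν L).prod (Measure.pi fun i : s => ν i)),
        (f a q.1.1 q.1.2).toReal ≤ hi :=
      Measure.quasiMeasurePreserving_fst.ae (hL.toReal_density_bounds a |>.mono fun q hq => hq.2)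
    filter_upwards [h2] with q hq
    rw [Real.norm_eq_abs, abs_of_nonneg ENNReal.toReal_nonneg]
    exact hq

lemma integrable_comp_covMed (hL : IsNuisance L Y ν π f η lo hi) {g : 𝒞 × (ι → ℝ) → ℝ}
    (hg : Integrable g (covBase ν L)) : Integrable (fun x => g (covMed x)) L :=
  (hg.of_measure_le_smul (by finiteness) hL.map_covMed_le).comp_measurable measurable_covMed

lemma abs_armWeight_le (hL : IsNuisance L Y ν π f η lo hi) (a A : Fin 2) :
    |armWeight π a A| ≤ (propensity π a)⁻¹ := by
  have hp := hL.propensity_pos a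
  by_cases h : A = a
  · simp [armWeight, h, abs_of_pos hp]
  · simp [armWeight, h, hp.le]

lemma integrable_armWeight_mul (hL : IsNuisance L Y ν π f η lo hi) (a : Fin 2)
    {g : Fin 2 × 𝒞 × (ι → ℝ) × 𝒴 → ℝ} (hg : Integrable g L) :
    Integrable (fun x => armWeight π a x.1 * g x) L :=
  hg.bdd_mul (c := (propensity π a)⁻¹) (measurable_armWeight π a).aestronglyMeasurable
    (Eventually.of_forall fun x => hL.abs_armWeight_le a x.1)

/-- Expectation over the arm `A = a` of the residual from another conditional mean. -/
lemma integral_armWeight_outcome (hL : IsNuisance L Y ν π f η lo hi) (a : Fin 2)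
    {k : 𝒞 × (ι → ℝ) → ℝ} (hk : Measurable k) {B : ℝ} (hB : ∀ᵐ q ∂(covBase ν L), |k q| ≤ B)
    {e : 𝒞 × (ι → ℝ) → ℝ} (he : Measurable e) (hei : Integrable e (covBase ν L)) :
    ∫ x, armWeight π a x.1 * (k (covMed x) * (Y x.2.2.2 - e (covMed x))) ∂L
      = ∫ q, (f a q.1 q.2).toReal * (k q * (η a q.2 q.1 - e q)) ∂(covBase ν L) := by
  have hkL : ∀ᵐ x ∂L, |k (covMed x)| ≤ B := hL.ae_of_ae_covBase (p := fun _ q => |k q| ≤ B)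
    fun _ => hB
  have h1 : ∫ x, (armWeight π a x.1 * k (covMed x)) * (Y x.2.2.2 - η x.1 x.2.2.1 x.2.1) ∂L = 0 := by
    refine hL.residual (fun a' q => armWeight π a a' * k q) (fun a' => measurable_const.mul hk)
      ((propensity π a)⁻¹ * B) ?_
    filter_upwards [hkL] with x hx
    rw [abs_mul]
    exact mul_le_mul (hL.abs_armWeight_le a x.1) hx (abs_nonneg _)
      (inv_nonneg.2 (hL.propensity_pos a).le)
  have h2 := hL.integral_armWeight a (g := fun q => k q * (η a q.2 q.1 - e q))
    (hk.mul ((hL.measurable_mean a).sub he))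
  have i0 : Integrable (fun x => Y x.2.2.2 - η x.1 x.2.2.1 x.2.1) L :=
    (hL.memLp_outcome.sub hL.memLp_mean).integrable (by norm_num)
  have i1 : Integrable (fun x => armWeight π a x.1 * (k (covMed x) *
      (Y x.2.2.2 - η x.1 x.2.2.1 x.2.1))) L :=
    hL.integrable_armWeight_mul a (i0.bdd_mul (hk.comp measurable_covMed).aestronglyMeasurable hkL)
  have i2 : Integrable (fun q : 𝒞 × (ι → ℝ) => k q * (η a q.2 q.1 - e q)) (covBase ν L) :=
    (((hL.memLp_covBase_mean a).integrable (by norm_num)).sub hei).bdd_mul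
      hk.aestronglyMeasurable hB
  have i3 := hL.integrable_armWeight_mul a (hL.integrable_comp_covMed i2)
  have e1 : ∀ x : Fin 2 × 𝒞 × (ι → ℝ) × 𝒴,
      armWeight π a x.1 * (k (covMed x) * (Y x.2.2.2 - e (covMed x)))
      = armWeight π a x.1 * (k (covMed x) * (Y x.2.2.2 - η x.1 x.2.2.1 x.2.1))
        + armWeight π a x.1 * (k (covMed x) * (η a (covMed x).2 (covMed x).1 - e (covMed x))) := by
    intro x
    have := armWeight_mul_arm π a x.1 (fun A => η A x.2.2.1 x.2.1)
    simp only [covMed] at this ⊢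
    linear_combination (k (x.2.1, x.2.2.1)) * this
  simp_rw [e1]
  rw [integral_add i1 i3, h2]
  simp_rw [← mul_assoc] at h1 ⊢
  rw [h1, zero_add]

end IsNuisance

end Slice

/-! ### The cross-arm mean and its influence function -/

section MarginalLTwo

variable {𝒞 ι : Type*} [MeasurableSpace 𝒞] [Fintype ι] [DecidableEq ι]
  {ν : ι → Measure ℝ} [∀ i, IsFiniteMeasure (ν i)] {ρ : Measure 𝒞} [IsFiniteMeasure ρ]

lemma eLpNorm_updateFinset (s : Finset ι) {h : 𝒞 × (ι → ℝ) → ℝ} (hh : Measurable h) :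
    eLpNorm (fun z : (𝒞 × (ι → ℝ)) × (s → ℝ) => h (z.1.1, Function.updateFinset z.1.2 s z.2)) 2
        ((ρ.prod (Measure.pi ν)).prod (Measure.pi fun i : s => ν i))
      = (Measure.pi fun i : s => ν i) Set.univ ^ (1 / 2 : ℝ)
        * eLpNorm h 2 (ρ.prod (Measure.pi ν)) := by
  have h1 := eLpNorm_comp_measurePreserving (p := 2)
    (hh.comp measurable_fst).aestronglyMeasurable (measurePreserving_resampleWith ν ρ s)
  have h2 := eLpNorm_map_measure (p := 2) (μ := (ρ.prod (Measure.pi ν)).prod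
    (Measure.pi fun i : s => ν i)) (f := Prod.fst) hh.aestronglyMeasurable
    measurable_fst.aemeasurable
  refine h1.trans (h2.symm.trans ?_)
  rw [Measure.map_fst_prod, eLpNorm_smul_measure_of_ne_top (by norm_num)]
  simp

/-- Integrating out coordinates is bounded on `L²`. -/
lemma eLpNorm_marginal_le (s : Finset ι) {h : 𝒞 × (ι → ℝ) → ℝ} (hh : Measurable h) :
    eLpNorm (fun q : 𝒞 × (ι → ℝ) => marginal ν s (fun m => h (q.1, m)) q.2) 2
        (ρ.prod (Measure.pi ν))
      ≤ (Measure.pi fun i : s => ν i) Set.univ * eLpNorm h 2 (ρ.prod (Measure.pi ν)) := by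
  refine (eLpNorm_two_integral_prod_le
    (hh.comp (measurable_updateWith s)).aestronglyMeasurable).trans ?_
  have h1 := eLpNorm_updateFinset (ν := ν) (ρ := ρ) s hh
  simp only [Function.comp_def]
  rw [h1, ← mul_assoc, ← ENNReal.rpow_add_of_nonneg _ _ (by norm_num) (by norm_num)]
  norm_num

lemma memLp_marginal (s : Finset ι) {h : 𝒞 × (ι → ℝ) → ℝ} (hh : Measurable h)
    (h2 : MemLp h 2 (ρ.prod (Measure.pi ν))) :
    MemLp (fun q : 𝒞 × (ι → ℝ) => marginal ν s (fun m => h (q.1, m)) q.2) 2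
      (ρ.prod (Measure.pi ν)) :=
  ⟨(measurable_marginal ν s hh).aestronglyMeasurable,
    (eLpNorm_marginal_le s hh).trans_lt (ENNReal.mul_lt_top (by finiteness) h2.2)⟩

end MarginalLTwo

section CrossMean

variable {𝒞 ι 𝒴 : Type*} [MeasurableSpace 𝒞] [Fintype ι] [DecidableEq ι] [MeasurableSpace 𝒴]

/-- The integral of the outcome mean under arm `a₁` against the product of two partially integrated
mediator densities, that of arm `a₂` with the coordinates in `s` integrated out and that of arm
`a₃` with the coordinates in `t` integrated out. -/
noncomputable def crossMean (ν : ι → Measure ℝ) (f : Fin 2 → 𝒞 → (ι → ℝ) → ℝ≥0∞)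
    (η : Fin 2 → (ι → ℝ) → 𝒞 → ℝ) (s t : Finset ι) (a₁ a₂ a₃ : Fin 2) (c : 𝒞) : ℝ :=
  ∫ m, η a₁ m c * subMass ν s (f a₂ c) m * subMass ν t (f a₃ c) m ∂(Measure.pi ν)

/-- The uncentred influence function of the mean of `crossMean`: an outcome residual, one centred
term for each of the two mediator densities, and `crossMean` itself. -/
noncomputable def crossIF (ν : ι → Measure ℝ) (π : ℝ) (f : Fin 2 → 𝒞 → (ι → ℝ) → ℝ≥0∞)
    (η : Fin 2 → (ι → ℝ) → 𝒞 → ℝ) (Y : 𝒴 → ℝ) (s t : Finset ι) (a₁ a₂ a₃ : Fin 2)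
    (x : Fin 2 × 𝒞 × (ι → ℝ) × 𝒴) : ℝ :=
  armWeight π a₁ x.1 * (subMass ν s (f a₂ x.2.1) x.2.2.1 * subMass ν t (f a₃ x.2.1) x.2.2.1
      / (f a₁ x.2.1 x.2.2.1).toReal * (Y x.2.2.2 - η a₁ x.2.2.1 x.2.1))
    + armWeight π a₂ x.1 * (marginal ν s
        (fun m => η a₁ m x.2.1 * subMass ν t (f a₃ x.2.1) m) x.2.2.1
      - crossMean ν f η s t a₁ a₂ a₃ x.2.1)
    + armWeight π a₃ x.1 * (marginal ν t
        (fun m => η a₁ m x.2.1 * subMass ν s (f a₂ x.2.1) m) x.2.2.1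
      - crossMean ν f η s t a₁ a₂ a₃ x.2.1)
    + crossMean ν f η s t a₁ a₂ a₃ x.2.1

lemma crossMean_swap (ν : ι → Measure ℝ) (f : Fin 2 → 𝒞 → (ι → ℝ) → ℝ≥0∞)
    (η : Fin 2 → (ι → ℝ) → 𝒞 → ℝ) (s t : Finset ι) (a₁ a₂ a₃ : Fin 2) (c : 𝒞) :
    crossMean ν f η s t a₁ a₂ a₃ c = crossMean ν f η t s a₁ a₃ a₂ c := by
  simp only [crossMean, mul_right_comm]

namespace IsNuisance

variable {L : Measure (Fin 2 × 𝒞 × (ι → ℝ) × 𝒴)} [IsFiniteMeasure L] {Y : 𝒴 → ℝ}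
  {ν : ι → Measure ℝ} [∀ i, IsFiniteMeasure (ν i)] {π : ℝ}
  {f : Fin 2 → 𝒞 → (ι → ℝ) → ℝ≥0∞} {η : Fin 2 → (ι → ℝ) → 𝒞 → ℝ} {lo hi : ℝ}

lemma measurable_crossMean (hL : IsNuisance L Y ν π f η lo hi) (s t : Finset ι)
    (a₁ a₂ a₃ : Fin 2) : Measurable (crossMean ν f η s t a₁ a₂ a₃) := by
  have h : StronglyMeasurable (fun q : 𝒞 × (ι → ℝ) =>
      η a₁ q.2 q.1 * subMass ν s (f a₂ q.1) q.2 * subMass ν t (f a₃ q.1) q.2) :=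
    (((hL.measurable_mean a₁).mul (measurable_subMass ν s (hL.measurable_density a₂))).mul
      (measurable_subMass ν t (hL.measurable_density a₃))).stronglyMeasurable
  exact h.integral_prod_right.measurable

/-- Multiplication by a partially integrated density preserves `L²`. -/
lemma memLp_subMass_mul (hL : IsNuisance L Y ν π f η lo hi) (a : Fin 2) (s : Finset ι)
    {g : 𝒞 × (ι → ℝ) → ℝ} (hg : MemLp g 2 (covBase ν L)) :
    MemLp (fun q => g q * subMass ν s (f a q.1) q.2) 2 (covBase ν L) := by
  have e : (fun q => g q * subMass ν s (f a q.1) q.2)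
      = fun q => subMass ν s (f a q.1) q.2 * g q := funext fun q => mul_comm _ _
  rw [e]
  exact memLp_two_bdd_mul hg (measurable_subMass ν s (hL.measurable_density a)).aestronglyMeasurable
    (hL.abs_subMass_le a s)

lemma memLp_mean_mul (hL : IsNuisance L Y ν π f η lo hi) (s t : Finset ι) (a₁ a₂ a₃ : Fin 2) :
    MemLp (fun q : 𝒞 × (ι → ℝ) => η a₁ q.2 q.1 * subMass ν s (f a₂ q.1) q.2
      * subMass ν t (f a₃ q.1) q.2) 2 (covBase ν L) :=
  hL.memLp_subMass_mul a₃ t (hL.memLp_subMass_mul a₂ s (hL.memLp_covBase_mean a₁))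

lemma memLp_crossMean (hL : IsNuisance L Y ν π f η lo hi) (s t : Finset ι) (a₁ a₂ a₃ : Fin 2) :
    MemLp (crossMean ν f η s t a₁ a₂ a₃) 2 (covLaw L) := by
  have h := hL.memLp_mean_mul s t a₁ a₂ a₃
  have h2 := eLpNorm_two_integral_prod_le h.1
  exact ⟨(hL.measurable_crossMean s t a₁ a₂ a₃).aestronglyMeasurable,
    h2.trans_lt (ENNReal.mul_lt_top (by finiteness) h.2)⟩

lemma memLp_comp_cov {g : 𝒞 → ℝ} (hg : MemLp g 2 (covLaw L)) :
    MemLp (fun x => g x.2.1) 2 L := hg.comp_of_map (by fun_prop)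

lemma memLp_armWeight_mul (hL : IsNuisance L Y ν π f η lo hi) (a : Fin 2)
    {g : Fin 2 × 𝒞 × (ι → ℝ) × 𝒴 → ℝ} (hg : MemLp g 2 L) :
    MemLp (fun x => armWeight π a x.1 * g x) 2 L :=
  memLp_two_bdd_mul hg (measurable_armWeight π a).aestronglyMeasurable
    (Eventually.of_forall fun x => hL.abs_armWeight_le a x.1)

/-- The weight multiplying the outcome residual. -/
lemma abs_ratio_le (hL : IsNuisance L Y ν π f η lo hi) (s t : Finset ι) (a₁ a₂ a₃ : Fin 2) :
    ∀ᵐ q ∂(covBase ν L), |subMass ν s (f a₂ q.1) q.2 * subMass ν t (f a₃ q.1) q.2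
      / (f a₁ q.1 q.2).toReal| ≤ massBound ν hi s * massBound ν hi t / lo := by
  filter_upwards [hL.abs_subMass_le a₂ s, hL.abs_subMass_le a₃ t, hL.toReal_density_bounds a₁]
    with q h1 h2 h3
  rw [abs_div, abs_mul, abs_of_nonneg (hL.lo_pos.le.trans h3.1)]
  exact div_le_div₀ (mul_nonneg (hL.massBound_nonneg s) (hL.massBound_nonneg t))
    (mul_le_mul h1 h2 (abs_nonneg _) (hL.massBound_nonneg s)) hL.lo_pos h3.1

lemma measurable_ratio (hL : IsNuisance L Y ν π f η lo hi) (s t : Finset ι) (a₁ a₂ a₃ : Fin 2) :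
    Measurable fun q : 𝒞 × (ι → ℝ) => subMass ν s (f a₂ q.1) q.2 * subMass ν t (f a₃ q.1) q.2
      / (f a₁ q.1 q.2).toReal :=
  ((measurable_subMass ν s (hL.measurable_density a₂)).mul
    (measurable_subMass ν t (hL.measurable_density a₃))).div
    (hL.measurable_density a₁).ennreal_toReal

lemma memLp_residual_part (hL : IsNuisance L Y ν π f η lo hi) (a : Fin 2)
    {k : 𝒞 × (ι → ℝ) → ℝ} (hk : Measurable k) {B : ℝ} (hB : ∀ᵐ q ∂(covBase ν L), |k q| ≤ B) :
    MemLp (fun x => armWeight π a x.1 * (k (covMed x) *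
      (Y x.2.2.2 - η a (covMed x).2 (covMed x).1))) 2 L := by
  have hkL : ∀ᵐ x ∂L, |k (covMed x)| ≤ B := hL.ae_of_ae_covBase (p := fun _ q => |k q| ≤ B)
    fun _ => hB
  have h0 := hL.memLp_outcome.sub hL.memLp_mean
  have h1 : MemLp (fun x => k (covMed x) * (Y x.2.2.2 - η x.1 x.2.2.1 x.2.1)) 2 L :=
    memLp_two_bdd_mul h0 (hk.comp measurable_covMed).aestronglyMeasurable hkL
  refine (memLp_congr_ae (Eventually.of_forall fun x => ?_)).1 (hL.memLp_armWeight_mul a h1)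
  have := armWeight_mul_arm π a x.1 (fun A => η A x.2.2.1 x.2.1)
  simp only [covMed] at this ⊢
  linear_combination -(k (x.2.1, x.2.2.1)) * this

lemma memLp_marginal_part (hL : IsNuisance L Y ν π f η lo hi) (s t : Finset ι)
    (a₁ a₂ a₃ a₄ : Fin 2) :
    MemLp (fun x => armWeight π a₄ x.1 * (marginal ν s
        (fun m => η a₁ m x.2.1 * subMass ν t (f a₃ x.2.1) m) x.2.2.1
      - crossMean ν f η s t a₁ a₂ a₃ x.2.1)) 2 L := by
  have hm : Measurable (fun q : 𝒞 × (ι → ℝ) => η a₁ q.2 q.1 * subMass ν t (f a₃ q.1) q.2) :=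
    (hL.measurable_mean a₁).mul (measurable_subMass ν t (hL.measurable_density a₃))
  have h1 := memLp_marginal (ν := ν) (ρ := covLaw L) s hm
    (hL.memLp_subMass_mul a₃ t (hL.memLp_covBase_mean a₁))
  exact hL.memLp_armWeight_mul a₄
    ((hL.memLp_comp_covMed h1).sub (memLp_comp_cov (hL.memLp_crossMean s t a₁ a₂ a₃)))

lemma memLp_crossIF (hL : IsNuisance L Y ν π f η lo hi) (s t : Finset ι) (a₁ a₂ a₃ : Fin 2) :
    MemLp (crossIF ν π f η Y s t a₁ a₂ a₃) 2 L := by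
  refine ((MemLp.add ?_ (hL.memLp_marginal_part s t a₁ a₂ a₃ a₂)).add ?_).add
    (memLp_comp_cov (hL.memLp_crossMean s t a₁ a₂ a₃))
  · exact hL.memLp_residual_part a₁ (hL.measurable_ratio s t a₁ a₂ a₃)
      (hL.abs_ratio_le s t a₁ a₂ a₃)
  · simp_rw [crossMean_swap ν f η s t a₁ a₂ a₃]
    exact hL.memLp_marginal_part t s a₁ a₃ a₂ a₃

end IsNuisance

end CrossMean

/-! ### Exact expansion of the cross-arm mean around a law -/

lemma integral_add_three {α : Type*} [MeasurableSpace α] {μ : Measure α} {u v w : α → ℝ}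
    (hu : Integrable u μ) (hv : Integrable v μ) (hw : Integrable w μ) :
    ∫ x, (u x + v x + w x) ∂μ = ∫ x, u x ∂μ + ∫ x, v x ∂μ + ∫ x, w x ∂μ := by
  rw [← integral_add hu hv]
  exact integral_add (hu.add hv) hw

lemma integral_add_five {α : Type*} [MeasurableSpace α] {μ : Measure α} {u v w p q : α → ℝ}
    (hu : Integrable u μ) (hv : Integrable v μ) (hw : Integrable w μ) (hp : Integrable p μ)
    (hq : Integrable q μ) :
    ∫ x, ((u x + v x + w x) + (p x + q x)) ∂μ
      = ∫ x, u x ∂μ + ∫ x, v x ∂μ + ∫ x, w x ∂μ + (∫ x, p x ∂μ + ∫ x, q x ∂μ) := by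
  rw [← integral_add_three hu hv hw, ← integral_add hp hq]
  exact integral_add ((hu.add hv).add hw) (hp.add hq)

section Expansion

variable {𝒞 ι 𝒴 : Type*} [MeasurableSpace 𝒞] [Fintype ι] [DecidableEq ι] [MeasurableSpace 𝒴]
  {ν : ι → Measure ℝ} [∀ i, IsFiniteMeasure (ν i)]
  {L L' : Measure (Fin 2 × 𝒞 × (ι → ℝ) × 𝒴)}

lemma covLaw_le {K : ℝ≥0∞} (h : L' ≤ K • L) : covLaw L' ≤ K • covLaw L := by
  have hm : Measurable (fun x : Fin 2 × 𝒞 × (ι → ℝ) × 𝒴 => x.2.1) := by fun_prop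
  refine (Measure.map_mono h hm).trans (le_of_eq ?_)
  rw [Measure.map_smul]
  rfl

lemma covBase_le [IsFiniteMeasure L] [IsFiniteMeasure L'] {K : ℝ≥0∞} (h : L' ≤ K • L) :
    covBase ν L' ≤ K • covBase ν L := by
  unfold covBase
  rw [← Measure.prod_smul_left]
  exact Measure.prod_mono (covLaw_le h) le_rfl

variable [IsFiniteMeasure L] [IsFiniteMeasure L'] {Y : 𝒴 → ℝ} {π : ℝ}
  {f f' : Fin 2 → 𝒞 → (ι → ℝ) → ℝ≥0∞} {η η' : Fin 2 → (ι → ℝ) → 𝒞 → ℝ} {lo hi lo' hi' : ℝ}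

lemma integral_mul_crossMean (s t : Finset ι) (a₁ a₂ a₃ : Fin 2) (W : 𝒞 → ℝ)
    (h : Integrable (fun q : 𝒞 × (ι → ℝ) => W q.1 * (η a₁ q.2 q.1 * subMass ν s (f a₂ q.1) q.2
      * subMass ν t (f a₃ q.1) q.2)) (covBase ν L)) :
    ∫ c, W c * crossMean ν f η s t a₁ a₂ a₃ c ∂(covLaw L)
      = ∫ q, W q.1 * (η a₁ q.2 q.1 * subMass ν s (f a₂ q.1) q.2
        * subMass ν t (f a₃ q.1) q.2) ∂(covBase ν L) := by
  unfold covBase at h ⊢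
  rw [integral_prod _ h]
  simp only [integral_const_mul]
  rfl

lemma ae_covBase_of_covLaw {p : 𝒞 → Prop} (h : ∀ᵐ c ∂(covLaw L), p c) :
    ∀ᵐ q ∂(covBase ν L), p q.1 :=
  Measure.quasiMeasurePreserving_fst.ae h

lemma ae_of_covLaw {p : 𝒞 → Prop} (h : ∀ᵐ c ∂(covLaw L), p c) : ∀ᵐ x ∂L, p x.2.1 :=
  ae_of_ae_map (f := fun x : Fin 2 × 𝒞 × (ι → ℝ) × 𝒴 => x.2.1) (by fun_prop) h

lemma integrable_weight_mul {W : 𝒞 → ℝ} (hW : Measurable W) {w₀ : ℝ}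
    (hb : ∀ᵐ c ∂(covLaw L), |W c| ≤ w₀) {g : 𝒞 × (ι → ℝ) → ℝ} (hg : MemLp g 2 (covBase ν L)) :
    Integrable (fun q => W q.1 * g q) (covBase ν L) :=
  (memLp_two_bdd_mul hg (hW.comp measurable_fst).aestronglyMeasurable
    (ae_covBase_of_covLaw hb)).integrable (by norm_num)

namespace IsNuisance

/-- The mean over arm `a₄` of the term of the influence function that belongs to a mediator
density. The law `L'` under which the mean is taken may differ from the law `L` of the nuisance
functions. -/
lemma integral_marginal_part (hL : IsNuisance L Y ν π f η lo hi)
    (hL' : IsNuisance L' Y ν π f' η' lo' hi') {K : ℝ≥0∞} (hK : K ≠ ∞) (hLL : L' ≤ K • L)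
    (s t : Finset ι) (a₁ a₂ a₃ a₄ : Fin 2) {W : 𝒞 → ℝ} (hW : Measurable W) {w₀ : ℝ}
    (hb : ∀ᵐ c ∂(covLaw L'), |W c| ≤ w₀) :
    ∫ x, armWeight π a₄ x.1 * (W x.2.1 * (marginal ν s
        (fun m => η a₁ m x.2.1 * subMass ν t (f a₃ x.2.1) m) x.2.2.1
      - crossMean ν f η s t a₁ a₂ a₃ x.2.1)) ∂L'
    = ∫ q, W q.1 * (η a₁ q.2 q.1 * subMass ν t (f a₃ q.1) q.2 * subMass ν s (f' a₄ q.1) q.2)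
        ∂(covBase ν L')
      - ∫ q, W q.1 * (η a₁ q.2 q.1 * subMass ν s (f a₂ q.1) q.2
        * subMass ν t (f a₃ q.1) q.2) ∂(covBase ν L') := by
  have hB := covBase_le (ν := ν) hLL
  have m1 : MemLp (fun q : 𝒞 × (ι → ℝ) => η a₁ q.2 q.1 * subMass ν t (f a₃ q.1) q.2) 2
      (covBase ν L') :=
    (hL.memLp_subMass_mul a₃ t (hL.memLp_covBase_mean a₁)).of_measure_le_smul hK hB
  have hm : Measurable (fun q : 𝒞 × (ι → ℝ) =>
      W q.1 * (η a₁ q.2 q.1 * subMass ν t (f a₃ q.1) q.2)) :=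
    (hW.comp measurable_fst).mul
      ((hL.measurable_mean a₁).mul (measurable_subMass ν t (hL.measurable_density a₃)))
  have i1 := integrable_weight_mul hW hb m1
  have i2 := integrable_weight_mul hW hb ((hL.memLp_mean_mul s t a₁ a₂ a₃).of_measure_le_smul hK hB)
  have e1 := hL'.integral_armWeight_marginal a₄ s hm i1
  have hWc : MemLp (fun c => W c * crossMean ν f η s t a₁ a₂ a₃ c) 2 (covLaw L') :=
    memLp_two_bdd_mul ((hL.memLp_crossMean s t a₁ a₂ a₃).of_measure_le_smul hK (covLaw_le hLL))
      hW.aestronglyMeasurable hb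
  have e2 := hL'.integral_armWeight_cov a₄ (g := fun c => W c * crossMean ν f η s t a₁ a₂ a₃ c)
    (hW.mul (hL.measurable_crossMean s t a₁ a₂ a₃)) (hWc.integrable (by norm_num))
  rw [integral_mul_crossMean s t a₁ a₂ a₃ W i2] at e2
  have e3 : ∀ x : Fin 2 × 𝒞 × (ι → ℝ) × 𝒴, armWeight π a₄ x.1 * (W x.2.1 * (marginal ν s
        (fun m => η a₁ m x.2.1 * subMass ν t (f a₃ x.2.1) m) x.2.2.1
      - crossMean ν f η s t a₁ a₂ a₃ x.2.1))
      = armWeight π a₄ x.1 * marginal ν s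
        (fun m => W x.2.1 * (η a₁ m x.2.1 * subMass ν t (f a₃ x.2.1) m)) x.2.2.1
      - armWeight π a₄ x.1 * (W x.2.1 * crossMean ν f η s t a₁ a₂ a₃ x.2.1) := by
    intro x
    simp only [marginal, integral_const_mul]
    ring
  simp_rw [e3]
  have j1 : Integrable (fun x : Fin 2 × 𝒞 × (ι → ℝ) × 𝒴 => armWeight π a₄ x.1 * marginal ν s
        (fun m => W x.2.1 * (η a₁ m x.2.1 * subMass ν t (f a₃ x.2.1) m)) x.2.2.1) L' := by
    refine hL'.integrable_armWeight_mul a₄ (hL'.integrable_comp_covMed (g := fun q => marginal ν s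
      (fun m => W q.1 * (η a₁ m q.1 * subMass ν t (f a₃ q.1) m)) q.2) ?_)
    exact (integrable_updateFinset ν s i1).integral_prod_left
  have j2 := hL'.integrable_armWeight_mul a₄ ((memLp_comp_cov hWc).integrable (by norm_num))
  rw [integral_sub j1 j2, e1, e2]
  congr 1
  refine integral_congr_ae (Eventually.of_forall fun q => ?_)
  ring

/-- The influence function is conditionally centred at `crossMean` given treatment and
covariates. -/
lemma integral_mul_crossIF_sub (hL : IsNuisance L Y ν π f η lo hi) (s t : Finset ι)
    (a₁ a₂ a₃ : Fin 2) {ψ : Fin 2 → 𝒞 → ℝ} (hψ : ∀ a, Measurable (ψ a)) {w₀ : ℝ}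
    (hb : ∀ a, ∀ᵐ c ∂(covLaw L), |ψ a c| ≤ w₀) :
    ∫ x, ψ x.1 x.2.1 * (crossIF ν π f η Y s t a₁ a₂ a₃ x
      - crossMean ν f η s t a₁ a₂ a₃ x.2.1) ∂L = 0 := by
  have hLL : L ≤ (1 : ℝ≥0∞) • L := by simp
  have hr := hL.measurable_ratio s t a₁ a₂ a₃
  have hrb := hL.abs_ratio_le s t a₁ a₂ a₃
  have hk : Measurable (fun q : 𝒞 × (ι → ℝ) => ψ a₁ q.1 *
      (subMass ν s (f a₂ q.1) q.2 * subMass ν t (f a₃ q.1) q.2 / (f a₁ q.1 q.2).toReal)) :=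
    ((hψ a₁).comp measurable_fst).mul hr
  have hkb : ∀ᵐ q ∂(covBase ν L), |ψ a₁ q.1 *
      (subMass ν s (f a₂ q.1) q.2 * subMass ν t (f a₃ q.1) q.2 / (f a₁ q.1 q.2).toReal)|
      ≤ w₀ * (massBound ν hi s * massBound ν hi t / lo) := by
    filter_upwards [hrb, ae_covBase_of_covLaw (hb a₁)] with q h1 h2
    rw [abs_mul]
    exact mul_le_mul h2 h1 (abs_nonneg _) ((abs_nonneg _).trans h2)
  have e1 := hL.integral_armWeight_outcome a₁ hk hkb (hL.measurable_mean a₁)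
    ((hL.memLp_covBase_mean a₁).integrable (by norm_num))
  have e2 := hL.integral_marginal_part hL ENNReal.one_ne_top hLL s t a₁ a₂ a₃ a₂ (hψ a₂) (hb a₂)
  have e3 := hL.integral_marginal_part hL ENNReal.one_ne_top hLL t s a₁ a₃ a₂ a₃ (hψ a₃) (hb a₃)
  simp only [sub_self, mul_zero, integral_zero] at e1
  rw [sub_eq_zero.2 (integral_congr_ae (Eventually.of_forall fun q => by ring))] at e2 e3
  have i1 := (hL.memLp_residual_part a₁ hk hkb).integrable (by norm_num)
  have i2 : ∀ (s t : Finset ι) (a₂ a₃ : Fin 2),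
      Integrable (fun x => armWeight π a₂ x.1 * (ψ a₂ x.2.1 * (marginal ν s
        (fun m => η a₁ m x.2.1 * subMass ν t (f a₃ x.2.1) m) x.2.2.1
      - crossMean ν f η s t a₁ a₂ a₃ x.2.1))) L := by
    intro s t a₂ a₃
    have := (hL.memLp_marginal_part s t a₁ a₂ a₃ a₂).integrable (by norm_num)
    refine (this.bdd_mul (((hψ a₂).comp (by fun_prop : Measurable fun x : Fin 2 × 𝒞 × (ι → ℝ) × 𝒴
      => x.2.1)).aestronglyMeasurable) (ae_of_covLaw (hb a₂))).congr
      (Eventually.of_forall fun x => ?_)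
    simp only [Function.comp]
    ring
  have key : ∫ x, ψ x.1 x.2.1 * (crossIF ν π f η Y s t a₁ a₂ a₃ x
      - crossMean ν f η s t a₁ a₂ a₃ x.2.1) ∂L = (0 + 0) + 0 := by
    conv_rhs =>
      enter [1, 1]
      rw [← e1]
    conv_rhs =>
      enter [1, 2]
      rw [← e2]
    conv_rhs =>
      enter [2]
      rw [← e3]
    rw [← integral_add_three i1 (i2 s t a₂ a₃) (i2 t s a₃ a₂)]
    refine integral_congr_ae (Eventually.of_forall fun x => ?_)
    have h := fun a => armWeight_mul_arm π a x.1 (fun A => ψ A x.2.1)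
    simp only [crossIF, covMed, crossMean_swap ν f η t s a₁ a₃ a₂]
    generalize crossMean ν f η s t a₁ a₂ a₃ x.2.1 = Λ
    generalize marginal ν s _ _ = τs
    generalize marginal ν t _ _ = τt
    generalize subMass ν s _ _ * subMass ν t _ _ / _ = r
    linear_combination r * (Y x.2.2.2 - η a₁ x.2.2.1 x.2.1) * h a₁ + (τs - Λ) * h a₂
      + (τt - Λ) * h a₃
  simpa using key

/-- The exact second-order expansion of the weighted mean of `crossMean` around the law `L`. -/
lemma integral_crossMean_sub_integral_crossIF (hL : IsNuisance L Y ν π f η lo hi)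
    (hL' : IsNuisance L' Y ν π f' η' lo' hi') {K : ℝ≥0∞} (hK : K ≠ ∞) (hLL : L' ≤ K • L)
    (s t : Finset ι) (a₁ a₂ a₃ : Fin 2) {W : 𝒞 → ℝ} (hW : Measurable W) {w₀ : ℝ}
    (hb : ∀ᵐ c ∂(covLaw L), |W c| ≤ w₀) :
    ∫ x, W x.2.1 * crossMean ν f' η' s t a₁ a₂ a₃ x.2.1 ∂L'
      - ∫ x, W x.2.1 * crossIF ν π f η Y s t a₁ a₂ a₃ x ∂L'
    = ∫ x, armWeight π a₁ x.1 * (W x.2.1 * ((subMass ν s (f' a₂ x.2.1) x.2.2.1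
            * subMass ν t (f' a₃ x.2.1) x.2.2.1
          - subMass ν s (f a₂ x.2.1) x.2.2.1 * subMass ν t (f a₃ x.2.1) x.2.2.1
            / (f a₁ x.2.1 x.2.2.1).toReal * (f' a₁ x.2.1 x.2.2.1).toReal)
          / (f' a₁ x.2.1 x.2.2.1).toReal) * (Y x.2.2.2 - η a₁ x.2.2.1 x.2.1)) ∂L'
      + ∫ q, W q.1 * (η a₁ q.2 q.1 * (subMass ν s (f' a₂ q.1) q.2 - subMass ν s (f a₂ q.1) q.2)
          * (subMass ν t (f' a₃ q.1) q.2 - subMass ν t (f a₃ q.1) q.2)) ∂(covBase ν L') := by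
  have hB := covBase_le (ν := ν) hLL
  have hac := Measure.absolutelyContinuous_of_le_smul hB
  have hb' : ∀ᵐ c ∂(covLaw L'), |W c| ≤ w₀ :=
    (Measure.absolutelyContinuous_of_le_smul (covLaw_le hLL)).ae_le hb
  have hWb := ae_covBase_of_covLaw (ν := ν) hb'
  have hWm : Measurable fun q : 𝒞 × (ι → ℝ) => W q.1 := hW.comp measurable_fst
  have hη : MemLp (fun q : 𝒞 × (ι → ℝ) => η a₁ q.2 q.1) 2 (covBase ν L') :=
    (hL.memLp_covBase_mean a₁).of_measure_le_smul hK hB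
  have hηi := hη.integrable (q := 2) (by norm_num)
  have hr := hL.measurable_ratio s t a₁ a₂ a₃
  have hr' := hL'.measurable_ratio s t a₁ a₂ a₃
  have hrb := hac.ae_le (hL.abs_ratio_le s t a₁ a₂ a₃)
  have hrb' := hL'.abs_ratio_le s t a₁ a₂ a₃
  have hfb' := hL'.toReal_density_bounds a₁
  -- the weight of the residual of `Y` from `η`, and the one in the remainder
  set r : 𝒞 × (ι → ℝ) → ℝ := fun q => subMass ν s (f a₂ q.1) q.2 * subMass ν t (f a₃ q.1) q.2
    / (f a₁ q.1 q.2).toReal with hrdef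
  set k : 𝒞 × (ι → ℝ) → ℝ := fun q => W q.1 * ((subMass ν s (f' a₂ q.1) q.2
    * subMass ν t (f' a₃ q.1) q.2 - r q * (f' a₁ q.1 q.2).toReal) / (f' a₁ q.1 q.2).toReal)
    with hkdef
  have hkm : Measurable k := hWm.mul ((((measurable_subMass ν s (hL'.measurable_density a₂)).mul
    (measurable_subMass ν t (hL'.measurable_density a₃))).sub
    (hr.mul (hL'.measurable_density a₁).ennreal_toReal)).div
    (hL'.measurable_density a₁).ennreal_toReal)
  have hkb : ∀ᵐ q ∂(covBase ν L'), |k q| ≤ w₀ * (massBound ν hi' s * massBound ν hi' t / lo'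
      + massBound ν hi s * massBound ν hi t / lo) := by
    filter_upwards [hWb, hrb, hrb', hfb'] with q h1 h2 h3 h4
    have h5 : (f' a₁ q.1 q.2).toReal ≠ 0 := (hL'.lo_pos.trans_le h4.1).ne'
    simp only [hkdef]
    rw [abs_mul, sub_div, mul_div_assoc (r q), div_self h5, mul_one]
    refine mul_le_mul h1 ((abs_sub _ _).trans (add_le_add h3 h2)) (abs_nonneg _)
      ((abs_nonneg _).trans h1)
  have hWr : Measurable (fun q => W q.1 * r q) := hWm.mul hr
  have hWrb : ∀ᵐ q ∂(covBase ν L'), |W q.1 * r q| ≤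
      w₀ * (massBound ν hi s * massBound ν hi t / lo) := by
    filter_upwards [hWb, hrb] with q h1 h2
    rw [abs_mul]
    exact mul_le_mul h1 h2 (abs_nonneg _) ((abs_nonneg _).trans h1)
  -- the terms of the influence function
  have t1 := hL'.integral_armWeight_outcome a₁ hWr hWrb (hL.measurable_mean a₁) hηi
  have t2 := hL.integral_marginal_part hL' hK hLL s t a₁ a₂ a₃ a₂ hW hb'
  have t3 := hL.integral_marginal_part hL' hK hLL t s a₁ a₃ a₂ a₃ hW hb'
  have t6 := hL'.integral_armWeight_outcome a₁ hkm hkb (hL.measurable_mean a₁) hηi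
  have hE1 := integrable_weight_mul hW hb' (hL'.memLp_mean_mul s t a₁ a₂ a₃)
  have hE4 := integrable_weight_mul hW hb' ((hL.memLp_mean_mul s t a₁ a₂ a₃).of_measure_le_smul hK hB)
  have hE3 := integrable_weight_mul hW hb' (hL'.memLp_subMass_mul a₂ s
    ((hL.memLp_subMass_mul a₃ t (hL.memLp_covBase_mean a₁)).of_measure_le_smul hK hB))
  have hE5 := integrable_weight_mul hW hb' (hL'.memLp_subMass_mul a₃ t
    ((hL.memLp_subMass_mul a₂ s (hL.memLp_covBase_mean a₁)).of_measure_le_smul hK hB))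
  have hdiff : Integrable (fun q : 𝒞 × (ι → ℝ) => η' a₁ q.2 q.1 - η a₁ q.2 q.1) (covBase ν L') :=
    ((hL'.memLp_covBase_mean a₁).sub hη).integrable (by norm_num)
  have hE2 := hL'.integrable_density_mul a₁ (hdiff.bdd_mul hWr.aestronglyMeasurable hWrb)
  have hE6 := hL'.integrable_density_mul a₁ (hdiff.bdd_mul hkm.aestronglyMeasurable hkb)
  have tΛ' := (integral_comp_cov (L := L')
    (hW.mul (hL'.measurable_crossMean s t a₁ a₂ a₃))).trans
    (integral_mul_crossMean s t a₁ a₂ a₃ W hE1)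
  have tΛ := (integral_comp_cov (L := L')
    (hW.mul (hL.measurable_crossMean s t a₁ a₂ a₃))).trans
    (integral_mul_crossMean s t a₁ a₂ a₃ W hE4)
  have hE7 : Integrable (fun q : 𝒞 × (ι → ℝ) => W q.1 * (η a₁ q.2 q.1
      * (subMass ν s (f' a₂ q.1) q.2 - subMass ν s (f a₂ q.1) q.2)
      * (subMass ν t (f' a₃ q.1) q.2 - subMass ν t (f a₃ q.1) q.2))) (covBase ν L') := by
    have := integrable_weight_mul hW hb' (hL'.memLp_subMass_mul a₃ t
      (hL'.memLp_subMass_mul a₂ s hη))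
    refine (((this.sub hE3).sub hE5).add hE4).congr (Eventually.of_forall fun q => ?_)
    simp only [Pi.add_apply, Pi.sub_apply]
    ring
  have key := integral_congr_ae (μ := covBase ν L')
    (f := fun q => ((f' a₁ q.1 q.2).toReal * (k q * (η' a₁ q.2 q.1 - η a₁ q.2 q.1))
      + W q.1 * (η a₁ q.2 q.1 * (subMass ν s (f' a₂ q.1) q.2 - subMass ν s (f a₂ q.1) q.2)
          * (subMass ν t (f' a₃ q.1) q.2 - subMass ν t (f a₃ q.1) q.2))
      + (f' a₁ q.1 q.2).toReal * (W q.1 * r q * (η' a₁ q.2 q.1 - η a₁ q.2 q.1)))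
      + (W q.1 * (η a₁ q.2 q.1 * subMass ν t (f a₃ q.1) q.2 * subMass ν s (f' a₂ q.1) q.2)
        + W q.1 * (η a₁ q.2 q.1 * subMass ν s (f a₂ q.1) q.2 * subMass ν t (f' a₃ q.1) q.2)))
    (g := fun q => W q.1 * (η' a₁ q.2 q.1 * subMass ν s (f' a₂ q.1) q.2
        * subMass ν t (f' a₃ q.1) q.2)
      + W q.1 * (η a₁ q.2 q.1 * subMass ν s (f a₂ q.1) q.2 * subMass ν t (f a₃ q.1) q.2)) (by
    filter_upwards [hfb'] with q h4
    have h5 : (f' a₁ q.1 q.2).toReal ≠ 0 := (hL'.lo_pos.trans_le h4.1).ne'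
    have h6 : (f' a₁ q.1 q.2).toReal * k q = W q.1 * (subMass ν s (f' a₂ q.1) q.2
        * subMass ν t (f' a₃ q.1) q.2 - r q * (f' a₁ q.1 q.2).toReal) := by
      simp only [hkdef]
      field_simp
    rw [← mul_assoc, h6]
    ring)
  rw [integral_add_five hE6 hE7 hE2 hE3 hE5, integral_add hE1 hE4] at key
  have hWφ : ∫ x, W x.2.1 * crossIF ν π f η Y s t a₁ a₂ a₃ x ∂L'
      = ∫ x, armWeight π a₁ x.1 * (W (covMed x).1 * r (covMed x)
          * (Y x.2.2.2 - η a₁ (covMed x).2 (covMed x).1)) ∂L'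
        + ∫ x, armWeight π a₂ x.1 * (W x.2.1 * (marginal ν s
          (fun m => η a₁ m x.2.1 * subMass ν t (f a₃ x.2.1) m) x.2.2.1
          - crossMean ν f η s t a₁ a₂ a₃ x.2.1)) ∂L'
        + ∫ x, armWeight π a₃ x.1 * (W x.2.1 * (marginal ν t
          (fun m => η a₁ m x.2.1 * subMass ν s (f a₂ x.2.1) m) x.2.2.1
          - crossMean ν f η t s a₁ a₃ a₂ x.2.1)) ∂L'
        + ∫ x, W x.2.1 * crossMean ν f η s t a₁ a₂ a₃ x.2.1 ∂L' := by
    have hWL : AEStronglyMeasurable (fun x : Fin 2 × 𝒞 × (ι → ℝ) × 𝒴 => W x.2.1) L' :=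
      (hW.comp (by fun_prop)).aestronglyMeasurable
    have hWbL : ∀ᵐ x ∂L', ‖W x.2.1‖ ≤ w₀ := ae_of_covLaw hb'
    have i1 := ((hL.memLp_residual_part a₁ hr (hL.abs_ratio_le s t a₁ a₂ a₃)).of_measure_le_smul
      hK hLL).integrable (by norm_num)
    have i2 := ((hL.memLp_marginal_part s t a₁ a₂ a₃ a₂).of_measure_le_smul hK hLL).integrable
      (by norm_num)
    have i3 := ((hL.memLp_marginal_part t s a₁ a₃ a₂ a₃).of_measure_le_smul hK hLL).integrable
      (by norm_num)
    have i4 := ((memLp_comp_cov (hL.memLp_crossMean s t a₁ a₂ a₃)).of_measure_le_smul hK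
      hLL).integrable (by norm_num)
    have j1 := (i1.bdd_mul hWL hWbL).congr (g := fun x => armWeight π a₁ x.1 * (W (covMed x).1
      * r (covMed x) * (Y x.2.2.2 - η a₁ (covMed x).2 (covMed x).1)))
      (Eventually.of_forall fun x => by simp only [covMed, hrdef]; ring)
    have j2 := (i2.bdd_mul hWL hWbL).congr (g := fun x => armWeight π a₂ x.1 * (W x.2.1
      * (marginal ν s (fun m => η a₁ m x.2.1 * subMass ν t (f a₃ x.2.1) m) x.2.2.1
        - crossMean ν f η s t a₁ a₂ a₃ x.2.1))) (Eventually.of_forall fun x => by ring)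
    have j3 := (i3.bdd_mul hWL hWbL).congr (g := fun x => armWeight π a₃ x.1 * (W x.2.1
      * (marginal ν t (fun m => η a₁ m x.2.1 * subMass ν s (f a₂ x.2.1) m) x.2.2.1
        - crossMean ν f η t s a₁ a₃ a₂ x.2.1))) (Eventually.of_forall fun x => by ring)
    have j4 := i4.bdd_mul hWL hWbL
    rw [← integral_add_three j1 j2 j3]
    refine Eq.trans ?_ (integral_add ((j1.add j2).add j3) j4)
    refine integral_congr_ae (Eventually.of_forall fun x => ?_)
    simp only [crossIF, covMed, crossMean_swap ν f η t s a₁ a₃ a₂, hrdef]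
    ring
  have hswap : ∫ q, W q.1 * (η a₁ q.2 q.1 * subMass ν t (f a₃ q.1) q.2
        * subMass ν s (f a₂ q.1) q.2) ∂(covBase ν L')
      = ∫ q, W q.1 * (η a₁ q.2 q.1 * subMass ν s (f a₂ q.1) q.2
        * subMass ν t (f a₃ q.1) q.2) ∂(covBase ν L') :=
    integral_congr_ae (Eventually.of_forall fun q => by ring)
  have t6' : ∫ x, armWeight π a₁ x.1 * (W x.2.1 * ((subMass ν s (f' a₂ x.2.1) x.2.2.1
            * subMass ν t (f' a₃ x.2.1) x.2.2.1
          - subMass ν s (f a₂ x.2.1) x.2.2.1 * subMass ν t (f a₃ x.2.1) x.2.2.1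
            / (f a₁ x.2.1 x.2.2.1).toReal * (f' a₁ x.2.1 x.2.2.1).toReal)
          / (f' a₁ x.2.1 x.2.2.1).toReal) * (Y x.2.2.2 - η a₁ x.2.2.1 x.2.1)) ∂L'
      = _ := t6
  rw [t6', hWφ, t1, t2, t3, hswap]
  simp only [Pi.mul_apply] at tΛ tΛ'
  rw [tΛ, tΛ']
  linarith

end IsNuisance

end Expansion

/-! ### The remainder of the expansion -/

section Remainder

variable {α : Type*} [MeasurableSpace α]

/-- `L'` has a likelihood ratio `p` with respect to `L` that lies between `b` and `b⁻¹`. -/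
structure IsPerturbation (L L' : Measure α) (p : α → ℝ) (b : ℝ) : Prop where
  pos : 0 < b
  measurable : Measurable p
  eq_withDensity : L' = L.withDensity fun x => ENNReal.ofReal (p x)
  bounds : ∀ᵐ x ∂L, b ≤ p x ∧ p x ≤ b⁻¹

namespace IsPerturbation

variable {L L' : Measure α} {p : α → ℝ} {b : ℝ}

lemma le_smul (h : IsPerturbation L L' p b) : L' ≤ ENNReal.ofReal b⁻¹ • L := by
  rw [h.eq_withDensity, ← withDensity_const]
  refine withDensity_mono ?_
  filter_upwards [h.bounds] with x hx
  exact ENNReal.ofReal_le_ofReal hx.2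

lemma smul_le (h : IsPerturbation L L' p b) : L ≤ ENNReal.ofReal b⁻¹ • L' := by
  have h1 : ENNReal.ofReal b • L ≤ L' := by
    rw [h.eq_withDensity, ← withDensity_const]
    refine withDensity_mono ?_
    filter_upwards [h.bounds] with x hx
    exact ENNReal.ofReal_le_ofReal hx.1
  refine Measure.le_iff.2 fun S hS => ?_
  have h2 := Measure.le_iff.1 h1 S hS
  simp only [Measure.smul_apply, smul_eq_mul] at h2 ⊢
  rw [ENNReal.ofReal_inv_of_pos h.pos]
  rwa [← ENNReal.mul_le_iff_le_inv (by simp [h.pos]) ENNReal.ofReal_ne_top]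

lemma integral_eq (h : IsPerturbation L L' p b) (g : α → ℝ) :
    ∫ x, g x ∂L' = ∫ x, p x * g x ∂L := by
  rw [h.eq_withDensity, integral_withDensity_eq_integral_toReal_smul
    h.measurable.ennreal_ofReal (Eventually.of_forall fun x => ENNReal.ofReal_lt_top)]
  refine integral_congr_ae ?_
  filter_upwards [h.bounds] with x hx
  rw [ENNReal.toReal_ofReal (h.pos.le.trans hx.1), smul_eq_mul]

/-- The change of a mean, bounded by the `L²` distance of the likelihood ratio from `1`. -/
lemma enorm_integral_sub_le (h : IsPerturbation L L' p b) {g : α → ℝ} (hg : Integrable g L) :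
    ‖∫ x, g x ∂L' - ∫ x, g x ∂L‖ₑ ≤ eLpNorm (fun x => p x - 1) 2 L * eLpNorm g 2 L := by
  have hp : ∀ᵐ x ∂L, ‖p x‖ ≤ b⁻¹ := by
    filter_upwards [h.bounds] with x hx
    rw [Real.norm_eq_abs, abs_of_nonneg (h.pos.le.trans hx.1)]
    exact hx.2
  rw [h.integral_eq, ← integral_sub (hg.bdd_mul h.measurable.aestronglyMeasurable hp) hg]
  have e : (fun x => p x * g x - g x) = fun x => (p x - 1) * g x := by
    funext x
    ring
  rw [e]
  exact enorm_integral_mul_le _ _ (h.measurable.sub_const 1).aestronglyMeasurable hg.1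

end IsPerturbation

variable {𝒞 ι 𝒴 : Type*} [MeasurableSpace 𝒞] [Fintype ι] [DecidableEq ι] [MeasurableSpace 𝒴]
  {ν : ι → Measure ℝ} [∀ i, IsFiniteMeasure (ν i)]
  {L L' : Measure (Fin 2 × 𝒞 × (ι → ℝ) × 𝒴)} [IsFiniteMeasure L] [IsFiniteMeasure L']
  {Y : 𝒴 → ℝ} {π : ℝ} {p : Fin 2 × 𝒞 × (ι → ℝ) × 𝒴 → ℝ} {b : ℝ}
  {f f' : Fin 2 → 𝒞 → (ι → ℝ) → ℝ≥0∞} {η η' : Fin 2 → (ι → ℝ) → 𝒞 → ℝ} {lo hi lo' hi' : ℝ}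

namespace IsNuisance

/-- The constant comparing `L²` norms of functions of `(C, M)` under a law and under
`covBase`. -/
noncomputable def lawConst (π hi : ℝ) : ℝ≥0∞ :=
  (ENNReal.ofReal (propensity π 0) * ENNReal.ofReal hi
    + ENNReal.ofReal (propensity π 1) * ENNReal.ofReal hi) ^ (1 / 2 : ℝ)

lemma lawConst_ne_top (π hi : ℝ) : lawConst π hi ≠ ∞ := by
  unfold lawConst; finiteness

lemma eLpNorm_comp_covMed_le (hL : IsNuisance L Y ν π f η lo hi) {g : 𝒞 × (ι → ℝ) → ℝ}
    (hg : Measurable g) :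
    eLpNorm (fun x => g (covMed x)) 2 L ≤ lawConst π hi * eLpNorm g 2 (covBase ν L) := by
  have h1 := eLpNorm_map_measure (p := 2) (μ := L) hg.aestronglyMeasurable
    measurable_covMed.aemeasurable
  have h2 := eLpNorm_le_of_measure_le_smul hL.map_covMed_le (f := g) (p := 2)
  rw [h1] at h2
  refine h2.trans (le_of_eq ?_)
  simp [lawConst]

/-- The constant of the `L²` Lipschitz bound for the mediator density. -/
noncomputable def densityConst (ν : ι → Measure ℝ) (π hi b : ℝ) (a : Fin 2) : ℝ≥0∞ :=
  ENNReal.ofReal b⁻¹ * (ENNReal.ofReal (propensity π a)⁻¹ *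
    (lawConst π hi + (Measure.pi ν Set.univ) ^ (1 / 2 : ℝ) * ENNReal.ofReal hi))

lemma densityConst_ne_top (ν : ι → Measure ℝ) [∀ i, IsFiniteMeasure (ν i)] (π hi b : ℝ)
    (a : Fin 2) : densityConst ν π hi b a ≠ ∞ := by
  have := lawConst_ne_top π hi
  unfold densityConst; finiteness

lemma memLp_of_bound {g : 𝒞 × (ι → ℝ) → ℝ} (hg : Measurable g) {B : ℝ}
    (hB : ∀ᵐ q ∂(covBase ν L), |g q| ≤ B) : MemLp g 2 (covBase ν L) :=
  MemLp.of_bound hg.aestronglyMeasurable B hB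

set_option maxHeartbeats 800000 in
/-- The mediator density is Lipschitz in `L²` along perturbations of the law. The proof tests the
difference of the densities against itself. -/
lemma eLpNorm_density_sub_le (hL : IsNuisance L Y ν π f η lo hi)
    (hL' : IsNuisance L' Y ν π f' η' lo' hi') (hp : IsPerturbation L L' p b) (a : Fin 2) :
    eLpNorm (fun q : 𝒞 × (ι → ℝ) => (f' a q.1 q.2).toReal - (f a q.1 q.2).toReal) 2 (covBase ν L)
      ≤ densityConst ν π hi b a * eLpNorm (fun x => p x - 1) 2 L := by
  have hB := covBase_le (ν := ν) hp.le_smul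
  have hB' := covBase_le (ν := ν) hp.smul_le
  have hac := Measure.absolutelyContinuous_of_le_smul hB
  have hac' := Measure.absolutelyContinuous_of_le_smul hB'
  have hfm := (hL.measurable_density a).ennreal_toReal
  have hfm' := (hL'.measurable_density a).ennreal_toReal
  set ψ : 𝒞 × (ι → ℝ) → ℝ := fun q => (f' a q.1 q.2).toReal - (f a q.1 q.2).toReal with hψ
  have hψm : Measurable ψ := hfm'.sub hfm
  have hψb : ∀ᵐ q ∂(covBase ν L), |ψ q| ≤ hi' + hi := by
    filter_upwards [hL.toReal_density_bounds a, hac'.ae_le (hL'.toReal_density_bounds a)]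
      with q h1 h2
    refine (abs_sub _ _).trans (add_le_add ?_ ?_)
    · rw [abs_of_nonneg ENNReal.toReal_nonneg]; exact h2.2
    · rw [abs_of_nonneg ENNReal.toReal_nonneg]; exact h1.2
  have hψ2 := memLp_of_bound hψm hψb
  have hψ2' : MemLp ψ 2 (covBase ν L') := hψ2.of_measure_le_smul ENNReal.ofReal_ne_top hB
  -- the conditional mean of `ψ` under the density `f`
  set ψc : 𝒞 → ℝ := fun c => ∫ m, (f a c m).toReal * ψ (c, m) ∂(Measure.pi ν) with hψc
  have hfψ : MemLp (fun q : 𝒞 × (ι → ℝ) => (f a q.1 q.2).toReal * ψ q) 2 (covBase ν L) := by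
    refine memLp_two_bdd_mul (B := hi) hψ2 hfm.aestronglyMeasurable ?_
    filter_upwards [hL.toReal_density_bounds a] with q h1
    rw [abs_of_nonneg ENNReal.toReal_nonneg]; exact h1.2
  have hψcm : Measurable ψc :=
    ((hfm.mul hψm).stronglyMeasurable.integral_prod_right).measurable
  have hψcb := eLpNorm_two_integral_prod_le hfψ.1
  have hψc2 : MemLp ψc 2 (covLaw L) :=
    ⟨hψcm.aestronglyMeasurable, hψcb.trans_lt (ENNReal.mul_lt_top (by finiteness) hfψ.2)⟩
  have hψc2' : MemLp ψc 2 (covLaw L') :=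
    hψc2.of_measure_le_smul ENNReal.ofReal_ne_top (covLaw_le hp.le_smul)
  have hfψ' : MemLp (fun q : 𝒞 × (ι → ℝ) => (f a q.1 q.2).toReal * ψ q) 2 (covBase ν L') :=
    hfψ.of_measure_le_smul ENNReal.ofReal_ne_top hB
  set g : Fin 2 × 𝒞 × (ι → ℝ) × 𝒴 → ℝ := fun x => armWeight π a x.1 * (ψ (covMed x) - ψc x.2.1)
    with hg
  have hg2 : MemLp g 2 L := hL.memLp_armWeight_mul a
    ((hL.memLp_comp_covMed hψ2).sub (memLp_comp_cov hψc2))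
  -- the mean of `g` under either law
  have mean_g : ∀ (M : Measure (Fin 2 × 𝒞 × (ι → ℝ) × 𝒴)) [IsFiniteMeasure M]
      (h : Fin 2 → 𝒞 → (ι → ℝ) → ℝ≥0∞) (ζ : Fin 2 → (ι → ℝ) → 𝒞 → ℝ) (l u : ℝ),
      IsNuisance M Y ν π h ζ l u → MemLp ψ 2 (covBase ν M) → MemLp ψc 2 (covLaw M) →
      MemLp (fun q : 𝒞 × (ι → ℝ) => (f a q.1 q.2).toReal * ψ q) 2 (covBase ν M) →
      ∫ x, g x ∂M = ∫ q, (h a q.1 q.2).toReal * ψ q ∂(covBase ν M)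
        - ∫ q, (f a q.1 q.2).toReal * ψ q ∂(covBase ν M) := by
    intro M _ h ζ l u hM h1 h2 h3
    have e1 := hM.integral_armWeight a hψm
    have e2 := hM.integral_armWeight_cov a hψcm (h2.integrable (by norm_num))
    have i1 := hM.integrable_armWeight_mul a ((hM.memLp_comp_covMed h1).integrable (by norm_num))
    have i2 := hM.integrable_armWeight_mul a ((memLp_comp_cov h2).integrable (by norm_num))
    simp only [hg, mul_sub]
    rw [integral_sub i1 i2, e1, e2]
    congr 1
    have h4 := h3.integrable (q := 2) (by norm_num)
    unfold covBase at h4 ⊢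
    rw [integral_prod _ h4]
  have g1 : ∫ x, g x ∂L = 0 := by
    rw [mean_g L f η lo hi hL hψ2 hψc2 hfψ, sub_self]
  have g2 : ∫ x, g x ∂L' = ∫ q, ψ q ^ 2 ∂(covBase ν L') := by
    rw [mean_g L' f' η' lo' hi' hL' hψ2' hψc2' hfψ', ← integral_sub
      (hL'.integrable_density_mul a (hψ2'.integrable (by norm_num)))
      (hfψ'.integrable (by norm_num))]
    refine integral_congr_ae (Eventually.of_forall fun q => ?_)
    simp only [hψ]
    ring
  have k1 := hp.enorm_integral_sub_le (hg2.integrable (by norm_num))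
  rw [g1, sub_zero, g2] at k1
  have k2 : eLpNorm ψ 2 (covBase ν L) ^ 2 ≤ ENNReal.ofReal b⁻¹ *
      ‖∫ q, ψ q ^ 2 ∂(covBase ν L')‖ₑ := by
    rw [eLpNorm_two_sq, Real.enorm_of_nonneg (integral_nonneg fun q => sq_nonneg _),
      ofReal_integral_eq_lintegral_ofReal hψ2'.integrable_sq
        (Eventually.of_forall fun q => sq_nonneg _)]
    refine (lintegral_mono' hB' le_rfl).trans (le_of_eq ?_)
    rw [lintegral_smul_measure, smul_eq_mul]
    congr 1
    refine lintegral_congr fun q => ?_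
    rw [← Real.enorm_of_nonneg (sq_nonneg _), enorm_pow]
  have k3 : eLpNorm g 2 L ≤ ENNReal.ofReal (propensity π a)⁻¹ *
      ((lawConst π hi + (Measure.pi ν Set.univ) ^ (1 / 2 : ℝ) * ENNReal.ofReal hi)
        * eLpNorm ψ 2 (covBase ν L)) := by
    have n1 : eLpNorm g 2 L ≤ ENNReal.ofReal (propensity π a)⁻¹ *
        eLpNorm (fun x => ψ (covMed x) - ψc x.2.1) 2 L :=
      eLpNorm_two_mul_le (f := fun x => ψ (covMed x) - ψc x.2.1)
        (Eventually.of_forall fun x => hL.abs_armWeight_le a x.1)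
    have n2 : eLpNorm (fun x => ψ (covMed x) - ψc x.2.1) 2 L
        ≤ eLpNorm (fun x => ψ (covMed x)) 2 L + eLpNorm (fun x => ψc x.2.1) 2 L :=
      eLpNorm_sub_le (f := fun x => ψ (covMed x)) (g := fun x => ψc x.2.1)
        (hL.memLp_comp_covMed hψ2).1 (memLp_comp_cov hψc2).1 (by norm_num)
    refine n1.trans (mul_le_mul' le_rfl (n2.trans ?_))
    rw [add_mul]
    refine add_le_add (hL.eLpNorm_comp_covMed_le hψm) ?_
    have h1 : eLpNorm ψc 2 (covLaw L) = eLpNorm (fun x => ψc x.2.1) 2 L :=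
      eLpNorm_map_measure (p := 2) (μ := L)
        (f := fun x : Fin 2 × 𝒞 × (ι → ℝ) × 𝒴 => x.2.1)
        hψcm.aestronglyMeasurable (by fun_prop)
    have h2 : eLpNorm (fun q : 𝒞 × (ι → ℝ) => (f a q.1 q.2).toReal * ψ q) 2 (covBase ν L)
        ≤ ENNReal.ofReal hi * eLpNorm ψ 2 (covBase ν L) := by
      refine eLpNorm_two_mul_le ?_
      filter_upwards [hL.toReal_density_bounds a] with q h1
      rw [abs_of_nonneg ENNReal.toReal_nonneg]; exact h1.2
    rw [← h1, mul_assoc]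
    exact hψcb.trans (mul_le_mul' le_rfl h2)
  -- cancel one factor `‖ψ‖`
  have k4 : eLpNorm ψ 2 (covBase ν L) * eLpNorm ψ 2 (covBase ν L)
      ≤ densityConst ν π hi b a * eLpNorm (fun x => p x - 1) 2 L * eLpNorm ψ 2 (covBase ν L) := by
    rw [← sq]
    refine k2.trans ((mul_le_mul' le_rfl (k1.trans (mul_le_mul' le_rfl k3))).trans (le_of_eq ?_))
    unfold densityConst
    ring
  by_cases h0 : eLpNorm ψ 2 (covBase ν L) = 0
  · rw [h0]; exact zero_le
  · exact (ENNReal.mul_le_mul_iff_left h0 hψ2.2.ne).1 k4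

end IsNuisance

end Remainder

section Asymptotics

variable {𝒞 ι 𝒴 : Type*} [MeasurableSpace 𝒞] [Fintype ι] [DecidableEq ι] [MeasurableSpace 𝒴]
  {ν : ι → Measure ℝ} [∀ i, IsFiniteMeasure (ν i)]
  {L L' : Measure (Fin 2 × 𝒞 × (ι → ℝ) × 𝒴)} [IsFiniteMeasure L] [IsFiniteMeasure L']
  {Y : 𝒴 → ℝ} {π : ℝ} {p : Fin 2 × 𝒞 × (ι → ℝ) × 𝒴 → ℝ} {b : ℝ}
  {f f' : Fin 2 → 𝒞 → (ι → ℝ) → ℝ≥0∞} {η η' : Fin 2 → (ι → ℝ) → 𝒞 → ℝ} {lo hi lo' hi' : ℝ}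

/-- The difference of two partially integrated densities. -/
noncomputable def massDiff (ν : ι → Measure ℝ) (f f' : Fin 2 → 𝒞 → (ι → ℝ) → ℝ≥0∞)
    (s : Finset ι) (a : Fin 2) (q : 𝒞 × (ι → ℝ)) : ℝ :=
  subMass ν s (f' a q.1) q.2 - subMass ν s (f a q.1) q.2

/-- The weight of the outcome residual in the remainder of the expansion. -/
noncomputable def residualCoef (ν : ι → Measure ℝ) (f f' : Fin 2 → 𝒞 → (ι → ℝ) → ℝ≥0∞)
    (W : 𝒞 → ℝ) (s t : Finset ι) (a₁ a₂ a₃ : Fin 2) (q : 𝒞 × (ι → ℝ)) : ℝ :=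
  W q.1 * ((subMass ν s (f' a₂ q.1) q.2 * subMass ν t (f' a₃ q.1) q.2
    - subMass ν s (f a₂ q.1) q.2 * subMass ν t (f a₃ q.1) q.2 / (f a₁ q.1 q.2).toReal
      * (f' a₁ q.1 q.2).toReal) / (f' a₁ q.1 q.2).toReal)

lemma subMass_empty (ν : ι → Measure ℝ) (g : (ι → ℝ) → ℝ≥0∞) (m : ι → ℝ) :
    subMass ν ∅ g m = (g m).toReal := by
  simp [subMass]

lemma lintegral_enorm_mul_le {α : Type*} [MeasurableSpace α] (u v : α → ℝ) {μ : Measure α}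
    (hu : AEStronglyMeasurable u μ) (hv : AEStronglyMeasurable v μ) :
    ∫⁻ x, ‖u x * v x‖ₑ ∂μ ≤ eLpNorm u 2 μ * eLpNorm v 2 μ := by
  have h := eLpNorm_smul_le_mul_eLpNorm (p := 2) (q := 2) (r := 1) hv hu
  rwa [eLpNorm_one_eq_lintegral_enorm] at h

namespace IsNuisance

lemma measurable_massDiff (hL : IsNuisance L Y ν π f η lo hi)
    (hL' : IsNuisance L' Y ν π f' η' lo' hi') (s : Finset ι) (a : Fin 2) :
    Measurable (massDiff ν f f' s a) :=
  (measurable_subMass ν s (hL'.measurable_density a)).sub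
    (measurable_subMass ν s (hL.measurable_density a))

lemma measurable_residualCoef (hL : IsNuisance L Y ν π f η lo hi)
    (hL' : IsNuisance L' Y ν π f' η' lo' hi') {W : 𝒞 → ℝ} (hW : Measurable W) (s t : Finset ι)
    (a₁ a₂ a₃ : Fin 2) : Measurable (residualCoef ν f f' W s t a₁ a₂ a₃) := by
  refine (hW.comp measurable_fst).mul (Measurable.div (Measurable.sub ?_ ?_)
    (hL'.measurable_density a₁).ennreal_toReal)
  · exact (measurable_subMass ν s (hL'.measurable_density a₂)).mul
      (measurable_subMass ν t (hL'.measurable_density a₃))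
  · exact (hL.measurable_ratio s t a₁ a₂ a₃).mul (hL'.measurable_density a₁).ennreal_toReal

lemma abs_massDiff_le (hL : IsNuisance L Y ν π f η lo hi)
    (hL' : IsNuisance L' Y ν π f' η' lo' hi') (hp : IsPerturbation L L' p b)
    (s : Finset ι) (a : Fin 2) :
    ∀ᵐ q ∂(covBase ν L), |massDiff ν f f' s a q| ≤ massBound ν hi' s + massBound ν hi s := by
  have hac' := Measure.absolutelyContinuous_of_le_smul (covBase_le (ν := ν) hp.smul_le)
  filter_upwards [hac'.ae_le (hL'.abs_subMass_le a s), hL.abs_subMass_le a s] with q h1 h2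
  exact (abs_sub _ _).trans (add_le_add h1 h2)

lemma eLpNorm_massDiff_le (hL : IsNuisance L Y ν π f η lo hi)
    (hL' : IsNuisance L' Y ν π f' η' lo' hi') (hp : IsPerturbation L L' p b)
    (s : Finset ι) (a : Fin 2) :
    eLpNorm (massDiff ν f f' s a) 2 (covBase ν L)
      ≤ (Measure.pi fun i : s => ν i) Set.univ * densityConst ν π hi b a
        * eLpNorm (fun x => p x - 1) 2 L := by
  have hac' := Measure.absolutelyContinuous_of_le_smul (covBase_le (ν := ν) hp.smul_le)
  have hfm := (hL.measurable_density a).ennreal_toReal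
  have hfm' := (hL'.measurable_density a).ennreal_toReal
  have int : ∀ (h : 𝒞 × (ι → ℝ) → ℝ) (B : ℝ), Measurable h →
      (∀ᵐ q ∂(covBase ν L), |h q| ≤ B) → ∀ᵐ q ∂(covBase ν L),
        Integrable (fun y => h (q.1, Function.updateFinset q.2 s y))
          (Measure.pi fun i : s => ν i) := by
    intro h B hm hB
    filter_upwards [ae_ae_updateFinset ν (ρ := covLaw L) s (p := fun q => |h q| ≤ B) hB] with q hq
    exact Integrable.of_bound
      (hm.comp (measurable_const.prodMk measurable_updateFinset)).aestronglyMeasurable B hq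
  have e : massDiff ν f f' s a =ᵐ[covBase ν L] fun q =>
      marginal ν s (fun m => (f' a q.1 m).toReal - (f a q.1 m).toReal) q.2 := by
    have b1 : ∀ᵐ q ∂(covBase ν L), |(f a q.1 q.2).toReal| ≤ hi := by
      filter_upwards [hL.toReal_density_bounds a] with q h1
      rw [abs_of_nonneg ENNReal.toReal_nonneg]; exact h1.2
    have b2 : ∀ᵐ q ∂(covBase ν L), |(f' a q.1 q.2).toReal| ≤ hi' := by
      filter_upwards [hac'.ae_le (hL'.toReal_density_bounds a)] with q h1
      rw [abs_of_nonneg ENNReal.toReal_nonneg]; exact h1.2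
    filter_upwards [hL.subMass_eq_marginal a s, hac'.ae_le (hL'.subMass_eq_marginal a s),
      int _ hi hfm b1, int _ hi' hfm' b2] with q h1 h2 h3 h4
    rw [massDiff, h1, h2, marginal, marginal, marginal, ← integral_sub h4 h3]
  rw [eLpNorm_congr_ae e, mul_assoc]
  exact (eLpNorm_marginal_le s (hfm'.sub hfm)).trans
    (mul_le_mul' le_rfl (hL.eLpNorm_density_sub_le hL' hp a))

/-- The weight of the outcome residual is dominated by the changes of the densities. -/
lemma abs_residualCoef_le (hL : IsNuisance L Y ν π f η lo hi)
    (hL' : IsNuisance L' Y ν π f' η' lo' hi') (hp : IsPerturbation L L' p b)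
    {W : 𝒞 → ℝ} {w₀ : ℝ} (hb : ∀ᵐ c ∂(covLaw L), |W c| ≤ w₀) (s t : Finset ι) (a₁ a₂ a₃ : Fin 2) :
    ∀ᵐ q ∂(covBase ν L), |residualCoef ν f f' W s t a₁ a₂ a₃ q|
      ≤ w₀ / lo' * massBound ν hi' t * |massDiff ν f f' s a₂ q|
        + w₀ / lo' * massBound ν hi s * |massDiff ν f f' t a₃ q|
        + w₀ / lo' * (massBound ν hi s * massBound ν hi t / lo) * |massDiff ν f f' ∅ a₁ q| := by
  have hac' := Measure.absolutelyContinuous_of_le_smul (covBase_le (ν := ν) hp.smul_le)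
  filter_upwards [hac'.ae_le (hL'.abs_subMass_le a₃ t), hL.abs_subMass_le a₂ s,
    hL.abs_subMass_le a₃ t, hL.toReal_density_bounds a₁,
    hac'.ae_le (hL'.toReal_density_bounds a₁), ae_covBase_of_covLaw hb] with q h1 h2 h3 h4 h5 h6
  have hlo := hL.lo_pos
  have hlo' := hL'.lo_pos
  have hw : 0 ≤ w₀ := (abs_nonneg _).trans h6
  simp only [massDiff, subMass_empty, residualCoef]
  generalize subMass ν s (f' a₂ q.1) q.2 = S' at *
  generalize subMass ν s (f a₂ q.1) q.2 = S at *
  generalize subMass ν t (f' a₃ q.1) q.2 = T' at *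
  generalize subMass ν t (f a₃ q.1) q.2 = T at *
  generalize (f a₁ q.1 q.2).toReal = F at *
  generalize (f' a₁ q.1 q.2).toReal = F' at *
  have hF : 0 < F := hlo.trans_le h4.1
  have hF' : 0 < F' := hlo'.trans_le h5.1
  have e : S' * T' - S * T / F * F' = T' * (S' - S) + S * (T' - T) - S * T / F * (F' - F) := by
    field_simp
    ring
  have hST : |S * T / F| ≤ massBound ν hi s * massBound ν hi t / lo := by
    rw [abs_div, abs_mul, abs_of_pos hF]
    exact div_le_div₀ (mul_nonneg (hL.massBound_nonneg s) (hL.massBound_nonneg t))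
      (mul_le_mul h2 h3 (abs_nonneg _) (hL.massBound_nonneg s)) hlo h4.1
  have hnum : |S' * T' - S * T / F * F'| ≤ massBound ν hi' t * |S' - S|
      + massBound ν hi s * |T' - T| + massBound ν hi s * massBound ν hi t / lo * |F' - F| := by
    rw [e]
    refine (abs_sub _ _).trans (add_le_add ((abs_add_le _ _).trans (add_le_add ?_ ?_)) ?_)
    all_goals rw [abs_mul]; gcongr
  rw [abs_mul, abs_div, abs_of_pos hF']
  calc |W q.1| * (|S' * T' - S * T / F * F'| / F')
      ≤ w₀ * ((massBound ν hi' t * |S' - S| + massBound ν hi s * |T' - T|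
        + massBound ν hi s * massBound ν hi t / lo * |F' - F|) / lo') := by
        refine mul_le_mul h6 (div_le_div₀ ((abs_nonneg _).trans hnum) hnum hlo' h5.1)
          (by positivity) hw
    _ = _ := by ring

/-- A bound on the weight of the outcome residual, uniform over perturbations. -/
noncomputable def residualBound (ν : ι → Measure ℝ) (lo hi lo' hi' w₀ : ℝ) (s t : Finset ι) : ℝ :=
  w₀ / lo' * massBound ν hi' t * (massBound ν hi' s + massBound ν hi s)
    + w₀ / lo' * massBound ν hi s * (massBound ν hi' t + massBound ν hi t)
    + w₀ / lo' * (massBound ν hi s * massBound ν hi t / lo)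
      * (massBound ν hi' ∅ + massBound ν hi ∅)

lemma abs_residualCoef_le_residualBound (hL : IsNuisance L Y ν π f η lo hi)
    (hL' : IsNuisance L' Y ν π f' η' lo' hi') (hp : IsPerturbation L L' p b)
    {W : 𝒞 → ℝ} {w₀ : ℝ} (hb : ∀ᵐ c ∂(covLaw L), |W c| ≤ w₀) (s t : Finset ι) (a₁ a₂ a₃ : Fin 2) :
    ∀ᵐ q ∂(covBase ν L), |residualCoef ν f f' W s t a₁ a₂ a₃ q|
      ≤ residualBound ν lo hi lo' hi' w₀ s t := by
  filter_upwards [hL.abs_residualCoef_le hL' hp hb s t a₁ a₂ a₃,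
    hL.abs_massDiff_le hL' hp s a₂, hL.abs_massDiff_le hL' hp t a₃,
    hL.abs_massDiff_le hL' hp ∅ a₁, ae_covBase_of_covLaw hb] with q h4 h5 h6 h7 h8
  have hw : 0 ≤ w₀ := (abs_nonneg _).trans h8
  have := hL.lo_pos
  have := hL'.lo_pos
  have := hL.massBound_nonneg s
  have := hL.massBound_nonneg t
  have := hL'.massBound_nonneg t
  refine h4.trans ?_
  unfold residualBound
  gcongr

lemma tendsto_massDiff {E : Type*} {l : Filter E}
    {L' : E → Measure (Fin 2 × 𝒞 × (ι → ℝ) × 𝒴)} [∀ e, IsFiniteMeasure (L' e)]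
    {p : E → Fin 2 × 𝒞 × (ι → ℝ) × 𝒴 → ℝ} {f' : E → Fin 2 → 𝒞 → (ι → ℝ) → ℝ≥0∞}
    {η' : E → Fin 2 → (ι → ℝ) → 𝒞 → ℝ} (hL : IsNuisance L Y ν π f η lo hi)
    (hL' : ∀ᶠ e in l, IsNuisance (L' e) Y ν π (f' e) (η' e) lo' hi')
    (hp : ∀ᶠ e in l, IsPerturbation L (L' e) (p e) b)
    (hδ : Tendsto (fun e => eLpNorm (fun x => p e x - 1) 2 L) l (𝓝 0)) (s : Finset ι) (a : Fin 2) :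
    Tendsto (fun e => eLpNorm (massDiff ν f (f' e) s a) 2 (covBase ν L)) l (𝓝 0) := by
  have hc : (Measure.pi fun i : s => ν i) Set.univ * densityConst ν π hi b a ≠ ∞ :=
    ENNReal.mul_ne_top (by finiteness) (densityConst_ne_top ν π hi b a)
  have h1 := ENNReal.Tendsto.const_mul hδ (Or.inr hc)
  rw [mul_zero] at h1
  refine tendsto_of_tendsto_of_tendsto_of_le_of_le' tendsto_const_nhds h1
    (Eventually.of_forall fun e => zero_le) ?_
  filter_upwards [hL', hp] with e h2 h3
  exact hL.eLpNorm_massDiff_le h2 h3 s a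

/-- Along perturbations of the law whose likelihood ratios tend to `1` in `L²`, the weight of the
outcome residual tends to `0` in `L²`. -/
lemma tendsto_residualCoef {E : Type*} {l : Filter E}
    {L' : E → Measure (Fin 2 × 𝒞 × (ι → ℝ) × 𝒴)} [∀ e, IsFiniteMeasure (L' e)]
    {p : E → Fin 2 × 𝒞 × (ι → ℝ) × 𝒴 → ℝ} {f' : E → Fin 2 → 𝒞 → (ι → ℝ) → ℝ≥0∞}
    {η' : E → Fin 2 → (ι → ℝ) → 𝒞 → ℝ} (hL : IsNuisance L Y ν π f η lo hi)
    (hL' : ∀ᶠ e in l, IsNuisance (L' e) Y ν π (f' e) (η' e) lo' hi')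
    (hp : ∀ᶠ e in l, IsPerturbation L (L' e) (p e) b)
    (hδ : Tendsto (fun e => eLpNorm (fun x => p e x - 1) 2 L) l (𝓝 0))
    {W : 𝒞 → ℝ} {w₀ : ℝ} (hb : ∀ᵐ c ∂(covLaw L), |W c| ≤ w₀) (s t : Finset ι)
    (a₁ a₂ a₃ : Fin 2) :
    Tendsto (fun e => eLpNorm (residualCoef ν f (f' e) W s t a₁ a₂ a₃) 2 (covBase ν L)) l
      (𝓝 0) := by
  have ht : ∀ (c : ℝ) (s : Finset ι) (a : Fin 2), Tendsto (fun e => ENNReal.ofReal |c| *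
      eLpNorm (massDiff ν f (f' e) s a) 2 (covBase ν L)) l (𝓝 0) := by
    intro c s a
    have := ENNReal.Tendsto.const_mul (hL.tendsto_massDiff hL' hp hδ s a)
      (Or.inr (ENNReal.ofReal_ne_top (r := |c|)))
    rwa [mul_zero] at this
  have h1 := ((ht (w₀ / lo' * massBound ν hi' t) s a₂).add
    (ht (w₀ / lo' * massBound ν hi s) t a₃)).add
    (ht (w₀ / lo' * (massBound ν hi s * massBound ν hi t / lo)) ∅ a₁)
  rw [add_zero, add_zero] at h1
  refine tendsto_of_tendsto_of_tendsto_of_le_of_le' tendsto_const_nhds h1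
    (Eventually.of_forall fun e => zero_le) ?_
  filter_upwards [hL', hp] with e h2 h3
  have hm : ∀ (c : ℝ) (s : Finset ι) (a : Fin 2), AEStronglyMeasurable
      (fun q => c * |massDiff ν f (f' e) s a q|) (covBase ν L) := fun c s a =>
    ((hL.measurable_massDiff h2 s a).abs.const_mul c).aestronglyMeasurable
  have hn : ∀ (c : ℝ) (s : Finset ι) (a : Fin 2),
      eLpNorm (fun q => c * |massDiff ν f (f' e) s a q|) 2 (covBase ν L)
        ≤ ENNReal.ofReal |c| * eLpNorm (massDiff ν f (f' e) s a) 2 (covBase ν L) := by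
    intro c s a
    refine eLpNorm_le_mul_eLpNorm_of_ae_le_mul (Eventually.of_forall fun q => ?_) 2
    simp
  refine (eLpNorm_mono_ae_real (hL.abs_residualCoef_le h2 h3 hb s t a₁ a₂ a₃)).trans ?_
  refine (eLpNorm_add_le ((hm _ _ _).add (hm _ _ _)) (hm _ _ _) (by norm_num)).trans
    (add_le_add ((eLpNorm_add_le (hm _ _ _) (hm _ _ _) (by norm_num)).trans
      (add_le_add (hn _ _ _) (hn _ _ _))) (hn _ _ _))

/-- Along perturbations of the law, the change of the mean of `W · crossMean` agrees with the mean
of `W · crossIF` up to a remainder that is small compared with the `L²` distance of the likelihood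
ratio from `1`. -/
lemma exists_remainder_bound {E : Type*} {l : Filter E}
    {L' : E → Measure (Fin 2 × 𝒞 × (ι → ℝ) × 𝒴)} [∀ e, IsFiniteMeasure (L' e)]
    {p : E → Fin 2 × 𝒞 × (ι → ℝ) × 𝒴 → ℝ} {f' : E → Fin 2 → 𝒞 → (ι → ℝ) → ℝ≥0∞}
    {η' : E → Fin 2 → (ι → ℝ) → 𝒞 → ℝ} (hL : IsNuisance L Y ν π f η lo hi)
    (hL' : ∀ᶠ e in l, IsNuisance (L' e) Y ν π (f' e) (η' e) lo' hi')
    (hp : ∀ᶠ e in l, IsPerturbation L (L' e) (p e) b)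
    (hδ : Tendsto (fun e => eLpNorm (fun x => p e x - 1) 2 L) l (𝓝 0))
    {W : 𝒞 → ℝ} (hW : Measurable W) {w₀ : ℝ} (hb : ∀ᵐ c ∂(covLaw L), |W c| ≤ w₀)
    (s t : Finset ι) (a₁ a₂ a₃ : Fin 2) :
    ∃ κ : E → ℝ≥0∞, Tendsto κ l (𝓝 0) ∧ ∀ᶠ e in l,
      ‖∫ x, W x.2.1 * crossMean ν (f' e) (η' e) s t a₁ a₂ a₃ x.2.1 ∂(L' e)
        - ∫ x, W x.2.1 * crossIF ν π f η Y s t a₁ a₂ a₃ x ∂(L' e)‖ₑ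
        ≤ κ e * eLpNorm (fun x => p e x - 1) 2 L := by
  set h : Fin 2 × 𝒞 × (ι → ℝ) × 𝒴 → ℝ := fun x =>
    Y x.2.2.2 - η a₁ (covMed x).2 (covMed x).1 with hh
  have hh2 : MemLp h 2 L := hL.memLp_outcome.sub (hL.memLp_comp_covMed (hL.memLp_covBase_mean a₁))
  set cs : ℝ≥0∞ := (Measure.pi fun i : s => ν i) Set.univ * densityConst ν π hi b a₂ with hcs
  have hcst : cs ≠ ∞ := ENNReal.mul_ne_top (by finiteness) (densityConst_ne_top ν π hi b a₂)
  -- the two factors that tend to zero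
  have t0 := hL.tendsto_residualCoef hL' hp hδ hb s t a₁ a₂ a₃
  have t1 : Tendsto (fun e => eLpNorm (fun x => residualCoef ν f (f' e) W s t a₁ a₂ a₃ (covMed x)
      * h x) 2 L) l (𝓝 0) := by
    refine tendsto_eLpNorm_mul_of_bounded hh2 (B := residualBound ν lo hi lo' hi' w₀ s t) ?_ ?_ ?_
    · filter_upwards [hL'] with e h2
      exact ((hL.measurable_residualCoef h2 hW s t a₁ a₂ a₃).comp
        measurable_covMed).aestronglyMeasurable
    · filter_upwards [hL', hp] with e h2 h3
      exact hL.ae_of_ae_covBase (p := fun _ q => |residualCoef ν f (f' e) W s t a₁ a₂ a₃ q| ≤ _)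
        fun _ => hL.abs_residualCoef_le_residualBound h2 h3 hb s t a₁ a₂ a₃
    · have h1 := ENNReal.Tendsto.const_mul t0 (Or.inr (lawConst_ne_top π hi))
      rw [mul_zero] at h1
      refine tendsto_of_tendsto_of_tendsto_of_le_of_le' tendsto_const_nhds h1
        (Eventually.of_forall fun e => zero_le) ?_
      filter_upwards [hL'] with e h2
      exact hL.eLpNorm_comp_covMed_le (hL.measurable_residualCoef h2 hW s t a₁ a₂ a₃)
  have t2 : Tendsto (fun e => eLpNorm (fun q : 𝒞 × (ι → ℝ) =>
      (W q.1 * massDiff ν f (f' e) t a₃ q) * η a₁ q.2 q.1) 2 (covBase ν L)) l (𝓝 0) := by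
    refine tendsto_eLpNorm_mul_of_bounded (hL.memLp_covBase_mean a₁)
      (B := w₀ * (massBound ν hi' t + massBound ν hi t)) ?_ ?_ ?_
    · filter_upwards [hL'] with e h2
      exact ((hW.comp measurable_fst).mul (hL.measurable_massDiff h2 t a₃)).aestronglyMeasurable
    · filter_upwards [hL', hp] with e h2 h3
      filter_upwards [hL.abs_massDiff_le h2 h3 t a₃, ae_covBase_of_covLaw hb] with q h4 h5
      rw [abs_mul]
      exact mul_le_mul h5 h4 (abs_nonneg _) ((abs_nonneg _).trans h5)
    · have h1 := ENNReal.Tendsto.const_mul (hL.tendsto_massDiff hL' hp hδ t a₃)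
        (Or.inr (ENNReal.ofReal_ne_top (r := w₀)))
      rw [mul_zero] at h1
      exact tendsto_of_tendsto_of_tendsto_of_le_of_le tendsto_const_nhds h1
        (fun e => zero_le) fun e => eLpNorm_two_mul_le (ae_covBase_of_covLaw hb)
  refine ⟨fun e => ENNReal.ofReal (propensity π a₁)⁻¹ * eLpNorm (fun x =>
      residualCoef ν f (f' e) W s t a₁ a₂ a₃ (covMed x) * h x) 2 L
    + ENNReal.ofReal b⁻¹ * cs * eLpNorm (fun q : 𝒞 × (ι → ℝ) =>
      (W q.1 * massDiff ν f (f' e) t a₃ q) * η a₁ q.2 q.1) 2 (covBase ν L), ?_, ?_⟩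
  · have h1 := (ENNReal.Tendsto.const_mul t1
      (Or.inr (ENNReal.ofReal_ne_top (r := (propensity π a₁)⁻¹)))).add
      (ENNReal.Tendsto.const_mul t2 (Or.inr (ENNReal.mul_ne_top
        (ENNReal.ofReal_ne_top (r := b⁻¹)) hcst)))
    rwa [mul_zero, mul_zero, add_zero] at h1
  filter_upwards [hL', hp] with e h2 h3
  have hkm := hL.measurable_residualCoef h2 hW s t a₁ a₂ a₃
  have hB := hL.abs_residualCoef_le_residualBound h2 h3 hb s t a₁ a₂ a₃
  have hBL : ∀ᵐ x ∂L, |residualCoef ν f (f' e) W s t a₁ a₂ a₃ (covMed x)|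
      ≤ residualBound ν lo hi lo' hi' w₀ s t :=
    hL.ae_of_ae_covBase (p := fun _ q => |residualCoef ν f (f' e) W s t a₁ a₂ a₃ q| ≤ _)
      fun _ => hB
  rw [hL.integral_crossMean_sub_integral_crossIF h2 ENNReal.ofReal_ne_top h3.le_smul s t a₁ a₂ a₃
    hW hb, add_mul]
  refine (enorm_add_le _ _).trans (add_le_add ?_ ?_)
  · -- the residual has mean zero under `L`
    have z : ∫ x, armWeight π a₁ x.1 * (residualCoef ν f (f' e) W s t a₁ a₂ a₃ (covMed x) * h x) ∂L
        = 0 := by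
      have h1 := hL.integral_armWeight_outcome a₁ hkm hB (hL.measurable_mean a₁)
        ((hL.memLp_covBase_mean a₁).integrable (by norm_num))
      refine h1.trans ?_
      simp
    have hr2 : MemLp (fun x => residualCoef ν f (f' e) W s t a₁ a₂ a₃ (covMed x) * h x) 2 L :=
      memLp_two_bdd_mul hh2 (hkm.comp measurable_covMed).aestronglyMeasurable hBL
    have h1 := h3.enorm_integral_sub_le
      ((hL.memLp_armWeight_mul a₁ hr2).integrable (by norm_num))
    rw [z, sub_zero] at h1
    have h4 : eLpNorm (fun x => armWeight π a₁ x.1 *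
        (residualCoef ν f (f' e) W s t a₁ a₂ a₃ (covMed x) * h x)) 2 L
        ≤ ENNReal.ofReal (propensity π a₁)⁻¹ * eLpNorm (fun x =>
          residualCoef ν f (f' e) W s t a₁ a₂ a₃ (covMed x) * h x) 2 L :=
      eLpNorm_two_mul_le (f := fun x => residualCoef ν f (f' e) W s t a₁ a₂ a₃ (covMed x) * h x)
        (Eventually.of_forall fun x => hL.abs_armWeight_le a₁ x.1)
    refine h1.trans ((mul_le_mul' le_rfl h4).trans (le_of_eq (mul_comm _ _)))
  · refine (enorm_integral_le_lintegral_enorm _).trans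
      ((lintegral_mono' (covBase_le h3.le_smul) le_rfl).trans ?_)
    rw [lintegral_smul_measure, smul_eq_mul, mul_assoc, mul_assoc]
    refine mul_le_mul' le_rfl ?_
    have e1 : ∀ q : 𝒞 × (ι → ℝ), W q.1 * (η a₁ q.2 q.1 * (subMass ν s (f' e a₂ q.1) q.2
        - subMass ν s (f a₂ q.1) q.2) * (subMass ν t (f' e a₃ q.1) q.2 - subMass ν t (f a₃ q.1) q.2))
        = massDiff ν f (f' e) s a₂ q *
          ((W q.1 * massDiff ν f (f' e) t a₃ q) * η a₁ q.2 q.1) := by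
      intro q
      simp only [massDiff]
      ring
    simp_rw [e1]
    refine (lintegral_enorm_mul_le _ _ (hL.measurable_massDiff h2 s a₂).aestronglyMeasurable
      ((((hW.comp measurable_fst).mul (hL.measurable_massDiff h2 t a₃)).mul
        (hL.measurable_mean a₁)).aestronglyMeasurable)).trans ?_
    refine (mul_le_mul' (hL.eLpNorm_massDiff_le h2 h3 s a₂) le_rfl).trans (le_of_eq ?_)
    rw [← hcs, mul_assoc, mul_comm (eLpNorm _ 2 L)]
    rfl

end IsNuisance

end Asymptotics

/-! ### Slices of an observed-data law -/

section SigmaType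

variable {X : ℕ → Type*} [∀ n, MeasurableSpace (X n)]

lemma measurableSet_sigma {s : Set (Σ n, X n)} :
    MeasurableSet s ↔ ∀ n, MeasurableSet (Sigma.mk n ⁻¹' s) :=
  ⟨fun h => MeasurableSpace.measurableSet_iInf.1 h, fun h => MeasurableSpace.measurableSet_iInf.2 h⟩

lemma measurable_sigmaMk (n : ℕ) : Measurable (Sigma.mk n : X n → Σ n, X n) :=
  fun _ hs => measurableSet_sigma.1 hs n

lemma measurable_sigma_iff {β : Type*} [MeasurableSpace β] {g : (Σ n, X n) → β} :
    Measurable g ↔ ∀ n, Measurable fun x => g ⟨n, x⟩ :=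
  ⟨fun h n => h.comp (measurable_sigmaMk n),
    fun h _ hs => measurableSet_sigma.2 fun n => h n hs⟩

lemma measurableSet_image_sigmaMk (n : ℕ) {S : Set (X n)} (hS : MeasurableSet S) :
    MeasurableSet (Sigma.mk n '' S) := by
  refine measurableSet_sigma.2 fun m => ?_
  by_cases h : m = n
  · subst h
    rwa [Set.preimage_image_eq _ sigma_mk_injective]
  · convert MeasurableSet.empty
    ext x
    simp only [Set.mem_preimage, Set.mem_image, Set.mem_empty_iff_false, iff_false, not_exists]
    rintro y ⟨_, hy⟩
    exact h (congrArg Sigma.fst hy).symm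

lemma measurableEmbedding_sigmaMk (n : ℕ) :
    MeasurableEmbedding (Sigma.mk n : X n → Σ n, X n) :=
  ⟨sigma_mk_injective, measurable_sigmaMk n, fun _ hS => measurableSet_image_sigmaMk n hS⟩

lemma sum_map_sigmaMk_comap (Q : Measure (Σ n, X n)) :
    Measure.sum (fun n => (Q.comap (Sigma.mk n)).map (Sigma.mk n)) = Q := by
  ext s hs
  rw [Measure.sum_apply _ hs]
  have h1 : ∀ n, ((Q.comap (Sigma.mk n)).map (Sigma.mk n)) s = Q (s ∩ Sigma.fst ⁻¹' {n}) := by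
    intro n
    rw [(measurableEmbedding_sigmaMk n).map_comap, Measure.restrict_apply hs,
      Set.range_sigmaMk]
  simp_rw [h1]
  rw [← measure_iUnion]
  · congr 1
    ext x
    simp
  · intro i j hij
    refine Set.disjoint_left.2 fun x hx hy => hij ?_
    exact hx.2.symm.trans hy.2
  · intro n
    refine hs.inter ?_
    rw [← Set.range_sigmaMk, ← Set.image_univ]
    exact measurableSet_image_sigmaMk n MeasurableSet.univ

end SigmaType

section Slices

variable {K dV dX : ℕ} {Q P : ProbabilityMeasure (Obs K dV dX)} {n : ℕ}

lemma slice_apply (Q : ProbabilityMeasure (Obs K dV dX)) (n : ℕ) (S : Set (ObsN K dV dX n)) :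
    slice Q n S = (Q : Measure (Obs K dV dX)) (Sigma.mk n '' S) := by
  rw [slice, (measurableEmbedding_sigmaMk n).comap_apply]

lemma ae_slice {p : Obs K dV dX → Prop} (h : ∀ᵐ o ∂(Q : Measure (Obs K dV dX)), p o) (n : ℕ) :
    ∀ᵐ x ∂(slice Q n), p ⟨n, x⟩ := by
  rw [ae_iff, slice_apply]
  refine measure_mono_null ?_ (ae_iff.1 h)
  rintro _ ⟨x, hx, rfl⟩
  exact hx

lemma ae_of_ae_slice {p : Obs K dV dX → Prop} (h : ∀ n, ∀ᵐ x ∂(slice Q n), p ⟨n, x⟩) :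
    ∀ᵐ o ∂(Q : Measure (Obs K dV dX)), p o := by
  have h1 : ({o | ¬ p o} : Set (Obs K dV dX)) = ⋃ n, Sigma.mk n '' {x | ¬ p ⟨n, x⟩} := by
    ext ⟨n, x⟩
    simp only [Set.mem_ofPred_eq, Set.mem_iUnion, Set.mem_image]
    constructor
    · intro hx; exact ⟨n, x, hx, rfl⟩
    · rintro ⟨m, y, hy, he⟩
      rw [← he]; exact hy
  rw [ae_iff, h1, measure_iUnion_null_iff]
  intro n
  rw [← slice_apply]
  exact h n

/-- A perturbation of the observed-data law perturbs the slices. -/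
lemma IsPerturbation.slice {p : Obs K dV dX → ℝ} {b : ℝ}
    (h : IsPerturbation (P : Measure (Obs K dV dX)) (Q : Measure (Obs K dV dX)) p b) (n : ℕ) :
    IsPerturbation (slice P n) (slice Q n) (fun x => p ⟨n, x⟩) b where
  pos := h.pos
  measurable := h.measurable.comp (measurable_sigmaMk n)
  eq_withDensity := by
    ext S hS
    have hS' := measurableSet_image_sigmaMk (X := fun n => ObsN K dV dX n) n hS
    rw [slice_apply, h.eq_withDensity, withDensity_apply _ hS', withDensity_apply _ hS]
    have e : (P : Measure (Obs K dV dX)).restrict (Sigma.mk n '' S)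
        = ((_root_.slice P n).restrict S).map (Sigma.mk n) := by
      rw [_root_.slice, (measurableEmbedding_sigmaMk n).restrict_comap,
        (measurableEmbedding_sigmaMk n).map_comap, Measure.restrict_restrict
          (measurableEmbedding_sigmaMk n).measurableSet_range,
        Set.inter_eq_right.2 (Set.image_subset_range _ _)]
    rw [e, lintegral_map h.measurable.ennreal_ofReal (measurable_sigmaMk n)]
  bounds := ae_slice h.bounds n

/-! ### Independence of the treatment -/

lemma propensity_pos {π : ℝ} (hπ0 : 0 < π) (hπ1 : π < 1) (a : Fin 2) : 0 < propensity π a := by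
  unfold propensity
  split_ifs <;> linarith

lemma trt_measurable : Measurable (trt : Obs K dV dX → Fin 2) :=
  measurable_sigma_iff.2 fun _ => measurable_fst

lemma sizeCov_measurable : Measurable (sizeCov : Obs K dV dX → Σ n : ℕ, Cov dV dX n) :=
  measurable_sigma_iff.2 fun n =>
    (measurable_sigmaMk (X := fun n => Cov dV dX n) n).comp (measurable_fst.comp measurable_snd)

lemma measure_trt_eq {π : ℝ} (hπ0 : 0 < π)
    (hQ : (Q : Measure (Obs K dV dX)) {o | trt o = 1} = ENNReal.ofReal π) (a : Fin 2) :
    (Q : Measure (Obs K dV dX)) {o | trt o = a} = ENNReal.ofReal (propensity π a) := by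
  have h1 : ({o | trt o = 1} : Set (Obs K dV dX)) = {o | trt o = 0}ᶜ := by
    ext o
    simp only [Set.mem_compl_iff, Set.mem_ofPred_eq]
    omega
  have hS : MeasurableSet ({o | trt o = 0} : Set (Obs K dV dX)) :=
    trt_measurable (measurableSet_singleton 0)
  fin_cases a
  · have h2 := prob_compl_eq_one_sub (μ := (Q : Measure (Obs K dV dX))) hS.compl
    rw [compl_compl, ← h1, hQ] at h2
    simp only [Fin.zero_eta, propensity]
    rw [h2, if_neg (by decide), ENNReal.ofReal_sub _ hπ0.le, ENNReal.ofReal_one]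
  · simpa [propensity] using hQ

lemma slice_trt_cov {π : ℝ} (hπ0 : 0 < π) (hQ : Q ∈ knownPropensityModel K dV dX π)
    (n : ℕ) (a : Fin 2) {S : Set (Cov dV dX n)} (hS : MeasurableSet S) :
    slice Q n {x | x.1 = a ∧ x.2.1 ∈ S}
      = ENNReal.ofReal (propensity π a) * covLaw (slice Q n) S := by
  have hS' := measurableSet_image_sigmaMk (X := fun n => Cov dV dX n) n hS
  have h := (indepFun_iff_measure_inter_preimage_eq_mul.1 hQ.2) {a} (Sigma.mk n '' S)
    (measurableSet_singleton a) hS'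
  have hpre : sizeCov ⁻¹' (Sigma.mk n '' S) = Sigma.mk n '' {x : ObsN K dV dX n | x.2.1 ∈ S} := by
    ext ⟨m, x⟩
    simp only [Set.mem_preimage, sizeCov, Set.mem_image, Set.mem_ofPred_eq]
    constructor
    · rintro ⟨c, hc, he⟩
      obtain rfl : n = m := congrArg Sigma.fst he
      have := sigma_mk_injective he
      exact ⟨x, by rwa [← this], rfl⟩
    · rintro ⟨y, hy, he⟩
      obtain rfl : n = m := congrArg Sigma.fst he
      have := sigma_mk_injective he
      subst this
      exact ⟨_, hy, rfl⟩
  have e1 : trt ⁻¹' {a} ∩ sizeCov ⁻¹' (Sigma.mk n '' S)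
      = Sigma.mk n '' {x : ObsN K dV dX n | x.1 = a ∧ x.2.1 ∈ S} := by
    rw [hpre]
    ext ⟨m, x⟩
    simp only [Set.mem_inter_iff, Set.mem_preimage, trt, Set.mem_singleton_iff, Set.mem_image,
      Set.mem_ofPred_eq]
    constructor
    · rintro ⟨h1, y, hy, he⟩
      obtain rfl : n = m := congrArg Sigma.fst he
      have := sigma_mk_injective he
      subst this
      exact ⟨y, ⟨h1, hy⟩, rfl⟩
    · rintro ⟨y, hy, he⟩
      obtain rfl : n = m := congrArg Sigma.fst he
      have := sigma_mk_injective he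
      subst this
      exact ⟨hy.1, y, hy.2, rfl⟩
  rw [e1, hpre, ← slice_apply, ← slice_apply] at h
  rw [h, covLaw, Measure.map_apply (by fun_prop) hS]
  congr 1
  exact measure_trt_eq hπ0 hQ.1 a

/-- Integration with respect to the law of `(A, C)` on `N = n`, by arms. -/
lemma lintegral_trt_cov {π : ℝ} (hπ0 : 0 < π)
    (hQ : Q ∈ knownPropensityModel K dV dX π) (n : ℕ) {g : Fin 2 × Cov dV dX n → ℝ≥0∞}
    (hg : Measurable g) :
    ∫⁻ z, g z ∂((slice Q n).map (fun x => (x.1, x.2.1)))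
      = ∑ a, ENNReal.ofReal (propensity π a) * ∫⁻ c, g (a, c) ∂(covLaw (slice Q n)) := by
  have hm : Measurable (fun x : ObsN K dV dX n => (x.1, x.2.1)) := by fun_prop
  have e : (slice Q n).map (fun x => (x.1, x.2.1))
      = ∑ a, ENNReal.ofReal (propensity π a) • (covLaw (slice Q n)).map (Prod.mk a) := by
    ext T hT
    rw [Measure.map_apply hm hT, Measure.finsetSum_apply]
    have h1 : (fun x : ObsN K dV dX n => (x.1, x.2.1)) ⁻¹' T
        = ⋃ a : Fin 2, {x | x.1 = a ∧ x.2.1 ∈ Prod.mk a ⁻¹' T} := by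
      ext x
      simp
    rw [h1, measure_iUnion, tsum_fintype]
    · refine Finset.sum_congr rfl fun a _ => ?_
      rw [slice_trt_cov hπ0 hQ n a (measurable_prodMk_left hT), Measure.smul_apply,
        Measure.map_apply measurable_prodMk_left hT, smul_eq_mul]
    · intro a b hab
      refine Set.disjoint_left.2 fun x hx hy => hab ?_
      exact hx.1.symm.trans hy.1
    · intro a
      exact (measurable_fst (measurableSet_singleton a)).inter
        ((measurable_fst.comp measurable_snd) (measurable_prodMk_left hT))
  rw [e, lintegral_finsetSum_measure]
  refine Finset.sum_congr rfl fun a _ => ?_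
  rw [lintegral_smul_measure, lintegral_map hg measurable_prodMk_left, smul_eq_mul]

end Slices

/-! ### The nuisance functions of an observed-data law -/

section Nuisance

variable {K dV dX : ℕ} {Q P : ProbabilityMeasure (Obs K dV dX)} {n : ℕ}
  {ν : Fin K → Measure ℝ} [∀ k, IsFiniteMeasure (ν k)] {π : ℝ}

instance : IsFiniteMeasure (refMeasure ν n) := by unfold refMeasure; infer_instance

instance : IsFiniteMeasure (baseMeasure ν Q n) := by unfold baseMeasure; infer_instance

instance : IsFiniteMeasure (jointLaw Q n) := by unfold jointLaw; infer_instance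

lemma lintegral_baseMeasure (hπ0 : 0 < π) (hQ : Q ∈ knownPropensityModel K dV dX π)
    {g : (Fin 2 × Cov dV dX n) × Med K n → ℝ≥0∞} (hg : Measurable g) :
    ∫⁻ z, g z ∂(baseMeasure ν Q n) = ∑ a, ENNReal.ofReal (propensity π a) *
      ∫⁻ q, g ((a, q.1), q.2) ∂(covBase (coordMeasure ν n) (slice Q n)) := by
  rw [baseMeasure, lintegral_prod _ hg.aemeasurable,
    lintegral_trt_cov hπ0 hQ n hg.lintegral_prod_right']
  refine Finset.sum_congr rfl fun a _ => ?_
  rw [covBase, lintegral_prod]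
  · rfl
  · exact (hg.comp (by fun_prop : Measurable fun q : Cov dV dX n × Med K n =>
      ((a, q.1), q.2))).aemeasurable

lemma ae_covBase_of_baseMeasure (hπ0 : 0 < π) (hπ1 : π < 1)
    (hQ : Q ∈ knownPropensityModel K dV dX π)
    {p : (Fin 2 × Cov dV dX n) × Med K n → Prop} (hp : ∀ᵐ z ∂(baseMeasure ν Q n), p z) (a : Fin 2) :
    ∀ᵐ q ∂(covBase (coordMeasure ν n) (slice Q n)), p ((a, q.1), q.2) := by
  obtain ⟨T, hT, hTm, hT0⟩ := exists_measurable_superset_of_null (ae_iff.1 hp)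
  have h1 := lintegral_baseMeasure (ν := ν) (n := n) hπ0 hQ
    (g := T.indicator 1) (measurable_one.indicator hTm)
  rw [lintegral_indicator_one hTm, hT0] at h1
  have h2 := (Finset.sum_eq_zero_iff.1 h1.symm) a (Finset.mem_univ a)
  have hm : Measurable fun q : Cov dV dX n × Med K n => ((a, q.1), q.2) := by fun_prop
  have h3 : ∫⁻ q, T.indicator 1 ((a, q.1), q.2)
      ∂(covBase (coordMeasure ν n) (slice Q n)) = 0 := by
    refine (mul_eq_zero.1 h2).resolve_left ?_
    simpa using propensity_pos hπ0 hπ1 a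
  have h4 := (lintegral_eq_zero_iff (f := fun q : Cov dV dX n × Med K n =>
    T.indicator 1 ((a, q.1), q.2)) ((measurable_one.indicator hTm).comp hm)).1 h3
  filter_upwards [h4] with q hq
  by_contra hn
  have : ((a, q.1), q.2) ∈ T := hT hn
  simp [this] at hq

lemma measurable_medDensity (ν : Fin K → Measure ℝ) (Q : ProbabilityMeasure (Obs K dV dX)) (n : ℕ)
    (a : Fin 2) : Measurable fun q : Cov dV dX n × Med K n => medDensity ν Q n a q.1 q.2 :=
  (Measure.measurable_rnDeriv _ _).comp
    (by fun_prop : Measurable fun q : Cov dV dX n × Med K n => ((a, q.1), q.2))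

lemma measurable_outcomeMean (Q : ProbabilityMeasure (Obs K dV dX)) (n : ℕ) (j : Fin n)
    (a : Fin 2) : Measurable fun q : Cov dV dX n × Med K n => outcomeMean Q n j a q.2 q.1 := by
  have h : StronglyMeasurable (fun z : Fin 2 × Med K n × Cov dV dX n =>
      ∫ y, y ∂(condDistrib (fun x : ObsN K dV dX n => x.2.2.2 j)
        (fun x : ObsN K dV dX n => (x.1, x.2.2.1, x.2.1)) (slice Q n) z)) :=
    (stronglyMeasurable_id.comp_measurable measurable_snd).integral_condDistrib
  exact h.measurable.comp (by fun_prop : Measurable fun q : Cov dV dX n × Med K n => (a, q.2, q.1))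

/-- Bounds on the mediator density from bounds on measures. -/
lemma medDensity_bounds {lo hi : ℝ}
    (hlo : ENNReal.ofReal lo • baseMeasure ν Q n ≤ jointLaw Q n)
    (hhi : jointLaw Q n ≤ ENNReal.ofReal hi • baseMeasure ν Q n) :
    ∀ᵐ z ∂(baseMeasure ν Q n), ENNReal.ofReal lo ≤ medDensity ν Q n z.1.1 z.1.2 z.2 ∧
      medDensity ν Q n z.1.1 z.1.2 z.2 ≤ ENNReal.ofReal hi := by
  have hac : jointLaw Q n ≪ baseMeasure ν Q n := Measure.absolutelyContinuous_of_le_smul hhi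
  have h1 : (fun _ => ENNReal.ofReal lo) ≤ᵐ[baseMeasure ν Q n]
      (jointLaw Q n).rnDeriv (baseMeasure ν Q n) := by
    refine ae_le_of_forall_setLIntegral_le_of_sigmaFinite measurable_const fun S hS _ => ?_
    rw [setLIntegral_const, Measure.setLIntegral_rnDeriv hac]
    exact Measure.le_iff.1 hlo S hS
  have h2 : (jointLaw Q n).rnDeriv (baseMeasure ν Q n) ≤ᵐ[baseMeasure ν Q n]
      (fun _ => ENNReal.ofReal hi) := by
    refine ae_le_of_forall_setLIntegral_le_of_sigmaFinite (Measure.measurable_rnDeriv _ _)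
      fun S hS _ => ?_
    rw [setLIntegral_const, Measure.setLIntegral_rnDeriv hac]
    exact Measure.le_iff.1 hhi S hS
  filter_upwards [h1, h2] with z h3 h4
  exact ⟨h3, h4⟩

/-- Conversely, bounds on the density give bounds on measures. -/
lemma smul_baseMeasure_le {lo : ℝ}
    (h : ∀ᵐ z ∂(baseMeasure ν Q n), ENNReal.ofReal lo ≤ medDensity ν Q n z.1.1 z.1.2 z.2) :
    ENNReal.ofReal lo • baseMeasure ν Q n ≤ jointLaw Q n := by
  rw [← withDensity_const]
  exact (withDensity_mono h).trans (Measure.withDensity_rnDeriv_le _ _)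

lemma jointLaw_le_smul {hi : ℝ} (hac : jointLaw Q n ≪ baseMeasure ν Q n)
    (h : ∀ᵐ z ∂(baseMeasure ν Q n), medDensity ν Q n z.1.1 z.1.2 z.2 ≤ ENNReal.ofReal hi) :
    jointLaw Q n ≤ ENNReal.ofReal hi • baseMeasure ν Q n := by
  conv_lhs => rw [← Measure.withDensity_rnDeriv_eq _ _ hac]
  rw [← withDensity_const]
  exact withDensity_mono h

lemma map_covMed_restrict (hπ0 : 0 < π) (hQ : Q ∈ knownPropensityModel K dV dX π)
    (hac : jointLaw Q n ≪ baseMeasure ν Q n) (a : Fin 2) :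
    ((slice Q n).restrict {x | x.1 = a}).map covMed = ENNReal.ofReal (propensity π a) •
      (covBase (coordMeasure ν n) (slice Q n)).withDensity fun q => medDensity ν Q n a q.1 q.2 := by
  ext T hT
  have hS : MeasurableSet {x : ObsN K dV dX n | x.1 = a} :=
    measurable_fst (measurableSet_singleton a)
  have hm : Measurable (fun x : ObsN K dV dX n => ((x.1, x.2.1), x.2.2.1)) := by fun_prop
  set Ta : Set ((Fin 2 × Cov dV dX n) × Med K n) := {z | z.1.1 = a ∧ (z.1.2, z.2) ∈ T} with hTa
  have hTam : MeasurableSet Ta :=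
    ((measurable_fst.comp measurable_fst) (measurableSet_singleton a)).inter
      ((by fun_prop : Measurable fun z : (Fin 2 × Cov dV dX n) × Med K n => (z.1.2, z.2)) hT)
  have e1 : ((slice Q n).restrict {x | x.1 = a}).map covMed T = jointLaw Q n Ta := by
    rw [Measure.map_apply measurable_covMed hT, Measure.restrict_apply (measurable_covMed hT),
      jointLaw, Measure.map_apply hm hTam]
    congr 1
    ext x
    simp [hTa, covMed, and_comm]
  rw [e1, ← Measure.withDensity_rnDeriv_eq _ _ hac, withDensity_apply _ hTam,
    ← lintegral_indicator hTam, lintegral_baseMeasure hπ0 hQ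
      ((Measure.measurable_rnDeriv _ _).indicator hTam), Measure.smul_apply, withDensity_apply _ hT,
    ← lintegral_indicator hT, smul_eq_mul, Finset.sum_eq_single a]
  · congr 1
    refine lintegral_congr fun q => ?_
    by_cases h : q ∈ T
    · rw [Set.indicator_of_mem h, Set.indicator_of_mem (show ((a, q.1), q.2) ∈ Ta from ⟨rfl, h⟩)]
      rfl
    · rw [Set.indicator_of_notMem h,
        Set.indicator_of_notMem (show ((a, q.1), q.2) ∉ Ta from fun h' => h h'.2)]
  · intro a' _ ha'
    have : ∀ q : Cov dV dX n × Med K n, Ta.indicator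
        ((jointLaw Q n).rnDeriv (baseMeasure ν Q n)) ((a', q.1), q.2) = 0 := fun q =>
      Set.indicator_of_notMem (fun h' => ha' h'.1) _
    simp only [this, lintegral_zero, mul_zero]
  · exact fun h => absurd (Finset.mem_univ a) h

lemma lintegral_medDensity (hπ0 : 0 < π) (hπ1 : π < 1) (hQ : Q ∈ knownPropensityModel K dV dX π)
    (hac : jointLaw Q n ≪ baseMeasure ν Q n) (a : Fin 2) :
    ∀ᵐ c ∂(covLaw (slice Q n)),
      ∫⁻ m, medDensity ν Q n a c m ∂(Measure.pi (coordMeasure ν n)) = 1 := by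
  have hm := measurable_medDensity ν Q n a
  refine ae_eq_of_forall_setLIntegral_eq_of_sigmaFinite hm.lintegral_prod_right'
    measurable_const fun S hS _ => ?_
  have hS' : MeasurableSet {x : ObsN K dV dX n | x.1 = a} :=
    measurable_fst (measurableSet_singleton a)
  have h1 := congrArg (fun μ => μ (S ×ˢ Set.univ)) (map_covMed_restrict hπ0 hQ hac a)
  simp only [Measure.smul_apply, smul_eq_mul] at h1
  rw [Measure.map_apply measurable_covMed (hS.prod MeasurableSet.univ),
    Measure.restrict_apply (measurable_covMed (hS.prod MeasurableSet.univ)),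
    withDensity_apply _ (hS.prod MeasurableSet.univ), covBase,
    setLIntegral_prod _ hm.aemeasurable] at h1
  have e : covMed ⁻¹' (S ×ˢ Set.univ) ∩ {x : ObsN K dV dX n | x.1 = a}
      = {x | x.1 = a ∧ x.2.1 ∈ S} := by
    ext x
    simp [covMed, and_comm]
  rw [e, slice_trt_cov hπ0 hQ n a hS] at h1
  have h2 : ENNReal.ofReal (propensity π a) ≠ 0 := by simpa using propensity_pos hπ0 hπ1 a
  have h3 := (ENNReal.mul_right_inj h2 ENNReal.ofReal_ne_top).1 h1
  rw [setLIntegral_one, h3]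
  simp

lemma outcomeMean_ae_eq_condExp {j : Fin n} (hY : Integrable (fun x => x.2.2.2 j) (slice Q n)) :
    (slice Q n)[fun x => x.2.2.2 j | MeasurableSpace.comap
        (fun x : ObsN K dV dX n => (x.1, x.2.2.1, x.2.1)) inferInstance]
      =ᵐ[slice Q n] fun x => outcomeMean Q n j x.1 x.2.2.1 x.2.1 :=
  condExp_ae_eq_integral_condDistrib' (by fun_prop) hY

/-- The mediator density and the outcome mean of a law in the model are nuisance functions in the
sense of `IsNuisance`. -/
lemma isNuisance_slice (hπ0 : 0 < π) (hπ1 : π < 1) (hQ : Q ∈ knownPropensityModel K dV dX π)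
    {lo hi : ℝ} (hlo : 0 < lo) (hlohi : lo ≤ hi)
    (hl : ENNReal.ofReal lo • baseMeasure ν Q n ≤ jointLaw Q n)
    (hh : jointLaw Q n ≤ ENNReal.ofReal hi • baseMeasure ν Q n) {j : Fin n}
    (hY : MemLp (fun x => x.2.2.2 j) 2 (slice Q n)) :
    IsNuisance (slice Q n) (fun y => y j) (coordMeasure ν n) π (medDensity ν Q n)
      (outcomeMean Q n j) lo hi where
  measurable_density := measurable_medDensity ν Q n
  measurable_mean := measurable_outcomeMean Q n j
  measurable_outcome := measurable_pi_apply j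
  lo_pos := hlo
  lo_le_hi := hlohi
  propensity_pos := propensity_pos hπ0 hπ1
  density_bounds := fun a => ae_covBase_of_baseMeasure hπ0 hπ1 hQ (medDensity_bounds hl hh) a
  law := map_covMed_restrict hπ0 hQ (Measure.absolutelyContinuous_of_le_smul hh)
  density_norm := lintegral_medDensity hπ0 hπ1 hQ (Measure.absolutelyContinuous_of_le_smul hh)
  memLp_outcome := hY
  memLp_mean := (memLp_congr_ae (outcomeMean_ae_eq_condExp
    (hY.integrable (by norm_num)))).1 (hY.condExp (by norm_num))
  residual := by
    intro ψ hψ B hB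
    have hYi := hY.integrable (q := 2) (by norm_num)
    have hX : Measurable (fun x : ObsN K dV dX n => (x.1, x.2.2.1, x.2.1)) := by fun_prop
    have hφ : Measurable (fun z : Fin 2 × Med K n × Cov dV dX n => ψ z.1 (z.2.2, z.2.1)) := by
      have h : Measurable (fun q : Fin 2 × (Cov dV dX n × Med K n) => ψ q.1 q.2) :=
        measurable_from_prod_countable_right hψ
      exact h.comp (by fun_prop : Measurable fun z : Fin 2 × Med K n × Cov dV dX n =>
        (z.1, (z.2.2, z.2.1)))
    have hψm : StronglyMeasurable[MeasurableSpace.comap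
        (fun x : ObsN K dV dX n => (x.1, x.2.2.1, x.2.1)) inferInstance]
        (fun x : ObsN K dV dX n => ψ x.1 (covMed x)) :=
      (hφ.stronglyMeasurable).comp_measurable (comap_measurable _)
    have hψm' : AEStronglyMeasurable (fun x : ObsN K dV dX n => ψ x.1 (covMed x)) (slice Q n) :=
      (hψm.mono hX.comap_le).aestronglyMeasurable
    have i1 : Integrable (fun x : ObsN K dV dX n => ψ x.1 (covMed x) * x.2.2.2 j) (slice Q n) :=
      hYi.bdd_mul hψm' hB
    have hc := outcomeMean_ae_eq_condExp hYi
    have i2 : Integrable (fun x => ψ x.1 (covMed x) * outcomeMean Q n j x.1 x.2.2.1 x.2.1)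
        (slice Q n) := (integrable_condExp.congr hc).bdd_mul hψm' hB
    have h1 := condExp_mul_of_stronglyMeasurable_left (μ := slice Q n) hψm i1 hYi
    have h2 := integral_condExp (μ := slice Q n) 
      (f := fun x : ObsN K dV dX n => ψ x.1 (covMed x) * x.2.2.2 j)
      hX.comap_le
    simp only [mul_sub]
    rw [integral_sub i1 i2, ← h2, sub_eq_zero]
    refine integral_congr_ae ?_
    filter_upwards [h1, hc] with x h3 h4
    refine h3.trans ?_
    rw [Pi.mul_apply, h4]

end Nuisance

/-! ### Sums over cluster sizes -/

section Sums

variable {K dV dX : ℕ} {Q P : ProbabilityMeasure (Obs K dV dX)} {n nmax : ℕ}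

lemma eq_sum_slice (h : ∀ n, slice Q n ≠ 0 → n ≤ nmax) :
    (Q : Measure (Obs K dV dX))
      = ∑ n ∈ Finset.range (nmax + 1), (slice Q n).map (Sigma.mk n) := by
  conv_lhs => rw [← sum_map_sigmaMk_comap (Q : Measure (Obs K dV dX))]
  ext s hs
  rw [Measure.sum_apply _ hs, Measure.finsetSum_apply, tsum_eq_sum]
  · rfl
  · intro n hn
    have h1 : slice Q n = 0 := by
      by_contra h2
      exact hn (Finset.mem_range.2 (Nat.lt_succ_of_le (h n h2)))
    change ((slice Q n).map (Sigma.mk n)) s = 0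
    simp [h1]

lemma integrable_obs (h : ∀ n, slice Q n ≠ 0 → n ≤ nmax) {g : Obs K dV dX → ℝ}
    (hg : ∀ n, Integrable (fun x => g ⟨n, x⟩) (slice Q n)) :
    Integrable g (Q : Measure (Obs K dV dX)) := by
  rw [eq_sum_slice h, integrable_finsetSum_measure]
  intro n _
  exact (measurableEmbedding_sigmaMk n).integrable_map_iff.2 (hg n)

lemma integral_obs (h : ∀ n, slice Q n ≠ 0 → n ≤ nmax) {g : Obs K dV dX → ℝ}
    (hg : ∀ n, Integrable (fun x => g ⟨n, x⟩) (slice Q n)) :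
    ∫ o, g o ∂(Q : Measure (Obs K dV dX))
      = ∑ n ∈ Finset.range (nmax + 1), ∫ x, g ⟨n, x⟩ ∂(slice Q n) := by
  conv_lhs => rw [eq_sum_slice h]
  rw [integral_finsetSum_measure
    (fun n _ => (measurableEmbedding_sigmaMk n).integrable_map_iff.2 (hg n))]
  refine Finset.sum_congr rfl fun n _ => ?_
  rw [(measurableEmbedding_sigmaMk n).integral_map]

lemma memLp_two_obs (h : ∀ n, slice Q n ≠ 0 → n ≤ nmax) {g : Obs K dV dX → ℝ}
    (hg : ∀ n, MemLp (fun x => g ⟨n, x⟩) 2 (slice Q n)) :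
    MemLp g 2 (Q : Measure (Obs K dV dX)) := by
  have h1 := integrable_obs h fun n => (hg n).integrable (by norm_num)
  refine (memLp_two_iff_integrable_sq h1.1).2 ?_
  exact integrable_obs h fun n => (hg n).integrable_sq

lemma map_slice_le (Q : ProbabilityMeasure (Obs K dV dX)) (n : ℕ) :
    (slice Q n).map (Sigma.mk n) ≤ (Q : Measure (Obs K dV dX)) := by
  rw [slice, (measurableEmbedding_sigmaMk n).map_comap]
  exact Measure.restrict_le_self

lemma eLpNorm_slice_le (g : Obs K dV dX → ℝ) (n : ℕ) :
    eLpNorm (fun x => g ⟨n, x⟩) 2 (slice Q n) ≤ eLpNorm g 2 (Q : Measure (Obs K dV dX)) := by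
  have h := (measurableEmbedding_sigmaMk n).eLpNorm_map_measure (g := g) (p := 2)
    (μ := slice Q n)
  exact h.symm.le.trans (eLpNorm_mono_measure _ (map_slice_le Q n))

/-- Regularity of an observed-data law in the model: bounded cluster size, bounded mediator
density, square-integrable outcomes and a bounded weight. -/
structure IsRegularLaw (ν : Fin K → Measure ℝ) (π : ℝ) (w : (Fin dV → ℝ) → ℕ → ℝ)
    (Q : ProbabilityMeasure (Obs K dV dX)) (nmax : ℕ) (lo hi w₀ : ℝ) : Prop where
  propensity_pos : 0 < π
  propensity_lt_one : π < 1
  mem_model : Q ∈ knownPropensityModel K dV dX π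
  size_pos : ∀ n, slice Q n ≠ 0 → 1 ≤ n
  size_le : ∀ n, slice Q n ≠ 0 → n ≤ nmax
  lo_pos : 0 < lo
  lo_le_hi : lo ≤ hi
  lower : ∀ n, ENNReal.ofReal lo • baseMeasure ν Q n ≤ jointLaw Q n
  upper : ∀ n, jointLaw Q n ≤ ENNReal.ofReal hi • baseMeasure ν Q n
  memLp_outcome : ∀ (n : ℕ) (j : Fin n), MemLp (fun x => x.2.2.2 j) 2 (slice Q n)
  measurable_weight : ∀ n, Measurable fun v => w v n
  abs_weight_le : ∀ᵐ o ∂(Q : Measure (Obs K dV dX)), |weight w o| ≤ w₀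

variable {ν : Fin K → Measure ℝ} [∀ k, IsFiniteMeasure (ν k)] {π : ℝ}
  {w : (Fin dV → ℝ) → ℕ → ℝ} {lo hi w₀ : ℝ}

lemma jointLaw_le {c : ℝ≥0∞} (h : slice P n ≤ c • slice Q n) : jointLaw P n ≤ c • jointLaw Q n := by
  unfold jointLaw
  rw [← Measure.map_smul]
  exact Measure.map_mono h (by fun_prop)

lemma baseMeasure_le {c : ℝ≥0∞} (h : slice P n ≤ c • slice Q n) :
    baseMeasure ν P n ≤ c • baseMeasure ν Q n := by
  unfold baseMeasure
  rw [← Measure.prod_smul_left, ← Measure.map_smul]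
  exact Measure.prod_mono (Measure.map_mono h (by fun_prop)) le_rfl

lemma IsRegularLaw.isNuisance (hP : IsRegularLaw ν π w P nmax lo hi w₀) (n : ℕ) (j : Fin n) :
    IsNuisance (slice P n) (fun y => y j) (coordMeasure ν n) π (medDensity ν P n)
      (outcomeMean P n j) lo hi :=
  isNuisance_slice hP.propensity_pos hP.propensity_lt_one hP.mem_model hP.lo_pos hP.lo_le_hi
    (hP.lower n) (hP.upper n) (hP.memLp_outcome n j)

lemma IsRegularLaw.perturb (hP : IsRegularLaw ν π w P nmax lo hi w₀)
    (hQ : Q ∈ knownPropensityModel K dV dX π) {p : Obs K dV dX → ℝ} {b : ℝ}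
    (h : IsPerturbation (P : Measure (Obs K dV dX)) (Q : Measure (Obs K dV dX)) p b) (hb : b ≤ 1) :
    IsRegularLaw ν π w Q nmax (b * b * lo) (b⁻¹ * b⁻¹ * hi) w₀ where
  propensity_pos := hP.propensity_pos
  propensity_lt_one := hP.propensity_lt_one
  mem_model := hQ
  size_pos n hn := hP.size_pos n fun h0 => hn <| by
    have h1 := (h.slice n).le_smul
    rw [h0, smul_zero] at h1
    exact le_antisymm h1 (Measure.zero_le _)
  size_le n hn := hP.size_le n fun h0 => hn <| by
    have h1 := (h.slice n).le_smul
    rw [h0, smul_zero] at h1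
    exact le_antisymm h1 (Measure.zero_le _)
  lo_pos := by
    have := h.pos
    have := hP.lo_pos
    positivity
  lo_le_hi := by
    have h0 := h.pos
    have h1 := hP.lo_pos
    have h2 := hP.lo_le_hi
    have h3 : 1 ≤ b⁻¹ := (one_le_inv₀ h0).2 hb
    have h4 : b * b ≤ 1 := mul_le_one₀ hb h0.le hb
    have h5 : 1 ≤ b⁻¹ * b⁻¹ := one_le_mul_of_one_le_of_one_le h3 h3
    calc b * b * lo ≤ 1 * lo := by gcongr
      _ ≤ b⁻¹ * b⁻¹ * hi := mul_le_mul h5 h2 h1.le (by positivity)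
  lower n := by
    have hb0 := h.pos
    have h1 := baseMeasure_le (ν := ν) (h.slice n).le_smul
    have h2 := jointLaw_le (h.slice n).smul_le
    have hbb : ENNReal.ofReal b * ENNReal.ofReal b⁻¹ = 1 := by
      rw [← ENNReal.ofReal_mul hb0.le, mul_inv_cancel₀ hb0.ne', ENNReal.ofReal_one]
    rw [ENNReal.ofReal_mul (by positivity), ENNReal.ofReal_mul hb0.le]
    refine Measure.le_iff.2 fun S hS => ?_
    have e1 := Measure.le_iff.1 h1 S hS
    have e2 := Measure.le_iff.1 h2 S hS
    have e3 := Measure.le_iff.1 (hP.lower n) S hS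
    simp only [Measure.smul_apply, smul_eq_mul] at e1 e2 e3 ⊢
    calc ENNReal.ofReal b * ENNReal.ofReal b * ENNReal.ofReal lo * baseMeasure ν Q n S
        ≤ ENNReal.ofReal b * ENNReal.ofReal b * ENNReal.ofReal lo *
          (ENNReal.ofReal b⁻¹ * baseMeasure ν P n S) := by gcongr
      _ = ENNReal.ofReal b * (ENNReal.ofReal b * ENNReal.ofReal b⁻¹) *
          (ENNReal.ofReal lo * baseMeasure ν P n S) := by ring
      _ ≤ ENNReal.ofReal b * (ENNReal.ofReal b * ENNReal.ofReal b⁻¹) *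
          (ENNReal.ofReal b⁻¹ * jointLaw Q n S) := mul_le_mul' le_rfl (e3.trans e2)
      _ = (ENNReal.ofReal b * ENNReal.ofReal b⁻¹) * (ENNReal.ofReal b * ENNReal.ofReal b⁻¹) *
          jointLaw Q n S := by ring
      _ = jointLaw Q n S := by rw [hbb, one_mul, one_mul]
  upper n := by
    have hb0 := h.pos
    have h1 := baseMeasure_le (ν := ν) (h.slice n).smul_le
    have h2 := jointLaw_le (h.slice n).le_smul
    have hhi : 0 ≤ hi := hP.lo_pos.le.trans hP.lo_le_hi
    rw [ENNReal.ofReal_mul (by positivity), ENNReal.ofReal_mul (by positivity)]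
    refine Measure.le_iff.2 fun S hS => ?_
    have e1 := Measure.le_iff.1 h1 S hS
    have e2 := Measure.le_iff.1 h2 S hS
    have e3 := Measure.le_iff.1 (hP.upper n) S hS
    simp only [Measure.smul_apply, smul_eq_mul] at e1 e2 e3 ⊢
    calc jointLaw Q n S ≤ ENNReal.ofReal b⁻¹ * (ENNReal.ofReal hi *
          (ENNReal.ofReal b⁻¹ * baseMeasure ν Q n S)) := by
          refine e2.trans ?_
          gcongr
          refine e3.trans ?_
          gcongr
      _ = _ := by ring
  memLp_outcome n j := (hP.memLp_outcome n j).of_measure_le_smul ENNReal.ofReal_ne_top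
    (h.slice n).le_smul
  measurable_weight := hP.measurable_weight
  abs_weight_le := (Measure.absolutelyContinuous_of_le_smul h.le_smul).ae_le hP.abs_weight_le

/-! ### The generic mediation functional and its expansion -/

/-- `w(V, n) / n`, as a function of the covariates. -/
noncomputable def covWeight (w : (Fin dV → ℝ) → ℕ → ℝ) (n : ℕ) (c : Cov dV dX n) : ℝ :=
  w c.1 n / (n : ℝ)

/-- The weighted cluster average of `crossMean`: for individual `j` the mediators in `U n j` are
drawn from arm `a₂`, the other ones independently from arm `a₃`, and the outcome mean is that of
arm `a₁`. -/
noncomputable def crossPsi (ν : Fin K → Measure ℝ) (w : (Fin dV → ℝ) → ℕ → ℝ)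
    (U : ∀ n, Fin n → Finset (Fin K × Fin n)) (a₁ a₂ a₃ : Fin 2)
    (Q : ProbabilityMeasure (Obs K dV dX)) : ℝ :=
  ∫ o, weightedAvg w (fun n j x => crossMean (coordMeasure ν n) (medDensity ν Q n)
    (outcomeMean Q n j) (U n j)ᶜ (U n j) a₁ a₂ a₃ x.2.1) o ∂(Q : Measure (Obs K dV dX))

/-- The uncentred influence function of `crossPsi`. -/
noncomputable def crossPhi (ν : Fin K → Measure ℝ) (π : ℝ) (w : (Fin dV → ℝ) → ℕ → ℝ)
    (U : ∀ n, Fin n → Finset (Fin K × Fin n)) (a₁ a₂ a₃ : Fin 2)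
    (P : ProbabilityMeasure (Obs K dV dX)) : Obs K dV dX → ℝ :=
  weightedAvg w fun n j x => crossIF (coordMeasure ν n) π (medDensity ν P n)
    (outcomeMean P n j) (fun y => y j) (U n j)ᶜ (U n j) a₁ a₂ a₃ x

lemma weightedAvg_mk (g : ∀ n : ℕ, Fin n → ObsN K dV dX n → ℝ) (x : ObsN K dV dX n) :
    weightedAvg w g ⟨n, x⟩ = ∑ j, covWeight w n x.2.1 * g n j x := by
  rw [← Finset.mul_sum]
  rfl

namespace IsRegularLaw

lemma measurable_covWeight (hP : IsRegularLaw ν π w P nmax lo hi w₀) (n : ℕ) :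
    Measurable (covWeight w n : Cov dV dX n → ℝ) :=
  ((hP.measurable_weight n).comp measurable_fst).div_const _

lemma bound_nonneg (hP : IsRegularLaw ν π w P nmax lo hi w₀) : 0 ≤ w₀ := by
  obtain ⟨o, ho⟩ := hP.abs_weight_le.exists
  exact (abs_nonneg _).trans ho

lemma abs_covWeight_le (hP : IsRegularLaw ν π w P nmax lo hi w₀) (n : ℕ) :
    ∀ᵐ c ∂(covLaw (slice P n)), |covWeight w n c| ≤ w₀ := by
  have hm : MeasurableSet {c : Cov dV dX n | |covWeight w n c| ≤ w₀} :=
    measurableSet_le (hP.measurable_covWeight n).abs measurable_const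
  rw [covLaw, ae_map_iff (by fun_prop) hm]
  filter_upwards [ae_slice hP.abs_weight_le n] with x hx
  change |w x.2.1.1 n / (n : ℝ)| ≤ w₀
  rw [abs_div]
  rcases Nat.eq_zero_or_pos n with h0 | h0
  · simp [h0, hP.bound_nonneg]
  · refine (div_le_self (abs_nonneg _) ?_).trans hx
    rw [abs_of_nonneg (Nat.cast_nonneg _)]
    exact_mod_cast h0

lemma memLp_covWeight_mul (hP : IsRegularLaw ν π w P nmax lo hi w₀) {g : ObsN K dV dX n → ℝ}
    (hg : MemLp g 2 (slice P n)) : MemLp (fun x => covWeight w n x.2.1 * g x) 2 (slice P n) :=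
  memLp_two_bdd_mul hg
    ((hP.measurable_covWeight n).comp (measurable_fst.comp measurable_snd)).aestronglyMeasurable
    (ae_of_covLaw (hP.abs_covWeight_le n))

lemma memLp_weightedAvg_slice (hP : IsRegularLaw ν π w P nmax lo hi w₀)
    {g : ∀ n : ℕ, Fin n → ObsN K dV dX n → ℝ} (hg : ∀ n j, MemLp (g n j) 2 (slice P n)) (n : ℕ) :
    MemLp (fun x => weightedAvg w g ⟨n, x⟩) 2 (slice P n) := by
  simp only [weightedAvg_mk]
  exact memLp_finsetSum _ fun j _ => hP.memLp_covWeight_mul (hg n j)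

lemma memLp_weightedAvg (hP : IsRegularLaw ν π w P nmax lo hi w₀)
    {g : ∀ n : ℕ, Fin n → ObsN K dV dX n → ℝ} (hg : ∀ n j, MemLp (g n j) 2 (slice P n)) :
    MemLp (weightedAvg w g) 2 (P : Measure (Obs K dV dX)) :=
  memLp_two_obs hP.size_le (hP.memLp_weightedAvg_slice hg)

lemma integral_weightedAvg (hP : IsRegularLaw ν π w P nmax lo hi w₀)
    {g : ∀ n : ℕ, Fin n → ObsN K dV dX n → ℝ} (hg : ∀ n j, MemLp (g n j) 2 (slice P n)) :
    ∫ o, weightedAvg w g o ∂(P : Measure (Obs K dV dX))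
      = ∑ n ∈ Finset.range (nmax + 1), ∑ j, ∫ x, covWeight w n x.2.1 * g n j x ∂(slice P n) := by
  rw [integral_obs hP.size_le fun n =>
    (hP.memLp_weightedAvg_slice hg n).integrable (by norm_num)]
  refine Finset.sum_congr rfl fun n _ => ?_
  simp only [weightedAvg_mk]
  exact integral_finsetSum _ fun j _ => (hP.memLp_covWeight_mul (hg n j)).integrable (by norm_num)

variable (U : ∀ n, Fin n → Finset (Fin K × Fin n)) (a₁ a₂ a₃ : Fin 2)

lemma memLp_crossMean_slice (hP : IsRegularLaw ν π w P nmax lo hi w₀) (n : ℕ) (j : Fin n) :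
    MemLp (fun x => crossMean (coordMeasure ν n) (medDensity ν P n)
      (outcomeMean P n j) (U n j)ᶜ (U n j) a₁ a₂ a₃ x.2.1) 2 (slice P n) :=
  IsNuisance.memLp_comp_cov ((hP.isNuisance n j).memLp_crossMean _ _ _ _ _)

lemma memLp_crossPhi (hP : IsRegularLaw ν π w P nmax lo hi w₀) :
    MemLp (crossPhi ν π w U a₁ a₂ a₃ P) 2 (P : Measure (Obs K dV dX)) :=
  hP.memLp_weightedAvg fun n j => (hP.isNuisance n j).memLp_crossIF _ _ _ _ _

/-- The mean of the uncentred influence function is the value of the functional. -/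
lemma integral_crossPhi (hP : IsRegularLaw ν π w P nmax lo hi w₀) :
    ∫ o, crossPhi ν π w U a₁ a₂ a₃ P o ∂(P : Measure (Obs K dV dX)) = crossPsi ν w U a₁ a₂ a₃ P := by
  rw [crossPsi, crossPhi,
    hP.integral_weightedAvg fun n j => (hP.isNuisance n j).memLp_crossIF _ _ _ _ _,
    hP.integral_weightedAvg fun n j => hP.memLp_crossMean_slice U a₁ a₂ a₃ n j]
  refine Finset.sum_congr rfl fun n _ => Finset.sum_congr rfl fun j _ => ?_
  have h := (hP.isNuisance n j).integral_mul_crossIF_sub (U n j)ᶜ (U n j) a₁ a₂ a₃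
    (ψ := fun _ => covWeight w n) (fun _ => hP.measurable_covWeight n)
    (fun _ => hP.abs_covWeight_le n)
  simp only [mul_sub] at h
  rw [integral_sub
    ((hP.memLp_covWeight_mul ((hP.isNuisance n j).memLp_crossIF _ _ _ _ _)).integrable
      (by norm_num))
    ((hP.memLp_covWeight_mul (hP.memLp_crossMean_slice U a₁ a₂ a₃ n j)).integrable
      (by norm_num)), sub_eq_zero] at h
  exact h

end IsRegularLaw

end Sums

/-! ### Derivatives along regular submodels -/

section Submodel

variable {𝒳 : Type*} [MeasurableSpace 𝒳] {model : Set (ProbabilityMeasure 𝒳)}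
  {P : ProbabilityMeasure 𝒳} {Q : ℝ → ProbabilityMeasure 𝒳} {S : 𝒳 → ℝ}

lemma IsRegularSubmodel.exists_perturbation (h : IsRegularSubmodel model P Q S) :
    ∃ (p : ℝ → 𝒳 → ℝ) (b : ℝ), b ≤ 1 ∧ (∀ ε, Measurable (p ε)) ∧
      (∀ᶠ ε in 𝓝 (0 : ℝ), IsPerturbation (P : Measure 𝒳) (Q ε : Measure 𝒳) (p ε) b) ∧
      Tendsto (fun ε : ℝ => eLpNorm (fun o => (p ε o - 1) / ε - S o) 2 (P : Measure 𝒳))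
        (𝓝[≠] 0) (𝓝 0) := by
  obtain ⟨p, b, hb, hm, hd, hbd, ht⟩ := h.exists_ratio
  refine ⟨p, b, ?_, hm, ?_, ht⟩
  · obtain ⟨ε, hε⟩ := hbd.exists
    obtain ⟨o, h1, h2⟩ := hε.exists
    by_contra! hlt
    have := inv_lt_one_of_one_lt₀ hlt
    linarith
  · filter_upwards [hd, hbd] with ε h1 h2
    exact ⟨hb, hm ε, h1, h2⟩

/-- The `L²` distance of the likelihood ratio from `1` is at most of order `ε`. -/
lemma eLpNorm_ratio_sub_one_le {p : ℝ → 𝒳 → ℝ} (hp : ∀ ε, Measurable (p ε))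
    (hS : MemLp S 2 (P : Measure 𝒳)) {ε : ℝ} (hε : ε ≠ 0) :
    eLpNorm (fun o => p ε o - 1) 2 (P : Measure 𝒳) ≤ ‖ε‖ₑ *
      (eLpNorm (fun o => (p ε o - 1) / ε - S o) 2 (P : Measure 𝒳)
        + eLpNorm S 2 (P : Measure 𝒳)) := by
  have e : (fun o => p ε o - 1) = ε • ((fun o => (p ε o - 1) / ε - S o) + S) := by
    funext o
    simp only [Pi.smul_apply, Pi.add_apply, smul_eq_mul]
    field_simp
    ring
  rw [e, eLpNorm_const_smul]
  refine mul_le_mul' le_rfl (eLpNorm_add_le ?_ hS.1 (by norm_num))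
  exact (((hp ε).sub_const 1).div_const ε).aestronglyMeasurable.sub hS.1

/-- The derivative at `0` of the mean of a square-integrable function along a submodel. -/
lemma tendsto_integral_slope {p : ℝ → 𝒳 → ℝ} (hp : ∀ ε, Measurable (p ε))
    (hS : MemLp S 2 (P : Measure 𝒳))
    (ht : Tendsto (fun ε : ℝ => eLpNorm (fun o => (p ε o - 1) / ε - S o) 2 (P : Measure 𝒳))
      (𝓝[≠] 0) (𝓝 0)) {φ : 𝒳 → ℝ} (hφ : MemLp φ 2 (P : Measure 𝒳)) :
    Tendsto (fun ε => ∫ o, φ o * ((p ε o - 1) / ε) ∂(P : Measure 𝒳)) (𝓝[≠] 0)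
      (𝓝 (∫ o, φ o * S o ∂(P : Measure 𝒳))) := by
  rw [tendsto_iff_edist_tendsto_0]
  have h1 := ENNReal.Tendsto.const_mul ht (Or.inr hφ.2.ne)
  rw [mul_zero] at h1
  refine tendsto_of_tendsto_of_tendsto_of_le_of_le' tendsto_const_nhds h1
    (Eventually.of_forall fun _ => zero_le) ?_
  have hfin : ∀ᶠ ε in 𝓝[≠] (0 : ℝ),
      eLpNorm (fun o => (p ε o - 1) / ε - S o) 2 (P : Measure 𝒳) < 1 :=
    ht.eventually_lt_const (by norm_num)
  filter_upwards [hfin] with ε h2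
  have m1 : AEStronglyMeasurable (fun o => (p ε o - 1) / ε - S o) (P : Measure 𝒳) :=
    (((hp ε).sub_const 1).div_const ε).aestronglyMeasurable.sub hS.1
  have m2 : MemLp (fun o => (p ε o - 1) / ε - S o) 2 (P : Measure 𝒳) :=
    ⟨m1, h2.trans (by norm_num)⟩
  have m3 : MemLp (fun o => (p ε o - 1) / ε) 2 (P : Measure 𝒳) := by
    refine (memLp_congr_ae (Eventually.of_forall fun o => ?_)).1 (m2.add hS)
    simp
  have i1 : Integrable (fun o => φ o * ((p ε o - 1) / ε)) (P : Measure 𝒳) := hφ.integrable_mul m3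
  have i2 : Integrable (fun o => φ o * S o) (P : Measure 𝒳) := hφ.integrable_mul hS
  rw [edist_eq_enorm_sub, ← integral_sub i1 i2]
  have e : (fun o => φ o * ((p ε o - 1) / ε) - φ o * S o)
      = fun o => φ o * ((p ε o - 1) / ε - S o) := by
    funext o
    ring
  rw [e]
  exact enorm_integral_mul_le _ _ hφ.1 m1

/-- A functional whose expansion along a submodel has a remainder of smaller order than the `L²`
distance of the likelihood ratio from `1` is differentiable along the submodel. -/
lemma hasDerivAt_of_remainder {Ψ : ProbabilityMeasure 𝒳 → ℝ} {φ : 𝒳 → ℝ}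
    (h : IsRegularSubmodel model P Q S) {p : ℝ → 𝒳 → ℝ} {b : ℝ} (hpm : ∀ ε, Measurable (p ε))
    (hp : ∀ᶠ ε in 𝓝 (0 : ℝ), IsPerturbation (P : Measure 𝒳) (Q ε : Measure 𝒳) (p ε) b)
    (ht : Tendsto (fun ε : ℝ => eLpNorm (fun o => (p ε o - 1) / ε - S o) 2 (P : Measure 𝒳))
      (𝓝[≠] 0) (𝓝 0)) (hφ : MemLp φ 2 (P : Measure 𝒳))
    (h0 : ∫ o, φ o ∂(P : Measure 𝒳) = Ψ P) {κ : ℝ → ℝ≥0∞} (hκ : Tendsto κ (𝓝[≠] 0) (𝓝 0))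
    (hrem : ∀ᶠ ε in 𝓝[≠] (0 : ℝ), ‖Ψ (Q ε) - ∫ o, φ o ∂(Q ε : Measure 𝒳)‖ₑ
      ≤ κ ε * eLpNorm (fun o => p ε o - 1) 2 (P : Measure 𝒳)) :
    HasDerivAt (fun ε => Ψ (Q ε)) (∫ o, φ o * S o ∂(P : Measure 𝒳)) 0 := by
  have hS := h.memLp_score
  have hφi := hφ.integrable (q := 2) (by norm_num)
  rw [hasDerivAt_iff_tendsto_slope]
  have t1 := tendsto_integral_slope hpm hS ht hφ
  -- the remainder divided by `ε`
  have t2 : Tendsto (fun ε => ε⁻¹ * (Ψ (Q ε) - ∫ o, φ o ∂(Q ε : Measure 𝒳))) (𝓝[≠] 0)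
      (𝓝 0) := by
    rw [tendsto_zero_iff_enorm_tendsto_zero]
    have h2 : Tendsto (fun ε => κ ε *
        (eLpNorm (fun o => (p ε o - 1) / ε - S o) 2 (P : Measure 𝒳)
          + eLpNorm S 2 (P : Measure 𝒳))) (𝓝[≠] 0) (𝓝 0) := by
      have h3 := ENNReal.Tendsto.mul hκ (Or.inr (by simpa using hS.2.ne))
        (ht.add_const (eLpNorm S 2 (P : Measure 𝒳))) (Or.inr ENNReal.zero_ne_top)
      rwa [zero_mul] at h3
    refine tendsto_of_tendsto_of_tendsto_of_le_of_le' tendsto_const_nhds h2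
      (Eventually.of_forall fun _ => zero_le) ?_
    filter_upwards [hrem, self_mem_nhdsWithin] with ε h4 h5
    have h5' : ε ≠ 0 := h5
    rw [enorm_mul]
    calc ‖ε⁻¹‖ₑ * ‖Ψ (Q ε) - ∫ o, φ o ∂(Q ε : Measure 𝒳)‖ₑ
        ≤ ‖ε⁻¹‖ₑ * (κ ε * (‖ε‖ₑ * (eLpNorm (fun o => (p ε o - 1) / ε - S o) 2 (P : Measure 𝒳)
          + eLpNorm S 2 (P : Measure 𝒳)))) :=
          mul_le_mul' le_rfl (h4.trans (mul_le_mul' le_rfl (eLpNorm_ratio_sub_one_le hpm hS h5')))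
      _ = (‖ε⁻¹‖ₑ * ‖ε‖ₑ) * (κ ε * (eLpNorm (fun o => (p ε o - 1) / ε - S o) 2 (P : Measure 𝒳)
          + eLpNorm S 2 (P : Measure 𝒳))) := by ring
      _ = _ := by rw [← enorm_mul, inv_mul_cancel₀ h5', enorm_one, one_mul]
  have t3 := t2.add t1
  rw [zero_add] at t3
  refine t3.congr' ?_
  filter_upwards [hp.filter_mono nhdsWithin_le_nhds, self_mem_nhdsWithin] with ε h4 h5
  have h5' : ε ≠ 0 := h5
  have i1 : Integrable (fun o => p ε o * φ o) (P : Measure 𝒳) := by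
    refine hφi.bdd_mul (c := b⁻¹) (hpm ε).aestronglyMeasurable ?_
    filter_upwards [h4.bounds] with o ho
    rw [Real.norm_eq_abs, abs_of_nonneg (h4.pos.le.trans ho.1)]
    exact ho.2
  have e1 : ∫ o, φ o * ((p ε o - 1) / ε) ∂(P : Measure 𝒳)
      = ε⁻¹ * (∫ o, φ o ∂(Q ε : Measure 𝒳) - Ψ P) := by
    rw [h4.integral_eq, ← h0, ← integral_sub i1 hφi, ← integral_const_mul]
    refine integral_congr_ae (Eventually.of_forall fun o => ?_)
    simp only
    ring
  rw [e1, slope_def_field, h.at_zero]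
  field_simp
  ring

lemma IsRegularSubmodel.hasDerivAt_integral (h : IsRegularSubmodel model P Q S) {φ : 𝒳 → ℝ}
    (hφ : MemLp φ 2 (P : Measure 𝒳)) :
    HasDerivAt (fun ε => ∫ o, φ o ∂(Q ε : Measure 𝒳)) (∫ o, φ o * S o ∂(P : Measure 𝒳)) 0 := by
  obtain ⟨p, b, -, hpm, hp, ht⟩ := h.exists_perturbation
  exact hasDerivAt_of_remainder (Ψ := fun R => ∫ o, φ o ∂(R : Measure 𝒳)) h hpm hp ht hφ rfl
    tendsto_const_nhds (Eventually.of_forall fun ε => by simp)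

/-- Scores have mean zero. -/
lemma IsRegularSubmodel.integral_score (h : IsRegularSubmodel model P Q S) :
    ∫ o, S o ∂(P : Measure 𝒳) = 0 := by
  have h1 := h.hasDerivAt_integral (φ := fun _ => 1) (memLp_const 1)
  simp only [one_mul, integral_const, probReal_univ, smul_eq_mul] at h1
  exact h1.unique (hasDerivAt_const 0 1)

end Submodel

section CrossDerivative

variable {K dV dX : ℕ} {P : ProbabilityMeasure (Obs K dV dX)} {nmax : ℕ}
  {ν : Fin K → Measure ℝ} [∀ k, IsFiniteMeasure (ν k)] {π : ℝ}
  {w : (Fin dV → ℝ) → ℕ → ℝ} {lo hi w₀ : ℝ}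

/-- `crossPhi` represents the derivative of `crossPsi` along regular submodels. -/
lemma IsRegularLaw.hasDerivAt_crossPsi (U : ∀ n, Fin n → Finset (Fin K × Fin n))
    (a₁ a₂ a₃ : Fin 2) (hP : IsRegularLaw ν π w P nmax lo hi w₀)
    {Q : ℝ → ProbabilityMeasure (Obs K dV dX)} {S : Obs K dV dX → ℝ}
    (h : IsRegularSubmodel (knownPropensityModel K dV dX π) P Q S) :
    HasDerivAt (fun ε => crossPsi ν w U a₁ a₂ a₃ (Q ε))
      (∫ o, crossPhi ν π w U a₁ a₂ a₃ P o * S o ∂(P : Measure (Obs K dV dX))) 0 := by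
  obtain ⟨p, b, hb1, hpm, hp, ht⟩ := h.exists_perturbation
  have hp' := hp.filter_mono (nhdsWithin_le_nhds (s := {0}ᶜ))
  have hQ' := h.mem_model.filter_mono (nhdsWithin_le_nhds (s := {0}ᶜ))
  have hδ : Tendsto (fun ε => eLpNorm (fun o => p ε o - 1) 2 (P : Measure (Obs K dV dX)))
      (𝓝[≠] 0) (𝓝 0) := by
    have h1 : Tendsto (fun ε : ℝ => ‖ε‖ₑ *
        (eLpNorm (fun o => (p ε o - 1) / ε - S o) 2 (P : Measure (Obs K dV dX))
        + eLpNorm S 2 (P : Measure (Obs K dV dX)))) (𝓝[≠] 0) (𝓝 0) := by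
      have h2 : Tendsto (fun ε : ℝ => ‖ε‖ₑ) (𝓝[≠] 0) (𝓝 0) := by
        have := (continuous_enorm (E := ℝ)).tendsto 0
        rw [enorm_zero] at this
        exact this.mono_left nhdsWithin_le_nhds
      have h3 := ENNReal.Tendsto.mul h2 (Or.inr (by simpa using h.memLp_score.2.ne))
        (ht.add_const (eLpNorm S 2 (P : Measure (Obs K dV dX)))) (Or.inr ENNReal.zero_ne_top)
      rwa [zero_mul] at h3
    refine tendsto_of_tendsto_of_tendsto_of_le_of_le' tendsto_const_nhds h1
      (Eventually.of_forall fun _ => zero_le) ?_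
    filter_upwards [self_mem_nhdsWithin] with ε hε
    exact eLpNorm_ratio_sub_one_le hpm h.memLp_score hε
  -- the remainder on each slice
  have hrem := fun (n : ℕ) (j : Fin n) => (hP.isNuisance n j).exists_remainder_bound
    (l := 𝓝[≠] (0 : ℝ)) (L' := fun ε => slice (Q ε) n) (p := fun ε x => p ε ⟨n, x⟩) (b := b)
    (f' := fun ε => medDensity ν (Q ε) n) (η' := fun ε => outcomeMean (Q ε) n j)
    (lo' := b * b * lo) (hi' := b⁻¹ * b⁻¹ * hi)
    (by
      filter_upwards [hp', hQ'] with ε h1 h2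
      exact (hP.perturb h2 h1 hb1).isNuisance n j)
    (by
      filter_upwards [hp'] with ε h1
      exact h1.slice n)
    (tendsto_of_tendsto_of_tendsto_of_le_of_le tendsto_const_nhds hδ (fun _ => zero_le)
      fun ε => eLpNorm_slice_le (fun o => p ε o - 1) n)
    (hP.measurable_covWeight n) (hP.abs_covWeight_le n) (U n j)ᶜ (U n j) a₁ a₂ a₃
  choose κ hκ hκb using hrem
  refine hasDerivAt_of_remainder (Ψ := crossPsi ν w U a₁ a₂ a₃)
    (φ := crossPhi ν π w U a₁ a₂ a₃ P) h hpm hp ht (hP.memLp_crossPhi U a₁ a₂ a₃)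
    (hP.integral_crossPhi U a₁ a₂ a₃)
    (κ := fun ε => ∑ n ∈ Finset.range (nmax + 1), ∑ j, κ n j ε) ?_ ?_
  · have h1 := tendsto_finsetSum (Finset.range (nmax + 1)) fun n _ =>
      tendsto_finsetSum (Finset.univ : Finset (Fin n)) fun j _ => hκ n j
    simpa using h1
  · have hall : ∀ᶠ ε in 𝓝[≠] (0 : ℝ), ∀ n ∈ Finset.range (nmax + 1), ∀ j : Fin n, _ :=
      (Filter.eventually_all_finset _).2 fun n _ => Filter.eventually_all.2 fun j => hκb n j
    filter_upwards [hall, hp', hQ'] with ε h1 h2 h3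
    have hQε := hP.perturb h3 h2 hb1
    have m1 : ∀ (n : ℕ) (j : Fin n), MemLp (crossIF (coordMeasure ν n) π (medDensity ν P n)
        (outcomeMean P n j) (fun y => y j) (U n j)ᶜ (U n j) a₁ a₂ a₃) 2 (slice (Q ε) n) :=
      fun n j => ((hP.isNuisance n j).memLp_crossIF _ _ _ _ _).of_measure_le_smul
        ENNReal.ofReal_ne_top (h2.slice n).le_smul
    rw [crossPsi, crossPhi, hQε.integral_weightedAvg m1,
      hQε.integral_weightedAvg fun n j => hQε.memLp_crossMean_slice U a₁ a₂ a₃ n j,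
      ← Finset.sum_sub_distrib, Finset.sum_mul]
    refine (enorm_sum_le _ _).trans (Finset.sum_le_sum fun n hn => ?_)
    rw [← Finset.sum_sub_distrib, Finset.sum_mul]
    refine (enorm_sum_le _ _).trans (Finset.sum_le_sum fun j _ => ?_)
    exact (h1 n hn j).trans (mul_le_mul' le_rfl (eLpNorm_slice_le (fun o => p ε o - 1) n))

end CrossDerivative

/-! ### The tangent space of the known-propensity model -/

section Tangent

variable {𝒳 𝒜 𝒵 : Type*} [m𝒳 : MeasurableSpace 𝒳] [MeasurableSpace 𝒜] [MeasurableSpace 𝒵]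
  {P : ProbabilityMeasure 𝒳} {A : 𝒳 → 𝒜} {Z : 𝒳 → 𝒵}

/-- The law with likelihood ratio `1 + ε S`, wherever this is at least `1 / 2`. -/
lemma exists_tilt {S : 𝒳 → ℝ} (hS : Measurable S) {R : ℝ} (hR : ∀ᵐ x ∂(P : Measure 𝒳), |S x| ≤ R)
    (h0 : ∫ x, S x ∂(P : Measure 𝒳) = 0) (ε : ℝ) (hε : |ε| * R ≤ 1 / 2) :
    IsProbabilityMeasure ((P : Measure 𝒳).withDensity fun x => ENNReal.ofReal (1 + ε * S x)) ∧
    (∀ᵐ x ∂(P : Measure 𝒳), 1 / 2 ≤ 1 + ε * S x ∧ 1 + ε * S x ≤ (1 / 2)⁻¹) ∧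
    ∀ s, MeasurableSet s → (P : Measure 𝒳).withDensity (fun x => ENNReal.ofReal (1 + ε * S x)) s
      = ENNReal.ofReal ((P : Measure 𝒳).real s + ε * ∫ x in s, S x ∂(P : Measure 𝒳)) := by
  have hb : ∀ᵐ x ∂(P : Measure 𝒳), 1 / 2 ≤ 1 + ε * S x ∧ 1 + ε * S x ≤ (1 / 2)⁻¹ := by
    filter_upwards [hR] with x hx
    have h1 : |ε * S x| ≤ 1 / 2 := by
      rw [abs_mul]
      exact (mul_le_mul_of_nonneg_left hx (abs_nonneg _)).trans hε
    have h2 := abs_le.1 h1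
    constructor <;> norm_num <;> linarith [h2.1, h2.2]
  have hSi : Integrable S (P : Measure 𝒳) := Integrable.of_bound hS.aestronglyMeasurable R hR
  have hset : ∀ s, MeasurableSet s →
      (P : Measure 𝒳).withDensity (fun x => ENNReal.ofReal (1 + ε * S x)) s
      = ENNReal.ofReal ((P : Measure 𝒳).real s + ε * ∫ x in s, S x ∂(P : Measure 𝒳)) := by
    intro s hs
    have i1 : Integrable (fun x => ε * S x) ((P : Measure 𝒳).restrict s) :=
      (hSi.const_mul ε).restrict
    have i2 : Integrable (fun x => 1 + ε * S x) ((P : Measure 𝒳).restrict s) :=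
      (integrable_const 1).add i1
    rw [withDensity_apply _ hs, ← ofReal_integral_eq_lintegral_ofReal i2,
      integral_add (integrable_const 1) i1, integral_const_mul]
    · simp
    · refine ae_restrict_of_ae ?_
      filter_upwards [hb] with x hx
      have : (0 : ℝ) ≤ 1 / 2 := by norm_num
      exact this.trans hx.1
  refine ⟨⟨?_⟩, hb, hset⟩
  rw [hset _ MeasurableSet.univ, setIntegral_univ, h0]
  simp

/-- A bounded function `S = g - E[g | A, Z] + E[g | Z] - E[g]` is the score of a path that leaves
the law of `A` and its independence of `Z` intact. -/
lemma indepFun_tilt (hA : Measurable A) (hZ : Measurable Z) (hind : IndepFun A Z (P : Measure 𝒳))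
    {g u S : 𝒳 → ℝ} (hg : Integrable g (P : Measure 𝒳))
    (hu : StronglyMeasurable[MeasurableSpace.comap Z inferInstance] u)
    (hui : Integrable u (P : Measure 𝒳)) (hu0 : ∫ x, u x ∂(P : Measure 𝒳) = 0)
    (hSe : S = fun x => g x - ((P : Measure 𝒳)[g | MeasurableSpace.comap (fun x => (A x, Z x))
      inferInstance]) x + u x)
    (Q : Measure 𝒳) (ε : ℝ)
    (hQ : ∀ s, MeasurableSet s →
      Q s = ENNReal.ofReal ((P : Measure 𝒳).real s + ε * ∫ x in s, S x ∂(P : Measure 𝒳))) :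
    IndepFun A Z Q ∧ ∀ B, MeasurableSet B → Q (A ⁻¹' B) = (P : Measure 𝒳) (A ⁻¹' B) := by
  have hAZ : Measurable (fun x => (A x, Z x)) := hA.prodMk hZ
  have hm1 : MeasurableSpace.comap Z inferInstance ≤ m𝒳 := hZ.comap_le
  -- integral of the score over a rectangle
  have key : ∀ (B : Set 𝒜) (D : Set 𝒵), MeasurableSet B → MeasurableSet D →
      ∫ x in A ⁻¹' B ∩ Z ⁻¹' D, S x ∂(P : Measure 𝒳)
        = (P : Measure 𝒳).real (A ⁻¹' B) * ∫ x in Z ⁻¹' D, u x ∂(P : Measure 𝒳) := by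
    intro B D hB hD
    have hs : MeasurableSet[MeasurableSpace.comap (fun x => (A x, Z x)) inferInstance]
        (A ⁻¹' B ∩ Z ⁻¹' D) := ⟨B ×ˢ D, hB.prod hD, by ext; simp⟩
    have i1 : Integrable (fun x => g x - ((P : Measure 𝒳)[g | MeasurableSpace.comap
        (fun x => (A x, Z x)) inferInstance]) x) (P : Measure 𝒳) := hg.sub integrable_condExp
    rw [hSe, integral_add i1.restrict hui.restrict,
      integral_sub hg.restrict integrable_condExp.restrict,
      setIntegral_condExp hAZ.comap_le hg hs, sub_self, zero_add]
    have hX : Measurable (B.indicator (1 : 𝒜 → ℝ)) := measurable_one.indicator hB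
    have hv : StronglyMeasurable[MeasurableSpace.comap Z inferInstance]
        ((Z ⁻¹' D).indicator u) := hu.indicator ⟨D, hD, rfl⟩
    have hi : IndepFun (fun x => B.indicator (1 : 𝒜 → ℝ) (A x)) ((Z ⁻¹' D).indicator u)
        (P : Measure 𝒳) := by
      rw [IndepFun_iff_Indep] at hind ⊢
      refine indep_of_indep_of_le_right (indep_of_indep_of_le_left hind ?_) ?_
      · rintro _ ⟨T, hT, rfl⟩
        exact ⟨_, hX hT, rfl⟩
      · exact hv.measurable.comap_le
    have h1 := hi.integral_fun_mul_eq_mul_integral (hX.comp hA).aestronglyMeasurable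
      (hv.mono hm1).aestronglyMeasurable
    rw [integral_indicator (hZ hD)] at h1
    have h2 : ∫ x, B.indicator (1 : 𝒜 → ℝ) (A x) ∂(P : Measure 𝒳)
        = (P : Measure 𝒳).real (A ⁻¹' B) := by
      rw [← integral_indicator_one (hA hB)]
      rfl
    rw [h2] at h1
    rw [← h1, ← integral_indicator ((hA hB).inter (hZ hD))]
    refine integral_congr_ae (Eventually.of_forall fun x => ?_)
    by_cases hx : A x ∈ B <;> by_cases hy : Z x ∈ D <;> simp [hx, hy]
  have hP : ∀ (B : Set 𝒜) (D : Set 𝒵), MeasurableSet B → MeasurableSet D →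
      (P : Measure 𝒳).real (A ⁻¹' B ∩ Z ⁻¹' D)
        = (P : Measure 𝒳).real (A ⁻¹' B) * (P : Measure 𝒳).real (Z ⁻¹' D) := by
    intro B D hB hD
    simp only [Measure.real]
    rw [indepFun_iff_measure_inter_preimage_eq_mul.1 hind B D hB hD, ENNReal.toReal_mul]
  have hQr : ∀ (B : Set 𝒜) (D : Set 𝒵), MeasurableSet B → MeasurableSet D →
      Q (A ⁻¹' B ∩ Z ⁻¹' D) = (P : Measure 𝒳) (A ⁻¹' B) * ENNReal.ofReal
        ((P : Measure 𝒳).real (Z ⁻¹' D) + ε * ∫ x in Z ⁻¹' D, u x ∂(P : Measure 𝒳)) := by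
    intro B D hB hD
    rw [hQ _ ((hA hB).inter (hZ hD)), key B D hB hD, hP B D hB hD, ← ofReal_measureReal,
      ← ENNReal.ofReal_mul measureReal_nonneg]
    congr 1
    ring
  have hQA : ∀ B, MeasurableSet B → Q (A ⁻¹' B) = (P : Measure 𝒳) (A ⁻¹' B) := by
    intro B hB
    have := hQr B Set.univ hB MeasurableSet.univ
    simpa [hu0] using this
  refine ⟨indepFun_iff_measure_inter_preimage_eq_mul.2 fun B D hB hD => ?_, hQA⟩
  have h1 := hQr Set.univ D MeasurableSet.univ hD
  simp only [Set.preimage_univ, Set.univ_inter, measure_univ, one_mul] at h1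
  rw [hQr B D hB hD, hQA B hB, h1]

/-- A square-integrable mean-zero function whose conditional mean given `(A, Z)` depends on `Z` only
is a limit of scores of models that restrict at most the law of `A` and its independence
of `Z`. -/
lemma exists_score_approx {model : Set (ProbabilityMeasure 𝒳)} (hA : Measurable A)
    (hZ : Measurable Z) (hind : IndepFun A Z (P : Measure 𝒳))
    (hmodel : ∀ Q : ProbabilityMeasure 𝒳, IndepFun A Z (Q : Measure 𝒳) →
      (∀ B, MeasurableSet B → (Q : Measure 𝒳) (A ⁻¹' B) = (P : Measure 𝒳) (A ⁻¹' B)) → Q ∈ model)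
    {φ : 𝒳 → ℝ} (hφ : MemLp φ 2 (P : Measure 𝒳)) (hφ0 : ∫ x, φ x ∂(P : Measure 𝒳) = 0)
    (hc : (P : Measure 𝒳)[φ | MeasurableSpace.comap (fun x => (A x, Z x)) inferInstance]
      =ᵐ[(P : Measure 𝒳)] (P : Measure 𝒳)[φ | MeasurableSpace.comap Z inferInstance])
    {δ : ℝ≥0∞} (hδ : 0 < δ) :
    ∃ S ∈ scoreSet model P, eLpNorm (fun x => φ x - S x) 2 (P : Measure 𝒳) < δ := by
  have hm1le : MeasurableSpace.comap Z inferInstance ≤ m𝒳 := hZ.comap_le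
  have hm2le : MeasurableSpace.comap (fun x => (A x, Z x)) inferInstance ≤ m𝒳 :=
    (hA.prodMk hZ).comap_le
  obtain ⟨g, hgδ, hg2⟩ := hφ.exists_simpleFunc_eLpNorm_sub_lt (by norm_num)
    (ENNReal.div_pos hδ.ne' (by norm_num : (4 : ℝ≥0∞) ≠ ∞)).ne'
  obtain ⟨R, hR⟩ := g.exists_forall_norm_le
  have hgR : ∀ x, |g x| ≤ R := hR
  have hgi : Integrable g (P : Measure 𝒳) := hg2.integrable (by norm_num)
  set G1 := (P : Measure 𝒳)[g | MeasurableSpace.comap Z inferInstance] with hG1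
  set G2 := (P : Measure 𝒳)[g | MeasurableSpace.comap (fun x => (A x, Z x)) inferInstance] with hG2
  set e0 := ∫ x, g x ∂(P : Measure 𝒳) with he0
  set u : 𝒳 → ℝ := fun x => G1 x - e0 with hu
  set S : 𝒳 → ℝ := fun x => g x - G2 x + u x with hS
  have hum : StronglyMeasurable[MeasurableSpace.comap Z inferInstance] u :=
    stronglyMeasurable_condExp.sub stronglyMeasurable_const
  have hui : Integrable u (P : Measure 𝒳) := integrable_condExp.sub (integrable_const _)
  have hu0 : ∫ x, u x ∂(P : Measure 𝒳) = 0 := by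
    rw [hu, integral_sub integrable_condExp (integrable_const _), integral_condExp hm1le]
    simp [he0]
  have hSm : Measurable S :=
    (g.measurable.sub (stronglyMeasurable_condExp.mono hm2le).measurable).add
      (hum.mono hm1le).measurable
  have hS0 : ∫ x, S x ∂(P : Measure 𝒳) = 0 := by
    have i1 : Integrable (fun x => g x - G2 x) (P : Measure 𝒳) := hgi.sub integrable_condExp
    rw [hS, integral_add i1 hui, integral_sub hgi integrable_condExp, integral_condExp hm2le, hu0]
    simp
  have he0b : |e0| ≤ R := by
    have := norm_integral_le_of_norm_le_const (μ := (P : Measure 𝒳)) (f := g) (C := R)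
      (Eventually.of_forall hgR)
    simpa using this
  have hSb : ∀ᵐ x ∂(P : Measure 𝒳), |S x| ≤ 4 * R := by
    filter_upwards [ae_bdd_abs_condExp_of_ae_bdd_abs (m := MeasurableSpace.comap Z inferInstance)
        (R := R) (Eventually.of_forall hgR),
      ae_bdd_abs_condExp_of_ae_bdd_abs (m := MeasurableSpace.comap (fun x => (A x, Z x)) inferInstance)
        (R := R) (Eventually.of_forall hgR)] with x h1 h2
    have h3 := abs_le.1 (hgR x)
    have h1 := abs_le.1 h1
    have h2 := abs_le.1 h2
    have h4 := abs_le.1 he0b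
    simp only [hS, hu]
    rw [abs_le]
    constructor <;> linarith [h1.1, h1.2, h2.1, h2.2, h3.1, h3.2, h4.1, h4.2]
  refine ⟨S, ?_, ?_⟩
  · -- the path with likelihood ratio `1 + ε S`
    have htilt := fun (ε : ℝ) hε => exists_tilt (P := P) hSm hSb hS0 ε hε
    classical
    let Q : ℝ → ProbabilityMeasure 𝒳 := fun ε =>
      if hε : |ε| * (4 * R) ≤ 1 / 2 then ⟨_, (htilt ε hε).1⟩ else P
    have hsmall : ∀ᶠ ε in 𝓝 (0 : ℝ), |ε| * (4 * R) ≤ 1 / 2 := by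
      have hcont : Tendsto (fun ε : ℝ => |ε| * (4 * R)) (𝓝 0) (𝓝 (|0| * (4 * R))) :=
        (continuous_abs.mul continuous_const).tendsto 0
      rw [abs_zero, zero_mul] at hcont
      exact hcont.eventually_le_const (by norm_num)
    have hQe : ∀ ε : ℝ, |ε| * (4 * R) ≤ 1 / 2 → (Q ε : Measure 𝒳)
        = (P : Measure 𝒳).withDensity fun x => ENNReal.ofReal (1 + ε * S x) := by
      intro ε hε
      have h1 : Q ε = ⟨_, (htilt ε hε).1⟩ := dif_pos hε
      rw [h1]
      rfl
    refine ⟨Q, ?_, ?_, ?_, fun ε x => 1 + ε * S x, 1 / 2, by norm_num, ?_, ?_, ?_, ?_⟩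
    · refine Subtype.ext ?_
      change (Q 0 : Measure 𝒳) = (P : Measure 𝒳)
      rw [hQe 0 (by simp)]
      simp
    · filter_upwards [hsmall] with ε hε
      have h1 := indepFun_tilt hA hZ hind hgi hum hui hu0 hS (Q ε : Measure 𝒳) ε (by
        rw [hQe ε hε]
        exact (htilt ε hε).2.2)
      exact hmodel _ h1.1 h1.2
    · exact MemLp.of_bound hSm.aestronglyMeasurable (4 * R) hSb
    · intro ε
      exact (hSm.const_mul ε).const_add 1
    · filter_upwards [hsmall] with ε hε
      exact hQe ε hε
    · filter_upwards [hsmall] with ε hε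
      exact (htilt ε hε).2.1
    · refine tendsto_const_nhds.congr' ?_
      filter_upwards [self_mem_nhdsWithin] with ε hε
      have hε' : ε ≠ 0 := hε
      have e : (fun o => (1 + ε * S o - 1) / ε - S o) = fun _ => (0 : ℝ) := by
        funext o
        field_simp
        ring
      change 0 = eLpNorm (fun o => (1 + ε * S o - 1) / ε - S o) 2 (P : Measure 𝒳)
      rw [e, eLpNorm_zero']
  · -- distance from `φ`
    set d : 𝒳 → ℝ := φ - g with hd
    have hφi : Integrable φ (P : Measure 𝒳) := hφ.integrable (by norm_num)
    have hd2 : MemLp d 2 (P : Measure 𝒳) := hφ.sub hg2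
    have hdi : Integrable d (P : Measure 𝒳) := hd2.integrable (by norm_num)
    have hed : ∫ x, d x ∂(P : Measure 𝒳) = -e0 := by
      rw [hd]
      simp only [Pi.sub_apply]
      rw [integral_sub hφi hgi, hφ0, zero_sub]
    have e : (fun x => φ x - S x) =ᵐ[(P : Measure 𝒳)]
        (d - (P : Measure 𝒳)[d | MeasurableSpace.comap (fun x => (A x, Z x)) inferInstance])
        + ((P : Measure 𝒳)[d | MeasurableSpace.comap Z inferInstance] - fun _ => ∫ y, d y ∂(P : Measure 𝒳)) := by
      filter_upwards [condExp_sub hφi hgi (MeasurableSpace.comap Z inferInstance),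
        condExp_sub hφi hgi (MeasurableSpace.comap (fun x => (A x, Z x)) inferInstance), hc] with x h1 h2 h3
      simp only [Pi.add_apply, Pi.sub_apply, hS, hu, hed] at h1 h2 ⊢
      rw [h1, h2, h3]
      simp only [hd, Pi.sub_apply]
      ring
    have n1 : eLpNorm ((P : Measure 𝒳)[d | MeasurableSpace.comap Z inferInstance])
        2 (P : Measure 𝒳) ≤ eLpNorm d 2 (P : Measure 𝒳) :=
      eLpNorm_condExp_le_eLpNorm _ (by norm_num)
    have n2 : eLpNorm ((P : Measure 𝒳)[d | MeasurableSpace.comap (fun x => (A x, Z x)) inferInstance])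
        2 (P : Measure 𝒳) ≤ eLpNorm d 2 (P : Measure 𝒳) :=
      eLpNorm_condExp_le_eLpNorm _ (by norm_num)
    have n3 : eLpNorm (fun _ : 𝒳 => ∫ y, d y ∂(P : Measure 𝒳)) 2 (P : Measure 𝒳)
        ≤ eLpNorm d 2 (P : Measure 𝒳) := by
      rw [eLpNorm_const _ (by norm_num) (IsProbabilityMeasure.ne_zero _)]
      simp only [measure_univ, ENNReal.one_rpow, mul_one]
      have h1 := enorm_integral_mul_le (μ := (P : Measure 𝒳)) (fun _ => 1) d
        aestronglyMeasurable_const hd2.1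
      simp only [one_mul] at h1
      refine h1.trans (le_of_eq ?_)
      rw [eLpNorm_const _ (by norm_num) (IsProbabilityMeasure.ne_zero _)]
      simp
    have c1 := (stronglyMeasurable_condExp.mono hm1le).aestronglyMeasurable
      (f := (P : Measure 𝒳)[d | MeasurableSpace.comap Z inferInstance])
      (μ := (P : Measure 𝒳))
    have c2 := (stronglyMeasurable_condExp.mono hm2le).aestronglyMeasurable
      (f := (P : Measure 𝒳)[d | MeasurableSpace.comap (fun x => (A x, Z x)) inferInstance])
      (μ := (P : Measure 𝒳))
    rw [eLpNorm_congr_ae e]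
    calc _ ≤ (eLpNorm d 2 (P : Measure 𝒳) + eLpNorm d 2 (P : Measure 𝒳))
          + (eLpNorm d 2 (P : Measure 𝒳) + eLpNorm d 2 (P : Measure 𝒳)) := by
          refine (eLpNorm_add_le (hd2.1.sub c2) (c1.sub aestronglyMeasurable_const)
            (by norm_num)).trans (add_le_add ?_ ?_)
          · exact (eLpNorm_sub_le hd2.1 c2 (by norm_num)).trans (add_le_add le_rfl n2)
          · exact (eLpNorm_sub_le c1 aestronglyMeasurable_const (by norm_num)).trans
              (add_le_add n1 n3)
      _ = 4 * eLpNorm d 2 (P : Measure 𝒳) := by ring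
      _ < 4 * (δ / 4) := (ENNReal.mul_lt_mul_iff_right (by norm_num) (by norm_num)).2 hgδ
      _ = δ := ENNReal.mul_div_cancel (by norm_num) (by norm_num)

end Tangent

/-! ### Efficient influence functions of the mediation functionals -/

section Assembly

variable {K dV dX : ℕ} {P : ProbabilityMeasure (Obs K dV dX)} {nmax : ℕ}
  {ν : Fin K → Measure ℝ} [∀ k, IsFiniteMeasure (ν k)] {π : ℝ}
  {w : (Fin dV → ℝ) → ℕ → ℝ} {lo hi w₀ : ℝ}

lemma integrable_fun_mul {α : Type*} [MeasurableSpace α] {μ : Measure α} {f g : α → ℝ}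
    (hf : MemLp f 2 μ) (hg : MemLp g 2 μ) : Integrable (fun x => f x * g x) μ :=
  hf.integrable_mul hg

/-- A square-integrable representer of the pathwise derivative whose conditional mean given
`(A, C, N)` depends on `(C, N)` only is, after centring, the efficient influence function. -/
lemma isEIF_of_derivative (hP : P ∈ knownPropensityModel K dV dX π)
    {Ψ : ProbabilityMeasure (Obs K dV dX) → ℝ} {φ H : Obs K dV dX → ℝ}
    (hφ : MemLp φ 2 (P : Measure (Obs K dV dX)))
    (hH : StronglyMeasurable[MeasurableSpace.comap sizeCov inferInstance] H)
    (hHi : Integrable H (P : Measure (Obs K dV dX)))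
    (hc : (P : Measure (Obs K dV dX))[φ | MeasurableSpace.comap (fun o => (trt o, sizeCov o))
      inferInstance] =ᵐ[(P : Measure (Obs K dV dX))] H)
    (hd : ∀ Q S, IsRegularSubmodel (knownPropensityModel K dV dX π) P Q S →
      HasDerivAt (fun ε => Ψ (Q ε)) (∫ o, φ o * S o ∂(P : Measure (Obs K dV dX))) 0)
    {c : ℝ} (hcφ : c = ∫ o, φ o ∂(P : Measure (Obs K dV dX))) :
    IsEIF (knownPropensityModel K dV dX π) Ψ P (fun o => φ o - c) := by
  have hφi := hφ.integrable (q := 2) (by norm_num)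
  have hφc : MemLp (fun o => φ o - c) 2 (P : Measure (Obs K dV dX)) := hφ.sub (memLp_const c)
  have h0 : ∫ o, (φ o - c) ∂(P : Measure (Obs K dV dX)) = 0 := by
    rw [integral_sub hφi (integrable_const c), hcφ]
    simp
  refine ⟨hφc, h0, fun Q S hQ => ?_, fun δ hδ => ?_⟩
  · have h1 := hd Q S hQ
    have e : ∫ o, (φ o - c) * S o ∂(P : Measure (Obs K dV dX))
        = ∫ o, φ o * S o ∂(P : Measure (Obs K dV dX)) := by
      simp only [sub_mul]
      rw [integral_sub (integrable_fun_mul hφ hQ.memLp_score)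
        ((hQ.memLp_score.integrable (by norm_num)).const_mul c), integral_const_mul,
        hQ.integral_score]
      simp
    rw [e]
    exact h1
  · have hm1 : MeasurableSpace.comap (sizeCov : Obs K dV dX → _) inferInstance
        ≤ MeasurableSpace.comap (fun o : Obs K dV dX => (trt o, sizeCov o)) inferInstance := by
      rintro _ ⟨T, hT, rfl⟩
      exact ⟨Set.univ ×ˢ T, MeasurableSet.univ.prod hT, by ext; simp⟩
    have hm2 := (trt_measurable.prodMk sizeCov_measurable :
      Measurable (fun o : Obs K dV dX => (trt o, sizeCov o))).comap_le
    have h1 : (P : Measure (Obs K dV dX))[φ | MeasurableSpace.comap sizeCov inferInstance]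
        =ᵐ[(P : Measure (Obs K dV dX))] H := by
      have h2 := condExp_condExp_of_le (μ := (P : Measure (Obs K dV dX))) (f := φ) hm1 hm2
      refine h2.symm.trans ((condExp_congr_ae hc).trans ?_)
      rw [condExp_of_stronglyMeasurable (hm1.trans hm2) hH hHi]
    obtain ⟨S, hS, hSδ⟩ := exists_score_approx (model := knownPropensityModel K dV dX π)
      trt_measurable sizeCov_measurable hP.2
      (fun Q h2 h3 => ⟨(h3 {1} (measurableSet_singleton 1)).trans hP.1, h2⟩) hφc h0
      (by
        have e1 := condExp_sub (μ := (P : Measure (Obs K dV dX))) hφi (integrable_const c)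
          (MeasurableSpace.comap sizeCov inferInstance)
        have e2 := condExp_sub (μ := (P : Measure (Obs K dV dX))) hφi (integrable_const c)
          (MeasurableSpace.comap (fun o => (trt o, sizeCov o)) inferInstance)
        refine e2.trans (EventuallyEq.trans ?_ e1.symm)
        rw [condExp_const hm2 c, condExp_const (hm1.trans hm2) c]
        filter_upwards [hc, h1] with o h3 h4
        simp only [Pi.sub_apply, h3, h4]) hδ
    exact ⟨S, Submodule.subset_span hS, hSδ⟩

lemma IsEIF.congr_ae {𝒳 : Type*} [MeasurableSpace 𝒳] {model : Set (ProbabilityMeasure 𝒳)}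
    {Ψ : ProbabilityMeasure 𝒳 → ℝ} {P : ProbabilityMeasure 𝒳} {φ φ' : 𝒳 → ℝ}
    (h : IsEIF model Ψ P φ) (he : φ =ᵐ[(P : Measure 𝒳)] φ') : IsEIF model Ψ P φ' where
  memLp := (memLp_congr_ae he).1 h.memLp
  mean_zero := (integral_congr_ae he).symm.trans h.mean_zero
  pathwise_derivative Q S hQ := by
    have e : ∫ o, φ' o * S o ∂(P : Measure 𝒳) = ∫ o, φ o * S o ∂(P : Measure 𝒳) := by
      refine integral_congr_ae ?_
      filter_upwards [he] with o ho
      rw [ho]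
    rw [e]
    exact h.pathwise_derivative Q S hQ
  mem_tangentSpace δ hδ := by
    obtain ⟨g, hg, hgδ⟩ := h.mem_tangentSpace δ hδ
    refine ⟨g, hg, ?_⟩
    have e : (fun o => φ' o - g o) =ᵐ[(P : Measure 𝒳)] fun o => φ o - g o := by
      filter_upwards [he] with o ho
      rw [ho]
    rwa [eLpNorm_congr_ae e]

/-- The conditional mean of `crossPhi` given `(A, C, N)`. -/
noncomputable def crossCov (ν : Fin K → Measure ℝ) (w : (Fin dV → ℝ) → ℕ → ℝ)
    (U : ∀ n, Fin n → Finset (Fin K × Fin n)) (a₁ a₂ a₃ : Fin 2)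
    (P : ProbabilityMeasure (Obs K dV dX)) : Obs K dV dX → ℝ :=
  weightedAvg w fun n j x => crossMean (coordMeasure ν n) (medDensity ν P n)
    (outcomeMean P n j) (U n j)ᶜ (U n j) a₁ a₂ a₃ x.2.1

lemma stronglyMeasurable_comp_sizeCov {h : (Σ n, Cov dV dX n) → ℝ}
    (hh : ∀ n, Measurable fun c => h ⟨n, c⟩) :
    StronglyMeasurable[MeasurableSpace.comap (sizeCov : Obs K dV dX → _) inferInstance]
      (fun o => h (sizeCov o)) :=
  (measurable_sigma_iff.2 hh).stronglyMeasurable.comp_measurable (comap_measurable _)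

namespace IsRegularLaw

variable (U : ∀ n, Fin n → Finset (Fin K × Fin n)) (a₁ a₂ a₃ : Fin 2)

lemma stronglyMeasurable_crossCov (hP : IsRegularLaw ν π w P nmax lo hi w₀) :
    StronglyMeasurable[MeasurableSpace.comap (sizeCov : Obs K dV dX → _) inferInstance]
      (crossCov ν w U a₁ a₂ a₃ P) := by
  set h : (Σ n, Cov dV dX n) → ℝ := fun z => ∑ j, covWeight w z.1 z.2 *
    crossMean (coordMeasure ν z.1) (medDensity ν P z.1) (outcomeMean P z.1 j) (U z.1 j)ᶜ (U z.1 j)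
      a₁ a₂ a₃ z.2 with hh
  have e : crossCov ν w U a₁ a₂ a₃ P = fun o : Obs K dV dX => h (sizeCov o) := by
    funext ⟨n, x⟩
    rw [crossCov, weightedAvg_mk]
    rfl
  rw [e]
  refine stronglyMeasurable_comp_sizeCov (h := h) fun n => ?_
  have h1 : ∀ j : Fin n, Measurable (fun c : Cov dV dX n => covWeight w n c *
      crossMean (coordMeasure ν n) (medDensity ν P n) (outcomeMean P n j) (U n j)ᶜ (U n j)
        a₁ a₂ a₃ c) := fun j => (hP.measurable_covWeight n).mul
    ((hP.isNuisance n j).measurable_crossMean (U n j)ᶜ (U n j) a₁ a₂ a₃)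
  have h2 := Finset.measurable_fun_sum (f := fun (j : Fin n) (c : Cov dV dX n) => covWeight w n c *
    crossMean (coordMeasure ν n) (medDensity ν P n) (outcomeMean P n j) (U n j)ᶜ (U n j)
      a₁ a₂ a₃ c) Finset.univ fun j _ => h1 j
  exact h2

lemma memLp_crossCov (hP : IsRegularLaw ν π w P nmax lo hi w₀) :
    MemLp (crossCov ν w U a₁ a₂ a₃ P) 2 (P : Measure (Obs K dV dX)) :=
  hP.memLp_weightedAvg fun n j => hP.memLp_crossMean_slice U a₁ a₂ a₃ n j

lemma condExp_crossPhi (hP : IsRegularLaw ν π w P nmax lo hi w₀) :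
    (P : Measure (Obs K dV dX))[crossPhi ν π w U a₁ a₂ a₃ P |
      MeasurableSpace.comap (fun o => (trt o, sizeCov o)) inferInstance]
      =ᵐ[(P : Measure (Obs K dV dX))] crossCov ν w U a₁ a₂ a₃ P := by
  have hm1 : MeasurableSpace.comap (sizeCov : Obs K dV dX → _) inferInstance
      ≤ MeasurableSpace.comap (fun o : Obs K dV dX => (trt o, sizeCov o)) inferInstance := by
    rintro _ ⟨T, hT, rfl⟩
    exact ⟨Set.univ ×ˢ T, MeasurableSet.univ.prod hT, by ext; simp⟩
  have hmm : Measurable (fun o : Obs K dV dX => (trt o, sizeCov o)) :=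
    trt_measurable.prodMk sizeCov_measurable
  have hφ := (hP.memLp_crossPhi U a₁ a₂ a₃).integrable (q := 2) (by norm_num)
  have hH := (hP.memLp_crossCov U a₁ a₂ a₃).integrable (q := 2) (by norm_num)
  symm
  refine ae_eq_condExp_of_forall_setIntegral_eq hmm.comap_le hφ (fun s _ _ => hH.integrableOn)
    ?_ ((hP.stronglyMeasurable_crossCov U a₁ a₂ a₃).mono hm1).aestronglyMeasurable
  rintro _ ⟨T, hT, rfl⟩ -
  have hTm : MeasurableSet ((fun o : Obs K dV dX => (trt o, sizeCov o)) ⁻¹' T) := hmm hT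
  rw [eq_comm, ← sub_eq_zero, ← integral_sub hφ.integrableOn hH.integrableOn,
    ← integral_indicator hTm]
  set ψ : ∀ n, Fin 2 → Cov dV dX n → ℝ := fun n a c =>
    T.indicator 1 (a, (⟨n, c⟩ : Σ n, Cov dV dX n)) * covWeight w n c with hψ
  have hψm : ∀ n a, Measurable (ψ n a) := fun n a =>
    ((measurable_one.indicator hT).comp
      (measurable_const.prodMk (measurable_sigmaMk (X := fun n => Cov dV dX n) n))).mul
      (hP.measurable_covWeight n)
  have hψb : ∀ n a, ∀ᵐ c ∂(covLaw (slice P n)), |ψ n a c| ≤ w₀ := by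
    intro n a
    filter_upwards [hP.abs_covWeight_le n] with c hc
    by_cases h : (a, (⟨n, c⟩ : Σ n, Cov dV dX n)) ∈ T
    · simpa [hψ, h] using hc
    · simpa [hψ, h] using hP.bound_nonneg
  set d : ∀ (n : ℕ) (j : Fin n), ObsN K dV dX n → ℝ := fun n j x =>
    crossIF (coordMeasure ν n) π (medDensity ν P n) (outcomeMean P n j) (fun y => y j)
      (U n j)ᶜ (U n j) a₁ a₂ a₃ x
    - crossMean (coordMeasure ν n) (medDensity ν P n) (outcomeMean P n j) (U n j)ᶜ (U n j)
      a₁ a₂ a₃ x.2.1 with hd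
  have e : ∀ n (x : ObsN K dV dX n), ((fun o : Obs K dV dX => (trt o, sizeCov o)) ⁻¹' T).indicator
      (fun o => crossPhi ν π w U a₁ a₂ a₃ P o - crossCov ν w U a₁ a₂ a₃ P o) ⟨n, x⟩
      = ∑ j, ψ n x.1 x.2.1 * d n j x := by
    intro n x
    rw [crossPhi, crossCov]
    by_cases h : (x.1, (⟨n, x.2.1⟩ : Σ n, Cov dV dX n)) ∈ T
    · have h' : (⟨n, x⟩ : Obs K dV dX) ∈ (fun o : Obs K dV dX => (trt o, sizeCov o)) ⁻¹' T := h
      rw [Set.indicator_of_mem h', weightedAvg_mk,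
        weightedAvg_mk, ← Finset.sum_sub_distrib]
      refine Finset.sum_congr rfl fun j _ => ?_
      simp only [hψ, hd, Set.indicator_of_mem h, Pi.one_apply]
      ring
    · have h' : (⟨n, x⟩ : Obs K dV dX) ∉ (fun o : Obs K dV dX => (trt o, sizeCov o)) ⁻¹' T := h
      rw [Set.indicator_of_notMem h']
      symm
      refine Finset.sum_eq_zero fun j _ => ?_
      simp only [hψ, Set.indicator_of_notMem h, zero_mul]
  have hdi : ∀ n j, Integrable (fun x : ObsN K dV dX n => ψ n x.1 x.2.1 * d n j x)
      (slice P n) := by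
    intro n j
    have h1 : Integrable (d n j) (slice P n) :=
      (((hP.isNuisance n j).memLp_crossIF _ _ _ _ _).sub
        (hP.memLp_crossMean_slice U a₁ a₂ a₃ n j)).integrable (q := 2) (by norm_num)
    have h2 : Measurable (fun z : Fin 2 × Cov dV dX n => ψ n z.1 z.2) :=
      measurable_from_prod_countable_right (hψm n)
    refine h1.bdd_mul (c := w₀) (h2.comp (by fun_prop : Measurable fun x : ObsN K dV dX n =>
      (x.1, x.2.1))).aestronglyMeasurable ?_
    filter_upwards [ae_of_covLaw (ae_all_iff.2 fun a => hψb n a)] with x hx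
    exact hx x.1
  rw [integral_obs hP.size_le]
  · refine Finset.sum_eq_zero fun n _ => ?_
    simp only [e]
    rw [integral_finsetSum _ fun j _ => hdi n j]
    exact Finset.sum_eq_zero fun j _ =>
      (hP.isNuisance n j).integral_mul_crossIF_sub (U n j)ᶜ (U n j) a₁ a₂ a₃ (hψm n) (hψb n)
  · intro n
    simp only [e]
    exact integrable_finsetSum _ fun j _ => hdi n j

lemma stronglyMeasurable_weight (hP : IsRegularLaw ν π w P nmax lo hi w₀) :
    StronglyMeasurable[MeasurableSpace.comap (sizeCov : Obs K dV dX → _) inferInstance]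
      (weight w : Obs K dV dX → ℝ) :=
  stronglyMeasurable_comp_sizeCov (h := fun z : Σ n, Cov dV dX n => w z.2.1 z.1)
    fun n => (hP.measurable_weight n).comp measurable_fst

lemma memLp_weight (hP : IsRegularLaw ν π w P nmax lo hi w₀) :
    MemLp (weight w) 2 (P : Measure (Obs K dV dX)) :=
  MemLp.of_bound ((hP.stronglyMeasurable_weight).mono
    sizeCov_measurable.comap_le).aestronglyMeasurable w₀ hP.abs_weight_le

/-- The efficient influence functions of a functional that agrees with `crossPsi` on regular laws,
and of its quotient by the mean weight. -/
theorem isEIF (hP : IsRegularLaw ν π w P nmax lo hi w₀) (hw : meanWeight w P ≠ 0)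
    {Ψ : ProbabilityMeasure (Obs K dV dX) → ℝ} {φ : Obs K dV dX → ℝ}
    (hΨ : ∀ Q lo hi, IsRegularLaw ν π w Q nmax lo hi w₀ → Ψ Q = crossPsi ν w U a₁ a₂ a₃ Q)
    (hφ : φ =ᵐ[(P : Measure (Obs K dV dX))] crossPhi ν π w U a₁ a₂ a₃ P) {θ : ℝ}
    (hθ : θ = Ψ P / meanWeight w P) :
    IsEIF (knownPropensityModel K dV dX π) (fun Q => Ψ Q / meanWeight w Q) P
        (fun o => (meanWeight w P)⁻¹ * (φ o - θ * weight w o)) ∧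
      IsEIF (knownPropensityModel K dV dX π) Ψ P (fun o => φ o - meanWeight w P * θ) := by
  have hm1 : MeasurableSpace.comap (sizeCov : Obs K dV dX → _) inferInstance
      ≤ MeasurableSpace.comap (fun o : Obs K dV dX => (trt o, sizeCov o)) inferInstance := by
    rintro _ ⟨T, hT, rfl⟩
    exact ⟨Set.univ ×ˢ T, MeasurableSet.univ.prod hT, by ext; simp⟩
  have hmm : Measurable (fun o : Obs K dV dX => (trt o, sizeCov o)) :=
    trt_measurable.prodMk sizeCov_measurable
  have hφ2 := hP.memLp_crossPhi U a₁ a₂ a₃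
  have hφi := hφ2.integrable (q := 2) (by norm_num)
  have hH2 := hP.memLp_crossCov U a₁ a₂ a₃
  have hHi := hH2.integrable (q := 2) (by norm_num)
  have hHm := hP.stronglyMeasurable_crossCov U a₁ a₂ a₃
  have hWm := hP.stronglyMeasurable_weight
  have hW2 := hP.memLp_weight
  have hWi := hW2.integrable (q := 2) (by norm_num)
  have hint := hP.integral_crossPhi U a₁ a₂ a₃
  have hΨP := hΨ P lo hi hP
  have hθ' : meanWeight w P * θ = crossPsi ν w U a₁ a₂ a₃ P := by
    rw [hθ, hΨP]
    field_simp
  -- the derivative of the unnormalised functional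
  have hder : ∀ Q S, IsRegularSubmodel (knownPropensityModel K dV dX π) P Q S →
      HasDerivAt (fun ε => Ψ (Q ε))
        (∫ o, crossPhi ν π w U a₁ a₂ a₃ P o * S o ∂(P : Measure (Obs K dV dX))) 0 := by
    intro Q S hQ
    refine (hP.hasDerivAt_crossPsi U a₁ a₂ a₃ hQ).congr_of_eventuallyEq ?_
    obtain ⟨p, b, hb1, -, hp, -⟩ := hQ.exists_perturbation
    filter_upwards [hp, hQ.mem_model] with ε h1 h2
    exact hΨ _ _ _ (hP.perturb h2 h1 hb1)
  constructor
  · have h1 := isEIF_of_derivative (Ψ := fun Q => Ψ Q / meanWeight w Q) hP.mem_model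
      (φ := fun o => (meanWeight w P)⁻¹ * (crossPhi ν π w U a₁ a₂ a₃ P o - θ * weight w o))
      (H := fun o => (meanWeight w P)⁻¹ * (crossCov ν w U a₁ a₂ a₃ P o - θ * weight w o))
      ((hφ2.sub (hW2.const_mul θ)).const_mul _)
      ((hHm.sub (hWm.const_mul θ)).const_mul _)
      ((hHi.sub (hWi.const_mul θ)).const_mul _) ?_ ?_ (c := 0) ?_
    · simp only [sub_zero] at h1
      refine h1.congr_ae ?_
      filter_upwards [hφ] with o ho
      rw [ho]
    · have e1 := condExp_smul (μ := (P : Measure (Obs K dV dX))) (meanWeight w P)⁻¹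
        (crossPhi ν π w U a₁ a₂ a₃ P - fun o => θ * weight w o)
        (MeasurableSpace.comap (fun o => (trt o, sizeCov o)) inferInstance)
      have e2 := condExp_sub (μ := (P : Measure (Obs K dV dX))) hφi (hWi.const_mul θ)
        (MeasurableSpace.comap (fun o => (trt o, sizeCov o)) inferInstance)
      have e3 := condExp_of_stronglyMeasurable (μ := (P : Measure (Obs K dV dX))) hmm.comap_le
        ((hWm.const_mul θ).mono hm1) (hWi.const_mul θ)
      have e4 := hP.condExp_crossPhi U a₁ a₂ a₃
      refine EventuallyEq.trans (Eventually.of_forall fun o => rfl) (e1.trans ?_)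
      filter_upwards [e2, e4] with o h2 h4
      simp only [Pi.smul_apply, Pi.sub_apply, smul_eq_mul] at h2 ⊢
      rw [h2, e3, h4]
    · intro Q S hQ
      have d1 := hder Q S hQ
      have d2 : HasDerivAt (fun ε => meanWeight w (Q ε))
          (∫ o, weight w o * S o ∂(P : Measure (Obs K dV dX))) 0 := hQ.hasDerivAt_integral hW2
      have d3 := d1.div d2 (by rw [hQ.at_zero]; exact hw)
      rw [hQ.at_zero, hΨP] at d3
      refine d3.congr_deriv ?_
      have e1 : ∀ o, (meanWeight w P)⁻¹ * (crossPhi ν π w U a₁ a₂ a₃ P o - θ * weight w o) * S o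
          = (meanWeight w P)⁻¹ * (crossPhi ν π w U a₁ a₂ a₃ P o * S o)
            - (meanWeight w P)⁻¹ * θ * (weight w o * S o) := fun o => by ring
      simp only [e1]
      rw [integral_sub ((integrable_fun_mul hφ2 hQ.memLp_score).const_mul _)
        ((integrable_fun_mul hW2 hQ.memLp_score).const_mul _), integral_const_mul, integral_const_mul,
        ← hθ']
      field_simp
    · rw [integral_const_mul, integral_sub hφi (hWi.const_mul θ), integral_const_mul, hint, ← hθ']
      change 0 = (meanWeight w P)⁻¹ * (meanWeight w P * θ - θ * meanWeight w P)
      ring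
  · refine (isEIF_of_derivative hP.mem_model hφ2 hHm hHi (hP.condExp_crossPhi U a₁ a₂ a₃) hder
      (hθ'.trans hint.symm)).congr_ae ?_
    filter_upwards [hφ] with o ho
    rw [ho]

end IsRegularLaw

end Assembly

/-! ### Regularity of the observed-data law of a super-population -/

lemma measurable_weight {K dV dX : ℕ} {w : (Fin dV → ℝ) → ℕ → ℝ}
    (hw : ∀ n, Measurable fun v => w v n) : Measurable (weight w : Obs K dV dX → ℝ) :=
  measurable_sigma_iff.2 fun n =>
    (hw n).comp (measurable_fst.comp (measurable_fst.comp measurable_snd))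

namespace FullData

variable {Ω : Type*} [mΩ : MeasurableSpace Ω] {𝒰 : Type*} [MeasurableSpace 𝒰] {K dV dX : ℕ}
  {D : FullData Ω 𝒰 K dV dX} {μ : Measure Ω} [IsProbabilityMeasure μ]
  {ν : Fin K → Measure ℝ} {π : ℝ} {w : (Fin dV → ℝ) → ℕ → ℝ} {n : ℕ}

lemma measurable_C (D : FullData Ω 𝒰 K dV dX) (n : ℕ) : Measurable (D.C n) :=
  D.measurable_V.prodMk (D.measurable_X n)

lemma measurableSet_size (D : FullData Ω 𝒰 K dV dX) (n : ℕ) : MeasurableSet (D.N ⁻¹' {n}) :=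
  D.measurable_N (measurableSet_singleton n)

lemma Mmix_univ (D : FullData Ω 𝒰 K dV dX) (n : ℕ) (ω : Ω) :
    D.Mmix n Finset.univ ω = D.Mpot n 0 ω := by
  funext t; simp [Mmix, mergeMed]

lemma Mmix_empty (D : FullData Ω 𝒰 K dV dX) (n : ℕ) (ω : Ω) :
    D.Mmix n ∅ ω = D.Mpot n 1 ω := by
  funext t; simp [Mmix, mergeMed]

lemma restrict_eq_smul_cond (μ : Measure Ω) [IsProbabilityMeasure μ] (D : FullData Ω 𝒰 K dV dX)
    (n : ℕ) : μ.restrict (D.N ⁻¹' {n}) = μ (D.N ⁻¹' {n}) • μ[|D.N ⁻¹' {n}] := by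
  rcases eq_or_ne (μ (D.N ⁻¹' {n})) 0 with h | h
  · rw [h, zero_smul, Measure.restrict_eq_zero.2 h]
  · rw [ProbabilityTheory.cond, smul_smul, ENNReal.mul_inv_cancel h (measure_ne_top _ _), one_smul]

lemma slice_obsLaw (D : FullData Ω 𝒰 K dV dX) (μ : Measure Ω) [IsProbabilityMeasure μ] (n : ℕ) :
    slice (D.obsLaw μ) n = μ (D.N ⁻¹' {n}) • (μ[|D.N ⁻¹' {n}]).map (D.obsN n) := by
  rw [← Measure.map_smul, ← restrict_eq_smul_cond]
  ext S hS
  have hS' := measurableSet_image_sigmaMk (X := fun n => ObsN K dV dX n) n hS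
  rw [slice_apply, Measure.map_apply (D.measurable_obsN n) hS,
    Measure.restrict_apply (D.measurable_obsN n hS)]
  change (μ.map D.obs) _ = _
  rw [Measure.map_apply D.measurable_obs hS']
  congr 1
  ext ω
  simp only [Set.mem_preimage, Set.mem_image, Set.mem_inter_iff, Set.mem_singleton_iff]
  constructor
  · rintro ⟨y, hy, he⟩
    obtain rfl : n = D.N ω := congrArg Sigma.fst he
    have := sigma_mk_injective he
    subst this
    exact ⟨hy, rfl⟩
  · rintro ⟨hy, rfl⟩
    exact ⟨_, hy, rfl⟩

lemma slice_obsLaw_ne_zero (h : slice (D.obsLaw μ) n ≠ 0) : μ (D.N ⁻¹' {n}) ≠ 0 := by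
  intro h0
  rw [slice_obsLaw, h0, zero_smul] at h
  exact h rfl

lemma isProbabilityMeasure_size (h : μ (D.N ⁻¹' {n}) ≠ 0) :
    IsProbabilityMeasure (μ[|D.N ⁻¹' {n}]) := cond_isProbabilityMeasure h

lemma meanWeight_obsLaw (D : FullData Ω 𝒰 K dV dX) (hw : ∀ n, Measurable fun v => w v n) :
    meanWeight w (D.obsLaw μ) = D.meanW μ w := by
  change ∫ o, weight w o ∂(μ.map D.obs) = _
  rw [integral_map D.measurable_obs.aemeasurable (measurable_weight hw).aestronglyMeasurable]
  rfl

lemma exists_size (D : FullData Ω 𝒰 K dV dX) (μ : Measure Ω) [IsProbabilityMeasure μ] :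
    ∃ n, μ (D.N ⁻¹' {n}) ≠ 0 := by
  by_contra! hn
  have h1 : ∀ᵐ ω ∂μ, ∀ n, D.N ω ≠ n := ae_all_iff.2 fun n => measure_eq_zero_iff_ae_notMem.1 (hn n)
  obtain ⟨ω, hω⟩ := h1.exists
  exact hω _ rfl

namespace SuperPopulation

lemma size_pos (h : D.SuperPopulation μ ν π) (hn : μ (D.N ⁻¹' {n}) ≠ 0) : 1 ≤ n := by
  obtain ⟨nmax, hs⟩ := h.size_bounded
  by_contra hlt
  refine hn (measure_mono_null (fun ω (hω : D.N ω = n) => ?_) (ae_iff.1 hs))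
  simp only [Set.mem_ofPred_eq]
  omega

/-- A density bounded away from zero forces the reference measures to be finite. -/
lemma isFiniteMeasure_ref [∀ k, SigmaFinite (ν k)] (h : D.SuperPopulation μ ν π) (k : Fin K) :
    IsFiniteMeasure (ν k) := by
  obtain ⟨n, hn⟩ := D.exists_size μ
  have h1 := h.size_pos hn
  obtain ⟨fmin, hf0, hf⟩ := h.density_lower
  have : IsProbabilityMeasure (μ[|D.N ⁻¹' {n}]) := isProbabilityMeasure_size hn
  have hs : slice (D.obsLaw μ) n Set.univ = μ (D.N ⁻¹' {n}) := by
    rw [slice_obsLaw, Measure.smul_apply, Measure.map_apply (D.measurable_obsN n) MeasurableSet.univ]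
    simp
  have hj : jointLaw (D.obsLaw μ) n Set.univ = μ (D.N ⁻¹' {n}) := by
    rw [jointLaw, Measure.map_apply (by fun_prop) MeasurableSet.univ, Set.preimage_univ, hs]
  have hb : baseMeasure ν (D.obsLaw μ) n Set.univ
      = μ (D.N ⁻¹' {n}) * ∏ t : Fin K × Fin n, ν t.1 Set.univ := by
    have : SigmaFinite (refMeasure ν n) := by unfold refMeasure; infer_instance
    rw [baseMeasure, ← Set.univ_prod_univ, Measure.prod_prod,
      Measure.map_apply (by fun_prop) MeasurableSet.univ, Set.preimage_univ, hs, refMeasure,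
      Measure.pi_univ]
  have hle : ENNReal.ofReal fmin • baseMeasure ν (D.obsLaw μ) n ≤ jointLaw (D.obsLaw μ) n := by
    rw [← withDensity_const]
    exact (withDensity_mono (hf n)).trans (Measure.withDensity_rnDeriv_le _ _)
  have h2 : ENNReal.ofReal fmin * baseMeasure ν (D.obsLaw μ) n Set.univ ≠ ∞ := by
    refine ((Measure.le_iff.1 hle Set.univ MeasurableSet.univ).trans_lt ?_).ne
    rw [hj]
    exact measure_lt_top _ _
  have h3 : baseMeasure ν (D.obsLaw μ) n Set.univ ≠ 0 := fun h0 => by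
    have := h.has_density n h0
    exact hn (hj ▸ this)
  rw [hb] at h2 h3
  have h4 := right_ne_zero_of_mul h3
  have h5 : ∏ t : Fin K × Fin n, ν t.1 Set.univ ≠ ∞ := fun ht => h2 <| by
    rw [ht, ENNReal.mul_top hn, ENNReal.mul_top (by simpa using hf0)]
  refine ⟨lt_top_iff_ne_top.2 fun ht => h5 ?_⟩
  rw [← Finset.mul_prod_erase _ _ (Finset.mem_univ ((k, ⟨0, h1⟩) : Fin K × Fin n))]
  simp only [ht]
  exact ENNReal.top_mul (Finset.prod_ne_zero_iff.2 fun t _ =>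
    Finset.prod_ne_zero_iff.1 h4 t (Finset.mem_univ t))

lemma cond_trt (h : D.SuperPopulation μ ν π) (hn : μ (D.N ⁻¹' {n}) ≠ 0) (S : Set (Fin 2)) :
    μ[|D.N ⁻¹' {n}] (D.A ⁻¹' S) = μ (D.A ⁻¹' S) := by
  have h1 := (indepFun_iff_measure_inter_preimage_eq_mul.1 h.treatment_indep_size) S {n}
    S.toFinite.measurableSet (measurableSet_singleton n)
  rw [cond_apply (D.measurableSet_size n), Set.inter_comm, h1, mul_comm, mul_assoc,
    ENNReal.mul_inv_cancel hn (measure_ne_top _ _), mul_one]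

lemma indepFun_trt_cov (h : D.SuperPopulation μ ν π) (n : ℕ) :
    IndepFun D.A (D.C n) (μ[|D.N ⁻¹' {n}]) := by
  rcases eq_or_ne (μ (D.N ⁻¹' {n})) 0 with hn | hn
  · rw [cond_eq_zero_of_meas_eq_zero hn]
    simp [indepFun_iff_measure_inter_preimage_eq_mul]
  · exact (h.randomization n ⟨0, h.size_pos hn⟩ 0).comp measurable_id measurable_fst

lemma mem_model (h : D.SuperPopulation μ ν π) : D.obsLaw μ ∈ knownPropensityModel K dV dX π := by
  refine ⟨?_, ?_⟩
  · change (μ.map D.obs) _ = _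
    have h1 : MeasurableSet ({o | trt o = 1} : Set (Obs K dV dX)) :=
      trt_measurable (measurableSet_singleton 1)
    rw [Measure.map_apply D.measurable_obs h1]
    exact h.treatment_prob
  · refine indepFun_iff_measure_inter_preimage_eq_mul.2 fun S T hS hT => ?_
    change (μ.map D.obs) _ = (μ.map D.obs) _ * (μ.map D.obs) _
    have hT' := sizeCov_measurable (K := K) hT
    rw [Measure.map_apply D.measurable_obs ((trt_measurable hS).inter hT'),
      Measure.map_apply D.measurable_obs (trt_measurable hS), Measure.map_apply D.measurable_obs hT']
    have split : ∀ E : Set Ω, MeasurableSet E → μ E = ∑' n, μ (D.N ⁻¹' {n} ∩ E) := by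
      intro E hE
      rw [← measure_iUnion]
      · congr 1
        ext ω
        simp
      · intro i j hij
        exact Set.disjoint_left.2 fun ω hi hj => hij (hi.1.symm.trans hj.1)
      · exact fun n => (D.measurableSet_size n).inter hE
    rw [Set.preimage_inter, split _ ((D.measurable_obs (trt_measurable hS)).inter
      (D.measurable_obs hT')), split _ (D.measurable_obs hT'), ← ENNReal.tsum_mul_left]
    refine tsum_congr fun n => ?_
    rcases eq_or_ne (μ (D.N ⁻¹' {n})) 0 with hn | hn
    · rw [measure_inter_null_of_null_left _ hn, measure_inter_null_of_null_left _ hn, mul_zero]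
    · have hTn := measurableSet_sigma.1 hT n
      have h1 := (indepFun_iff_measure_inter_preimage_eq_mul.1 (h.indepFun_trt_cov n)) S _ hS hTn
      rw [h.cond_trt hn, cond_apply (D.measurableSet_size n), cond_apply (D.measurableSet_size n)]
        at h1
      have h2 : D.N ⁻¹' {n} ∩ (D.obs ⁻¹' (trt ⁻¹' S) ∩ D.obs ⁻¹' (sizeCov ⁻¹' T))
          = D.N ⁻¹' {n} ∩ (D.A ⁻¹' S ∩ D.C n ⁻¹' (Sigma.mk n ⁻¹' T)) := by
        ext ω
        refine and_congr_right ?_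
        rintro rfl
        rfl
      have h3 : D.N ⁻¹' {n} ∩ (D.obs ⁻¹' (sizeCov ⁻¹' T))
          = D.N ⁻¹' {n} ∩ (D.C n ⁻¹' (Sigma.mk n ⁻¹' T)) := by
        ext ω
        refine and_congr_right ?_
        rintro rfl
        rfl
      rw [h2, h3]
      change _ = μ (D.A ⁻¹' S) * _
      rw [mul_left_comm] at h1
      exact (ENNReal.mul_right_inj (ENNReal.inv_ne_zero.2 (measure_ne_top _ _))
        (ENNReal.inv_ne_top.2 hn)).1 h1

lemma memLp_potential (h : D.SuperPopulation μ ν π) (j : Fin n) (a : Fin 2) :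
    MemLp (fun ω => D.Y n j a (D.Mpot n a ω) ω) 2 (μ[|D.N ⁻¹' {n}]) := by
  rcases Fin.exists_fin_two.1 ⟨a, rfl⟩ with rfl | rfl
  · simpa only [Mmix_univ] using h.second_moments n j 0 Finset.univ
  · simpa only [Mmix_empty] using h.second_moments n j 1 ∅

lemma memLp_outcome (h : D.SuperPopulation μ ν π) (j : Fin n) :
    MemLp (fun x : ObsN K dV dX n => x.2.2.2 j) 2 (slice (D.obsLaw μ) n) := by
  rw [slice_obsLaw]
  refine MemLp.smul_measure ?_ (measure_ne_top _ _)
  refine (memLp_map_measure_iff (by fun_prop) (D.measurable_obsN n).aemeasurable).2 ?_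
  have h1 : ∀ a, MemLp (fun ω => (D.A ⁻¹' {a}).indicator
      (fun ω => D.Y n j a (D.Mpot n a ω) ω) ω) 2 (μ[|D.N ⁻¹' {n}]) := fun a =>
    (h.memLp_potential j a).indicator (D.measurable_A (measurableSet_singleton a))
  refine (memLp_congr_ae (Eventually.of_forall fun ω => ?_)).1
    (memLp_finsetSum Finset.univ fun a _ => h1 a)
  simp only [Function.comp, obsN]
  rw [Finset.sum_eq_single (D.A ω)]
  · exact Set.indicator_of_mem (s := D.A ⁻¹' {D.A ω}) rfl _
  · intro a _ ha
    exact Set.indicator_of_notMem (s := D.A ⁻¹' {a}) (fun h => ha h.symm) _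
  · exact fun h => absurd (Finset.mem_univ _) h

lemma exists_isRegularLaw [∀ k, IsFiniteMeasure (ν k)] (h : D.SuperPopulation μ ν π)
    (hreg : D.Regularity μ ν w) (hπ0 : 0 < π) (hπ1 : π < 1) :
    ∃ nmax lo hi w₀, IsRegularLaw ν π w (D.obsLaw μ) nmax lo hi w₀ := by
  obtain ⟨nmax, hs⟩ := h.size_bounded
  obtain ⟨lo, hlo, hl⟩ := h.density_lower
  obtain ⟨hi, hh⟩ := hreg.density_upper
  obtain ⟨w₀, hw⟩ := hreg.weight_bounded
  refine ⟨nmax, lo, max hi lo, w₀, ?_⟩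
  exact
  { propensity_pos := hπ0
    propensity_lt_one := hπ1
    mem_model := h.mem_model
    size_pos := fun n hn => h.size_pos (slice_obsLaw_ne_zero hn)
    size_le := fun n hn => by
      by_contra hlt
      refine slice_obsLaw_ne_zero hn
        (measure_mono_null (fun ω (hω : D.N ω = n) => ?_) (ae_iff.1 hs))
      simp only [Set.mem_ofPred_eq]
      omega
    lo_pos := hlo
    lo_le_hi := le_max_right _ _
    lower := fun n => smul_baseMeasure_le (hl n)
    upper := fun n => jointLaw_le_smul (h.has_density n) <| by
      filter_upwards [hh n] with z hz
      exact hz.trans (ENNReal.ofReal_le_ofReal (le_max_left _ _))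
    memLp_outcome := fun n j => h.memLp_outcome j
    measurable_weight := hreg.weight_measurable
    abs_weight_le := by
      change ∀ᵐ o ∂(μ.map D.obs), _
      exact (ae_map_iff D.measurable_obs.aemeasurable (measurableSet_le
        (measurable_weight hreg.weight_measurable).abs measurable_const)).2 hw }

end SuperPopulation

end FullData

/-! ### The mediation functionals as instances of the generic functional -/

section Links

variable {ι : Type*} [Fintype ι] [DecidableEq ι] (ν : ι → Measure ℝ) [∀ i, SigmaFinite (ν i)]

lemma marginal_empty (h : (ι → ℝ) → ℝ) (m : ι → ℝ) : marginal ν ∅ h m = h m := by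
  rw [marginal, Measure.pi_of_empty, integral_dirac]
  simp

lemma marginal_univ (h : (ι → ℝ) → ℝ) (m : ι → ℝ) :
    marginal ν Finset.univ h m = ∫ x, h x ∂(Measure.pi ν) := by
  let e : { j // j ∈ Finset.univ } ≃ ι := Equiv.subtypeUnivEquiv Finset.mem_univ
  have hp := measurePreserving_piCongrLeft ν e
  rw [← hp.integral_comp (MeasurableEquiv.measurableEmbedding _)]
  refine integral_congr_ae (Eventually.of_forall fun y => ?_)
  simp only
  congr 1
  funext i
  simp only [Function.updateFinset, Finset.mem_univ, dif_pos, MeasurableEquiv.coe_piCongrLeft]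
  exact (Equiv.piCongrLeft_apply_apply (fun _ => ℝ) e y ⟨i, Finset.mem_univ i⟩).symm

lemma subMass_univ (f : (ι → ℝ) → ℝ≥0∞) (m : ι → ℝ) :
    subMass ν Finset.univ f m = (∫⁻ x, f x ∂(Measure.pi ν)).toReal := by
  rw [subMass, lmarginal_univ]

variable {K dV dX : ℕ} {P : ProbabilityMeasure (Obs K dV dX)} {n nmax : ℕ}
  {ν : Fin K → Measure ℝ} {π : ℝ} {w : (Fin dV → ℝ) → ℕ → ℝ}

lemma lam1_eq_crossMean (j : Fin n) (U : Finset (Fin K × Fin n)) (a₁ a₂ a₃ : Fin 2)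
    (c : Cov dV dX n) : lam1 ν P n j U a₁ a₂ a₃ c
      = crossMean (coordMeasure ν n) (medDensity ν P n) (outcomeMean P n j) Uᶜ U a₁ a₂ a₃ c := by
  simp only [lam1, crossMean, subDensity, subMass, compl_compl]
  rfl

lemma lam1_compl_eq_crossMean (j : Fin n) (U : Finset (Fin K × Fin n)) (a₁ a₂ a₃ : Fin 2)
    (c : Cov dV dX n) : lam1 ν P n j Uᶜ a₁ a₃ a₂ c
      = crossMean (coordMeasure ν n) (medDensity ν P n) (outcomeMean P n j) Uᶜ U a₁ a₂ a₃ c := by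
  rw [lam1_eq_crossMean, compl_compl, crossMean_swap]

lemma lam2_eq_marginal (j : Fin n) (U : Finset (Fin K × Fin n)) (a : Fin 2) (m : Med K n)
    (c : Cov dV dX n) : lam2 ν P n j U a m c = marginal (coordMeasure ν n) U
      (fun m => outcomeMean P n j 1 m c * subMass (coordMeasure ν n) Uᶜ (medDensity ν P n a c) m)
      m := rfl

lemma lam3_eq_subMass (U : Finset (Fin K × Fin n)) (a₁ a₂ a₃ : Fin 2) (m : Med K n)
    (c : Cov dV dX n) : lam3 ν P n U a₁ a₂ a₃ m c
      = subMass (coordMeasure ν n) Uᶜ (medDensity ν P n a₁ c) m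
        * subMass (coordMeasure ν n) U (medDensity ν P n a₂ c) m
        / (medDensity ν P n a₃ c m).toReal := by
  simp only [lam3, subDensity, subMass, compl_compl]

lemma psiII_eq_crossPsi (J : Finset (Fin K)) :
    psiII ν w J P = crossPsi ν w (fun n _ => blockSet J n) 1 0 1 P := by
  simp only [psiII, crossPsi, lam1_eq_crossMean]

lemma psiIII_eq_crossPsi (k : Fin K) (J : Finset (Fin K)) :
    psiIII ν w k J P = crossPsi ν w (fun n j => spillSet k J n j) 1 0 1 P := by
  simp only [psiIII, crossPsi, lam1_compl_eq_crossMean]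

lemma phiII_eq_crossPhi (J : Finset (Fin K)) :
    phiII ν π w P J = crossPhi ν π w (fun n _ => blockSet J n) 1 0 1 P := by
  unfold phiII crossPhi
  congr 1
  funext n j x
  simp only [lam1_eq_crossMean, lam2_eq_marginal, lam3_eq_subMass, crossIF, Fin.sum_univ_two,
    compl_compl]
  ring

lemma phiIII_eq_crossPhi (k : Fin K) (J : Finset (Fin K)) :
    phiIII ν π w P k J = crossPhi ν π w (fun n j => spillSet k J n j) 1 0 1 P := by
  unfold phiIII crossPhi
  congr 1
  funext n j x
  simp only [lam1_compl_eq_crossMean, lam2_eq_marginal, lam3_eq_subMass, crossIF, Fin.sum_univ_two,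
    compl_compl]
  ring

variable [∀ k, IsFiniteMeasure (ν k)]

lemma crossMean_univ {j : Fin n} {aS a' a₃ : Fin 2} {c : Cov dV dX n}
    (hc : ∫⁻ m, medDensity ν P n a₃ c m ∂(Measure.pi (coordMeasure ν n)) = 1) :
    crossMean (coordMeasure ν n) (medDensity ν P n) (outcomeMean P n j) Finset.univᶜ Finset.univ
      aS a' a₃ c = etaStar ν P n j aS a' c := by
  simp only [crossMean, Finset.compl_univ, subMass_empty, subMass_univ, hc, ENNReal.toReal_one,
    mul_one]
  rfl

variable {lo hi w₀ : ℝ}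

lemma ae_lintegral_medDensity (hP : IsRegularLaw ν π w P nmax lo hi w₀) (n : ℕ) (a : Fin 2) :
    ∀ᵐ x ∂(slice P n),
      ∫⁻ m, medDensity ν P n a x.2.1 m ∂(Measure.pi (coordMeasure ν n)) = 1 :=
  ae_of_covLaw (lintegral_medDensity hP.propensity_pos hP.propensity_lt_one hP.mem_model
    (Measure.absolutelyContinuous_of_le_smul (hP.upper n)) a)

lemma weightedAvg_congr_ae {g g' : ∀ n : ℕ, Fin n → ObsN K dV dX n → ℝ}
    (h : ∀ n, ∀ᵐ x ∂(slice P n), ∀ j, g n j x = g' n j x) :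
    weightedAvg w g =ᵐ[(P : Measure (Obs K dV dX))] weightedAvg w g' := by
  refine ae_of_ae_slice fun n => ?_
  filter_upwards [h n] with x hx
  simp only [weightedAvg_mk, hx]

lemma psiI_eq_crossPsi (hP : IsRegularLaw ν π w P nmax lo hi w₀) (aS a' : Fin 2) :
    psiI ν w aS a' P = crossPsi ν w (fun _ _ => Finset.univ) aS a' a' P := by
  refine integral_congr_ae (weightedAvg_congr_ae fun n => ?_)
  filter_upwards [ae_lintegral_medDensity hP n a'] with x hx j
  exact (crossMean_univ hx).symm

lemma phiI_ae_eq_crossPhi (hP : IsRegularLaw ν π w P nmax lo hi w₀) (aS a' : Fin 2) :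
    phiI ν π w P aS a' =ᵐ[(P : Measure (Obs K dV dX))]
      crossPhi ν π w (fun _ _ => Finset.univ) aS a' a' P := by
  refine weightedAvg_congr_ae fun n => ?_
  filter_upwards [ae_lintegral_medDensity hP n a'] with x hx j
  have e : crossMean (coordMeasure ν n) (medDensity ν P n) (outcomeMean P n j) ∅ Finset.univ
      aS a' a' x.2.1 = etaStar ν P n j aS a' x.2.1 := by
    rw [← crossMean_univ hx, Finset.compl_univ]
  simp only [crossIF, Finset.compl_univ, e, subMass_empty, subMass_univ, marginal_empty,
    marginal_univ, hx, ENNReal.toReal_one, mul_one]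
  change _ = _ + _ + armWeight π a' x.1 * (etaStar ν P n j aS a' x.2.1 - _) + _
  ring

end Links

/-! ### Conditional independence through regular conditional probabilities -/

section Conditional

variable {Ω 𝒵 𝒞 𝒳 𝒰 𝒜 : Type*} [mΩ : MeasurableSpace Ω] [StandardBorelSpace Ω] [Nonempty Ω]
  [MeasurableSpace 𝒵] [MeasurableSpace 𝒞] [MeasurableSpace 𝒳] [MeasurableSpace 𝒰]
  [MeasurableSpace 𝒜] {μ : Measure Ω} [IsFiniteMeasure μ] {Z : Ω → 𝒵} {C : Ω → 𝒞} {X : Ω → 𝒳}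
  {Y : Ω → 𝒰} {A : Ω → 𝒜}

/-- Disintegration along `Z`. -/
lemma lintegral_comp_condDistrib_id (hZ : Measurable Z) {F : 𝒵 × Ω → ℝ≥0∞} (hF : Measurable F) :
    ∫⁻ ω, ∫⁻ ω', F (Z ω, ω') ∂(condDistrib id Z μ (Z ω)) ∂μ = ∫⁻ ω, F (Z ω, ω) ∂μ := by
  have h : μ.map Z ⊗ₘ condDistrib id Z μ = μ.map fun ω => (Z ω, id ω) :=
    compProd_map_condDistrib aemeasurable_id
  have h1 := Measure.lintegral_compProd (μ := μ.map Z) (κ := condDistrib id Z μ) hF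
  rw [h, lintegral_map hF (hZ.prodMk measurable_id), lintegral_map hF.lintegral_kernel_prod_right' hZ]
    at h1
  exact h1.symm

/-- Conditional independence given `Z` as a property of the conditional probabilities given `Z`. -/
lemma ProbabilityTheory.CondIndepFun.ae_condDistrib_inter (hZ : Measurable Z)
    (hX : Measurable X) (hY : Measurable Y)
    (h : CondIndepFun (MeasurableSpace.comap Z inferInstance) hZ.comap_le X Y μ)
    {T : Set 𝒳} {T' : Set 𝒰} (hT : MeasurableSet T) (hT' : MeasurableSet T') :
    ∀ᵐ ω ∂μ, condDistrib id Z μ (Z ω) (X ⁻¹' T ∩ Y ⁻¹' T')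
      = condDistrib id Z μ (Z ω) (X ⁻¹' T) * condDistrib id Z μ (Z ω) (Y ⁻¹' T') := by
  have h1 := (condIndepFun_iff_condExp_inter_preimage_eq_mul hX hY).1 h T T' hT hT'
  have h2 := condDistrib_ae_eq_condExp (μ := μ) hZ measurable_id ((hX hT).inter (hY hT'))
  have h3 := condDistrib_ae_eq_condExp (μ := μ) hZ measurable_id (hX hT)
  have h4 := condDistrib_ae_eq_condExp (μ := μ) hZ measurable_id (hY hT')
  filter_upwards [h1, h2, h3, h4] with ω e1 e2 e3 e4
  simp only [Set.preimage_id] at e2 e3 e4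
  rw [← e2, ← e3, ← e4, Measure.real, Measure.real, Measure.real, ← ENNReal.toReal_mul] at e1
  exact (ENNReal.toReal_eq_toReal_iff' (measure_ne_top _ _)
    (ENNReal.mul_ne_top (measure_ne_top _ _) (measure_ne_top _ _))).1 e1

/-- If `A` is independent of `(C, X)`, conditioning on `A` in addition to `C` does not change
the conditional law of `X`. -/
lemma ae_condDistrib_prodMk_of_indepFun (hA : Measurable A) (hC : Measurable C) (hX : Measurable X)
    (h : IndepFun A (fun ω => (C ω, X ω)) μ) [IsProbabilityMeasure μ]
    {T : Set 𝒳} (hT : MeasurableSet T) :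
    ∀ᵐ ω ∂μ, condDistrib id (fun ω => (A ω, C ω)) μ (A ω, C ω) (X ⁻¹' T)
      = condDistrib id C μ (C ω) (X ⁻¹' T) := by
  have hAC : Measurable fun ω => (A ω, C ω) := hA.prodMk hC
  have hg1 : Measurable fun z : 𝒜 × 𝒞 => condDistrib id (fun ω => (A ω, C ω)) μ z (X ⁻¹' T) :=
    Kernel.measurable_coe _ (hX hT)
  have hg2 : Measurable fun c : 𝒞 => condDistrib id C μ c (X ⁻¹' T) :=
    Kernel.measurable_coe _ (hX hT)
  have hg3 : Measurable fun z : 𝒜 × 𝒞 => condDistrib id C μ z.2 (X ⁻¹' T) :=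
    hg2.comp measurable_snd
  have hlaw : μ.map (fun ω => (A ω, C ω)) = (μ.map A).prod (μ.map C) :=
    (indepFun_iff_map_prod_eq_prod_map_map hA.aemeasurable hC.aemeasurable).1
      (h.comp measurable_id measurable_fst)
  have hlaw' : μ.map (fun ω => (A ω, C ω, X ω)) = (μ.map A).prod (μ.map fun ω => (C ω, X ω)) :=
    (indepFun_iff_map_prod_eq_prod_map_map hA.aemeasurable (hC.prodMk hX).aemeasurable).1 h
  have : IsProbabilityMeasure (μ.map A) := Measure.isProbabilityMeasure_map hA.aemeasurable
  have : IsProbabilityMeasure (μ.map C) := Measure.isProbabilityMeasure_map hC.aemeasurable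
  have : IsProbabilityMeasure (μ.map fun ω => (C ω, X ω)) :=
    Measure.isProbabilityMeasure_map (hC.prodMk hX).aemeasurable
  suffices hs : (fun z : 𝒜 × 𝒞 => condDistrib id (fun ω => (A ω, C ω)) μ z (X ⁻¹' T))
      =ᵐ[μ.map fun ω => (A ω, C ω)] fun z => condDistrib id C μ z.2 (X ⁻¹' T) from
    ae_of_ae_map hAC.aemeasurable hs
  have : IsFiniteMeasure (μ.map fun ω => (A ω, C ω)) := by rw [hlaw]; infer_instance
  refine ae_eq_of_forall_setLIntegral_eq_of_sigmaFinite hg1 hg3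
    fun E hE _ => ?_
  rw [setLIntegral_map hE hg1 hAC]
  have e1 := setLIntegral_preimage_condDistrib (μ := μ) (Y := id) hAC measurable_id.aemeasurable
    (hX hT) hE
  rw [Set.preimage_id] at e1
  rw [e1]
  have hE' : MeasurableSet {q : 𝒜 × 𝒞 × 𝒳 | (q.1, q.2.1) ∈ E ∧ q.2.2 ∈ T} :=
    ((by fun_prop : Measurable fun q : 𝒜 × 𝒞 × 𝒳 => (q.1, q.2.1)) hE).inter
      ((measurable_snd.comp measurable_snd) hT)
  have e2 : μ ((fun ω => (A ω, C ω)) ⁻¹' E ∩ X ⁻¹' T)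
      = μ.map (fun ω => (A ω, C ω, X ω)) {q | (q.1, q.2.1) ∈ E ∧ q.2.2 ∈ T} := by
    rw [Measure.map_apply (hA.prodMk (hC.prodMk hX)) hE']
    rfl
  rw [e2, hlaw', Measure.prod_apply hE', hlaw, ← lintegral_indicator hE,
    lintegral_prod _ (hg3.indicator hE).aemeasurable]
  refine lintegral_congr fun a => ?_
  have hEa : MeasurableSet (Prod.mk a ⁻¹' E) := measurable_prodMk_left hE
  rw [Measure.map_apply (hC.prodMk hX) (measurable_prodMk_left hE')]
  have e3 := setLIntegral_preimage_condDistrib (μ := μ) (Y := id) hC measurable_id.aemeasurable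
    (hX hT) hEa
  rw [Set.preimage_id] at e3
  refine e3.symm.trans ?_
  rw [← setLIntegral_map hEa hg2 hC, ← lintegral_indicator hEa]
  rfl

/-- A factorisation of the conditional probabilities given `Z`, a refinement of `C = p ∘ Z`, whose
second factor only depends on `C`, identifies the joint law. -/
lemma map_prodMk_eq_compProd_of_ae {p : 𝒵 → 𝒞} (hp : Measurable p) (hZ : Measurable Z)
    (hX : Measurable X) (hY : Measurable Y)
    (h : ∀ (T : Set 𝒳) (T' : Set 𝒰), MeasurableSet T → MeasurableSet T' →
      ∀ᵐ ω ∂μ, condDistrib id Z μ (Z ω) (X ⁻¹' T ∩ Y ⁻¹' T')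
        = condDistrib id Z μ (Z ω) (X ⁻¹' T)
          * condDistrib id (fun ω => p (Z ω)) μ (p (Z ω)) (Y ⁻¹' T')) :
    μ.map (fun ω => ((p (Z ω), X ω), Y ω)) = μ.map (fun ω => (p (Z ω), X ω)) ⊗ₘ
      ((condDistrib id (fun ω => p (Z ω)) μ).map Y).prodMkRight 𝒳 := by
  have hpZ : Measurable fun ω => p (Z ω) := hp.comp hZ
  refine Measure.ext_prod₃' fun {S T T'} hS hT hT' => ?_
  have hq : Measurable fun c : 𝒞 => condDistrib id (fun ω => p (Z ω)) μ c (Y ⁻¹' T') :=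
    Kernel.measurable_coe _ (hY hT')
  rw [Measure.map_apply ((hpZ.prodMk hX).prodMk hY) ((hS.prod hT).prod hT'),
    Measure.compProd_apply_prod (hS.prod hT) hT',
    ← lintegral_indicator_one (((hpZ.prodMk hX).prodMk hY) ((hS.prod hT).prod hT'))]
  have hF1 : Measurable fun q : 𝒵 × Ω => (p ⁻¹' S).indicator (1 : 𝒵 → ℝ≥0∞) q.1
      * (X ⁻¹' T ∩ Y ⁻¹' T').indicator 1 q.2 :=
    ((measurable_one.indicator (hp hS)).comp measurable_fst).mul
      ((measurable_one.indicator ((hX hT).inter (hY hT'))).comp measurable_snd)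
  have hF2 : Measurable fun q : 𝒵 × Ω => ((p ⁻¹' S).indicator (1 : 𝒵 → ℝ≥0∞) q.1
      * condDistrib id (fun ω => p (Z ω)) μ (p q.1) (Y ⁻¹' T')) * (X ⁻¹' T).indicator 1 q.2 :=
    (((measurable_one.indicator (hp hS)).mul (hq.comp hp)).comp measurable_fst).mul
      ((measurable_one.indicator (hX hT)).comp measurable_snd)
  have e1 := lintegral_comp_condDistrib_id (μ := μ) hZ hF1
  have e2 := lintegral_comp_condDistrib_id (μ := μ) hZ hF2
  have hm : Measurable fun q : 𝒞 × 𝒳 =>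
      ((condDistrib id (fun ω => p (Z ω)) μ).map Y).prodMkRight 𝒳 q T' :=
    Kernel.measurable_coe _ hT'
  rw [setLIntegral_map (hS.prod hT) hm (hpZ.prodMk hX),
    ← lintegral_indicator ((hpZ.prodMk hX) (hS.prod hT))]
  refine Eq.trans ?_ (e1.symm.trans ((lintegral_congr_ae ?_).trans (e2.trans ?_)))
  · refine lintegral_congr fun ω => ?_
    by_cases h1 : p (Z ω) ∈ S <;> by_cases h2 : X ω ∈ T <;> by_cases h3 : Y ω ∈ T' <;>
      simp [Set.indicator, h1, h2, h3]
  · filter_upwards [h T T' hT hT'] with ω hω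
    rw [lintegral_const_mul _ (measurable_one.indicator ((hX hT).inter (hY hT'))),
      lintegral_const_mul _ (measurable_one.indicator (hX hT)),
      lintegral_indicator_one ((hX hT).inter (hY hT')), lintegral_indicator_one (hX hT), hω]
    ring
  · refine lintegral_congr fun ω => ?_
    by_cases h1 : p (Z ω) ∈ S <;> by_cases h2 : X ω ∈ T <;>
      simp [Set.indicator, h1, h2, Kernel.prodMkRight_apply, Kernel.map_apply' _ hY _ hT']

/-- Under conditional independence given `C`, the joint law of `(C, X, Y)` is obtained by drawing
`Y` from its conditional law given `C`. -/
lemma ProbabilityTheory.CondIndepFun.map_prodMk_eq_compProd (hC : Measurable C)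
    (hX : Measurable X) (hY : Measurable Y)
    (h : CondIndepFun (MeasurableSpace.comap C inferInstance) hC.comap_le X Y μ) :
    μ.map (fun ω => ((C ω, X ω), Y ω)) = μ.map (fun ω => (C ω, X ω)) ⊗ₘ
      ((condDistrib id C μ).map Y).prodMkRight 𝒳 :=
  map_prodMk_eq_compProd_of_ae (p := id) (Z := C) measurable_id hC hX hY fun _ _ hT hT' =>
    h.ae_condDistrib_inter hC hX hY hT hT'

/-- If `Y` and `X` are conditionally independent given `(A, C)` and `A` is independent of `(C, Y)`,
the joint law of `(C, X, Y)` is obtained by drawing `Y` from its conditional law given `C`. -/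
lemma ProbabilityTheory.CondIndepFun.map_prodMk_eq_compProd_of_indepFun
    [IsProbabilityMeasure μ] (hA : Measurable A) (hC : Measurable C)
    (hX : Measurable X) (hY : Measurable Y)
    (h : CondIndepFun (MeasurableSpace.comap (fun ω => (A ω, C ω)) inferInstance)
      (hA.prodMk hC).comap_le Y X μ) (hind : IndepFun A (fun ω => (C ω, Y ω)) μ) :
    μ.map (fun ω => ((C ω, X ω), Y ω)) = μ.map (fun ω => (C ω, X ω)) ⊗ₘ
      ((condDistrib id C μ).map Y).prodMkRight 𝒳 := by
  refine map_prodMk_eq_compProd_of_ae (p := Prod.snd) (Z := fun ω => (A ω, C ω)) measurable_snd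
    (hA.prodMk hC) hX hY fun T T' hT hT' => ?_
  filter_upwards [h.ae_condDistrib_inter (hA.prodMk hC) hY hX hT' hT,
    ae_condDistrib_prodMk_of_indepFun hA hC hY hind hT'] with ω h1 h2
  rw [Set.inter_comm, h1, h2, mul_comm]

/-- The regular conditional probability given the σ-algebra of `C`, as a function of `C`. -/
lemma ae_condExpKernel_eq_condDistrib (hC : Measurable C) :
    ∀ᵐ ω ∂μ, condExpKernel μ (MeasurableSpace.comap C inferInstance) ω
      = condDistrib id C μ (C ω) := by
  have h : μ ⊗ₘ (condExpKernel μ (MeasurableSpace.comap C inferInstance)).comap id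
        (measurable_id'' hC.comap_le)
      = μ ⊗ₘ (condDistrib id C μ).comap C hC := by
    refine Measure.ext_prod fun {S T} hS hT => ?_
    rw [Measure.compProd_apply_prod hS hT, Measure.compProd_apply_prod hS hT]
    refine setLIntegral_congr_fun_ae hS ?_
    filter_upwards [condDistrib_apply_ae_eq_condExpKernel_map (μ := μ) measurable_id hC hT]
      with ω hω _
    rw [Kernel.map_id] at hω
    exact hω.symm
  exact Kernel.ae_eq_of_compProd_eq h

end Conditional

/-! ### Cross-world mediator arrays -/

section Merge

variable {ι : Type*} [Fintype ι] [DecidableEq ι] (ν : ι → Measure ℝ) [∀ i, SigmaFinite (ν i)]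

/-- If two arrays are drawn independently from the densities `g₀` and `g₁`, the array that takes
the coordinates in `U` from the first and the others from the second has as density the product of
the two marginal densities. -/
lemma lintegral_merge (U : Finset ι) {g₀ g₁ Φ : (ι → ℝ) → ℝ≥0∞} (h₀ : Measurable g₀)
    (h₁ : Measurable g₁) (hΦ : Measurable Φ) :
    ∫⁻ m₁, g₁ m₁ * ∫⁻ m₀, g₀ m₀ * Φ (Function.updateFinset m₁ U (U.restrict m₀)) ∂(Measure.pi ν)
        ∂(Measure.pi ν)
      = ∫⁻ m, (lmarginal ν Uᶜ g₀ m * lmarginal ν U g₁ m) * Φ m ∂(Measure.pi ν) := by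
  have key : ∀ m₁, ∫⁻ m₀, g₀ m₀ * Φ (Function.updateFinset m₁ U (U.restrict m₀)) ∂(Measure.pi ν)
      = lmarginal ν U (fun m => lmarginal ν Uᶜ g₀ m * Φ m) m₁ := by
    intro m₁
    have hm : Measurable fun m₀ => g₀ m₀ * Φ (Function.updateFinset m₁ U (U.restrict m₀)) :=
      h₀.mul (hΦ.comp (measurable_updateFinset.comp (Finset.measurable_restrict U)))
    rw [lintegral_eq_lmarginal_univ m₁, ← Finset.union_compl U, lmarginal_union ν _ hm disjoint_compl_right]
    have e1 : ∀ m, lmarginal ν Uᶜ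
        (fun m₀ => g₀ m₀ * Φ (Function.updateFinset m₁ U (U.restrict m₀))) m
        = lmarginal ν Uᶜ g₀ m * Φ (Function.updateFinset m₁ U (U.restrict m)) := by
      intro m
      have e2 : ∀ y : (Uᶜ : Finset ι) → ℝ,
          U.restrict (Function.updateFinset m Uᶜ y) = U.restrict m := by
        intro y
        funext i
        simp [Function.updateFinset]
      simp only [lmarginal, e2]
      exact lintegral_mul_const _ (h₀.comp measurable_updateFinset)
    simp only [lmarginal] at e1 ⊢
    refine lintegral_congr fun y => ?_
    rw [e1, restrict_updateFinset_same]
  simp_rw [key]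
  have h2 : Measurable fun m => lmarginal ν Uᶜ g₀ m * Φ m := (h₀.lmarginal ν).mul hΦ
  rw [← lintegral_lmarginal_mul ν U h₁ h2]
  refine lintegral_congr fun m => ?_
  ring

end Merge

section CrossWorld

variable {Ω 𝒞 ι 𝒰 : Type*} [mΩ : MeasurableSpace Ω] [StandardBorelSpace Ω] [Nonempty Ω]
  [MeasurableSpace 𝒞] [Fintype ι] [DecidableEq ι] [MeasurableSpace 𝒰]
  {μ : Measure Ω} [IsProbabilityMeasure μ] {C : Ω → 𝒞} {M₀ M₁ : Ω → ι → ℝ} {Y : Ω → 𝒰}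
  {ν : ι → Measure ℝ} [∀ i, IsFiniteMeasure (ν i)] {f₀ f₁ : 𝒞 → (ι → ℝ) → ℝ≥0∞}

/-- The conditional law of `Y` given `C`, with a passive second coordinate. -/
noncomputable def condLaw (μ : Measure Ω) [IsFiniteMeasure μ] (C : Ω → 𝒞) (Y : Ω → 𝒰)
    (ι : Type*) : Kernel (𝒞 × (ι → ℝ)) 𝒰 :=
  ((condDistrib id C μ).map Y).prodMkRight (ι → ℝ)

lemma isMarkovKernel_condLaw (hY : Measurable Y) : IsMarkovKernel (condLaw μ C Y ι) := by
  have := Kernel.IsMarkovKernel.map (condDistrib id C μ) hY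
  unfold condLaw
  infer_instance

/-- The density of the array that takes the coordinates in `U` from an array with density `f₀` and
the others from an independent array with density `f₁`. -/
noncomputable def mergeDensity (ν : ι → Measure ℝ) (U : Finset ι) (f₀ f₁ : 𝒞 → (ι → ℝ) → ℝ≥0∞)
    (q : 𝒞 × (ι → ℝ)) : ℝ≥0∞ :=
  lmarginal ν Uᶜ (f₀ q.1) q.2 * lmarginal ν U (f₁ q.1) q.2

lemma measurable_mergeDensity (U : Finset ι) (hf₀ : Measurable fun q : 𝒞 × (ι → ℝ) => f₀ q.1 q.2)
    (hf₁ : Measurable fun q : 𝒞 × (ι → ℝ) => f₁ q.1 q.2) :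
    Measurable (mergeDensity ν U f₀ f₁) :=
  (measurable_lmarginal_prod ν Uᶜ hf₀).mul (measurable_lmarginal_prod ν U hf₁)

lemma measurable_merge (U : Finset ι) : Measurable fun p : (ι → ℝ) × (ι → ℝ) =>
    Function.updateFinset p.2 U (U.restrict p.1) :=
  measurable_updateFinset'.comp
    (measurable_snd.prodMk ((Finset.measurable_restrict U).comp measurable_fst))

/-- The joint law of the covariates, the cross-world array and the outcome when
the treated world (`M₁` and `Y`) is redrawn conditionally on the covariates. -/
lemma lintegral_decoupled (hC : Measurable C) (hM₀ : Measurable M₀) (hM₁ : Measurable M₁)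
    (hY : Measurable Y) (hf₀ : Measurable fun q : 𝒞 × (ι → ℝ) => f₀ q.1 q.2)
    (hf₁ : Measurable fun q : 𝒞 × (ι → ℝ) => f₁ q.1 q.2)
    (hlaw₀ : μ.map (fun ω => (C ω, M₀ ω))
      = ((μ.map C).prod (Measure.pi ν)).withDensity fun q => f₀ q.1 q.2)
    (hlaw₁ : μ.map (fun ω => (C ω, M₁ ω))
      = ((μ.map C).prod (Measure.pi ν)).withDensity fun q => f₁ q.1 q.2)
    (hind : μ.map (fun ω => ((C ω, M₁ ω), Y ω)) = μ.map (fun ω => (C ω, M₁ ω)) ⊗ₘ condLaw μ C Y ι)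
    (U : Finset ι) {φ : (𝒞 × (ι → ℝ)) × 𝒰 → ℝ≥0∞} (hφ : Measurable φ) :
    ∫⁻ ω, ∫⁻ ω', φ ((C ω, Function.updateFinset (M₁ ω') U (U.restrict (M₀ ω))), Y ω')
        ∂(condDistrib id C μ (C ω)) ∂μ
      = ∫⁻ z, φ z ∂((((μ.map C).prod (Measure.pi ν)).withDensity (mergeDensity ν U f₀ f₁))
          ⊗ₘ condLaw μ C Y ι) := by
  have : IsMarkovKernel (condLaw μ C Y ι) := isMarkovKernel_condLaw hY
  have : IsProbabilityMeasure (μ.map C) := Measure.isProbabilityMeasure_map hC.aemeasurable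
  set κ := condDistrib id C μ with hκ
  have hmerge := measurable_merge (ι := ι) U
  -- the integrand as a function of the covariates, both arrays and the outcome
  have hψ : Measurable fun p : (𝒞 × (ι → ℝ)) × ((ι → ℝ) × 𝒰) =>
      φ ((p.1.1, Function.updateFinset p.2.1 U (U.restrict p.1.2)), p.2.2) :=
    hφ.comp (((measurable_fst.comp measurable_fst).prodMk
      (hmerge.comp ((measurable_snd.comp measurable_fst).prodMk
        (measurable_fst.comp measurable_snd)))).prodMk (measurable_snd.comp measurable_snd))
  have hψΩ : Measurable fun p : (𝒞 × (ι → ℝ)) × Ω =>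
      φ ((p.1.1, Function.updateFinset (M₁ p.2) U (U.restrict p.1.2)), Y p.2) :=
    hψ.comp (measurable_fst.prodMk ((hM₁.comp measurable_snd).prodMk (hY.comp measurable_snd)))
  have hG : Measurable fun q : 𝒞 × (ι → ℝ) =>
      ∫⁻ ω', φ ((q.1, Function.updateFinset (M₁ ω') U (U.restrict q.2)), Y ω') ∂(κ q.1) :=
    Measurable.lintegral_kernel_prod_right' (κ := κ.prodMkRight (ι → ℝ)) hψΩ
  have hH : Measurable fun p : (𝒞 × (ι → ℝ)) × 𝒰 => ∫⁻ m₀, f₀ p.1.1 m₀ *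
      φ ((p.1.1, Function.updateFinset p.1.2 U (U.restrict m₀)), p.2) ∂(Measure.pi ν) := by
    have h : Measurable fun r : ((𝒞 × (ι → ℝ)) × 𝒰) × (ι → ℝ) => f₀ r.1.1.1 r.2 *
        φ ((r.1.1.1, Function.updateFinset r.1.1.2 U (U.restrict r.2)), r.1.2) :=
      (hf₀.comp (by fun_prop : Measurable fun r : ((𝒞 × (ι → ℝ)) × 𝒰) × (ι → ℝ) =>
        (r.1.1.1, r.2))).mul (hψ.comp (by fun_prop :
          Measurable fun r : ((𝒞 × (ι → ℝ)) × 𝒰) × (ι → ℝ) =>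
            ((r.1.1.1, r.2), (r.1.1.2, r.1.2))))
    exact h.lintegral_prod_right'
  have hΦ : Measurable fun q : 𝒞 × (ι → ℝ) => ∫⁻ u, φ (q, u) ∂(condLaw μ C Y ι q) :=
    hφ.lintegral_kernel_prod_right'
  have step1 : ∫⁻ ω, ∫⁻ ω', φ ((C ω, Function.updateFinset (M₁ ω') U (U.restrict (M₀ ω))), Y ω')
        ∂(κ (C ω)) ∂μ
      = ∫⁻ c, ∫⁻ ω', ∫⁻ m₀, f₀ c m₀ *
          φ ((c, Function.updateFinset (M₁ ω') U (U.restrict m₀)), Y ω') ∂(Measure.pi ν) ∂(κ c)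
        ∂(μ.map C) := by
    rw [← lintegral_map (f := fun q : 𝒞 × (ι → ℝ) =>
      ∫⁻ ω', φ ((q.1, Function.updateFinset (M₁ ω') U (U.restrict q.2)), Y ω') ∂(κ q.1)) hG
      (hC.prodMk hM₀), hlaw₀, lintegral_withDensity_eq_lintegral_mul _ hf₀ hG,
      lintegral_prod _ (hf₀.mul hG).aemeasurable]
    refine lintegral_congr fun c => ?_
    rw [lintegral_lintegral_swap]
    · refine lintegral_congr fun m₀ => ?_
      simp only [Pi.mul_apply]
      rw [lintegral_const_mul]
      have h : Measurable fun ω' : Ω => ((c, m₀), ω') := measurable_prodMk_left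
      exact hψΩ.comp h
    · have h : Measurable fun r : Ω × (ι → ℝ) => f₀ c r.2 *
          φ ((c, Function.updateFinset (M₁ r.1) U (U.restrict r.2)), Y r.1) :=
        (hf₀.comp (measurable_const.prodMk measurable_snd)).mul
          (hψΩ.comp ((measurable_const.prodMk measurable_snd).prodMk measurable_fst))
      exact h.aemeasurable
  have step2 : ∫⁻ c, ∫⁻ ω', ∫⁻ m₀, f₀ c m₀ *
          φ ((c, Function.updateFinset (M₁ ω') U (U.restrict m₀)), Y ω') ∂(Measure.pi ν) ∂(κ c)
        ∂(μ.map C)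
      = ∫⁻ ω, ∫⁻ m₀, f₀ (C ω) m₀ *
          φ ((C ω, Function.updateFinset (M₁ ω) U (U.restrict m₀)), Y ω) ∂(Measure.pi ν) ∂μ := by
    have hF : Measurable fun p : 𝒞 × Ω => ∫⁻ m₀, f₀ p.1 m₀ *
        φ ((p.1, Function.updateFinset (M₁ p.2) U (U.restrict m₀)), Y p.2) ∂(Measure.pi ν) :=
      hH.comp ((measurable_fst.prodMk (hM₁.comp measurable_snd)).prodMk (hY.comp measurable_snd))
    rw [← lintegral_comp_condDistrib_id hC hF, lintegral_map _ hC]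
    exact hF.lintegral_kernel_prod_right'
  have step3 : ∫⁻ ω, ∫⁻ m₀, f₀ (C ω) m₀ *
          φ ((C ω, Function.updateFinset (M₁ ω) U (U.restrict m₀)), Y ω) ∂(Measure.pi ν) ∂μ
      = ∫⁻ c, ∫⁻ m₁, f₁ c m₁ * ∫⁻ m₀, f₀ c m₀ *
          ∫⁻ u, φ ((c, Function.updateFinset m₁ U (U.restrict m₀)), u)
            ∂(condLaw μ C Y ι (c, Function.updateFinset m₁ U (U.restrict m₀)))
          ∂(Measure.pi ν) ∂(Measure.pi ν) ∂(μ.map C) := by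
    have hHk : Measurable fun q : 𝒞 × (ι → ℝ) => ∫⁻ u, ∫⁻ m₀, f₀ q.1 m₀ *
        φ ((q.1, Function.updateFinset q.2 U (U.restrict m₀)), u) ∂(Measure.pi ν)
          ∂(condLaw μ C Y ι q) := hH.lintegral_kernel_prod_right'
    rw [← lintegral_map (f := fun p : (𝒞 × (ι → ℝ)) × 𝒰 => ∫⁻ m₀, f₀ p.1.1 m₀ *
      φ ((p.1.1, Function.updateFinset p.1.2 U (U.restrict m₀)), p.2) ∂(Measure.pi ν)) hH
      ((hC.prodMk hM₁).prodMk hY), hind, Measure.lintegral_compProd hH, hlaw₁,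
      lintegral_withDensity_eq_lintegral_mul _ hf₁ hHk,
      lintegral_prod _ (hf₁.mul hHk).aemeasurable]
    refine lintegral_congr fun c => lintegral_congr fun m₁ => ?_
    simp only [Pi.mul_apply]
    congr 1
    rw [lintegral_lintegral_swap]
    · refine lintegral_congr fun m₀ => ?_
      rw [lintegral_const_mul]
      · rfl
      · exact hφ.comp (measurable_const.prodMk measurable_id)
    · have h : Measurable fun r : 𝒰 × (ι → ℝ) => f₀ c r.2 *
          φ ((c, Function.updateFinset m₁ U (U.restrict r.2)), r.1) :=
        (hf₀.comp (measurable_const.prodMk measurable_snd)).mul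
          (hψ.comp ((measurable_const.prodMk measurable_snd).prodMk
            (measurable_const.prodMk measurable_fst)))
      exact h.aemeasurable
  rw [step1, step2, step3, Measure.lintegral_compProd hφ,
    lintegral_withDensity_eq_lintegral_mul _ (measurable_mergeDensity U hf₀ hf₁) hΦ,
    lintegral_prod _ ((measurable_mergeDensity U hf₀ hf₁).mul hΦ).aemeasurable]
  refine lintegral_congr fun c => ?_
  exact lintegral_merge ν U (hf₀.comp measurable_prodMk_left) (hf₁.comp measurable_prodMk_left)
    (hΦ.comp measurable_prodMk_left)

end CrossWorld

/-! ### Means of outcomes at cross-world mediator arrays -/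

section CrossWorldMean

variable {Ω 𝒞 ι 𝒰 𝒴 : Type*} [mΩ : MeasurableSpace Ω] [StandardBorelSpace Ω] [Nonempty Ω]
  [MeasurableSpace 𝒞] [Fintype ι] [DecidableEq ι] [MeasurableSpace 𝒰] [MeasurableSpace 𝒴]
  {μ : Measure Ω} [IsProbabilityMeasure μ] {C : Ω → 𝒞} {M₀ M₁ : Ω → ι → ℝ} {Y : Ω → 𝒰}
  {ν : ι → Measure ℝ} [∀ i, IsFiniteMeasure (ν i)]

/-- Under cross-world independence of the two parts of the merged array given the covariates, its
density is the product of the two marginal densities. -/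
lemma map_merge_eq_withDensity {f₀ f₁ : 𝒞 → (ι → ℝ) → ℝ≥0∞} (hC : Measurable C)
    (hM₀ : Measurable M₀) (hM₁ : Measurable M₁)
    (hY : Measurable Y) (hf₀ : Measurable fun q : 𝒞 × (ι → ℝ) => f₀ q.1 q.2)
    (hf₁ : Measurable fun q : 𝒞 × (ι → ℝ) => f₁ q.1 q.2)
    (hlaw₀ : μ.map (fun ω => (C ω, M₀ ω))
      = ((μ.map C).prod (Measure.pi ν)).withDensity fun q => f₀ q.1 q.2)
    (hlaw₁ : μ.map (fun ω => (C ω, M₁ ω))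
      = ((μ.map C).prod (Measure.pi ν)).withDensity fun q => f₁ q.1 q.2)
    (hind : μ.map (fun ω => ((C ω, M₁ ω), Y ω)) = μ.map (fun ω => (C ω, M₁ ω)) ⊗ₘ condLaw μ C Y ι)
    (U : Finset ι)
    (hcross : CondIndepFun (MeasurableSpace.comap C inferInstance) hC.comap_le
      (fun ω => U.restrict (M₀ ω)) (fun ω => Uᶜ.restrict (M₁ ω)) μ) :
    μ.map (fun ω => (C ω, Function.updateFinset (M₁ ω) U (U.restrict (M₀ ω))))
      = ((μ.map C).prod (Measure.pi ν)).withDensity (mergeDensity ν U f₀ f₁) := by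
  have : IsMarkovKernel (condLaw μ C Y ι) := isMarkovKernel_condLaw hY
  have hr₀ : Measurable fun ω => U.restrict (M₀ ω) := (Finset.measurable_restrict U).comp hM₀
  have hr₁ : Measurable fun ω => Uᶜ.restrict (M₁ ω) := (Finset.measurable_restrict Uᶜ).comp hM₁
  have hG : Measurable fun ω => Function.updateFinset (M₁ ω) U (U.restrict (M₀ ω)) :=
    (measurable_merge U).comp (hM₀.prodMk hM₁)
  -- the merged array only depends on the coordinates in `U` of `M₀` and outside `U` of `M₁`
  have hglue : ∀ m₀ m₁ : ι → ℝ, Function.updateFinset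
      (Function.updateFinset (0 : ι → ℝ) Uᶜ (Uᶜ.restrict m₁)) U (U.restrict m₀)
      = Function.updateFinset m₁ U (U.restrict m₀) := by
    intro m₀ m₁
    funext i
    by_cases hi : i ∈ U <;> simp [Function.updateFinset, hi]
  have hgm : Measurable fun p : (𝒞 × (U → ℝ)) × ((Uᶜ : Finset ι) → ℝ) =>
      (p.1.1, Function.updateFinset (Function.updateFinset (0 : ι → ℝ) Uᶜ p.2) U p.1.2) :=
    (measurable_fst.comp measurable_fst).prodMk (measurable_updateFinset'.comp
      ((measurable_updateFinset.comp measurable_snd).prodMk (measurable_snd.comp measurable_fst)))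
  refine Measure.ext_of_lintegral _ fun φ hφ => ?_
  have h1 := lintegral_decoupled hC hM₀ hM₁ hY hf₀ hf₁ hlaw₀ hlaw₁ hind U
    (φ := fun z => φ z.1) (hφ.comp measurable_fst)
  have h2 : ∫⁻ z, φ z.1 ∂((((μ.map C).prod (Measure.pi ν)).withDensity (mergeDensity ν U f₀ f₁))
      ⊗ₘ condLaw μ C Y ι)
      = ∫⁻ q, φ q ∂(((μ.map C).prod (Measure.pi ν)).withDensity (mergeDensity ν U f₀ f₁)) := by
    have : SFinite (((μ.map C).prod (Measure.pi ν)).withDensity (mergeDensity ν U f₀ f₁)) :=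
      inferInstance
    have hφ1 : Measurable fun z : (𝒞 × (ι → ℝ)) × 𝒰 => φ z.1 := hφ.comp measurable_fst
    rw [Measure.lintegral_compProd hφ1]
    simp
  rw [← h2, ← h1, lintegral_map hφ (hC.prodMk hG)]
  have h3 := hcross.map_prodMk_eq_compProd hC hr₀ hr₁
  have hφg : Measurable fun p : (𝒞 × (U → ℝ)) × ((Uᶜ : Finset ι) → ℝ) => φ (p.1.1,
      Function.updateFinset (Function.updateFinset (0 : ι → ℝ) Uᶜ p.2) U p.1.2) := hφ.comp hgm
  have h4 := congrArg (fun m => ∫⁻ p, φ (p.1.1,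
      Function.updateFinset (Function.updateFinset (0 : ι → ℝ) Uᶜ p.2) U p.1.2) ∂m) h3
  have hk : IsMarkovKernel ((condDistrib id C μ).map fun ω => Uᶜ.restrict (M₁ ω)) :=
    Kernel.IsMarkovKernel.map _ hr₁
  rw [lintegral_map hφg ((hC.prodMk hr₀).prodMk hr₁), Measure.lintegral_compProd hφg,
    lintegral_map hφg.lintegral_kernel_prod_right' (hC.prodMk hr₀)] at h4
  simp only [hglue] at h4
  rw [h4]
  refine lintegral_congr fun ω => ?_
  rw [Kernel.prodMkRight_apply, Kernel.map_apply _ hr₁, lintegral_map _ hr₁]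
  · simp only [hglue]
  · have h5 : Measurable fun b : (Uᶜ : Finset ι) → ℝ => ((C ω, U.restrict (M₀ ω)), b) :=
      measurable_prodMk_left
    exact hφg.comp h5

namespace IsNuisance

variable {L : Measure (Fin 2 × 𝒞 × (ι → ℝ) × 𝒴)} [IsFiniteMeasure L] {y : 𝒴 → ℝ} {π : ℝ}
  {f : Fin 2 → 𝒞 → (ι → ℝ) → ℝ≥0∞} {η : Fin 2 → (ι → ℝ) → 𝒞 → ℝ} {lo hi : ℝ}
  {ev : 𝒰 → (ι → ℝ) → ℝ}

lemma lmarginal_le (hL : IsNuisance L y ν π f η lo hi) (a : Fin 2) (s : Finset ι) :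
    ∀ᵐ q ∂(covBase ν L), lmarginal ν s (f a q.1) q.2 ≤ ENNReal.ofReal (massBound ν hi s) := by
  have h := ae_ae_updateFinset ν (ρ := covLaw L) s (p := fun q => f a q.1 q.2 ≤ ENNReal.ofReal hi)
    (by filter_upwards [hL.density_bounds a] with q hq using hq.2)
  filter_upwards [h] with q hq
  rw [lmarginal, massBound, ENNReal.ofReal_mul hL.hi_pos.le,
    ENNReal.ofReal_toReal (measure_ne_top _ _), ← lintegral_const]
  exact lintegral_mono_ae hq

lemma mergeDensity_le (hL : IsNuisance L y ν π f η lo hi) (U : Finset ι) :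
    ∀ᵐ q ∂(covBase ν L), mergeDensity ν U (f 0) (f 1) q
      ≤ ENNReal.ofReal (massBound ν hi Uᶜ * massBound ν hi U / lo) * f 1 q.1 q.2 := by
  filter_upwards [hL.lmarginal_le 0 Uᶜ, hL.lmarginal_le 1 U, hL.density_bounds 1] with q h1 h2 h3
  have hlo := hL.lo_pos
  have h0 := hL.massBound_nonneg (ν := ν) Uᶜ
  have h0' := hL.massBound_nonneg (ν := ν) U
  calc mergeDensity ν U (f 0) (f 1) q
      ≤ ENNReal.ofReal (massBound ν hi Uᶜ) * ENNReal.ofReal (massBound ν hi U) := mul_le_mul' h1 h2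
    _ = ENNReal.ofReal (massBound ν hi Uᶜ * massBound ν hi U / lo) * ENNReal.ofReal lo := by
        rw [← ENNReal.ofReal_mul h0, ← ENNReal.ofReal_mul (by positivity), div_mul_cancel₀ _ hlo.ne']
    _ ≤ _ := mul_le_mul' le_rfl h3.1

lemma mergeDensity_lt_top (hL : IsNuisance L y ν π f η lo hi) (U : Finset ι) :
    ∀ᵐ q ∂(covBase ν L), mergeDensity ν U (f 0) (f 1) q < ∞ := by
  filter_upwards [hL.mergeDensity_le U, hL.density_lt_top 1] with q h1 h2
  exact h1.trans_lt (ENNReal.mul_lt_top ENNReal.ofReal_lt_top h2)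

/-- The conditional mean of the potential outcome at a fixed array is the outcome regression. -/
lemma integral_condLaw_ae_eq (hL : IsNuisance L y ν π f η lo hi) (hC : Measurable C)
    (hM₁ : Measurable M₁) (hY : Measurable Y)
    (hlaw₁ : μ.map (fun ω => (C ω, M₁ ω)) = (covBase ν L).withDensity fun q => f 1 q.1 q.2)
    (hind : μ.map (fun ω => ((C ω, M₁ ω), Y ω)) = μ.map (fun ω => (C ω, M₁ ω)) ⊗ₘ condLaw μ C Y ι)
    (hev : Measurable fun p : 𝒰 × (ι → ℝ) => ev p.1 p.2)
    (hint : Integrable (fun ω => ev (Y ω) (M₁ ω)) μ)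
    (hmean : ∀ S : Set (𝒞 × (ι → ℝ)), MeasurableSet S →
      ∫ ω, S.indicator 1 (C ω, M₁ ω) * ev (Y ω) (M₁ ω) ∂μ
        = ∫ q, (f 1 q.1 q.2).toReal * (S.indicator 1 q * η 1 q.2 q.1) ∂(covBase ν L)) :
    ∀ᵐ q ∂(covBase ν L), ∫ u, ev u q.2 ∂(condLaw μ C Y ι q) = η 1 q.2 q.1 := by
  have : IsMarkovKernel (condLaw μ C Y ι) := isMarkovKernel_condLaw hY
  have hmY : Measurable fun ω => ((C ω, M₁ ω), Y ω) := (hC.prodMk hM₁).prodMk hY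
  have hfm := hL.measurable_density 1
  have hevm : Measurable fun z : (𝒞 × (ι → ℝ)) × 𝒰 => ev z.2 z.1.2 :=
    hev.comp (measurable_snd.prodMk (measurable_snd.comp measurable_fst))
  have hbar : Measurable fun q : 𝒞 × (ι → ℝ) => ∫ u, ev u q.2 ∂(condLaw μ C Y ι q) :=
    (hevm.stronglyMeasurable.integral_kernel_prod_right' (κ := condLaw μ C Y ι)).measurable
  have hi1 : Integrable (fun z : (𝒞 × (ι → ℝ)) × 𝒰 => ev z.2 z.1.2)
      (μ.map (fun ω => (C ω, M₁ ω)) ⊗ₘ condLaw μ C Y ι) := by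
    rw [← hind]
    exact (integrable_map_measure hevm.aestronglyMeasurable hmY.aemeasurable).2 hint
  have hi2 : Integrable (fun q : 𝒞 × (ι → ℝ) =>
      (f 1 q.1 q.2).toReal * ∫ u, ev u q.2 ∂(condLaw μ C Y ι q)) (covBase ν L) := by
    have h : Integrable (fun q : 𝒞 × (ι → ℝ) => ∫ u, ev u q.2 ∂(condLaw μ C Y ι q))
        (μ.map fun ω => (C ω, M₁ ω)) :=
      ((Measure.integrable_compProd_iff hi1.1).1 hi1).2.mono hbar.aestronglyMeasurable
        (Eventually.of_forall fun q => (norm_integral_le_integral_norm _).trans (le_abs_self _))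
    rw [hlaw₁, integrable_withDensity_iff_integrable_smul' hfm (hL.density_lt_top 1)] at h
    exact h
  have hi3 : Integrable (fun q : 𝒞 × (ι → ℝ) => (f 1 q.1 q.2).toReal * η 1 q.2 q.1)
      (covBase ν L) :=
    ((hL.memLp_covBase_mean 1).integrable (by norm_num)).bdd_mul (c := hi)
      hfm.ennreal_toReal.aestronglyMeasurable (by
        filter_upwards [hL.toReal_density_bounds 1] with q hq
        rw [Real.norm_eq_abs, abs_of_nonneg ENNReal.toReal_nonneg]
        exact hq.2)
  have key := Integrable.ae_eq_of_forall_setIntegral_eq _ _ hi2 hi3 fun S hS _ => by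
    have hSm : Measurable (S.indicator (1 : 𝒞 × (ι → ℝ) → ℝ)) := measurable_one.indicator hS
    have e1 : ∫ ω, S.indicator 1 (C ω, M₁ ω) * ev (Y ω) (M₁ ω) ∂μ
        = ∫ q in S, (f 1 q.1 q.2).toReal * ∫ u, ev u q.2 ∂(condLaw μ C Y ι q) ∂(covBase ν L) := by
      have hF : Measurable fun z : (𝒞 × (ι → ℝ)) × 𝒰 => S.indicator 1 z.1 * ev z.2 z.1.2 :=
        (hSm.comp measurable_fst).mul hevm
      have hFi : Integrable (fun z : (𝒞 × (ι → ℝ)) × 𝒰 => S.indicator 1 z.1 * ev z.2 z.1.2)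
          (μ.map (fun ω => (C ω, M₁ ω)) ⊗ₘ condLaw μ C Y ι) :=
        hi1.bdd_mul (c := 1) (hSm.comp measurable_fst).aestronglyMeasurable
          (Eventually.of_forall fun z => by
            by_cases hz : z.1 ∈ S <;> simp [Set.indicator, hz])
      have e := integral_map (φ := fun ω => ((C ω, M₁ ω), Y ω)) hmY.aemeasurable (μ := μ)
        (f := fun z : (𝒞 × (ι → ℝ)) × 𝒰 => S.indicator 1 z.1 * ev z.2 z.1.2)
        hF.aestronglyMeasurable
      rw [hind, Measure.integral_compProd hFi, hlaw₁,
        integral_withDensity_eq_integral_toReal_smul hfm (hL.density_lt_top 1)] at e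
      rw [← integral_indicator hS]
      refine e.symm.trans (integral_congr_ae (Eventually.of_forall fun q => ?_))
      simp only [smul_eq_mul]
      rw [integral_const_mul]
      by_cases hq : q ∈ S <;> simp [Set.indicator, hq]
    rw [← e1, hmean S hS, ← integral_indicator hS]
    refine integral_congr_ae (Eventually.of_forall fun q => ?_)
    by_cases hq : q ∈ S <;> simp [Set.indicator, hq]
  filter_upwards [key, hL.toReal_density_bounds 1] with q h1 h2
  exact mul_left_cancel₀ (hL.lo_pos.trans_le h2.1).ne' h1

lemma integrable_weight_mul_outcome (hL : IsNuisance L y ν π f η lo hi) (hC : Measurable C)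
    (hM₁ : Measurable M₁) (hY : Measurable Y)
    (hlaw₁ : μ.map (fun ω => (C ω, M₁ ω)) = (covBase ν L).withDensity fun q => f 1 q.1 q.2)
    (hind : μ.map (fun ω => ((C ω, M₁ ω), Y ω)) = μ.map (fun ω => (C ω, M₁ ω)) ⊗ₘ condLaw μ C Y ι)
    (hev : Measurable fun p : 𝒰 × (ι → ℝ) => ev p.1 p.2)
    (hint : Integrable (fun ω => ev (Y ω) (M₁ ω)) μ) (U : Finset ι) {W : 𝒞 → ℝ}
    (hW : Measurable W) {w₀ : ℝ} (hw : ∀ᵐ c ∂(covLaw L), |W c| ≤ w₀) :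
    Integrable (fun z : (𝒞 × (ι → ℝ)) × 𝒰 => W z.1.1 * ev z.2 z.1.2)
      (((covBase ν L).withDensity (mergeDensity ν U (f 0) (f 1))) ⊗ₘ condLaw μ C Y ι) := by
  have : IsMarkovKernel (condLaw μ C Y ι) := isMarkovKernel_condLaw hY
  have hmY : Measurable fun ω => ((C ω, M₁ ω), Y ω) := (hC.prodMk hM₁).prodMk hY
  have hgm := measurable_mergeDensity (ν := ν) U (hL.measurable_density 0) (hL.measurable_density 1)
  have hevm : Measurable fun z : (𝒞 × (ι → ℝ)) × 𝒰 => ev z.2 z.1.2 :=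
    hev.comp (measurable_snd.prodMk (measurable_snd.comp measurable_fst))
  have hF : Measurable fun z : (𝒞 × (ι → ℝ)) × 𝒰 => W z.1.1 * ev z.2 z.1.2 :=
    (hW.comp (measurable_fst.comp measurable_fst)).mul hevm
  have hinner : Measurable fun q : 𝒞 × (ι → ℝ) => ∫⁻ u, ‖ev u q.2‖ₑ ∂(condLaw μ C Y ι q) :=
    hevm.enorm.lintegral_kernel_prod_right'
  have hfin : ∫⁻ q, f 1 q.1 q.2 * ∫⁻ u, ‖ev u q.2‖ₑ ∂(condLaw μ C Y ι q) ∂(covBase ν L) < ∞ := by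
    have h := hint.2
    rw [hasFiniteIntegral_iff_enorm] at h
    have e := lintegral_map (μ := μ) (f := fun z : (𝒞 × (ι → ℝ)) × 𝒰 => ‖ev z.2 z.1.2‖ₑ)
      hevm.enorm hmY
    rw [hind, Measure.lintegral_compProd hevm.enorm, hlaw₁,
      lintegral_withDensity_eq_lintegral_mul _ (hL.measurable_density 1) hinner] at e
    exact e.trans_lt h
  refine ⟨hF.aestronglyMeasurable, ?_⟩
  rw [hasFiniteIntegral_iff_enorm, Measure.lintegral_compProd hF.enorm,
    lintegral_withDensity_eq_lintegral_mul _ hgm hF.enorm.lintegral_kernel_prod_right']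
  refine lt_of_le_of_lt (lintegral_mono_ae (g := fun q =>
    ENNReal.ofReal (massBound ν hi Uᶜ * massBound ν hi U / lo) * ENNReal.ofReal w₀ *
      (f 1 q.1 q.2 * ∫⁻ u, ‖ev u q.2‖ₑ ∂(condLaw μ C Y ι q))) ?_) ?_
  · filter_upwards [hL.mergeDensity_le U, ae_covBase_of_covLaw hw] with q h1 h2
    have h3 : ‖W q.1‖ₑ ≤ ENNReal.ofReal w₀ := by
      rw [← ofReal_norm, Real.norm_eq_abs]
      exact ENNReal.ofReal_le_ofReal h2
    have h4 : ∫⁻ u, ‖W q.1 * ev u q.2‖ₑ ∂(condLaw μ C Y ι q)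
        = ‖W q.1‖ₑ * ∫⁻ u, ‖ev u q.2‖ₑ ∂(condLaw μ C Y ι q) := by
      simp only [enorm_mul]
      exact lintegral_const_mul' _ _ enorm_ne_top
    simp only [Pi.mul_apply]
    rw [h4]
    refine (mul_le_mul' h1 (mul_le_mul' h3 le_rfl)).trans (le_of_eq ?_)
    ring
  · rw [lintegral_const_mul' _ _ (by finiteness)]
    exact ENNReal.mul_lt_top (by finiteness) hfin

/-- The weighted mean of the potential outcome at the merged array, when the outcome is drawn from
its conditional law given the covariates. -/
lemma integral_weight_mul_outcome (hL : IsNuisance L y ν π f η lo hi) (hC : Measurable C)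
    (hM₁ : Measurable M₁) (hY : Measurable Y)
    (hlaw₁ : μ.map (fun ω => (C ω, M₁ ω)) = (covBase ν L).withDensity fun q => f 1 q.1 q.2)
    (hind : μ.map (fun ω => ((C ω, M₁ ω), Y ω)) = μ.map (fun ω => (C ω, M₁ ω)) ⊗ₘ condLaw μ C Y ι)
    (hev : Measurable fun p : 𝒰 × (ι → ℝ) => ev p.1 p.2)
    (hint : Integrable (fun ω => ev (Y ω) (M₁ ω)) μ)
    (hmean : ∀ S : Set (𝒞 × (ι → ℝ)), MeasurableSet S →
      ∫ ω, S.indicator 1 (C ω, M₁ ω) * ev (Y ω) (M₁ ω) ∂μ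
        = ∫ q, (f 1 q.1 q.2).toReal * (S.indicator 1 q * η 1 q.2 q.1) ∂(covBase ν L))
    (U : Finset ι) {W : 𝒞 → ℝ} (hW : Measurable W) {w₀ : ℝ}
    (hw : ∀ᵐ c ∂(covLaw L), |W c| ≤ w₀) :
    ∫ z : (𝒞 × (ι → ℝ)) × 𝒰, W z.1.1 * ev z.2 z.1.2
        ∂(((covBase ν L).withDensity (mergeDensity ν U (f 0) (f 1))) ⊗ₘ condLaw μ C Y ι)
      = ∫ c, W c * crossMean ν f η Uᶜ U 1 0 1 c ∂(covLaw L) := by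
  have : IsMarkovKernel (condLaw μ C Y ι) := isMarkovKernel_condLaw hY
  have hgm := measurable_mergeDensity (ν := ν) U (hL.measurable_density 0) (hL.measurable_density 1)
  have : SFinite ((covBase ν L).withDensity (mergeDensity ν U (f 0) (f 1))) := inferInstance
  rw [Measure.integral_compProd
    (hL.integrable_weight_mul_outcome hC hM₁ hY hlaw₁ hind hev hint U hW hw),
    integral_withDensity_eq_integral_toReal_smul hgm (hL.mergeDensity_lt_top U),
    integral_mul_crossMean Uᶜ U 1 0 1 W (integrable_weight_mul hW hw (hL.memLp_mean_mul _ _ _ _ _))]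
  refine integral_congr_ae ?_
  filter_upwards [hL.integral_condLaw_ae_eq hC hM₁ hY hlaw₁ hind hev hint hmean] with q hq
  simp only [smul_eq_mul]
  rw [integral_const_mul, hq, mergeDensity, ENNReal.toReal_mul]
  simp only [subMass]
  ring

end IsNuisance

end CrossWorldMean

/-! ### Identification in clusters of a fixed size -/

section Decoupled

variable {Ω 𝒞 ι 𝒰 : Type*} [mΩ : MeasurableSpace Ω] [StandardBorelSpace Ω] [Nonempty Ω]
  [MeasurableSpace 𝒞] [Fintype ι] [DecidableEq ι] [MeasurableSpace 𝒰]
  {μ : Measure Ω} [IsProbabilityMeasure μ] {C : Ω → 𝒞} {M₀ M₁ : Ω → ι → ℝ} {Y : Ω → 𝒰}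
  {ν : ι → Measure ℝ} [∀ i, IsFiniteMeasure (ν i)] {f₀ f₁ : 𝒞 → (ι → ℝ) → ℝ≥0∞}

/-- Two copies of the sample point, conditionally independent with the same covariates. -/
noncomputable def decoupled (μ : Measure Ω) [IsFiniteMeasure μ] (C : Ω → 𝒞) (hC : Measurable C) :
    Measure (Ω × Ω) :=
  μ ⊗ₘ (condDistrib id C μ).comap C hC

lemma measurable_decoupled (hC : Measurable C) (hM₀ : Measurable M₀) (hM₁ : Measurable M₁)
    (hY : Measurable Y) (U : Finset ι) : Measurable fun p : Ω × Ω =>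
      ((C p.1, Function.updateFinset (M₁ p.2) U (U.restrict (M₀ p.1))), Y p.2) :=
  ((hC.comp measurable_fst).prodMk ((measurable_merge U).comp
    ((hM₀.comp measurable_fst).prodMk (hM₁.comp measurable_snd)))).prodMk (hY.comp measurable_snd)

lemma map_decoupled (hC : Measurable C) (hM₀ : Measurable M₀) (hM₁ : Measurable M₁)
    (hY : Measurable Y) (hf₀ : Measurable fun q : 𝒞 × (ι → ℝ) => f₀ q.1 q.2)
    (hf₁ : Measurable fun q : 𝒞 × (ι → ℝ) => f₁ q.1 q.2)
    (hlaw₀ : μ.map (fun ω => (C ω, M₀ ω))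
      = ((μ.map C).prod (Measure.pi ν)).withDensity fun q => f₀ q.1 q.2)
    (hlaw₁ : μ.map (fun ω => (C ω, M₁ ω))
      = ((μ.map C).prod (Measure.pi ν)).withDensity fun q => f₁ q.1 q.2)
    (hind : μ.map (fun ω => ((C ω, M₁ ω), Y ω)) = μ.map (fun ω => (C ω, M₁ ω)) ⊗ₘ condLaw μ C Y ι)
    (U : Finset ι) :
    (decoupled μ C hC).map (fun p =>
        ((C p.1, Function.updateFinset (M₁ p.2) U (U.restrict (M₀ p.1))), Y p.2))
      = (((μ.map C).prod (Measure.pi ν)).withDensity (mergeDensity ν U f₀ f₁))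
          ⊗ₘ condLaw μ C Y ι := by
  have hT := measurable_decoupled hC hM₀ hM₁ hY U
  refine Measure.ext_of_lintegral _ fun φ hφ => ?_
  have hφT : Measurable fun p : Ω × Ω =>
    φ ((C p.1, Function.updateFinset (M₁ p.2) U (U.restrict (M₀ p.1))), Y p.2) := hφ.comp hT
  rw [lintegral_map hφ hT, decoupled, Measure.lintegral_compProd hφT,
    ← lintegral_decoupled hC hM₀ hM₁ hY hf₀ hf₁ hlaw₀ hlaw₁ hind U hφ]
  rfl

end Decoupled

/-- Nuisance functions do not depend on the total mass of the law. -/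
lemma IsNuisance.of_smul {𝒞 ι 𝒴 : Type*} [MeasurableSpace 𝒞] [Fintype ι] [DecidableEq ι]
    [MeasurableSpace 𝒴] {L : Measure (Fin 2 × 𝒞 × (ι → ℝ) × 𝒴)} {p : ℝ≥0∞} {Y : 𝒴 → ℝ}
    {ν : ι → Measure ℝ} [∀ i, IsFiniteMeasure (ν i)] {π : ℝ} {f : Fin 2 → 𝒞 → (ι → ℝ) → ℝ≥0∞}
    {η : Fin 2 → (ι → ℝ) → 𝒞 → ℝ} {lo hi : ℝ} [IsFiniteMeasure L] (hp0 : p ≠ 0) (hp : p ≠ ∞)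
    (h : IsNuisance (p • L) Y ν π f η lo hi) : IsNuisance L Y ν π f η lo hi := by
  have hcov : covLaw (p • L) = p • covLaw L := Measure.map_smul _ _ _
  have hbase : covBase ν (p • L) = p • covBase ν L := by
    rw [covBase, covBase, hcov, Measure.prod_smul_left]
  have hinv : p⁻¹ • p • L = L := by rw [smul_smul, ENNReal.inv_mul_cancel hp0 hp, one_smul]
  exact
  { measurable_density := h.measurable_density
    measurable_mean := h.measurable_mean
    measurable_outcome := h.measurable_outcome
    lo_pos := h.lo_pos
    lo_le_hi := h.lo_le_hi
    propensity_pos := h.propensity_pos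
    density_bounds := fun a => by
      have h1 := h.density_bounds a
      rwa [hbase, Measure.ae_ennreal_smul_measure_iff hp0] at h1
    law := fun a => by
      have h1 := h.law a
      rw [hbase, Measure.restrict_smul, Measure.map_smul, withDensity_smul_measure,
        smul_comm] at h1
      have h2 := congrArg (fun m => p⁻¹ • m) h1
      simpa only [smul_smul, ← mul_assoc, ENNReal.inv_mul_cancel hp0 hp, one_mul, one_smul] using h2
    density_norm := fun a => by
      have h1 := h.density_norm a
      rwa [hcov, Measure.ae_ennreal_smul_measure_iff hp0] at h1
    memLp_outcome := by
      have h1 := h.memLp_outcome.smul_measure (ENNReal.inv_ne_top.2 hp0)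
      rwa [hinv] at h1
    memLp_mean := by
      have h1 := h.memLp_mean.smul_measure (ENNReal.inv_ne_top.2 hp0)
      rwa [hinv] at h1
    residual := fun ψ hψ B hB => by
      have h1 := h.residual ψ hψ B ((Measure.ae_ennreal_smul_measure_iff hp0).2 hB)
      rw [integral_smul_measure, smul_eq_mul] at h1
      exact (mul_eq_zero.1 h1).resolve_left (ENNReal.toReal_ne_zero.2 ⟨hp0, hp⟩) }

lemma mergeMed_eq_updateFinset {K n : ℕ} (U : Finset (Fin K × Fin n)) (m₀ m₁ : Med K n) :
    mergeMed U m₀ m₁ = Function.updateFinset m₁ U (U.restrict m₀) := by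
  funext t
  by_cases ht : t ∈ U <;> simp [mergeMed, Function.updateFinset, ht]

namespace FullData.SuperPopulation

variable {Ω : Type*} [mΩ : MeasurableSpace Ω] [StandardBorelSpace Ω] [Nonempty Ω]
  {𝒰 : Type*} [MeasurableSpace 𝒰] {K dV dX : ℕ}
  {D : FullData Ω 𝒰 K dV dX} {μ : Measure Ω} [IsProbabilityMeasure μ]
  {ν : Fin K → Measure ℝ} [∀ k, IsFiniteMeasure (ν k)] {π : ℝ} {w : (Fin dV → ℝ) → ℕ → ℝ}
  {n nmax : ℕ} {lo hi w₀ : ℝ}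

lemma isNuisance (hP : IsRegularLaw ν π w (D.obsLaw μ) nmax lo hi w₀)
    (hn : μ (D.N ⁻¹' {n}) ≠ 0) (j : Fin n) :
    IsNuisance ((μ[|D.N ⁻¹' {n}]).map (D.obsN n)) (fun y => y j) (coordMeasure ν n) π
      (medDensity ν (D.obsLaw μ) n) (outcomeMean (D.obsLaw μ) n j) lo hi := by
  have h1 := hP.isNuisance n j
  have h2 : slice (D.obsLaw μ) n = _ := slice_obsLaw D μ n
  exact IsNuisance.of_smul hn (measure_ne_top μ _) (h2 ▸ h1)

lemma covLaw_obsN (D : FullData Ω 𝒰 K dV dX) (n : ℕ) :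
    covLaw ((μ[|D.N ⁻¹' {n}]).map (D.obsN n)) = (μ[|D.N ⁻¹' {n}]).map (D.C n) :=
  Measure.map_map (by fun_prop) (D.measurable_obsN n)

lemma cond_arm (h : D.SuperPopulation μ ν π) (hP : IsRegularLaw ν π w (D.obsLaw μ) nmax lo hi w₀)
    (hn : μ (D.N ⁻¹' {n}) ≠ 0) (a : Fin 2) :
    μ[|D.N ⁻¹' {n}] (D.A ⁻¹' {a}) = ENNReal.ofReal (propensity π a) := by
  have hm : MeasurableSet ({o | trt o = a} : Set (Obs K dV dX)) :=
    trt_measurable (measurableSet_singleton a)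
  have h1 := measure_trt_eq hP.propensity_pos hP.mem_model.1 a
  change (μ.map D.obs) _ = _ at h1
  rw [Measure.map_apply D.measurable_obs hm] at h1
  rw [h.cond_trt hn, ← h1]
  rfl

/-- By randomisation, the mediator density of an arm is that of the potential mediators. -/
lemma map_potential (h : D.SuperPopulation μ ν π)
    (hP : IsRegularLaw ν π w (D.obsLaw μ) nmax lo hi w₀) (hn : μ (D.N ⁻¹' {n}) ≠ 0) (a : Fin 2) :
    (μ[|D.N ⁻¹' {n}]).map (fun ω => (D.C n ω, D.Mpot n a ω))
      = (covBase (coordMeasure ν n) ((μ[|D.N ⁻¹' {n}]).map (D.obsN n))).withDensity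
          fun q => medDensity ν (D.obsLaw μ) n a q.1 q.2 := by
  have hCM : Measurable fun ω => (D.C n ω, D.Mpot n a ω) :=
    (D.measurable_C n).prodMk (D.measurable_Mpot n a)
  have hlaw := (isNuisance hP hn ⟨0, h.size_pos hn⟩).law a
  have hind : IndepFun D.A (fun ω => (D.C n ω, D.Mpot n a ω)) (μ[|D.N ⁻¹' {n}]) :=
    (h.randomization n ⟨0, h.size_pos hn⟩ a).comp measurable_id
      (measurable_fst.prodMk (measurable_fst.comp measurable_snd))
  have hp : ENNReal.ofReal (propensity π a) ≠ 0 := by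
    simpa using propensity_pos hP.propensity_pos hP.propensity_lt_one a
  ext T hT
  have hS : MeasurableSet {x : ObsN K dV dX n | x.1 = a} :=
    measurable_fst (measurableSet_singleton a)
  have h1 := congrArg (fun m => m T) hlaw
  rw [Measure.map_apply measurable_covMed hT, Measure.restrict_apply (measurable_covMed hT),
    Measure.map_apply (D.measurable_obsN n) ((measurable_covMed hT).inter hS),
    Measure.smul_apply, smul_eq_mul] at h1
  have e : D.obsN n ⁻¹' (covMed ⁻¹' T ∩ {x | x.1 = a})
      = D.A ⁻¹' {a} ∩ (fun ω => (D.C n ω, D.Mpot n a ω)) ⁻¹' T := by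
    ext ω
    simp only [Set.mem_preimage, Set.mem_inter_iff, Set.mem_ofPred_eq, Set.mem_singleton_iff, obsN,
      covMed]
    constructor
    · rintro ⟨hω, rfl⟩
      exact ⟨rfl, hω⟩
    · rintro ⟨rfl, hω⟩
      exact ⟨hω, rfl⟩
  rw [e, (indepFun_iff_measure_inter_preimage_eq_mul.1 hind) {a} T (measurableSet_singleton a) hT,
    h.cond_arm hP hn] at h1
  rw [Measure.map_apply hCM hT]
  exact (ENNReal.mul_right_inj hp ENNReal.ofReal_ne_top).1 h1

/-- By randomisation, the outcome regression of an arm is that of the potential outcome at the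
potential mediators of that arm. -/
lemma integral_mul_potential (h : D.SuperPopulation μ ν π)
    (hP : IsRegularLaw ν π w (D.obsLaw μ) nmax lo hi w₀) (hn : μ (D.N ⁻¹' {n}) ≠ 0)
    (j : Fin n) (a : Fin 2) {k : Cov dV dX n × Med K n → ℝ} (hk : Measurable k) {B : ℝ}
    (hB : ∀ᵐ q ∂(covBase (coordMeasure ν n) ((μ[|D.N ⁻¹' {n}]).map (D.obsN n))), |k q| ≤ B) :
    ∫ ω, k (D.C n ω, D.Mpot n a ω) * D.Y n j a (D.Mpot n a ω) ω ∂(μ[|D.N ⁻¹' {n}])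
      = ∫ q, (medDensity ν (D.obsLaw μ) n a q.1 q.2).toReal
          * (k q * outcomeMean (D.obsLaw μ) n j a q.2 q.1)
          ∂(covBase (coordMeasure ν n) ((μ[|D.N ⁻¹' {n}]).map (D.obsN n))) := by
  have hprob : IsProbabilityMeasure (μ[|D.N ⁻¹' {n}]) := isProbabilityMeasure_size hn
  have hL := isNuisance hP hn j
  have h1 := hL.integral_armWeight_outcome a hk hB (e := fun _ => 0) measurable_const
    (integrable_const 0)
  simp only [sub_zero] at h1
  rw [← h1, integral_map (D.measurable_obsN n).aemeasurable]
  · have e1 : ∀ ω, armWeight π a (D.obsN n ω).1 * (k (covMed (D.obsN n ω)) * (D.obsN n ω).2.2.2 j)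
        = armWeight π a (D.A ω) *
          (k (D.C n ω, D.Mpot n a ω) * D.Y n j a (D.Mpot n a ω) ω) := fun ω =>
      armWeight_mul_arm π a (D.A ω)
        fun A => k (D.C n ω, D.Mpot n A ω) * D.Y n j A (D.Mpot n A ω) ω
    simp_rw [e1]
    have hg : Measurable fun r : Cov dV dX n × Med K n × 𝒰 =>
        k (r.1, r.2.1) * D.ev n r.2.2 r.2.1 :=
      (hk.comp (by fun_prop)).mul ((D.measurable_ev n).comp
        ((measurable_snd.comp measurable_snd).prodMk (measurable_fst.comp measurable_snd)))
    have hind : IndepFun (fun ω => armWeight π a (D.A ω))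
        (fun ω => k (D.C n ω, D.Mpot n a ω) * D.Y n j a (D.Mpot n a ω) ω) (μ[|D.N ⁻¹' {n}]) :=
      (h.randomization n j a).comp (measurable_of_countable (armWeight π a)) hg
    rw [hind.integral_fun_mul_eq_mul_integral
      (((measurable_of_countable (armWeight π a)).comp D.measurable_A).aestronglyMeasurable)
      ((hg.comp ((D.measurable_C n).prodMk ((D.measurable_Mpot n a).prodMk
        (D.measurable_Ypot n j a)))).aestronglyMeasurable)]
    have hA : ∫ ω, armWeight π a (D.A ω) ∂(μ[|D.N ⁻¹' {n}]) = 1 := by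
      have hp := propensity_pos hP.propensity_pos hP.propensity_lt_one a
      have e2 : ∀ ω, armWeight π a (D.A ω)
          = (D.A ⁻¹' {a}).indicator (fun _ => (propensity π a)⁻¹) ω := by
        intro ω
        by_cases hω : D.A ω = a <;> simp [armWeight, Set.indicator, hω]
      simp_rw [e2]
      rw [integral_indicator (D.measurable_A (measurableSet_singleton a)), setIntegral_const,
        Measure.real, h.cond_arm hP hn, ENNReal.toReal_ofReal hp.le, smul_eq_mul,
        mul_inv_cancel₀ hp.ne']
    rw [hA, one_mul]
  · exact (((measurable_armWeight π a).mul ((hk.comp measurable_covMed).mul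
      (by fun_prop))).aestronglyMeasurable)

end FullData.SuperPopulation

/-! ### The mean potential outcome at a counterfactual mediator array -/

namespace FullData.SuperPopulation

variable {Ω : Type*} [mΩ : MeasurableSpace Ω] [StandardBorelSpace Ω] [Nonempty Ω]
  {𝒰 : Type*} [MeasurableSpace 𝒰] {K dV dX : ℕ}
  {D : FullData Ω 𝒰 K dV dX} {μ : Measure Ω} [IsProbabilityMeasure μ]
  {ν : Fin K → Measure ℝ} [∀ k, IsFiniteMeasure (ν k)] {π : ℝ} {w : (Fin dV → ℝ) → ℕ → ℝ}
  {n nmax : ℕ} {lo hi w₀ : ℝ}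

lemma abs_covWeight_le (hP : IsRegularLaw ν π w (D.obsLaw μ) nmax lo hi w₀)
    (hn : μ (D.N ⁻¹' {n}) ≠ 0) :
    ∀ᵐ c ∂(covLaw ((μ[|D.N ⁻¹' {n}]).map (D.obsN n))), |covWeight w n c| ≤ w₀ := by
  have h1 := hP.abs_covWeight_le n
  have h2 : slice (D.obsLaw μ) n = _ := slice_obsLaw D μ n
  rw [h2, covLaw, Measure.map_smul, Measure.ae_ennreal_smul_measure_iff hn] at h1
  exact h1

/-- The weighted mean of the potential outcome at the potential mediators of the same arm. -/
lemma integral_weight_mul_potential (h : D.SuperPopulation μ ν π)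
    (hP : IsRegularLaw ν π w (D.obsLaw μ) nmax lo hi w₀) (hn : μ (D.N ⁻¹' {n}) ≠ 0)
    (j : Fin n) (a : Fin 2) :
    ∫ ω, covWeight w n (D.C n ω) * D.Y n j a (D.Mpot n a ω) ω ∂(μ[|D.N ⁻¹' {n}])
      = ∫ c, covWeight w n c * etaStar ν (D.obsLaw μ) n j a a c
          ∂(covLaw ((μ[|D.N ⁻¹' {n}]).map (D.obsN n))) := by
  have hprob : IsProbabilityMeasure (μ[|D.N ⁻¹' {n}]) := isProbabilityMeasure_size hn
  have hL := isNuisance hP hn j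
  have hw := abs_covWeight_le hP hn
  have hW := hP.measurable_covWeight (w := w) (ν := ν) n
  have h1 := h.integral_mul_potential hP hn j a (k := fun q => covWeight w n q.1)
    (hW.comp measurable_fst) (ae_covBase_of_covLaw hw)
  have hi := integrable_weight_mul hW hw (hL.memLp_subMass_mul a ∅ (hL.memLp_covBase_mean a))
  simp only [subMass_empty] at hi
  refine h1.trans ?_
  have e : ∫ q : Cov dV dX n × Med K n, (medDensity ν (D.obsLaw μ) n a q.1 q.2).toReal
          * (covWeight w n q.1 * outcomeMean (D.obsLaw μ) n j a q.2 q.1)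
          ∂(covBase (coordMeasure ν n) ((μ[|D.N ⁻¹' {n}]).map (D.obsN n)))
      = ∫ q : Cov dV dX n × Med K n, covWeight w n q.1 *
          (outcomeMean (D.obsLaw μ) n j a q.2 q.1
            * (medDensity ν (D.obsLaw μ) n a q.1 q.2).toReal)
          ∂(covBase (coordMeasure ν n) ((μ[|D.N ⁻¹' {n}]).map (D.obsN n))) :=
    integral_congr_ae (Eventually.of_forall fun q => by ring)
  rw [e]
  unfold covBase at hi ⊢
  rw [integral_prod _ hi]
  simp only [integral_const_mul]
  rfl

/-- Mediator-outcome ignorability passes from conditioning on `(A, C)` to conditioning on `C`. -/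
lemma map_ignorable (h : D.SuperPopulation μ ν π) (hn : μ (D.N ⁻¹' {n}) ≠ 0)
    (hign : D.MediatorOutcomeIgnorability μ) (j : Fin n) {g : Med K n × Med K n → Med K n}
    (hg : Measurable g) :
    (μ[|D.N ⁻¹' {n}]).map (fun ω => ((D.C n ω, g (D.Mpot n 0 ω, D.Mpot n 1 ω)), D.Ypot n j 1 ω))
      = (μ[|D.N ⁻¹' {n}]).map (fun ω => (D.C n ω, g (D.Mpot n 0 ω, D.Mpot n 1 ω))) ⊗ₘ
        condLaw (μ[|D.N ⁻¹' {n}]) (D.C n) (D.Ypot n j 1) (Fin K × Fin n) := by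
  have hprob : IsProbabilityMeasure (μ[|D.N ⁻¹' {n}]) := isProbabilityMeasure_size hn
  exact ((hign n j 1).comp measurable_id hg).map_prodMk_eq_compProd_of_indepFun D.measurable_A
    (D.measurable_C n) (hg.comp ((D.measurable_Mpot n 0).prodMk (D.measurable_Mpot n 1)))
    (D.measurable_Ypot n j 1)
    ((h.randomization n j 1).comp measurable_id
      (measurable_fst.prodMk (measurable_snd.comp measurable_snd)))

lemma mean_indicator (h : D.SuperPopulation μ ν π)
    (hP : IsRegularLaw ν π w (D.obsLaw μ) nmax lo hi w₀) (hn : μ (D.N ⁻¹' {n}) ≠ 0)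
    (j : Fin n) (S : Set (Cov dV dX n × Med K n)) (hS : MeasurableSet S) :
    ∫ ω, S.indicator 1 (D.C n ω, D.Mpot n 1 ω) * D.ev n (D.Ypot n j 1 ω) (D.Mpot n 1 ω)
        ∂(μ[|D.N ⁻¹' {n}])
      = ∫ q, (medDensity ν (D.obsLaw μ) n 1 q.1 q.2).toReal
          * (S.indicator 1 q * outcomeMean (D.obsLaw μ) n j 1 q.2 q.1)
          ∂(covBase (coordMeasure ν n) ((μ[|D.N ⁻¹' {n}]).map (D.obsN n))) := by
  refine h.integral_mul_potential hP hn j 1 (measurable_one.indicator hS) (B := 1)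
    (Eventually.of_forall fun q => ?_)
  by_cases hq : q ∈ S <;> simp [Set.indicator, hq]

/-- The law of the covariates and the outcome-generating function, with mediators drawn from the
product of two marginal densities. -/
noncomputable def crossLaw (D : FullData Ω 𝒰 K dV dX) (μ : Measure Ω) [IsProbabilityMeasure μ]
    (ν : Fin K → Measure ℝ) (n : ℕ) (j : Fin n) (U : Finset (Fin K × Fin n)) :
    Measure ((Cov dV dX n × Med K n) × 𝒰) :=
  ((covBase (coordMeasure ν n) ((μ[|D.N ⁻¹' {n}]).map (D.obsN n))).withDensity
    (mergeDensity (coordMeasure ν n) U (medDensity ν (D.obsLaw μ) n 0)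
      (medDensity ν (D.obsLaw μ) n 1))) ⊗ₘ
    condLaw (μ[|D.N ⁻¹' {n}]) (D.C n) (D.Ypot n j 1) (Fin K × Fin n)

lemma integrable_crossLaw (h : D.SuperPopulation μ ν π)
    (hP : IsRegularLaw ν π w (D.obsLaw μ) nmax lo hi w₀) (hn : μ (D.N ⁻¹' {n}) ≠ 0)
    (hign : D.MediatorOutcomeIgnorability μ) (j : Fin n) (U : Finset (Fin K × Fin n)) :
    Integrable (fun z : (Cov dV dX n × Med K n) × 𝒰 => covWeight w n z.1.1 * D.ev n z.2 z.1.2)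
      (crossLaw D μ ν n j U) := by
  have hprob : IsProbabilityMeasure (μ[|D.N ⁻¹' {n}]) := isProbabilityMeasure_size hn
  exact (isNuisance hP hn j).integrable_weight_mul_outcome (D.measurable_C n)
    (D.measurable_Mpot n 1) (D.measurable_Ypot n j 1) (h.map_potential hP hn 1)
    (h.map_ignorable hn hign j measurable_snd) (D.measurable_ev n)
    ((h.memLp_potential j 1).integrable (by norm_num)) U (hP.measurable_covWeight n)
    (abs_covWeight_le hP hn)

lemma integral_crossLaw (h : D.SuperPopulation μ ν π)
    (hP : IsRegularLaw ν π w (D.obsLaw μ) nmax lo hi w₀) (hn : μ (D.N ⁻¹' {n}) ≠ 0)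
    (hign : D.MediatorOutcomeIgnorability μ) (j : Fin n) (U : Finset (Fin K × Fin n)) :
    ∫ z, covWeight w n z.1.1 * D.ev n z.2 z.1.2 ∂(crossLaw D μ ν n j U)
      = ∫ c, covWeight w n c * crossMean (coordMeasure ν n) (medDensity ν (D.obsLaw μ) n)
          (outcomeMean (D.obsLaw μ) n j) Uᶜ U 1 0 1 c
          ∂(covLaw ((μ[|D.N ⁻¹' {n}]).map (D.obsN n))) := by
  have hprob : IsProbabilityMeasure (μ[|D.N ⁻¹' {n}]) := isProbabilityMeasure_size hn
  exact (isNuisance hP hn j).integral_weight_mul_outcome (D.measurable_C n)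
    (D.measurable_Mpot n 1) (D.measurable_Ypot n j 1) (h.map_potential hP hn 1)
    (h.map_ignorable hn hign j measurable_snd) (D.measurable_ev n)
    ((h.memLp_potential j 1).integrable (by norm_num)) (h.mean_indicator hP hn j) U
    (hP.measurable_covWeight n) (abs_covWeight_le hP hn)

/-- The mean potential outcome at a merged mediator array with the product density. -/
lemma integral_weight_mul_of_map_Mmix (h : D.SuperPopulation μ ν π)
    (hP : IsRegularLaw ν π w (D.obsLaw μ) nmax lo hi w₀) (hn : μ (D.N ⁻¹' {n}) ≠ 0)
    (hign : D.MediatorOutcomeIgnorability μ) (j : Fin n) (U : Finset (Fin K × Fin n))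
    (hmix : (μ[|D.N ⁻¹' {n}]).map (fun ω => (D.C n ω, D.Mmix n U ω))
      = (covBase (coordMeasure ν n) ((μ[|D.N ⁻¹' {n}]).map (D.obsN n))).withDensity
        (mergeDensity (coordMeasure ν n) U (medDensity ν (D.obsLaw μ) n 0)
          (medDensity ν (D.obsLaw μ) n 1))) :
    ∫ ω, covWeight w n (D.C n ω) * D.Y n j 1 (D.Mmix n U ω) ω ∂(μ[|D.N ⁻¹' {n}])
      = ∫ c, covWeight w n c * crossMean (coordMeasure ν n) (medDensity ν (D.obsLaw μ) n)
          (outcomeMean (D.obsLaw μ) n j) Uᶜ U 1 0 1 c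
          ∂(covLaw ((μ[|D.N ⁻¹' {n}]).map (D.obsN n))) := by
  have e : D.Mmix n U = fun ω => Function.updateFinset (D.Mpot n 1 ω) U
      (U.restrict (D.Mpot n 0 ω)) := funext fun ω => mergeMed_eq_updateFinset _ _ _
  have hlaw := h.map_ignorable hn hign j (measurable_merge U)
  rw [e] at hmix
  rw [hmix] at hlaw
  rw [← h.integral_crossLaw hP hn hign j U, crossLaw, ← hlaw, integral_map, e]
  · rfl
  · exact (((D.measurable_C n).prodMk ((measurable_merge U).comp ((D.measurable_Mpot n 0).prodMk
      (D.measurable_Mpot n 1)))).prodMk (D.measurable_Ypot n j 1)).aemeasurable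
  · rw [hlaw]
    exact (h.integrable_crossLaw hP hn hign j U).1

/-- All mediators from the control arm. -/
lemma integral_weight_mul_control (h : D.SuperPopulation μ ν π)
    (hP : IsRegularLaw ν π w (D.obsLaw μ) nmax lo hi w₀) (hn : μ (D.N ⁻¹' {n}) ≠ 0)
    (hign : D.MediatorOutcomeIgnorability μ) (j : Fin n) :
    ∫ ω, covWeight w n (D.C n ω) * D.Y n j 1 (D.Mmix n Finset.univ ω) ω ∂(μ[|D.N ⁻¹' {n}])
      = ∫ c, covWeight w n c * etaStar ν (D.obsLaw μ) n j 1 0 c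
          ∂(covLaw ((μ[|D.N ⁻¹' {n}]).map (D.obsN n))) := by
  have hnorm := (isNuisance hP hn j).density_norm 1
  rw [h.integral_weight_mul_of_map_Mmix hP hn hign j Finset.univ]
  · refine integral_congr_ae ?_
    filter_upwards [hnorm] with c hc
    rw [crossMean_univ hc]
  · simp only [Mmix_univ]
    rw [h.map_potential hP hn 0]
    refine withDensity_congr_ae ?_
    filter_upwards [ae_covBase_of_covLaw hnorm] with q hq
    simp only [mergeDensity, Finset.compl_univ, lmarginal_empty, lmarginal_univ, hq, mul_one]

/-- Cross-world independent mediators. -/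
lemma integral_weight_mul_crossWorld (h : D.SuperPopulation μ ν π)
    (hP : IsRegularLaw ν π w (D.obsLaw μ) nmax lo hi w₀) (hn : μ (D.N ⁻¹' {n}) ≠ 0)
    (hign : D.MediatorOutcomeIgnorability μ) (j : Fin n) (U : Finset (Fin K × Fin n))
    (hcross : CondIndepFun (MeasurableSpace.comap (D.C n) inferInstance)
      (D.measurable_C n).comap_le (fun ω => U.restrict (D.Mpot n 0 ω))
      (fun ω => Uᶜ.restrict (D.Mpot n 1 ω)) (μ[|D.N ⁻¹' {n}])) :
    ∫ ω, covWeight w n (D.C n ω) * D.Y n j 1 (D.Mmix n U ω) ω ∂(μ[|D.N ⁻¹' {n}])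
      = ∫ c, covWeight w n c * crossMean (coordMeasure ν n) (medDensity ν (D.obsLaw μ) n)
          (outcomeMean (D.obsLaw μ) n j) Uᶜ U 1 0 1 c
          ∂(covLaw ((μ[|D.N ⁻¹' {n}]).map (D.obsN n))) := by
  have hprob : IsProbabilityMeasure (μ[|D.N ⁻¹' {n}]) := isProbabilityMeasure_size hn
  have hlaw₀ := h.map_potential hP hn 0
  have hlaw₁ := h.map_potential hP hn 1
  have hind := h.map_ignorable hn hign j measurable_snd
  refine h.integral_weight_mul_of_map_Mmix hP hn hign j U ?_
  rw [covBase, covLaw_obsN] at hlaw₀ hlaw₁ ⊢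
  have e : D.Mmix n U = fun ω => Function.updateFinset (D.Mpot n 1 ω) U
      (U.restrict (D.Mpot n 0 ω)) := funext fun ω => mergeMed_eq_updateFinset _ _ _
  rw [e]
  exact map_merge_eq_withDensity (D.measurable_C n) (D.measurable_Mpot n 0) (D.measurable_Mpot n 1)
    (D.measurable_Ypot n j 1) (measurable_medDensity ν _ n 0) (measurable_medDensity ν _ n 1)
    hlaw₀ hlaw₁ hind U hcross

end FullData.SuperPopulation

/-! ### Conditional homogeneity -/

namespace FullData.SuperPopulation

variable {Ω : Type*} [mΩ : MeasurableSpace Ω] [StandardBorelSpace Ω] [Nonempty Ω]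
  {𝒰 : Type*} [MeasurableSpace 𝒰] {K dV dX : ℕ}
  {D : FullData Ω 𝒰 K dV dX} {μ : Measure Ω} [IsProbabilityMeasure μ]
  {ν : Fin K → Measure ℝ} [∀ k, IsFiniteMeasure (ν k)] {π : ℝ} {w : (Fin dV → ℝ) → ℕ → ℝ}
  {n nmax : ℕ} {lo hi w₀ : ℝ}

lemma ae_abs_covWeight_le (hP : IsRegularLaw ν π w (D.obsLaw μ) nmax lo hi w₀)
    (hn : μ (D.N ⁻¹' {n}) ≠ 0) :
    ∀ᵐ ω ∂(μ[|D.N ⁻¹' {n}]), |covWeight w n (D.C n ω)| ≤ w₀ := by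
  have h1 := abs_covWeight_le hP hn
  rw [covLaw_obsN] at h1
  exact ae_of_ae_map (D.measurable_C n).aemeasurable h1

lemma integrable_weight_mul_Mmix (h : D.SuperPopulation μ ν π)
    (hP : IsRegularLaw ν π w (D.obsLaw μ) nmax lo hi w₀) (hn : μ (D.N ⁻¹' {n}) ≠ 0)
    (j : Fin n) (a : Fin 2) (U : Finset (Fin K × Fin n)) :
    Integrable (fun ω => covWeight w n (D.C n ω) * D.Y n j a (D.Mmix n U ω) ω)
      (μ[|D.N ⁻¹' {n}]) :=
  ((h.second_moments n j a U).integrable (by norm_num)).bdd_mul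
    ((hP.measurable_covWeight n).comp (D.measurable_C n)).aestronglyMeasurable
    (ae_abs_covWeight_le hP hn)

/-- Under conditional homogeneity the mean of the cluster-average potential outcome does not change
when the treated world is redrawn given the covariates. -/
lemma sum_integral_weight_mul_homogeneous (h : D.SuperPopulation μ ν π)
    (hP : IsRegularLaw ν π w (D.obsLaw μ) nmax lo hi w₀) (hn : μ (D.N ⁻¹' {n}) ≠ 0)
    (hign : D.MediatorOutcomeIgnorability μ) {J Js : Finset (Fin K)}
    (hhom : D.ConditionalHomogeneity μ J) (hJs : Js ⊆ J) (h0 : Js ≠ ∅) (h1 : Js ≠ Finset.univ) :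
    ∑ j, ∫ ω, covWeight w n (D.C n ω) * D.Y n j 1 (D.Mmix n (blockSet Js n) ω) ω
        ∂(μ[|D.N ⁻¹' {n}])
      = ∑ j, ∫ c, covWeight w n c * crossMean (coordMeasure ν n) (medDensity ν (D.obsLaw μ) n)
          (outcomeMean (D.obsLaw μ) n j) (blockSet Js n)ᶜ (blockSet Js n) 1 0 1 c
          ∂(covLaw ((μ[|D.N ⁻¹' {n}]).map (D.obsN n))) := by
  have hprob : IsProbabilityMeasure (μ[|D.N ⁻¹' {n}]) := isProbabilityMeasure_size hn
  set U := blockSet Js n with hU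
  have hn0 : (n : ℝ) ≠ 0 := Nat.cast_ne_zero.2 (by have := h.size_pos hn; omega)
  have hC := D.measurable_C n
  have hWm : Measurable fun ω => covWeight w n (D.C n ω) := (hP.measurable_covWeight n).comp hC
  have hWb := ae_abs_covWeight_le hP hn
  -- the outcome at the redrawn array, as a function of the two conditionally independent copies
  have hlaw₀ := h.map_potential hP hn 0
  have hlaw₁ := h.map_potential hP hn 1
  rw [covBase, covLaw_obsN] at hlaw₀ hlaw₁
  have hmap : ∀ j, (decoupled (μ[|D.N ⁻¹' {n}]) (D.C n) hC).map (fun p =>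
        ((D.C n p.1, Function.updateFinset (D.Mpot n 1 p.2) U (U.restrict (D.Mpot n 0 p.1))),
          D.Ypot n j 1 p.2)) = crossLaw D μ ν n j U := by
    intro j
    rw [map_decoupled hC (D.measurable_Mpot n 0) (D.measurable_Mpot n 1) (D.measurable_Ypot n j 1)
      (measurable_medDensity ν _ n 0) (measurable_medDensity ν _ n 1) hlaw₀ hlaw₁
      (h.map_ignorable hn hign j measurable_snd) U, crossLaw, covBase, covLaw_obsN]
  have hTm := fun j => measurable_decoupled hC (D.measurable_Mpot n 0) (D.measurable_Mpot n 1)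
    (D.measurable_Ypot n j 1) U
  set G : Fin n → Ω × Ω → ℝ := fun j p => covWeight w n (D.C n p.1) *
    D.Y n j 1 (mergeMed U (D.Mpot n 0 p.1) (D.Mpot n 1 p.2)) p.2 with hG
  have hGi : ∀ j, Integrable (G j) (decoupled (μ[|D.N ⁻¹' {n}]) (D.C n) hC) := by
    intro j
    have h2 := h.integrable_crossLaw hP hn hign j U
    have h3 := h2.1
    rw [← hmap j] at h2 h3
    rw [integrable_map_measure h3 (hTm j).aemeasurable] at h2
    refine h2.congr (Eventually.of_forall fun p => ?_)
    simp only [hG, mergeMed_eq_updateFinset]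
    rfl
  have hGv : ∀ j, ∫ p, G j p ∂(decoupled (μ[|D.N ⁻¹' {n}]) (D.C n) hC)
      = ∫ z, covWeight w n z.1.1 * D.ev n z.2 z.1.2 ∂(crossLaw D μ ν n j U) := by
    intro j
    rw [← hmap j, integral_map (hTm j).aemeasurable
      (by rw [hmap j]; exact (h.integrable_crossLaw hP hn hign j U).1)]
    refine integral_congr_ae (Eventually.of_forall fun p => ?_)
    simp only [hG, mergeMed_eq_updateFinset]
    rfl
  have hZ : Measurable fun ω' => (D.C n ω', U.restrict (D.Mpot n 0 ω')) :=
    hC.prodMk ((Finset.measurable_restrict U).comp (D.measurable_Mpot n 0))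
  have hYi : Integrable (fun ω => D.Ybar n (D.Mmix n U ω) ω) (μ[|D.N ⁻¹' {n}]) :=
    (integrable_finsetSum Finset.univ fun j _ =>
      (h.second_moments n j 1 U).integrable (by norm_num)).const_mul _
  have hWs : StronglyMeasurable[MeasurableSpace.comap
      (fun ω' => (D.C n ω', U.restrict (D.Mpot n 0 ω'))) inferInstance]
      (fun ω => covWeight w n (D.C n ω)) :=
    ((hP.measurable_covWeight n).comp measurable_fst).stronglyMeasurable.comp_measurable
      (comap_measurable _)
  have hWY : Integrable (fun ω => covWeight w n (D.C n ω) * D.Ybar n (D.Mmix n U ω) ω)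
      (μ[|D.N ⁻¹' {n}]) := hYi.bdd_mul hWm.aestronglyMeasurable hWb
  have hpull := condExp_mul_of_stronglyMeasurable_left (μ := μ[|D.N ⁻¹' {n}]) hWs hWY hYi
  have key : ∫ ω, covWeight w n (D.C n ω) * D.Ybar n (D.Mmix n U ω) ω ∂(μ[|D.N ⁻¹' {n}])
      = ∫ p, (n : ℝ)⁻¹ * ∑ j, G j p ∂(decoupled (μ[|D.N ⁻¹' {n}]) (D.C n) hC) := by
    have hsum : Integrable (fun p => (n : ℝ)⁻¹ * ∑ j, G j p)
        (decoupled (μ[|D.N ⁻¹' {n}]) (D.C n) hC) :=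
      (integrable_finsetSum Finset.univ fun j _ => hGi j).const_mul _
    rw [← integral_condExp (μ := μ[|D.N ⁻¹' {n}]) (f := fun ω => covWeight w n (D.C n ω) *
      D.Ybar n (D.Mmix n U ω) ω) hZ.comap_le, decoupled, Measure.integral_compProd hsum]
    refine integral_congr_ae ?_
    filter_upwards [hpull, hhom Js hJs h0 h1 n,
      ae_condExpKernel_eq_condDistrib (μ := μ[|D.N ⁻¹' {n}]) hC] with ω e1 e2 e3
    refine e1.trans ?_
    rw [Pi.mul_apply, e2, e3, ← integral_const_mul]
    refine integral_congr_ae (Eventually.of_forall fun ω' => ?_)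
    simp only [hG, Ybar, ← Finset.mul_sum]
    ring
  rw [integral_const_mul, integral_finsetSum _ fun j _ => hGi j] at key
  have e4 : ∫ ω, covWeight w n (D.C n ω) * D.Ybar n (D.Mmix n U ω) ω ∂(μ[|D.N ⁻¹' {n}])
      = (n : ℝ)⁻¹ * ∑ j, ∫ ω, covWeight w n (D.C n ω) * D.Y n j 1 (D.Mmix n U ω) ω
        ∂(μ[|D.N ⁻¹' {n}]) := by
    rw [← integral_finsetSum _ fun j _ => h.integrable_weight_mul_Mmix hP hn j 1 U,
      ← integral_const_mul]
    refine integral_congr_ae (Eventually.of_forall fun ω => ?_)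
    simp only [Ybar, ← Finset.mul_sum]
    ring
  rw [e4] at key
  refine (mul_left_cancel₀ (inv_ne_zero hn0) key).trans (Finset.sum_congr rfl fun j _ => ?_)
  rw [hGv j, h.integral_crossLaw hP hn hign j U]

/-! ### Identification of the causal estimands -/

/-- Identification within each cluster size implies identification of the estimand. -/
lemma integral_estimand_eq (h : D.SuperPopulation μ ν π)
    (hP : IsRegularLaw ν π w (D.obsLaw μ) nmax lo hi w₀) (a : Fin 2)
    (U : ∀ n, Fin n → Finset (Fin K × Fin n)) {g : ∀ n, Fin n → Cov dV dX n → ℝ}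
    (hg : ∀ n j, MemLp (g n j) 2 (covLaw (slice (D.obsLaw μ) n)))
    (hn : ∀ n, μ (D.N ⁻¹' {n}) ≠ 0 →
      ∑ j, ∫ ω, covWeight w n (D.C n ω) * D.Y n j a (D.Mmix n (U n j) ω) ω ∂(μ[|D.N ⁻¹' {n}])
        = ∑ j, ∫ c, covWeight w n c * g n j c ∂(covLaw ((μ[|D.N ⁻¹' {n}]).map (D.obsN n)))) :
    ∫ ω, w (D.V ω) (D.N ω) / (D.N ω : ℝ) *
        ∑ j : Fin (D.N ω), D.Y (D.N ω) j a (D.Mmix (D.N ω) (U (D.N ω) j) ω) ω ∂μ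
      = ∫ o, weightedAvg w (fun n j x => g n j x.2.1) o
          ∂(D.obsLaw μ : Measure (Obs K dV dX)) := by
  have hμ : μ = ∑ n ∈ Finset.range (nmax + 1), μ (D.N ⁻¹' {n}) • μ[|D.N ⁻¹' {n}] := by
    simp_rw [← restrict_eq_smul_cond]
    ext S hS
    rw [Measure.finsetSum_apply]
    have hzero : ∀ n ∉ Finset.range (nmax + 1), μ.restrict (D.N ⁻¹' {n}) S = 0 := by
      intro n hn'
      have h2 : μ (D.N ⁻¹' {n}) = 0 := by
        by_contra h3
        refine hn' (Finset.mem_range.2 (Nat.lt_succ_of_le (hP.size_le n fun h4 => h3 ?_)))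
        have hprob : IsProbabilityMeasure (μ[|D.N ⁻¹' {n}]) := isProbabilityMeasure_size h3
        have h5 : slice (D.obsLaw μ) n Set.univ = 0 := by rw [h4]; rfl
        rwa [slice_obsLaw, Measure.smul_apply,
          Measure.map_apply (D.measurable_obsN n) MeasurableSet.univ, Set.preimage_univ,
          measure_univ, smul_eq_mul, mul_one] at h5
      rw [Measure.restrict_eq_zero.2 h2]
      rfl
    have hts := tsum_eq_sum (L := SummationFilter.unconditional ℕ) (fun n hn' => hzero n hn')
    rw [← hts]
    simp_rw [Measure.restrict_apply hS]
    rw [← measure_iUnion]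
    · congr 1
      ext ω
      simp
    · intro i k hik
      exact Set.disjoint_left.2 fun ω hi hk => hik (hi.2.symm.trans hk.2)
    · exact fun n => hS.inter (D.measurableSet_size n)
  set F : Ω → ℝ := fun ω => w (D.V ω) (D.N ω) / (D.N ω : ℝ) *
    ∑ j : Fin (D.N ω), D.Y (D.N ω) j a (D.Mmix (D.N ω) (U (D.N ω) j) ω) ω with hF
  have hFae : ∀ n, F =ᵐ[μ (D.N ⁻¹' {n}) • μ[|D.N ⁻¹' {n}]] fun ω =>
      ∑ j, covWeight w n (D.C n ω) * D.Y n j a (D.Mmix n (U n j) ω) ω := by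
    intro n
    rw [← restrict_eq_smul_cond]
    filter_upwards [ae_restrict_mem (D.measurableSet_size n)] with ω hω
    obtain rfl : D.N ω = n := hω
    rw [← Finset.mul_sum]
    rfl
  have hi : ∀ n, Integrable (fun ω =>
      ∑ j, covWeight w n (D.C n ω) * D.Y n j a (D.Mmix n (U n j) ω) ω)
      (μ (D.N ⁻¹' {n}) • μ[|D.N ⁻¹' {n}]) := by
    intro n
    rcases eq_or_ne (μ (D.N ⁻¹' {n})) 0 with h0 | h0
    · rw [h0, zero_smul]
      exact integrable_zero_measure
    · exact (integrable_finsetSum Finset.univ fun j _ =>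
        h.integrable_weight_mul_Mmix hP h0 j a (U n j)).smul_measure (measure_ne_top _ _)
  rw [hP.integral_weightedAvg fun n j => IsNuisance.memLp_comp_cov (hg n j)]
  conv_lhs => rw [hμ]
  rw [integral_finsetSum_measure fun n _ => (hi n).congr (hFae n).symm]
  refine Finset.sum_congr rfl fun n _ => ?_
  rw [integral_congr_ae (hFae n)]
  rcases eq_or_ne (μ (D.N ⁻¹' {n})) 0 with h0 | h0
  · simp [slice_obsLaw, h0]
  · rw [integral_smul_measure, integral_finsetSum _ fun j _ =>
      h.integrable_weight_mul_Mmix hP h0 j a (U n j), hn n h0, smul_eq_mul, Finset.mul_sum]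
    refine Finset.sum_congr rfl fun j _ => ?_
    have hcov : covLaw (slice (D.obsLaw μ) n)
        = μ (D.N ⁻¹' {n}) • covLaw ((μ[|D.N ⁻¹' {n}]).map (D.obsN n)) := by
      rw [slice_obsLaw, covLaw, covLaw, Measure.map_smul]
    have hWg : AEStronglyMeasurable (fun c => covWeight w n c * g n j c)
        (covLaw (slice (D.obsLaw μ) n)) :=
      (hP.measurable_covWeight n).aestronglyMeasurable.mul (hg n j).1
    have e := integral_map (μ := slice (D.obsLaw μ) n) (φ := fun x : ObsN K dV dX n => x.2.1)
      (by fun_prop) hWg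
    rw [← e, ← covLaw, hcov, integral_smul_measure, smul_eq_mul]

end FullData.SuperPopulation

/-! ### Identification and efficient influence functions of the mediation effects -/

namespace FullData.SuperPopulation

variable {Ω : Type*} [mΩ : MeasurableSpace Ω] [StandardBorelSpace Ω] [Nonempty Ω]
  {𝒰 : Type*} [MeasurableSpace 𝒰] {K dV dX : ℕ}
  {D : FullData Ω 𝒰 K dV dX} {μ : Measure Ω} [IsProbabilityMeasure μ]
  {ν : Fin K → Measure ℝ} [∀ k, IsFiniteMeasure (ν k)] {π : ℝ} {w : (Fin dV → ℝ) → ℕ → ℝ}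
  {nmax : ℕ} {lo hi w₀ : ℝ}

lemma memLp_etaStar (hP : IsRegularLaw ν π w (D.obsLaw μ) nmax lo hi w₀) (n : ℕ) (j : Fin n)
    (aS a' : Fin 2) :
    MemLp (etaStar ν (D.obsLaw μ) n j aS a') 2 (covLaw (slice (D.obsLaw μ) n)) := by
  refine (memLp_congr_ae ?_).1
    ((hP.isNuisance n j).memLp_crossMean Finset.univᶜ Finset.univ aS a' a')
  filter_upwards [(hP.isNuisance n j).density_norm a'] with c hc
  exact crossMean_univ hc

lemma theta1_eq_psiI (h : D.SuperPopulation μ ν π)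
    (hP : IsRegularLaw ν π w (D.obsLaw μ) nmax lo hi w₀) (aS : Fin 2)
    (J : Finset (Fin K)) (a' : Fin 2)
    (hcase : (aS = 0 ∧ J = Finset.univ ∧ a' = 0) ∨ (aS = 1 ∧ J = ∅ ∧ a' = 1) ∨
      (aS = 1 ∧ J = Finset.univ ∧ a' = 0 ∧ D.MediatorOutcomeIgnorability μ)) :
    D.theta1 μ w aS J = psiI ν w aS a' (D.obsLaw μ) / meanWeight w (D.obsLaw μ) := by
  rw [meanWeight_obsLaw D hP.measurable_weight, theta1, psiI]
  congr 1
  refine h.integral_estimand_eq hP aS (fun n _ => blockSet J n)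
    (fun n j => memLp_etaStar hP n j aS a') fun n hn => Finset.sum_congr rfl fun j _ => ?_
  have huniv : blockSet (Finset.univ : Finset (Fin K)) n = Finset.univ :=
    Finset.univ_product_univ
  have hempty : blockSet (∅ : Finset (Fin K)) n = ∅ := Finset.empty_product _
  rcases hcase with ⟨rfl, rfl, rfl⟩ | ⟨rfl, rfl, rfl⟩ | ⟨rfl, rfl, rfl, hign⟩
  · simp only [huniv, Mmix_univ]
    exact h.integral_weight_mul_potential hP hn j 0
  · simp only [hempty, Mmix_empty]
    exact h.integral_weight_mul_potential hP hn j 1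
  · simp only [huniv]
    exact h.integral_weight_mul_control hP hn hign j

lemma theta1_eq_psiII (h : D.SuperPopulation μ ν π)
    (hP : IsRegularLaw ν π w (D.obsLaw μ) nmax lo hi w₀) (hign : D.MediatorOutcomeIgnorability μ)
    {J Js : Finset (Fin K)} (hhom : D.ConditionalHomogeneity μ J) (hJs : Js ⊆ J) (h0 : Js ≠ ∅)
    (h1 : Js ≠ Finset.univ) :
    D.theta1 μ w 1 Js = psiII ν w Js (D.obsLaw μ) / meanWeight w (D.obsLaw μ) := by
  rw [meanWeight_obsLaw D hP.measurable_weight, theta1, psiII_eq_crossPsi, crossPsi]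
  congr 1
  exact h.integral_estimand_eq hP 1 (fun n _ => blockSet Js n)
    (fun n j => (hP.isNuisance n j).memLp_crossMean _ _ _ _ _)
    fun n hn => h.sum_integral_weight_mul_homogeneous hP hn hign hhom hJs h0 h1

lemma theta2_eq_psiIII (h : D.SuperPopulation μ ν π)
    (hP : IsRegularLaw ν π w (D.obsLaw μ) nmax lo hi w₀) (hign : D.MediatorOutcomeIgnorability μ)
    {k : Fin K} {J Js : Finset (Fin K)} (hcross : D.CrossWorldIndependence μ k J)
    (hJs : Js ⊆ J \ {k}) :
    D.theta2 μ w k Js = psiIII ν w k Js (D.obsLaw μ) / meanWeight w (D.obsLaw μ) := by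
  rw [meanWeight_obsLaw D hP.measurable_weight, theta2, psiIII_eq_crossPsi, crossPsi]
  congr 1
  exact h.integral_estimand_eq hP 1 (fun n j => spillSet k Js n j)
    (fun n j => (hP.isNuisance n j).memLp_crossMean _ _ _ _ _)
    fun n hn => Finset.sum_congr rfl fun j _ =>
      h.integral_weight_mul_crossWorld hP hn hign j _ (hcross Js hJs n j)

end FullData.SuperPopulation

theorem theorem3 {Ω : Type*} [MeasurableSpace Ω] [StandardBorelSpace Ω]
    {𝒰 : Type*} [MeasurableSpace 𝒰] {K dV dX : ℕ} [NeZero K] (hK : 2 ≤ K)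
    (μ : Measure Ω) [IsProbabilityMeasure μ]
    (D : FullData Ω 𝒰 K dV dX)
    (ν : Fin K → Measure ℝ) [∀ k, SigmaFinite (ν k)]
    (π : ℝ) (hπ0 : 0 < π) (hπ1 : π < 1)
    (w : (Fin dV → ℝ) → ℕ → ℝ)
    (hsuper : D.SuperPopulation μ ν π)
    (hreg : D.Regularity μ ν w) :
    -- `θ₁(a*, a_J)` for `(a*, J)` in `{(0, 𝒦), (1, 𝒦), (1, ∅)}`
    (∀ (aS : Fin 2) (J : Finset (Fin K)),
      ((aS = 0 ∧ J = Finset.univ) ∨ (aS = 1 ∧ J = ∅) ∨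
        (aS = 1 ∧ J = Finset.univ ∧ D.MediatorOutcomeIgnorability μ)) →
      let P := D.obsLaw μ
      let a' := armTuple J 0
      let θ := D.theta1 μ w aS J
      let Ew := meanWeight w P
      θ = psiI ν w aS a' P / Ew ∧
      IsEIF (knownPropensityModel K dV dX π) (fun Q => psiI ν w aS a' Q / meanWeight w Q) P
        (fun o => Ew⁻¹ * (phiI ν π w P aS a' o - θ * weight w o)) ∧
      IsEIF (knownPropensityModel K dV dX π) (psiI ν w aS a') P
        (fun o => phiI ν π w P aS a' o - Ew * θ)) ∧
    -- `θ₁(1, a_J*)` for `J* ⊆ J`, `J* ∉ {𝒦, ∅}`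
    (∀ J : Finset (Fin K), D.MediatorOutcomeIgnorability μ → D.ConditionalHomogeneity μ J →
      ∀ Js ⊆ J, Js ≠ Finset.univ → Js ≠ ∅ →
      let P := D.obsLaw μ
      let θ := D.theta1 μ w 1 Js
      let Ew := meanWeight w P
      θ = psiII ν w Js P / Ew ∧
      IsEIF (knownPropensityModel K dV dX π) (fun Q => psiII ν w Js Q / meanWeight w Q) P
        (fun o => Ew⁻¹ * (phiII ν π w P Js o - θ * weight w o)) ∧
      IsEIF (knownPropensityModel K dV dX π) (psiII ν w Js) P
        (fun o => phiII ν π w P Js o - Ew * θ)) ∧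
    -- `θ₂(k, J*)` for `J* ⊆ J ∖ {k}`
    (∀ (k : Fin K) (J : Finset (Fin K)), D.MediatorOutcomeIgnorability μ →
      D.CrossWorldIndependence μ k J →
      ∀ Js ⊆ J \ {k},
      let P := D.obsLaw μ
      let θ := D.theta2 μ w k Js
      let Ew := meanWeight w P
      θ = psiIII ν w k Js P / Ew ∧
      IsEIF (knownPropensityModel K dV dX π) (fun Q => psiIII ν w k Js Q / meanWeight w Q) P
        (fun o => Ew⁻¹ * (phiIII ν π w P k Js o - θ * weight w o)) ∧
      IsEIF (knownPropensityModel K dV dX π) (psiIII ν w k Js) P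
        (fun o => phiIII ν π w P k Js o - Ew * θ)) := by
  have hne : Nonempty Ω := nonempty_of_isProbabilityMeasure μ
  have hfin : ∀ k, IsFiniteMeasure (ν k) := hsuper.isFiniteMeasure_ref
  obtain ⟨nmax, lo, hi, w₀, hP⟩ := hsuper.exists_isRegularLaw hreg hπ0 hπ1
  have hw : meanWeight w (D.obsLaw μ) ≠ 0 := by
    rw [FullData.meanWeight_obsLaw D hP.measurable_weight]
    exact hreg.weight_mean
  refine ⟨fun aS J hcase => ?_, fun J hign hhom Js hJs h1 h0 => ?_,
    fun k J hign hcross Js hJs => ?_⟩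
  · have hθ := hsuper.theta1_eq_psiI hP aS J (armTuple J 0) (by
      rcases hcase with ⟨rfl, rfl⟩ | ⟨rfl, rfl⟩ | ⟨rfl, rfl, hign⟩
      · exact Or.inl ⟨rfl, rfl, by simp [armTuple]⟩
      · exact Or.inr (Or.inl ⟨rfl, rfl, by simp [armTuple]⟩)
      · exact Or.inr (Or.inr ⟨rfl, rfl, by simp [armTuple], hign⟩))
    exact ⟨hθ, hP.isEIF _ aS _ _ hw (fun Q lo hi hQ => psiI_eq_crossPsi hQ aS _)
      (phiI_ae_eq_crossPhi hP aS _) hθ⟩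
  · have hθ := hsuper.theta1_eq_psiII hP hign hhom hJs h0 h1
    exact ⟨hθ, hP.isEIF _ 1 0 1 hw (fun Q lo hi _ => psiII_eq_crossPsi Js)
      (Eventually.of_forall fun o => congrFun (phiII_eq_crossPhi Js) o) hθ⟩
  · have hθ := hsuper.theta2_eq_psiIII hP hign hcross hJs
    exact ⟨hθ, hP.isEIF _ 1 0 1 hw (fun Q lo hi _ => psiIII_eq_crossPsi k Js)
      (Eventually.of_forall fun o => congrFun (phiIII_eq_crossPhi k Js) o) hθ⟩
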